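/- Let $(W,S)$ be a finite Coxeter group with length function $l$, let $R$ be a commutative ring and let $(q_s)_{s\in S}$ be a family of invertible elements of $R$ such that $q_s=q_t$ whenever $s,t\in S$ are conjugate in $W$. Let $\mathcal H=\bigoplus_{w\in W}Rh_w$ be the Iwahori–Hecke algebra, i.e. the $R$-algebra that is free over $R$ with basis $(h_w)_{w\in W}$ and whose multiplication satisfies $h_wh_{w'}=h_{ww'}$ if $l(ww')=l(w)+l(w')$, and $h_s^2=(q_s-1)h_s+q_s$ for $s\in S$. For $I\subseteq S$ let $W_I$ be the subgroup of $W$ generated by $I$ and $\mathcal H_I=\bigoplus_{w\in W_I}Rh_w$, a subalgebra of $\mathcal H$. Choose a total order on $S$. Let $X(\mathcal H)$ be the cochain complex of $\mathcal H$-bimodules with $$X(\mathcal H)^i=\bigoplus_{I\subseteq S,\ |I|=i}\mathcal H\otimes_{\mathcal H_I}\mathcal H$$ and with differential given on the summand indexed by $I$ by $$h\otimes_{\mathcal H_I}h'\longmapsto\sum_{s\in S\setminus I}(-1)^{n(I,s)}\,h\otimes_{\mathcal H_{I\cup\{s\}}}h',\qquad n(I,s)=|\{t\in I: t<s\}|.$$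 Then the functor $X(\mathcal H)\otimes_{\mathcal H}-$ (total complex of the tensor product) induces an auto-equivalence of the homotopy category $\mathbf K^{\mathbf b}(\mathcal H)$ of bounded complexes of left $\mathcal H$-modules. This holds both when the terms of the complexes are required to be finitely generated $\mathcal H$-modules and when they are arbitrary $\mathcal H$-modules. -/

import Mathlib

universe u v w z

namespace Hecke

section CoxeterGroup
variable {B W : Type v} [Group W] {M : CoxeterMatrix B}

section Exchange

variable (cs : CoxeterSystem M W)

open Classical in
/-- The permutation `(x, z) ↦ (s x s⁻¹, z + [x = s])` of `W × ℤ/2`. -/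
noncomputable def inversionPerm (i : B) : Equiv.Perm (W × ZMod 2) :=
  Function.Involutive.toPerm
    (fun p => (cs.simple i * p.1 * cs.simple i, p.2 + if p.1 = cs.simple i then 1 else 0)) (by
      rintro ⟨x, z⟩
      have e : cs.simple i * x * cs.simple i = cs.simple i ↔ x = cs.simple i := by
        constructor
        · intro h
          have := congrArg (fun y => cs.simple i * y * cs.simple i) h
          simpa [mul_assoc] using this
        · rintro rfl; simp
      have h2 : (1 : ZMod 2) + 1 = 0 := by decide
      ext
      · simp [mul_assoc]
      · simp only [e]
        split_ifs <;> simp [add_assoc, h2])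

open Classical in
theorem inversionPerm_apply (i : B) (x : W) (z : ZMod 2) :
    inversionPerm cs i (x, z) =
      (cs.simple i * x * cs.simple i, z + if x = cs.simple i then 1 else 0) := rfl

open Classical in
theorem inversionPerm_liftable : M.IsLiftable (inversionPerm cs) := by
  intro i j
  set p : W := cs.simple i * cs.simple j with hp
  have hpj : ∀ n : ℕ, p ^ n * cs.simple j * p ^ n = cs.simple j := by
    intro n
    induction n with
    | zero => simp
    | succ n ih =>
      have h1 : p * cs.simple j * p = cs.simple j := by simp [hp, mul_assoc]
      calc p ^ (n + 1) * cs.simple j * p ^ (n + 1)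
          = p ^ n * (p * cs.simple j * p) * p ^ n := by
            rw [pow_succ]; nth_rewrite 2 [← pow_succ]; rw [pow_succ']; group
        _ = cs.simple j := by rw [h1, ih]
  have key : ∀ n : ℕ, ∀ x : W, ∀ z : ZMod 2,
      ((inversionPerm cs i * inversionPerm cs j) ^ n) (x, z) =
        (p ^ n * x * (p ^ n)⁻¹,
          z + ∑ k ∈ Finset.range (2 * n), if x = cs.simple j * p ^ k then 1 else 0) := by
    intro n
    induction n with
    | zero => intro x z; simp
    | succ n ih =>
      intro x z
      rw [pow_succ', Equiv.Perm.mul_apply, ih, Equiv.Perm.mul_apply, inversionPerm_apply,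
        inversionPerm_apply, show 2 * (n + 1) = 2 * n + 1 + 1 by ring,
        Finset.sum_range_succ, Finset.sum_range_succ]
      have e1 : p ^ n * x * (p ^ n)⁻¹ = cs.simple j ↔ x = cs.simple j * p ^ (2 * n) := by
        rw [mul_inv_eq_iff_eq_mul]
        constructor
        · intro h
          have : p ^ n * x = p ^ n * (cs.simple j * p ^ (2 * n)) := by
            rw [h, two_mul, pow_add, ← mul_assoc, ← mul_assoc, hpj]
          exact mul_left_cancel this
        · rintro rfl
          rw [two_mul, pow_add, ← mul_assoc, ← mul_assoc, hpj]
      have e2 : cs.simple j * (p ^ n * x * (p ^ n)⁻¹) * cs.simple j = cs.simple i ↔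
          x = cs.simple j * p ^ (2 * n + 1) := by
        have hc : cs.simple j * (p ^ n * x * (p ^ n)⁻¹) * cs.simple j = cs.simple i ↔
            p ^ n * x * (p ^ n)⁻¹ = cs.simple j * p := by
          constructor
          · intro h
            have := congrArg (fun y => cs.simple j * y * cs.simple j) h
            simpa [mul_assoc, hp] using this
          · intro h
            rw [h]; simp [mul_assoc, hp]
        rw [hc, mul_inv_eq_iff_eq_mul]
        have e3 : p ^ n * (cs.simple j * p ^ (2 * n + 1)) = cs.simple j * p * p ^ n := by
          rw [show 2 * n + 1 = n + (n + 1) by ring, pow_add, ← mul_assoc, ← mul_assoc, hpj,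
            pow_succ', ← mul_assoc]
        constructor
        · intro h
          exact mul_left_cancel (h.trans e3.symm)
        · rintro rfl
          exact e3
      simp only [e1, e2]
      ext
      · simp only [hp, pow_succ', mul_inv_rev, CoxeterSystem.inv_simple, mul_assoc]
      · simp only [add_assoc]
  have hpm : p ^ M i j = 1 := cs.simple_mul_simple_pow i j
  ext1 ⟨x, z⟩
  rw [key, hpm, two_mul, Finset.sum_range_add]
  simp only [pow_add, hpm, one_mul, inv_one, mul_one]
  have h2 : ∀ a : ZMod 2, a + a = 0 := by decide
  rw [h2]
  simp

/-- The action of `W` on `W × ℤ/2` whose second component counts inversions modulo 2. -/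
noncomputable def inversionHom : W →* Equiv.Perm (W × ZMod 2) :=
  cs.lift ⟨inversionPerm cs, inversionPerm_liftable cs⟩

theorem inversionHom_simple (i : B) : inversionHom cs (cs.simple i) = inversionPerm cs i :=
  cs.lift_apply_simple (inversionPerm_liftable cs) i

open Classical in
theorem inversionHom_wordProd (ω : List B) (x : W) (z : ZMod 2) :
    inversionHom cs (cs.wordProd ω) (x, z) =
      (cs.wordProd ω * x * (cs.wordProd ω)⁻¹, z + ((cs.rightInvSeq ω).count x : ℕ)) := by
  induction ω with
  | nil => simp
  | cons i ω ih =>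
    rw [cs.wordProd_cons, map_mul, Equiv.Perm.mul_apply, ih, inversionHom_simple,
      inversionPerm_apply, CoxeterSystem.rightInvSeq, List.count_cons]
    have e : cs.wordProd ω * x * (cs.wordProd ω)⁻¹ = cs.simple i ↔
        ((cs.wordProd ω)⁻¹ * cs.simple i * cs.wordProd ω == x) = true := by
      rw [beq_iff_eq]
      constructor
      · intro h; rw [← h]; group
      · rintro rfl; group
    simp only [e]
    ext
    · simp [mul_assoc]
    · push_cast
      simp only [add_assoc]

theorem length_mul_simple_lt_of_snd {x : W} {i : B}
    (h : (inversionHom cs x (cs.simple i, 0)).2 ≠ 0) :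
    cs.length (x * cs.simple i) < cs.length x := by
  classical
  obtain ⟨ω, hω, rfl⟩ := cs.exists_isReduced x
  rw [inversionHom_wordProd] at h
  have hc : (cs.rightInvSeq ω).count (cs.simple i) ≠ 0 := by
    intro h0; apply h; simp [h0]
  exact (cs.isRightInversion_of_mem_rightInvSeq hω
    (List.count_pos_iff.mp (Nat.pos_of_ne_zero hc))).2

theorem snd_of_length_mul_simple_lt {x : W} {i : B}
    (h : cs.length (x * cs.simple i) < cs.length x) :
    (inversionHom cs x (cs.simple i, 0)).2 ≠ 0 := by
  classical
  intro h0
  have h1 : (inversionHom cs (x * cs.simple i) (cs.simple i, 0)).2 ≠ 0 := by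
    obtain ⟨ω, hω, rfl⟩ := cs.exists_isReduced x
    rw [inversionHom_wordProd] at h0
    rw [map_mul, Equiv.Perm.mul_apply, inversionHom_simple, inversionPerm_apply,
      CoxeterSystem.simple_mul_simple_self, one_mul, inversionHom_wordProd]
    simp only [zero_add] at h0
    simp [h0]
  have h2 := length_mul_simple_lt_of_snd cs h1
  rw [mul_assoc, CoxeterSystem.simple_mul_simple_self, mul_one] at h2
  omega

/-- If the right descent status at `t` changes from `x` to `s x`, then `s x = x t`. -/
theorem simple_mul_eq_of_lt {x : W} {i j : B}
    (h1 : cs.length x < cs.length (x * cs.simple j))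
    (h2 : cs.length (cs.simple i * x * cs.simple j) < cs.length (cs.simple i * x)) :
    cs.simple i * x = x * cs.simple j := by
  classical
  have h3 := snd_of_length_mul_simple_lt cs h2
  by_contra hne
  apply hne
  by_contra hne
  apply absurd (length_mul_simple_lt_of_snd cs (x := x) (i := j) _) (by omega)
  obtain ⟨ω, hω, rfl⟩ := cs.exists_isReduced x
  rw [map_mul, Equiv.Perm.mul_apply, inversionHom_simple] at h3
  rw [inversionHom_wordProd] at h3 ⊢
  rw [inversionPerm_apply, if_neg] at h3
  · simpa using h3
  · intro h
    apply hne
    rw [← h]; group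

theorem simple_mul_eq_of_gt {x : W} {i j : B}
    (h1 : cs.length (x * cs.simple j) < cs.length x)
    (h2 : cs.length (cs.simple i * x) < cs.length (cs.simple i * x * cs.simple j)) :
    cs.simple i * x = x * cs.simple j := by
  have := simple_mul_eq_of_lt cs (x := cs.simple i * x) (i := i) (j := j) h2 (by simpa using h1)
  rw [CoxeterSystem.simple_mul_simple_cancel_left] at this
  have h := congrArg (fun y => y * cs.simple j) this
  simpa using h.symm

end Exchange
section HeckeAlgebra

variable {R : Type u} [CommRing R]

/-- A family `(q_s)` of invertible parameters, indexed by the simple reflections, with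
`q_s = q_t` whenever `s` and `t` are conjugate in `W`. -/
structure Parameters (cs : CoxeterSystem M W) (R : Type u) [CommRing R] where
  /-- the parameters -/
  q : B → Rˣ
  q_eq_of_isConj : ∀ i j : B, IsConj (cs.simple i) (cs.simple j) → q i = q j

variable {cs : CoxeterSystem M W} (P : Parameters cs R)

/-- Left multiplication by `h_s` on the free module with basis `(h_w)`. -/
noncomputable def leftOp (i : B) : (W →₀ R) →ₗ[R] (W →₀ R) :=
  Finsupp.linearCombination R fun w =>
    if cs.length w < cs.length (cs.simple i * w) then Finsupp.single (cs.simple i * w) 1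
    else ((P.q i : R) - 1) • Finsupp.single w 1 + (P.q i : R) • Finsupp.single (cs.simple i * w) 1

/-- Right multiplication by `h_s` on the free module with basis `(h_w)`. -/
noncomputable def rightOp (i : B) : (W →₀ R) →ₗ[R] (W →₀ R) :=
  Finsupp.linearCombination R fun w =>
    if cs.length w < cs.length (w * cs.simple i) then Finsupp.single (w * cs.simple i) 1
    else ((P.q i : R) - 1) • Finsupp.single w 1 + (P.q i : R) • Finsupp.single (w * cs.simple i) 1

theorem leftOp_of_lt {i : B} {w : W} (h : cs.length w < cs.length (cs.simple i * w)) :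
    leftOp P i (Finsupp.single w 1) = Finsupp.single (cs.simple i * w) 1 := by
  simp [leftOp, h]

theorem leftOp_of_gt {i : B} {w : W} (h : cs.length (cs.simple i * w) < cs.length w) :
    leftOp P i (Finsupp.single w 1) = ((P.q i : R) - 1) • Finsupp.single w 1 +
      (P.q i : R) • Finsupp.single (cs.simple i * w) 1 := by
  rw [leftOp, Finsupp.linearCombination_single, one_smul, if_neg (by omega)]

theorem rightOp_of_lt {i : B} {w : W} (h : cs.length w < cs.length (w * cs.simple i)) :
    rightOp P i (Finsupp.single w 1) = Finsupp.single (w * cs.simple i) 1 := by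
  simp [rightOp, h]

theorem rightOp_of_gt {i : B} {w : W} (h : cs.length (w * cs.simple i) < cs.length w) :
    rightOp P i (Finsupp.single w 1) = ((P.q i : R) - 1) • Finsupp.single w 1 +
      (P.q i : R) • Finsupp.single (w * cs.simple i) 1 := by
  rw [rightOp, Finsupp.linearCombination_single, one_smul, if_neg (by omega)]

theorem leftOp_leftOp (i : B) (x : W →₀ R) :
    leftOp P i (leftOp P i x) = ((P.q i : R) - 1) • leftOp P i x + (P.q i : R) • x := by
  induction x using Finsupp.induction_linear with
  | zero => simp
  | add x y hx hy => rw [map_add, map_add, hx, hy]; module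
  | single w a =>
    have : Finsupp.single w a = a • Finsupp.single w (1 : R) := by simp
    rw [this, map_smul, map_smul]
    suffices h : leftOp P i (leftOp P i (Finsupp.single w 1)) =
        ((P.q i : R) - 1) • leftOp P i (Finsupp.single w 1) + (P.q i : R) • Finsupp.single w 1 by
      rw [h]; module
    rcases lt_or_gt_of_ne (cs.length_simple_mul_ne w i) with h | h
    · rw [leftOp_of_gt P h, map_add, map_smul, map_smul, leftOp_of_gt P h,
        leftOp_of_lt P (by simpa using h), CoxeterSystem.simple_mul_simple_cancel_left]
    · rw [leftOp_of_lt P h, leftOp_of_gt P (by simpa using h),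
        CoxeterSystem.simple_mul_simple_cancel_left]

theorem rightOp_rightOp (i : B) (x : W →₀ R) :
    rightOp P i (rightOp P i x) = ((P.q i : R) - 1) • rightOp P i x + (P.q i : R) • x := by
  induction x using Finsupp.induction_linear with
  | zero => simp
  | add x y hx hy => rw [map_add, map_add, hx, hy]; module
  | single w a =>
    have : Finsupp.single w a = a • Finsupp.single w (1 : R) := by simp
    rw [this, map_smul, map_smul]
    suffices h : rightOp P i (rightOp P i (Finsupp.single w 1)) =
        ((P.q i : R) - 1) • rightOp P i (Finsupp.single w 1) +
          (P.q i : R) • Finsupp.single w 1 by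
      rw [h]; module
    rcases lt_or_gt_of_ne (cs.length_mul_simple_ne w i) with h | h
    · rw [rightOp_of_gt P h, map_add, map_smul, map_smul, rightOp_of_gt P h,
        rightOp_of_lt P (by simpa using h), CoxeterSystem.simple_mul_simple_cancel_right]
    · rw [rightOp_of_lt P h, rightOp_of_gt P (by simpa using h),
        CoxeterSystem.simple_mul_simple_cancel_right]

/-- Left and right multiplications commute. -/
theorem leftOp_rightOp (i j : B) (x : W →₀ R) :
    leftOp P i (rightOp P j x) = rightOp P j (leftOp P i x) := by
  induction x using Finsupp.induction_linear with
  | zero => simp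
  | add x y hx hy => simp only [map_add, hx, hy]
  | single w a =>
    have : Finsupp.single w a = a • Finsupp.single w (1 : R) := by simp
    rw [this]
    simp only [map_smul]
    congr 1
    by_cases he : cs.simple i * w = w * cs.simple j
    · have hq : P.q i = P.q j := by
        apply P.q_eq_of_isConj
        rw [isConj_comm, isConj_iff]
        exact ⟨w, by rw [← he]; group⟩
      have h1 : leftOp P i (Finsupp.single w 1) = rightOp P j (Finsupp.single w 1) := by
        simp [leftOp, rightOp, he, hq]
      rw [← h1, leftOp_leftOp, h1, rightOp_rightOp, hq]
    · have hL := cs.length_simple_mul_ne w i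
      have hR := cs.length_mul_simple_ne w j
      have a1 : cs.length w < cs.length (w * cs.simple j) →
          cs.length (cs.simple i * w) < cs.length (cs.simple i * w * cs.simple j) := by
        intro h
        by_contra h'
        exact he (simple_mul_eq_of_lt cs h (lt_of_le_of_ne (not_lt.mp h')
          (cs.length_mul_simple_ne _ _)))
      have a2 : cs.length (w * cs.simple j) < cs.length w →
          cs.length (cs.simple i * w * cs.simple j) < cs.length (cs.simple i * w) := by
        intro h
        by_contra h'
        exact he (simple_mul_eq_of_gt cs h (lt_of_le_of_ne (not_lt.mp h')
          (cs.length_mul_simple_ne _ _).symm))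
      have hpar := cs.length_simple_mul w i
      have hpar' := cs.length_simple_mul (w * cs.simple j) i
      have hp1 := cs.length_mul_simple w j
      have hp2 := cs.length_mul_simple (cs.simple i * w) j
      rw [← mul_assoc] at hpar'
      rcases lt_or_gt_of_ne hL with hl | hl <;> rcases lt_or_gt_of_ne hR with hr | hr
      · have b := a2 hr
        have c : cs.length (cs.simple i * (w * cs.simple j)) < cs.length (w * cs.simple j) := by
          rw [← mul_assoc]; omega
        rw [leftOp_of_gt P hl, rightOp_of_gt P hr]
        simp only [map_add, map_smul]
        rw [leftOp_of_gt P hl, rightOp_of_gt P hr, leftOp_of_gt P c, rightOp_of_gt P b, mul_assoc]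
        module
      · have b := a1 hr
        have c : cs.length (cs.simple i * (w * cs.simple j)) < cs.length (w * cs.simple j) := by
          rw [← mul_assoc]; omega
        rw [leftOp_of_gt P hl, rightOp_of_lt P hr]
        simp only [map_add, map_smul]
        rw [rightOp_of_lt P hr, leftOp_of_gt P c, rightOp_of_lt P b, mul_assoc]
      · have b := a2 hr
        have c : cs.length (w * cs.simple j) < cs.length (cs.simple i * (w * cs.simple j)) := by
          rw [← mul_assoc]; omega
        rw [leftOp_of_lt P hl, rightOp_of_gt P hr]
        simp only [map_add, map_smul]
        rw [leftOp_of_lt P hl, leftOp_of_lt P c, rightOp_of_gt P b, mul_assoc]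
      · have b := a1 hr
        have c : cs.length (w * cs.simple j) < cs.length (cs.simple i * (w * cs.simple j)) := by
          rw [← mul_assoc]; omega
        rw [leftOp_of_lt P hl, rightOp_of_lt P hr, leftOp_of_lt P c, rightOp_of_lt P b, mul_assoc]

/-- Left multiplication by `h_w`, through a chosen reduced word for `w`. -/
noncomputable def leftOpElt (w : W) : Module.End R (W →₀ R) :=
  ((cs.exists_isReduced w).choose.map (leftOp P)).prod

/-- Left multiplication by an arbitrary element of the free module with basis `(h_w)`. -/
noncomputable def leftMul : (W →₀ R) →ₗ[R] Module.End R (W →₀ R) :=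
  Finsupp.linearCombination R (leftOpElt P)

theorem leftOp_prod_one {ω : List B} (h : cs.IsReduced ω) :
    (ω.map (leftOp P)).prod (Finsupp.single 1 1) = Finsupp.single (cs.wordProd ω) 1 := by
  induction ω with
  | nil => simp
  | cons i ω ih =>
    have h' : cs.IsReduced ω := by simpa using h.drop 1
    rw [List.map_cons, List.prod_cons, Module.End.mul_apply, ih h', cs.wordProd_cons,
      leftOp_of_lt]
    have e1 := h.eq
    have e2 := h'.eq
    rw [cs.wordProd_cons] at e1
    simp only [List.length_cons] at e1
    omega

theorem leftMul_one (x : W →₀ R) : leftMul P x (Finsupp.single 1 1) = x := by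
  induction x using Finsupp.induction_linear with
  | zero => simp
  | add x y hx hy => rw [map_add, LinearMap.add_apply, hx, hy]
  | single w a =>
    obtain ⟨h1, h2⟩ := (cs.exists_isReduced w).choose_spec
    rw [leftMul, Finsupp.linearCombination_single, LinearMap.smul_apply, leftOpElt,
      leftOp_prod_one P h1, ← h2]
    simp

theorem leftMul_rightOp (x : W →₀ R) (j : B) (y : W →₀ R) :
    leftMul P x (rightOp P j y) = rightOp P j (leftMul P x y) := by
  induction x using Finsupp.induction_linear with
  | zero => simp
  | add x x' hx hy => simp only [map_add, LinearMap.add_apply, hx, hy]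
  | single w a =>
    rw [leftMul, Finsupp.linearCombination_single, LinearMap.smul_apply, LinearMap.smul_apply,
      map_smul, leftOpElt]
    congr 1
    generalize (cs.exists_isReduced w).choose = ω
    induction ω with
    | nil => simp
    | cons i ω ih => simp [ih, leftOp_rightOp]

/-- An endomorphism commuting with the right multiplications is determined by its value
at `h_1`. -/
theorem eq_of_commute_rightOp {f g : Module.End R (W →₀ R)}
    (hf : ∀ j y, f (rightOp P j y) = rightOp P j (f y))
    (hg : ∀ j y, g (rightOp P j y) = rightOp P j (g y))
    (h : f (Finsupp.single 1 1) = g (Finsupp.single 1 1)) : f = g := by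
  have key : ∀ n : ℕ, ∀ w : W, cs.length w = n →
      f (Finsupp.single w 1) = g (Finsupp.single w 1) := by
    intro n
    induction n with
    | zero =>
      intro w hw
      rw [cs.length_eq_zero_iff.mp hw, h]
    | succ n ih =>
      intro w hw
      obtain ⟨j, hj⟩ := cs.exists_rightDescent_of_ne_one (w := w) (by
        rintro rfl; simp at hw)
      rw [cs.isRightDescent_iff] at hj
      have e := rightOp_of_lt P (i := j) (w := w * cs.simple j) (by simp; omega)
      rw [CoxeterSystem.simple_mul_simple_cancel_right] at e
      rw [← e, hf, hg, ih _ (by omega)]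
  apply Finsupp.lhom_ext
  intro w a
  have : Finsupp.single w a = a • Finsupp.single w (1 : R) := by simp
  rw [this, map_smul, map_smul, key _ w rfl]

theorem leftMul_leftMul (x y : W →₀ R) : leftMul P (leftMul P x y) = leftMul P x * leftMul P y := by
  apply eq_of_commute_rightOp P (leftMul_rightOp P _)
  · intro j z
    simp only [Module.End.mul_apply, leftMul_rightOp]
  · rw [leftMul_one, Module.End.mul_apply, leftMul_one]

theorem leftMul_single_one : leftMul P (Finsupp.single 1 1) = 1 := by
  apply eq_of_commute_rightOp P (leftMul_rightOp P _)
  · intro j z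
    simp only [Module.End.one_apply]
  · rw [leftMul_one, Module.End.one_apply]

/-- The Iwahori–Hecke algebra of the Coxeter system `cs` over `R` with parameters `P`: the free
`R`-module with basis `(h_w)`, `w ∈ W`. -/
def HeckeAlgebra {cs : CoxeterSystem M W} (_P : Parameters cs R) : Type (max u v) := W →₀ R

namespace HeckeAlgebra

noncomputable instance : AddCommGroup (HeckeAlgebra P) := inferInstanceAs (AddCommGroup (W →₀ R))

noncomputable instance : Module R (HeckeAlgebra P) := inferInstanceAs (Module R (W →₀ R))

/-- The basis `(h_w)` of the Hecke algebra. -/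
noncomputable def basis : Module.Basis W R (HeckeAlgebra P) := Module.Basis.ofRepr (LinearEquiv.refl R (W →₀ R))

/-- The multiplication of the Hecke algebra, characterized by the rules
`h_w h_w' = h_{ww'}` when lengths add and `h_s ^ 2 = (q_s - 1) h_s + q_s`, see
`basis_mul_basis` and `basis_simple_mul_self`. -/
noncomputable instance : Mul (HeckeAlgebra P) := ⟨fun x y => leftMul P x y⟩

noncomputable instance : One (HeckeAlgebra P) := ⟨Finsupp.single 1 1⟩

theorem mul_def (x y : HeckeAlgebra P) : x * y = leftMul P x y := rfl

theorem one_def : (1 : HeckeAlgebra P) = Finsupp.single 1 1 := rfl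

noncomputable instance : Ring (HeckeAlgebra P) :=
  { (inferInstance : AddCommGroup (HeckeAlgebra P)),
    (inferInstance : Mul (HeckeAlgebra P)),
    (inferInstance : One (HeckeAlgebra P)) with
    left_distrib := fun x y z => map_add (leftMul P x) y z
    right_distrib := fun x y z => LinearMap.congr_fun (map_add (leftMul P) x y) z
    zero_mul := fun x => LinearMap.congr_fun (map_zero (leftMul P)) x
    mul_zero := fun x => map_zero (leftMul P x)
    mul_assoc := fun x y z => LinearMap.congr_fun (leftMul_leftMul P x y) z
    one_mul := fun x => LinearMap.congr_fun (leftMul_single_one P) x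
    mul_one := fun x => leftMul_one P x }

noncomputable instance : Algebra R (HeckeAlgebra P) :=
  Algebra.ofModule
    (fun r x y => LinearMap.congr_fun (map_smul (leftMul P) r x) y)
    (fun r x y => map_smul (leftMul P x) r y)

theorem basis_eq (w : W) : basis P w = Finsupp.single w 1 := rfl

theorem basis_one : basis P 1 = 1 := rfl

theorem leftMul_simple (i : B) : leftMul P (Finsupp.single (cs.simple i) 1) = leftOp P i := by
  apply eq_of_commute_rightOp P (leftMul_rightOp P _)
  · intro j z
    exact leftOp_rightOp P i j z
  · rw [leftMul_one, leftOp_of_lt P (by simp), mul_one]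

theorem basis_simple_mul_of_lt {i : B} {w : W} (h : cs.length w < cs.length (cs.simple i * w)) :
    basis P (cs.simple i) * basis P w = basis P (cs.simple i * w) := by
  rw [mul_def, basis_eq, basis_eq, leftMul_simple, leftOp_of_lt P h]; rfl

/-- `h_w h_w' = h_{ww'}` when lengths add. -/
theorem basis_mul_basis {w w' : W} (h : cs.length (w * w') = cs.length w + cs.length w') :
    basis P w * basis P w' = basis P (w * w') := by
  induction hn : cs.length w generalizing w with
  | zero =>
    rw [cs.length_eq_zero_iff.mp hn, basis_one, one_mul, one_mul]
  | succ n ih =>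
    obtain ⟨i, hi⟩ := cs.exists_leftDescent_of_ne_one (w := w) (by rintro rfl; simp at hn)
    rw [cs.isLeftDescent_iff] at hi
    obtain ⟨x, rfl⟩ : ∃ x, w = cs.simple i * x := ⟨cs.simple i * w, by simp⟩
    rw [CoxeterSystem.simple_mul_simple_cancel_left] at hi
    have h1 := cs.length_mul_le x w'
    have h2 := cs.length_simple_mul (x * w') i
    rw [mul_assoc] at h
    rw [← basis_simple_mul_of_lt P (by omega), mul_assoc, ih (by omega) (by omega), mul_assoc,
      basis_simple_mul_of_lt P (by omega)]

/-- `h_s ^ 2 = (q_s - 1) h_s + q_s`. -/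
theorem basis_simple_mul_self (i : B) :
    basis P (cs.simple i) * basis P (cs.simple i) =
      ((P.q i : R) - 1) • basis P (cs.simple i) + (P.q i : R) • 1 := by
  rw [mul_def, basis_eq, leftMul_simple, leftOp_of_gt P (by simp),
    CoxeterSystem.simple_mul_simple_self]
  rfl

theorem basis_simple_mul_of_gt {i : B} {w : W} (h : cs.length (cs.simple i * w) < cs.length w) :
    basis P (cs.simple i) * basis P w =
      ((P.q i : R) - 1) • basis P w + (P.q i : R) • basis P (cs.simple i * w) := by
  rw [mul_def, basis_eq, basis_eq, leftMul_simple, leftOp_of_gt P h]; rfl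

end HeckeAlgebra

/-- The parabolic subgroup `W_I`. -/
def parabolicSubgroup (cs : CoxeterSystem M W) (I : Set B) : Subgroup W :=
  Subgroup.closure (cs.simple '' I)

/-- The submodule `H_I = ⊕_{w ∈ W_I} R h_w`. -/
noncomputable def parabolicSubmodule (I : Set B) : Submodule R (HeckeAlgebra P) :=
  Submodule.span R (HeckeAlgebra.basis P '' (parabolicSubgroup cs I : Set W))

theorem basis_mem_parabolicSubmodule {I : Set B} {w : W} (h : w ∈ parabolicSubgroup cs I) :
    HeckeAlgebra.basis P w ∈ parabolicSubmodule P I :=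
  Submodule.subset_span ⟨w, h, rfl⟩

theorem simple_mul_mem_parabolicSubmodule {I : Set B} {i : B} (hi : i ∈ I) {x : HeckeAlgebra P}
    (hx : x ∈ parabolicSubmodule P I) :
    HeckeAlgebra.basis P (cs.simple i) * x ∈ parabolicSubmodule P I := by
  induction hx using Submodule.span_induction with
  | zero => simp
  | add x y _ _ hx hy => rw [mul_add]; exact add_mem hx hy
  | smul a x _ hx => rw [mul_smul_comm]; exact Submodule.smul_mem _ _ hx
  | mem x hx =>
    obtain ⟨w, hw, rfl⟩ := hx
    have hs : cs.simple i * w ∈ parabolicSubgroup cs I :=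
      mul_mem (Subgroup.subset_closure ⟨i, hi, rfl⟩) hw
    rcases lt_or_gt_of_ne (cs.length_simple_mul_ne w i) with h | h
    · rw [HeckeAlgebra.basis_simple_mul_of_gt P h]
      exact add_mem (Submodule.smul_mem _ _ (basis_mem_parabolicSubmodule P hw))
        (Submodule.smul_mem _ _ (basis_mem_parabolicSubmodule P hs))
    · rw [HeckeAlgebra.basis_simple_mul_of_lt P h]
      exact basis_mem_parabolicSubmodule P hs

theorem basis_mul_mem_parabolicSubmodule {I : Set B} {w : W} (hw : w ∈ parabolicSubgroup cs I) :
    ∀ x ∈ parabolicSubmodule P I, HeckeAlgebra.basis P w * x ∈ parabolicSubmodule P I := by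
  induction hw using Subgroup.closure_induction_left with
  | one => intro x hx; rwa [HeckeAlgebra.basis_one, one_mul]
  | mul_left a ha w _ ih =>
    obtain ⟨i, hi, rfl⟩ := ha
    intro x hx
    rcases lt_or_gt_of_ne (cs.length_simple_mul_ne w i) with h | h
    · have e := HeckeAlgebra.basis_simple_mul_of_gt P h
      have e' : HeckeAlgebra.basis P (cs.simple i * w) = ((P.q i)⁻¹ : Rˣ) •
          (HeckeAlgebra.basis P (cs.simple i) * HeckeAlgebra.basis P w -
            ((P.q i : R) - 1) • HeckeAlgebra.basis P w) := by
        rw [e, add_sub_cancel_left, Units.smul_def, smul_smul, Units.inv_mul, one_smul]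
      rw [e', Units.smul_def, smul_mul_assoc, sub_mul, mul_assoc, smul_mul_assoc]
      exact Submodule.smul_mem _ _ (sub_mem
        (simple_mul_mem_parabolicSubmodule P hi (ih x hx)) (Submodule.smul_mem _ _ (ih x hx)))
    · rw [← HeckeAlgebra.basis_simple_mul_of_lt P h, mul_assoc]
      exact simple_mul_mem_parabolicSubmodule P hi (ih x hx)
  | inv_mul_cancel a ha w _ ih =>
    obtain ⟨i, hi, rfl⟩ := ha
    rw [CoxeterSystem.inv_simple]
    intro x hx
    rcases lt_or_gt_of_ne (cs.length_simple_mul_ne w i) with h | h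
    · have e := HeckeAlgebra.basis_simple_mul_of_gt P h
      have e' : HeckeAlgebra.basis P (cs.simple i * w) = ((P.q i)⁻¹ : Rˣ) •
          (HeckeAlgebra.basis P (cs.simple i) * HeckeAlgebra.basis P w -
            ((P.q i : R) - 1) • HeckeAlgebra.basis P w) := by
        rw [e, add_sub_cancel_left, Units.smul_def, smul_smul, Units.inv_mul, one_smul]
      rw [e', Units.smul_def, smul_mul_assoc, sub_mul, mul_assoc, smul_mul_assoc]
      exact Submodule.smul_mem _ _ (sub_mem
        (simple_mul_mem_parabolicSubmodule P hi (ih x hx)) (Submodule.smul_mem _ _ (ih x hx)))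
    · rw [← HeckeAlgebra.basis_simple_mul_of_lt P h, mul_assoc]
      exact simple_mul_mem_parabolicSubmodule P hi (ih x hx)

/-- The subalgebra `H_I = ⊕_{w ∈ W_I} R h_w` of the Hecke algebra. -/
noncomputable def parabolicSubalgebra (I : Set B) : Subalgebra R (HeckeAlgebra P) :=
  (parabolicSubmodule P I).toSubalgebra
    (by rw [← HeckeAlgebra.basis_one]; exact basis_mem_parabolicSubmodule P (one_mem _))
    (by
      intro x y hx hy
      induction hx using Submodule.span_induction with
      | zero => simp
      | add x x' _ _ hx hx' => rw [add_mul]; exact add_mem hx hx'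
      | smul a x _ hx => rw [smul_mul_assoc]; exact Submodule.smul_mem _ _ hx
      | mem x hx =>
        obtain ⟨w, hw, rfl⟩ := hx
        exact basis_mul_mem_parabolicSubmodule P hw y hy)

theorem parabolicSubalgebra_mono {I J : Set B} (h : I ⊆ J) :
    parabolicSubalgebra P I ≤ parabolicSubalgebra P J :=
  Submodule.span_mono (Set.image_mono (Subgroup.closure_mono (Set.image_mono h)))

end HeckeAlgebra

end CoxeterGroup

section CoefficientSystem

open CategoryTheory

variable {S : Type w} [LinearOrder S] {A : Type u} [Ring A]

/-- `(-1) ^ n(I, s)`, where `n(I, s)` is the number of elements of `I` smaller than `s`. -/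
def coeffSign (I : Finset S) (s : S) : ℤ := (-1) ^ (I.filter (· < s)).card

/-- The differential of the complex of a coefficient system: its restriction to `M^I` is
`∑_{s ∉ I} (-1)^{n(I, s)} φ_{I ∪ {s}, I}`. It is written here through its component on `M^J`,
which only involves the `I = J \ {s}` with `s ∈ J`. It vanishes unless `j = i + 1`. -/
def coeffD (F : Finset S ⥤ ModuleCat.{v} A) (i j : ℤ) :
    (∀ I : {I : Finset S // (I.card : ℤ) = i}, F.obj I.1) →ₗ[A]
      (∀ J : {J : Finset S // (J.card : ℤ) = j}, F.obj J.1) :=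
  LinearMap.pi fun J => ∑ s ∈ J.1,
    if h : ((J.1.erase s).card : ℤ) = i then
      coeffSign (J.1.erase s) s •
        ((F.map (homOfLE (Finset.erase_subset s J.1))).hom ∘ₗ
          LinearMap.proj (φ := fun I : {I : Finset S // (I.card : ℤ) = i} => F.obj I.1)
            ⟨J.1.erase s, h⟩)
    else 0

theorem coeffD_apply (F : Finset S ⥤ ModuleCat.{v} A) (i j : ℤ)
    (x : ∀ I : {I : Finset S // (I.card : ℤ) = i}, F.obj I.1)
    (J : {J : Finset S // (J.card : ℤ) = j}) :
    coeffD F i j x J = ∑ s ∈ J.1,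
      if h : ((J.1.erase s).card : ℤ) = i then
        coeffSign (J.1.erase s) s •
          (F.map (homOfLE (Finset.erase_subset s J.1))).hom (x ⟨J.1.erase s, h⟩)
      else 0 := by
  rw [coeffD, LinearMap.pi_apply, LinearMap.sum_apply]
  refine Finset.sum_congr rfl fun s _ => ?_
  split_ifs <;> rfl

theorem coeffD_eq_zero (F : Finset S ⥤ ModuleCat.{v} A) (i j : ℤ) (h : i + 1 ≠ j) :
    coeffD F i j = 0 := by
  apply LinearMap.ext
  intro x
  funext J
  rw [coeffD_apply]
  refine Finset.sum_eq_zero fun s hs => dif_neg fun h' => h ?_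
  have := Finset.card_erase_add_one hs
  have := J.2
  omega

theorem coeffSign_mul_add (K : Finset S) {s t : S} (hs : s ∈ K) (ht : t ∈ K) (hst : s ≠ t) :
    coeffSign (K.erase s) s * coeffSign ((K.erase s).erase t) t +
      coeffSign (K.erase t) t * coeffSign ((K.erase t).erase s) s = 0 := by
  wlog h : s < t generalizing s t
  · rw [add_comm]
    exact this ht hs hst.symm (lt_of_le_of_ne (not_lt.mp h) hst.symm)
  have e1 : (((K.erase s).erase t).filter (· < t)).card + 1 = ((K.erase t).filter (· < t)).card := by
    have : s ∈ (K.erase t).filter (· < t) := by simp [hs, hst, h]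
    rw [← Finset.card_erase_add_one this]
    congr 2
    ext x
    simp only [Finset.mem_filter, Finset.mem_erase]
    tauto
  have e2 : ((K.erase t).erase s).filter (· < s) = (K.erase s).filter (· < s) := by
    ext x
    simp only [Finset.mem_filter, Finset.mem_erase]
    constructor
    · tauto
    · rintro ⟨⟨a, b⟩, c⟩
      exact ⟨⟨a, (c.trans h).ne, b⟩, c⟩
  unfold coeffSign
  rw [← e1, e2, pow_succ]
  ring

theorem coeffD_comp (F : Finset S ⥤ ModuleCat.{v} A) (i j k : ℤ) :
    coeffD F j k ∘ₗ coeffD F i j = 0 := by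
  apply LinearMap.ext
  intro x
  funext K
  change coeffD F j k (coeffD F i j x) K = 0
  rw [coeffD_apply]
  by_cases hjk : j + 1 = k
  swap
  · refine Finset.sum_eq_zero fun s hs => dif_neg fun h' => hjk ?_
    have := Finset.card_erase_add_one hs
    have := K.2
    omega
  by_cases hij : i + 1 = j
  swap
  · rw [coeffD_eq_zero F i j hij]
    simp
  obtain ⟨K, hK⟩ := K
  have hc1 : ∀ s ∈ K, ((K.erase s).card : ℤ) = j := fun s hs => by
    have := Finset.card_erase_add_one hs
    omega
  have hc2 : ∀ s ∈ K, ∀ t ∈ K.erase s, (((K.erase s).erase t).card : ℤ) = i := fun s hs t ht => by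
    have := Finset.card_erase_add_one ht
    have := hc1 s hs
    omega
  -- the term indexed by the pair `(s, t)`
  let f : S × S → F.obj K := fun p =>
    if h : (((K.erase p.1).erase p.2).card : ℤ) = i then
      (coeffSign (K.erase p.1) p.1 * coeffSign ((K.erase p.1).erase p.2) p.2) •
        (F.map (homOfLE ((Finset.erase_subset p.2 (K.erase p.1)).trans
          (Finset.erase_subset p.1 K)))).hom (x ⟨(K.erase p.1).erase p.2, h⟩)
    else 0
  have h1 : ∀ s ∈ K, (if h : ((K.erase s).card : ℤ) = j then
      coeffSign (K.erase s) s • (F.map (homOfLE (Finset.erase_subset s K))).hom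
        (coeffD F i j x ⟨K.erase s, h⟩) else 0) = ∑ t ∈ K.erase s, f (s, t) := by
    intro s hs
    rw [dif_pos (hc1 s hs), coeffD_apply, map_sum, Finset.smul_sum]
    refine Finset.sum_congr rfl fun t ht => ?_
    simp only [f]
    rw [dif_pos (hc2 s hs t ht), dif_pos (hc2 s hs t ht), map_zsmul, smul_smul,
      ← homOfLE_comp (Finset.erase_subset t (K.erase s)) (Finset.erase_subset s K), F.map_comp]
    rfl
  rw [Finset.sum_congr rfl h1]
  have h2 : ∑ s ∈ K, ∑ t ∈ K.erase s, f (s, t) = ∑ p ∈ K.offDiag, f p := by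
    rw [Finset.sum_sigma']
    refine Finset.sum_bij' (fun p _ => (p.1, p.2)) (fun p _ => ⟨p.1, p.2⟩) ?_ ?_ ?_ ?_ ?_
    · rintro ⟨s, t⟩ h
      simp only [Finset.mem_sigma, Finset.mem_erase, Finset.mem_offDiag] at h ⊢
      exact ⟨h.1, h.2.2, h.2.1.symm⟩
    · rintro ⟨s, t⟩ h
      simp only [Finset.mem_sigma, Finset.mem_erase, Finset.mem_offDiag] at h ⊢
      exact ⟨h.1, h.2.2.symm, h.2.1⟩
    · intros; rfl
    · intros; rfl
    · intros; rfl
  rw [h2]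
  refine Finset.sum_involution (fun p _ => (p.2, p.1)) ?_ ?_ ?_ ?_
  · rintro ⟨s, t⟩ h
    obtain ⟨hs, ht, hst⟩ := Finset.mem_offDiag.mp h
    have hs' : s ∈ K.erase t := Finset.mem_erase.mpr ⟨hst, hs⟩
    have ht' : t ∈ K.erase s := Finset.mem_erase.mpr ⟨hst.symm, ht⟩
    simp only [f]
    rw [dif_pos (hc2 s hs t ht'), dif_pos (hc2 t ht s hs')]
    have e : ∀ (L : Finset S) (hL : L = (K.erase s).erase t) (hLi : (L.card : ℤ) = i)
        (hLK : L ⊆ K), (F.map (homOfLE hLK)).hom (x ⟨L, hLi⟩) =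
          (F.map (homOfLE ((Finset.erase_subset t (K.erase s)).trans
            (Finset.erase_subset s K)))).hom (x ⟨(K.erase s).erase t, hc2 s hs t ht'⟩) := by
      rintro L rfl hLi hLK
      rfl
    rw [e ((K.erase t).erase s) (Finset.erase_right_comm) (hc2 t ht s hs') _, ← add_smul,
      coeffSign_mul_add K hs ht hst, zero_smul]
  · rintro ⟨s, t⟩ h _ he
    exact (Finset.mem_offDiag.mp h).2.2 (congrArg Prod.snd he)
  · rintro ⟨s, t⟩ h
    obtain ⟨hs, ht, hst⟩ := Finset.mem_offDiag.mp h
    exact Finset.mem_offDiag.mpr ⟨ht, hs, hst.symm⟩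
  · intros; rfl

/-- The cochain complex associated with a coefficient system of `A`-modules on the subsets of
`S`, i.e. with a functor on the poset of subsets of `S`: in degree `n` it is the direct sum of
the `M^I` with `|I| = n`. -/
noncomputable def coeffComplex [Finite S] (F : Finset S ⥤ ModuleCat.{max v w} A) :
    CochainComplex (ModuleCat.{max v w} A) ℤ where
  X n := ModuleCat.of A (∀ I : {I : Finset S // (I.card : ℤ) = n}, F.obj I.1)
  d i j := ModuleCat.ofHom (coeffD F i j)
  shape i j h := by
    rw [coeffD_eq_zero F i j h]; rfl
  d_comp_d' i j k _ _ := by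
    rw [← ModuleCat.ofHom_comp, coeffD_comp]; rfl

end CoefficientSystem

section Tensor

open CategoryTheory TensorProduct MulOpposite

variable {R : Type u} [CommRing R] {A : Type v} {B : Type w} [Ring A] [Ring B] [Algebra R A]
  [Algebra R B]

/-- An `A`-`B`-bimodule (with `R` acting centrally), regarded as a left `A`-module. -/
noncomputable abbrev leftModule (X : ModuleCat.{z} (A ⊗[R] Bᵐᵒᵖ)) : ModuleCat.{z} A :=
  (ModuleCat.restrictScalars
    (Algebra.TensorProduct.includeLeft : A →ₐ[R] A ⊗[R] Bᵐᵒᵖ).toRingHom).obj X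

/-- The right action `x ↦ x b` of `b ∈ B` on an `A`-`B`-bimodule. -/
noncomputable def rightAct (X : ModuleCat.{z} (A ⊗[R] Bᵐᵒᵖ)) (b : B) (x : leftModule X) : leftModule X :=
  (((1 : A) ⊗ₜ[R] op b : A ⊗[R] Bᵐᵒᵖ) • (x : X) : X)

/-- The relations `x b ⊗ m = x ⊗ b m` of the tensor product over `B`. -/
noncomputable def balancedRel (X : ModuleCat.{z} (A ⊗[R] Bᵐᵒᵖ)) (N : ModuleCat.{z} B) :
    Submodule A (leftModule X ⊗[ℤ] N) :=
  Submodule.span A {y | ∃ (x : leftModule X) (b : B) (n : N),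
    y = rightAct X b x ⊗ₜ[ℤ] n - x ⊗ₜ[ℤ] (b • n)}

/-- The tensor product `X ⊗_B N` of an `A`-`B`-bimodule and a left `B`-module, as a left
`A`-module. -/
noncomputable def tensorObj (X : ModuleCat.{z} (A ⊗[R] Bᵐᵒᵖ)) (N : ModuleCat.{z} B) :
    ModuleCat.{z} A :=
  ModuleCat.of A ((leftModule X ⊗[ℤ] N) ⧸ balancedRel X N)

/-- The element `x ⊗ n` of `X ⊗_B N`. -/
noncomputable def tensorMk {X : ModuleCat.{z} (A ⊗[R] Bᵐᵒᵖ)} {N : ModuleCat.{z} B}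
    (x : leftModule X) (n : N) : tensorObj X N :=
  (balancedRel X N).mkQ (x ⊗ₜ[ℤ] n)

theorem tensor_induction {X : ModuleCat.{z} (A ⊗[R] Bᵐᵒᵖ)} {N : ModuleCat.{z} B}
    {p : tensorObj X N → Prop} (h0 : p 0) (hadd : ∀ x y, p x → p y → p (x + y))
    (hmk : ∀ x n, p (tensorMk x n)) (y : tensorObj X N) : p y := by
  obtain ⟨y, rfl⟩ := (balancedRel X N).mkQ_surjective y
  induction y using TensorProduct.induction_on with
  | zero => rw [map_zero]; exact h0
  | tmul x n => exact hmk x n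
  | add x y hx hy => rw [map_add]; exact hadd _ _ hx hy

theorem tensor_hom_ext {X : ModuleCat.{z} (A ⊗[R] Bᵐᵒᵖ)} {N : ModuleCat.{z} B}
    {Y : ModuleCat.{z} A} {f g : tensorObj X N ⟶ Y}
    (h : ∀ x n, f.hom (tensorMk x n) = g.hom (tensorMk x n)) : f = g := by
  ext y
  induction y using tensor_induction with
  | h0 => rw [map_zero, map_zero]
  | hadd x y hx hy => rw [map_add, map_add, hx, hy]
  | hmk x n => exact h x n

/-- The map `x ⊗ n ↦ f x ⊗ g n`. -/
noncomputable def tensorMap {X X' : ModuleCat.{z} (A ⊗[R] Bᵐᵒᵖ)} {N N' : ModuleCat.{z} B}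
    (f : X ⟶ X') (g : N ⟶ N') : tensorObj X N ⟶ tensorObj X' N' :=
  ModuleCat.ofHom ((balancedRel X N).mapQ (balancedRel X' N')
    (AlgebraTensorModule.map ((ModuleCat.restrictScalars _).map f).hom
      (g.hom.toAddMonoidHom.toIntLinearMap))
    (by
      rw [balancedRel, Submodule.span_le]
      rintro _ ⟨x, b, n, rfl⟩
      refine Submodule.subset_span ⟨f.hom x, b, g.hom n, ?_⟩
      rw [map_sub, AlgebraTensorModule.map_tmul, AlgebraTensorModule.map_tmul]
      congr 2
      · exact map_smul f.hom _ _
      · exact map_smul g.hom _ _))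

theorem tensorMap_mk {X X' : ModuleCat.{z} (A ⊗[R] Bᵐᵒᵖ)} {N N' : ModuleCat.{z} B}
    (f : X ⟶ X') (g : N ⟶ N') (x : leftModule X) (n : N) :
    (tensorMap f g).hom (tensorMk x n) =
      tensorMk (X := X') (f.hom x : X') (g.hom n) := rfl

theorem tensorMk_add_left {X : ModuleCat.{z} (A ⊗[R] Bᵐᵒᵖ)} {N : ModuleCat.{z} B}
    (x y : leftModule X) (n : N) : tensorMk (x + y) n = tensorMk x n + tensorMk y n := by
  simp only [tensorMk, TensorProduct.add_tmul, map_add]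
  rfl

theorem tensorMk_add_right {X : ModuleCat.{z} (A ⊗[R] Bᵐᵒᵖ)} {N : ModuleCat.{z} B}
    (x : leftModule X) (n m : N) : tensorMk x (n + m) = tensorMk x n + tensorMk x m := by
  simp only [tensorMk, TensorProduct.tmul_add, map_add]
  rfl

theorem tensorMk_smul_left {X : ModuleCat.{z} (A ⊗[R] Bᵐᵒᵖ)} {N : ModuleCat.{z} B}
    (a : A) (x : leftModule X) (n : N) : tensorMk (a • x) n = a • tensorMk x n := by
  simp only [tensorMk, ← TensorProduct.smul_tmul', map_smul]
  rfl

theorem tensorMk_smul_right {X : ModuleCat.{z} (A ⊗[R] Bᵐᵒᵖ)} {N : ModuleCat.{z} B}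
    (b : B) (x : leftModule X) (n : N) : tensorMk x (b • n) = tensorMk (rightAct X b x) n := by
  refine ((Submodule.Quotient.eq _).mpr ?_).symm
  exact Submodule.subset_span ⟨x, b, n, rfl⟩

/-- The bifunctor `(X, N) ↦ X ⊗_B N`. -/
noncomputable def tensorBifunctor (R : Type u) [CommRing R] (A : Type v) (B : Type w) [Ring A]
    [Ring B] [Algebra R A] [Algebra R B] :
    ModuleCat.{z} (A ⊗[R] Bᵐᵒᵖ) ⥤ ModuleCat.{z} B ⥤ ModuleCat.{z} A where
  obj X :=
    { obj := fun N => tensorObj X N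
      map := fun g => tensorMap (𝟙 X) g
      map_id := fun N => tensor_hom_ext fun x n => rfl
      map_comp := fun f g => tensor_hom_ext fun x n => rfl }
  map f :=
    { app := fun N => tensorMap f (𝟙 N)
      naturality := fun N N' g => tensor_hom_ext fun x n => rfl }
  map_id X := by
    ext N : 2
    exact tensor_hom_ext fun x n => rfl
  map_comp f g := by
    ext N : 2
    exact tensor_hom_ext fun x n => rfl

instance : (tensorBifunctor.{u, v, w, z} R A B).Additive where
  map_add {X Y f g} := by
    ext N : 2
    exact tensor_hom_ext fun x n => tensorMk_add_left (X := Y) (f.hom x : Y) (g.hom x : Y) n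

instance (X : ModuleCat.{z} (A ⊗[R] Bᵐᵒᵖ)) : ((tensorBifunctor.{u, v, w, z} R A B).obj X).Additive where
  map_add {_ _ f g} := tensor_hom_ext fun x n => tensorMk_add_right x (f.hom n) (g.hom n)

/-- The functor `X ⊗_B -` on cochain complexes, for a complex `X` of `A`-`B`-bimodules: in degree
`n` it is the direct sum of the `X^i ⊗_B N^j`, `i + j = n`, with the usual total differential. -/
noncomputable def tensorComplex (X : CochainComplex (ModuleCat.{z} (A ⊗[R] Bᵐᵒᵖ)) ℤ) :
    CochainComplex (ModuleCat.{z} B) ℤ ⥤ CochainComplex (ModuleCat.{z} A) ℤ :=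
  ((tensorBifunctor.{u, v, w, z} R A B).map₂CochainComplex).obj X

/-- The functor induced by `X ⊗_B -` on (unbounded) homotopy categories. -/
noncomputable def tensorHomotopy (X : CochainComplex (ModuleCat.{z} (A ⊗[R] Bᵐᵒᵖ)) ℤ) :
    HomotopyCategory (ModuleCat.{z} B) (ComplexShape.up ℤ) ⥤
      HomotopyCategory (ModuleCat.{z} A) (ComplexShape.up ℤ) :=
  CategoryTheory.Quotient.lift _ (tensorComplex X ⋙ HomotopyCategory.quotient _ _)
    (fun _ _ _ _ ⟨h⟩ => HomotopyCategory.eq_of_homotopy _ _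
      (HomologicalComplex.mapBifunctorMapHomotopy₂ (𝟙 X) h
        (tensorBifunctor.{u, v, w, z} R A B) (ComplexShape.up ℤ)))

end Tensor

section Bounded

open CategoryTheory Limits

/-- A complex of `A`-modules is bounded when its terms are zero outside of a finite range
of degrees. -/
def IsBounded {A : Type u} [Ring A] (K : CochainComplex (ModuleCat.{z} A) ℤ) : Prop :=
  ∃ a b : ℤ, ∀ i, (i < a ∨ b < i) → IsZero (K.X i)

/-- Bounded complexes of `A`-modules with terms in a given class of modules, as objects of the
homotopy category. -/
def boundedProperty (A : Type u) [Ring A] (Q : ObjectProperty (ModuleCat.{z} A)) :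
    ObjectProperty (HomotopyCategory (ModuleCat.{z} A) (ComplexShape.up ℤ)) :=
  fun K => IsBounded K.as ∧ ∀ i, Q (K.as.X i)

/-- The homotopy category of bounded complexes of `A`-modules with terms in a given class `Q` of
modules. Morphisms are homotopy classes of morphisms of complexes. -/
abbrev BoundedHomotopyCategory (A : Type u) [Ring A] (Q : ObjectProperty (ModuleCat.{z} A)) :=
  (boundedProperty A Q).FullSubcategory

/-- The class of finitely generated modules. -/
def finitelyGenerated (A : Type u) [Ring A] : ObjectProperty (ModuleCat.{z} A) :=
  fun N => Module.Finite A N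

end Bounded

section Preservation

open CategoryTheory Limits TensorProduct MulOpposite

variable {R : Type u} [CommRing R] {A : Type v} {B : Type w} [Ring A] [Ring B] [Algebra R A]
  [Algebra R B]

theorem isBounded_tensorComplex {X : CochainComplex (ModuleCat.{z} (A ⊗[R] Bᵐᵒᵖ)) ℤ}
    (hX : IsBounded X) {K : CochainComplex (ModuleCat.{z} B) ℤ} (hK : IsBounded K) :
    IsBounded ((tensorComplex X).obj K) := by
  obtain ⟨a, b, hX⟩ := hX
  obtain ⟨c, d, hK⟩ := hK
  refine ⟨a + c, b + d, fun n hn => ?_⟩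
  rw [IsZero.iff_id_eq_zero]
  refine HomologicalComplex.mapBifunctor.hom_ext (K₁ := X) (K₂ := K)
    (F := tensorBifunctor.{u, v, w, z} R A B) (c := ComplexShape.up ℤ) fun i j hij => ?_
  refine IsZero.eq_of_src ?_ _ _
  have hij : i + j = n := hij
  by_cases hi : i < a ∨ b < i
  · exact ((tensorBifunctor.{u, v, w, z} R A B).map_isZero (hX i hi)).obj _
  · exact ((tensorBifunctor.{u, v, w, z} R A B).obj _).map_isZero (hK j (by omega))

theorem finite_tensorObj {X : ModuleCat.{z} (A ⊗[R] Bᵐᵒᵖ)} {N : ModuleCat.{z} B}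
    (hX : Module.Finite A (leftModule X)) (hN : Module.Finite B N) :
    Module.Finite A (tensorObj X N) := by
  classical
  obtain ⟨s, hs⟩ := hX
  obtain ⟨t, ht⟩ := hN
  refine ⟨Finset.image₂ (fun x n => (tensorMk x n : tensorObj X N)) s t, ?_⟩
  rw [eq_top_iff]
  rintro y -
  induction y using tensor_induction with
  | h0 => exact zero_mem _
  | hadd x y hx hy => exact add_mem hx hy
  | hmk x n =>
    have hn : n ∈ Submodule.span B (t : Set N) := by rw [ht]; trivial
    induction hn using Submodule.span_induction generalizing x with
    | zero =>
      have : (tensorMk x 0 : tensorObj X N) = 0 := by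
        simp only [tensorMk, TensorProduct.tmul_zero, map_zero]
        rfl
      rw [this]; exact zero_mem _
    | add n m _ _ hn hm => rw [tensorMk_add_right]; exact add_mem (hn x) (hm x)
    | smul b n _ hn => rw [tensorMk_smul_right]; exact hn _
    | mem n hn =>
      have hx : x ∈ Submodule.span A (s : Set (leftModule X)) := by rw [hs]; trivial
      induction hx using Submodule.span_induction with
      | zero =>
        have : (tensorMk 0 n : tensorObj X N) = 0 := by
          simp only [tensorMk, TensorProduct.zero_tmul, map_zero]
          rfl
        rw [this]; exact zero_mem _
      | add x y _ _ hx hy => rw [tensorMk_add_left]; exact add_mem hx hy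
      | smul a x _ hx => rw [tensorMk_smul_left]; exact Submodule.smul_mem _ _ hx
      | mem x hx =>
        exact Submodule.subset_span (Finset.mem_coe.mpr (Finset.mem_image₂_of_mem hx hn))

theorem finite_tensorComplex {X : CochainComplex (ModuleCat.{z} (A ⊗[R] Bᵐᵒᵖ)) ℤ}
    (hX : IsBounded X) (hX' : ∀ i, Module.Finite A (leftModule (X.X i)))
    {K : CochainComplex (ModuleCat.{z} B) ℤ} (hK : ∀ i, Module.Finite B (K.X i)) (n : ℤ) :
    Module.Finite A (((tensorComplex X).obj K).X n) := by
  obtain ⟨a, b, hX⟩ := hX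
  let ι (i : ℤ) : tensorObj (X.X i) (K.X (n - i)) ⟶ ((tensorComplex X).obj K).X n :=
    HomologicalComplex.ιMapBifunctor X K (tensorBifunctor.{u, v, w, z} R A B) (ComplexShape.up ℤ)
      i (n - i) n (show i + (n - i) = n by omega)
  let N : Submodule A (((tensorComplex X).obj K).X n) :=
    ⨆ i : Set.Icc a b, LinearMap.range (ι i).hom
  have hN : N = ⊤ := by
    have h0 : ModuleCat.ofHom N.mkQ = 0 := by
      refine HomologicalComplex.mapBifunctor.hom_ext (K₁ := X) (K₂ := K)
        (F := tensorBifunctor.{u, v, w, z} R A B) (c := ComplexShape.up ℤ) fun i j hij => ?_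
      have hij : i + j = n := hij
      obtain rfl : j = n - i := by omega
      by_cases hi : i < a ∨ b < i
      · exact IsZero.eq_of_src
          (((tensorBifunctor.{u, v, w, z} R A B).map_isZero (hX i hi)).obj _) _ _
      · apply ModuleCat.hom_ext
        apply LinearMap.ext
        intro y
        refine (Submodule.Quotient.mk_eq_zero N).mpr ?_
        exact Submodule.mem_iSup_of_mem (⟨i, by simp; omega⟩ : Set.Icc a b) ⟨y, rfl⟩
    rw [eq_top_iff]
    rintro y -
    rw [← Submodule.Quotient.mk_eq_zero]
    exact LinearMap.congr_fun (congrArg ModuleCat.Hom.hom h0) y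
  have hfg : N.FG := by
    refine Submodule.fg_iSup _ fun i => ?_
    have := finite_tensorObj (hX' i) (hK (n - i))
    rw [LinearMap.range_eq_map]
    exact Module.Finite.fg_top.map (ι i).hom
  exact ⟨hN ▸ hfg⟩

/-- The functor induced by `X ⊗_B -` on bounded homotopy categories. -/
noncomputable def tensorBounded (X : CochainComplex (ModuleCat.{z} (A ⊗[R] Bᵐᵒᵖ)) ℤ)
    {Q : ObjectProperty (ModuleCat.{z} B)} {Q' : ObjectProperty (ModuleCat.{z} A)}
    (h : ∀ K, boundedProperty B Q K → boundedProperty A Q' ((tensorHomotopy X).obj K)) :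
    BoundedHomotopyCategory B Q ⥤ BoundedHomotopyCategory A Q' :=
  (boundedProperty A Q').lift ((boundedProperty B Q).ι ⋙ tensorHomotopy X)
    fun K => h _ K.property

end Preservation

section SubalgebraSystem

open CategoryTheory Limits TensorProduct MulOpposite

section Quotient

variable {T : Type u} [Ring T] {N : Type v} [AddCommGroup N] [Module T N]

/-- The map `N ⧸ p ⟶ N ⧸ q`, `x ↦ x`, for submodules `p ≤ q`. -/
noncomputable def quotientMap {p q : Submodule T N} (h : p ≤ q) :
    ModuleCat.of T (N ⧸ p) ⟶ ModuleCat.of T (N ⧸ q) :=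
  ModuleCat.ofHom (Submodule.factor h)

theorem quotientMap_refl (p : Submodule T N) (h : p ≤ p) : quotientMap h = 𝟙 _ := by
  apply ModuleCat.hom_ext
  apply LinearMap.ext
  intro x
  obtain ⟨x, rfl⟩ := Submodule.mkQ_surjective _ x
  rfl

theorem quotientMap_comp {p q r : Submodule T N} (h : p ≤ q) (h' : q ≤ r) (h'' : p ≤ r) :
    quotientMap h'' = quotientMap h ≫ quotientMap h' := by
  apply ModuleCat.hom_ext
  apply LinearMap.ext
  intro x
  obtain ⟨x, rfl⟩ := Submodule.mkQ_surjective _ x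
  rfl

end Quotient

variable {R : Type u} [CommRing R] {A : Type (max u v)} [Ring A] [Algebra R A]

/-- The sub-bimodule of `A ⊗_R A` spanned by the `x b ⊗ y - x ⊗ b y` with `b ∈ C`. Bimodules
are left modules over `A ⊗_R Aᵒᵖ`, and `x ⊗ y ∈ A ⊗_R A` is written `x ⊗ₜ op y`. -/
noncomputable def squareRel (C : Subalgebra R A) : Submodule (A ⊗[R] Aᵐᵒᵖ) (A ⊗[R] Aᵐᵒᵖ) :=
  Submodule.span _ {t | ∃ x y, ∃ b ∈ C, t = (x * b) ⊗ₜ[R] op y - x ⊗ₜ[R] op (b * y)}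

/-- The `A`-bimodule `A ⊗_C A`, for a subalgebra `C` of `A`. -/
noncomputable abbrev square (C : Subalgebra R A) : ModuleCat.{max u v} (A ⊗[R] Aᵐᵒᵖ) :=
  ModuleCat.of _ ((A ⊗[R] Aᵐᵒᵖ) ⧸ squareRel C)

theorem squareRel_mono {C D : Subalgebra R A} (h : C ≤ D) : squareRel C ≤ squareRel D := by
  refine Submodule.span_mono ?_
  rintro _ ⟨x, y, b, hb, rfl⟩
  exact ⟨x, y, b, h hb, rfl⟩

/-- The bimodule map `x ⊗_C y ↦ x ⊗_D y` for `C ≤ D`. -/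
noncomputable def squareMap {C D : Subalgebra R A} (h : C ≤ D) : square C ⟶ square D :=
  quotientMap (squareRel_mono h)

variable {S : Type v} [LinearOrder S]

/-- The coefficient system `I ↦ A ⊗_{C_I} A` attached to an increasing family of subalgebras. -/
noncomputable def squareSystem (C : Finset S → Subalgebra R A) (hC : Monotone C) :
    Finset S ⥤ ModuleCat.{max u v} (A ⊗[R] Aᵐᵒᵖ) where
  obj I := square (C I)
  map f := squareMap (hC (leOfHom f))
  map_id _ := quotientMap_refl _ _
  map_comp _ _ := quotientMap_comp _ _ _

theorem isBounded_coeffComplex {T : Type u} [Ring T] [Finite S]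
    (F : Finset S ⥤ ModuleCat.{max u v} T) : IsBounded (coeffComplex.{u, max u v, v} F) := by
  have := Fintype.ofFinite S
  refine ⟨0, Fintype.card S, fun n hn => ?_⟩
  have : IsEmpty {I : Finset S // (I.card : ℤ) = n} := by
    refine ⟨fun I => ?_⟩
    have h1 := I.1.card_le_univ
    have h2 := I.2
    omega
  have h0 : Subsingleton (∀ I : {I : Finset S // (I.card : ℤ) = n}, F.obj I.1) := inferInstance
  exact ModuleCat.isZero_of_iff_subsingleton.mpr h0

theorem finite_square [h1 : Module.Finite R A] (C : Subalgebra R A) :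
    Module.Finite A (leftModule (square C)) := by
  have h2 : Module.Finite R Aᵐᵒᵖ := Module.Finite.equiv (MulOpposite.opLinearEquiv R)
  have h3 : Module.Finite A (A ⊗[R] Aᵐᵒᵖ) := Module.Finite.base_change _ _ _
  have hs : ∀ (a : A) (x : A ⊗[R] Aᵐᵒᵖ), a • x = (a ⊗ₜ[R] (1 : Aᵐᵒᵖ)) • x := by
    intro a x
    induction x using TensorProduct.induction_on with
    | zero => rw [smul_zero, smul_zero]
    | add x y hx hy => rw [smul_add, smul_add, hx, hy]
    | tmul x y => simp [TensorProduct.smul_tmul']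
  let f : (A ⊗[R] Aᵐᵒᵖ) →ₗ[A] leftModule (square C) :=
    { toFun := fun t => (squareRel C).mkQ t
      map_add' := fun x y => map_add (squareRel C).mkQ x y
      map_smul' := fun a x =>
        (congrArg (squareRel C).mkQ (hs a x)).trans (map_smul (squareRel C).mkQ _ x) }
  have hf : Function.Surjective f := fun y => (squareRel C).mkQ_surjective y
  exact Module.Finite.of_surjective f hf

theorem finite_coeffComplex [Finite S] (F : Finset S ⥤ ModuleCat.{max u v} (A ⊗[R] Aᵐᵒᵖ))
    (hF : ∀ I, Module.Finite A (leftModule (F.obj I))) (n : ℤ) :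
    Module.Finite A (leftModule ((coeffComplex F).X n)) := by
  let g : (∀ I : {I : Finset S // (I.card : ℤ) = n}, leftModule (F.obj I.1))
      →ₗ[A] leftModule ((coeffComplex F).X n) :=
    { toFun := fun x => x
      map_add' := fun x y => rfl
      map_smul' := fun a x => rfl }
  have hg : Function.Surjective g := fun x => ⟨x, rfl⟩
  exact Module.Finite.of_surjective g hg

end SubalgebraSystem

section HeckeComplex

open CategoryTheory TensorProduct

variable {B W : Type v} [Group W] {M : CoxeterMatrix B} {cs : CoxeterSystem M W}
  {R : Type u} [CommRing R] (P : Parameters cs R)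

theorem HeckeAlgebra.finite [Finite W] : Module.Finite R (HeckeAlgebra P) :=
  Module.Finite.of_basis (HeckeAlgebra.basis P)

theorem parabolicSubalgebra_monotone :
    Monotone fun I : Finset B => parabolicSubalgebra P (I : Set B) :=
  fun _ _ h => parabolicSubalgebra_mono P (Finset.coe_subset.mpr h)

/-- The complex `X(H)` of `H`-bimodules, attached to the coefficient system
`I ↦ H ⊗_{H_I} H`. -/
noncomputable def heckeComplex [Finite B] [LinearOrder B] :
    CochainComplex (ModuleCat.{max u v} (HeckeAlgebra P ⊗[R] (HeckeAlgebra P)ᵐᵒᵖ)) ℤ :=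
  coeffComplex (squareSystem _ (parabolicSubalgebra_monotone P))

theorem isBounded_heckeComplex [Finite B] [LinearOrder B] : IsBounded (heckeComplex P) :=
  isBounded_coeffComplex _

theorem finite_heckeComplex [Finite W] [Finite B] [LinearOrder B] (n : ℤ) :
    Module.Finite (HeckeAlgebra P) (leftModule ((heckeComplex P).X n)) :=
  finite_coeffComplex _ (fun _ => finite_square (h1 := HeckeAlgebra.finite P) _) n

/-- The functor `X(H) ⊗_H -` on the homotopy category of bounded complexes of finitely
generated `H`-modules. -/
noncomputable def heckeFunctorFinite [Finite W] [Finite B] [LinearOrder B] :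
    BoundedHomotopyCategory.{max u v, max u v} (HeckeAlgebra P) (finitelyGenerated _) ⥤
      BoundedHomotopyCategory.{max u v, max u v} (HeckeAlgebra P) (finitelyGenerated _) :=
  tensorBounded (heckeComplex P) fun _ hK =>
    ⟨isBounded_tensorComplex (isBounded_heckeComplex P) hK.1,
      finite_tensorComplex (isBounded_heckeComplex P) (finite_heckeComplex P) hK.2⟩

/-- The functor `X(H) ⊗_H -` on the homotopy category of bounded complexes of `H`-modules. -/
noncomputable def heckeFunctor [Finite B] [LinearOrder B] :
    BoundedHomotopyCategory.{max u v, max u v} (HeckeAlgebra P) ⊤ ⥤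
      BoundedHomotopyCategory.{max u v, max u v} (HeckeAlgebra P) ⊤ :=
  tensorBounded (heckeComplex P) fun _ hK =>
    ⟨isBounded_tensorComplex (isBounded_heckeComplex P) hK.1, fun _ => trivial⟩

end HeckeComplex

end Hecke

-- The quasi-inverse is tensoring with an explicit complex Y, `dualComplex`. Its terms are the
-- bimodules H ⊗_{H_Q} H with Q = S \ J, placed in degree |J| - |S|; it runs from H in degree -|S|
-- to H ⊗_R H in degree 0. The maps H ⊗_{H_Q} H → H ⊗_{H_Q'} H for Q' ⊆ Q exist because H is a
-- Frobenius extension of each H_Q: the h_m with m minimal in m W_Q, and suitable multiples of the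
-- h_{m⁻¹}, are dual bases for the projection p_Q : H → H_Q. The map is given by a Casimir element ∑
-- h_m ⊗ p_Q(h_m^∨), over the minimal m for Q'. Both composites of X ⊗ - and Y ⊗ - have to be the
-- identity up to homotopy.
--
-- The composite X ⊗ Y ⊗ L is a total complex of cells H ⊗_{H_I} H ⊗_{H_Q} - indexed by pairs (I,
-- J). A cell is generated by the elements 1 ⊗ h_w ⊗ n. Let v be the longest element of W_I w W_Q.
-- (1) If v ∉ W_Q, there is a left descent s of v with s v ∉ v W_Q (`exists_isMovingDescent`).
-- Adding s to I does not change v, and by `IsTop.mem_parabolicSubgroup_diff` the cosets of W_{I \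
-- {s}} in W_{I \ {s}} v W_Q correspond to those of W_{I ∪ {s}} in W_{I ∪ {s}} v W_Q. So the
-- component of the differential which adds s is invertible on this part, with inverse h_w ↦ h_w
-- h_n⁻¹ ⊗ h_n, for any n in W_{I ∪ {s}} w ∩ v W_Q. That this is a bimodule map is
-- `Translation.splitting_mul_of_mem` and `Translation.splitting_mul`. (2) If v ∈ W_Q, then I ⊆ Q
-- and w ∈ W_Q, and h_w can be moved out of the middle, so w = 1 suffices. If I ≠ S, fix t ∉ I
-- depending on I only. The component which adds t to J sends 1 ⊗ 1 ⊗ n to 1 ⊗ 1 ⊗ n plus terms of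
-- type (1), so it is invertible up to such terms. (3) If I = S in case (2), then J is empty. This
-- is the only critical cell; it is the identity functor, in degree 0.
--
-- Let σ be the degree -1 map which inverts the matched components. For a suitable height function
-- all other components of d strictly decrease heights, so 1 - (dσ + σd), which is homotopic to the
-- identity and natural in L, lowers heights except on the critical cell
-- (`BiSystem.apply_gen_sub_laplacian_mem`). A large power of it retracts the total complex to L:
-- this is algebraic Morse theory, `MorseFiltration.quotientIso`. The composite in the other order
-- has the same structure after applying h_w ↦ h_{w⁻¹}; the common features are the axioms of
-- `BiSystem`. Naturality in L gives isomorphisms of functors on homotopy categories, and both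
-- functors preserve boundedness and finite generation.

universe u₁ u₂ u₃ u₄ u₅ u₆

namespace Hecke

/-! ### The geometric representation; distinct labels give distinct simple reflections -/

section SimpleInjective

variable {B : Type v} (M : CoxeterMatrix B)

/-- The entries `-cos (π / m)` of the Gram matrix of the geometric representation. -/
noncomputable def gramEntry (i j : B) : ℂ := -Complex.cos (Real.pi / M i j)

/-- The linear form `x ↦ ⟨x, e_i⟩` on the geometric representation. -/
noncomputable def rootForm (i : B) : (B →₀ ℂ) →ₗ[ℂ] ℂ :=
  Finsupp.linearCombination ℂ fun b => gramEntry M b i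

/-- The reflection `x ↦ x - 2 ⟨x, e_i⟩ e_i`. -/
noncomputable def rootReflection (i : B) : Module.End ℂ (B →₀ ℂ) :=
  1 - (2 : ℂ) • (rootForm M i).smulRight (Finsupp.single i 1)

theorem rootReflection_apply (i : B) (x : B →₀ ℂ) :
    rootReflection M i x = x - (2 * rootForm M i x) • Finsupp.single i 1 := by
  simp [rootReflection, mul_smul]

theorem rootForm_single (i j : B) : rootForm M i (Finsupp.single j 1) = gramEntry M j i := by
  simp [rootForm]

theorem gramEntry_self (i : B) : gramEntry M i i = 1 := by
  simp [gramEntry]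

theorem gramEntry_symm (i j : B) : gramEntry M i j = gramEntry M j i := by
  simp [gramEntry, M.symmetric i j]

theorem rootReflection_mul_self (i : B) : rootReflection M i * rootReflection M i = 1 := by
  apply LinearMap.ext
  intro x
  rw [Module.End.mul_apply, rootReflection_apply, rootReflection_apply, map_sub, map_smul,
    rootForm_single, gramEntry_self, Module.End.one_apply, smul_eq_mul]
  module

/-- For m ≥ 3 the numbers ζ, ζ⁻¹, 1 are distinct m-th roots of unity, so the annihilating cubic (X -
ζ)(X - ζ⁻¹)(X - 1) divides X ^ m - 1. -/
theorem pow_eq_one_of_isPrimitiveRoot {E : Type*} [Ring E] [Algebra ℂ E] {m : ℕ} (hm : 3 ≤ m)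
    {ζ : ℂ} (hprim : IsPrimitiveRoot ζ m) (T : E)
    (hT : (T * T - (ζ + ζ⁻¹) • T + 1) * (T - 1) = 0) : T ^ m = 1 := by
  have hz0 : ζ ≠ 0 := hprim.ne_zero (by omega)
  have h1z : (1 : ℂ) ≠ ζ := by
    intro h
    exact hprim.ne_one (by omega) h.symm
  have h1z' : (1 : ℂ) ≠ ζ⁻¹ := by
    intro h
    exact h1z (by rw [← inv_inv ζ, ← h, inv_one])
  have hzz : ζ ≠ ζ⁻¹ := by
    intro h
    have h2 : ζ ^ 2 = 1 := by
      rw [pow_two]; nth_rewrite 2 [h]; exact mul_inv_cancel₀ hz0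
    exact absurd (Nat.le_of_dvd (by norm_num) (hprim.dvd_of_pow_eq_one 2 h2)) (by omega)
  have hdvd : (Polynomial.X * Polynomial.X - (ζ + ζ⁻¹) • Polynomial.X + 1) *
      (Polynomial.X - 1) ∣ (Polynomial.X ^ m - 1 : Polynomial ℂ) := by
    classical
    have hsub : ({ζ, ζ⁻¹, 1} : Finset ℂ) ⊆ Polynomial.nthRootsFinset m (1 : ℂ) := by
      intro x hx
      rw [Polynomial.mem_nthRootsFinset (by omega)]
      simp only [Finset.mem_insert, Finset.mem_singleton] at hx
      rcases hx with rfl | rfl | rfl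
      · exact hprim.pow_eq_one
      · rw [inv_pow, hprim.pow_eq_one, inv_one]
      · simp
    have := Finset.prod_dvd_prod_of_subset _ _
      (fun μ => Polynomial.X - Polynomial.C μ) hsub
    rw [Finset.prod_insert (by simp [hzz, h1z.symm]), Finset.prod_insert (by simp [h1z'.symm]),
      Finset.prod_singleton, ← Polynomial.X_pow_sub_one_eq_prod (by omega) hprim] at this
    convert this using 1
    have e : Polynomial.C ζ * Polynomial.C ζ⁻¹ = 1 := by
      rw [← Polynomial.C_mul, mul_inv_cancel₀ hz0, Polynomial.C_1]
    rw [Polynomial.smul_eq_C_mul, Polynomial.C_add, Polynomial.C_1]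
    linear_combination (1 - Polynomial.X) * e
  obtain ⟨g, hg⟩ := hdvd
  have h0 := congrArg (Polynomial.aeval T) hg
  simp only [map_sub, map_mul, map_add, map_smul, map_pow, Polynomial.aeval_X, map_one, hT,
    zero_mul] at h0
  exact sub_eq_zero.mp h0

/-- The product T of two reflections moves each vector by an element of the plane spanned by e_i and
e_j, where T has trace 4c² - 2 and determinant 1. Cayley–Hamilton on that plane gives the cubic
relation, and 4c² - 2 = 2 cos (2π / m) = ζ + ζ⁻¹. For m = 2 the roots ζ and ζ⁻¹ coincide, but c = 0
and a direct computation suffices; m = 0 encodes infinite order. -/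
theorem rootReflection_liftable : M.IsLiftable (rootReflection M) := by
  intro i j
  by_cases hij : i = j
  · subst hij
    rw [M.diagonal, pow_one, rootReflection_mul_self]
  set c := gramEntry M i j with hc
  set T := rootReflection M i * rootReflection M j with hT
  have hTx : ∀ x, T x = x + (4 * c * rootForm M j x - 2 * rootForm M i x) • Finsupp.single i 1
      - (2 * rootForm M j x) • Finsupp.single j 1 := by
    intro x
    rw [hT, Module.End.mul_apply, rootReflection_apply, rootReflection_apply, map_sub, map_smul,
      rootForm_single, gramEntry_symm M j i, ← hc, smul_eq_mul]
    module
  have hi : T (Finsupp.single i 1) = (4 * c ^ 2 - 1) • Finsupp.single i 1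
      - (2 * c) • Finsupp.single j 1 := by
    rw [hTx, rootForm_single, rootForm_single, gramEntry_self, ← hc]
    module
  have hj : T (Finsupp.single j 1) = (2 * c) • Finsupp.single i 1
      - (1 : ℂ) • Finsupp.single j 1 := by
    rw [hTx, rootForm_single, rootForm_single, gramEntry_self, gramEntry_symm M j i, ← hc]
    module
  have hE : ∀ x, (T * T - (4 * c ^ 2 - 2) • T + 1 : Module.End ℂ (B →₀ ℂ)) (T x - x) = 0 := by
    intro x
    have e1 : T x - x = (4 * c * rootForm M j x - 2 * rootForm M i x) • Finsupp.single i 1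
      - (2 * rootForm M j x) • Finsupp.single j 1 := by rw [hTx]; abel
    rw [e1]
    generalize (4 * c * rootForm M j x - 2 * rootForm M i x) = α
    generalize (2 * rootForm M j x) = β
    simp only [LinearMap.add_apply, LinearMap.sub_apply, LinearMap.smul_apply,
      Module.End.mul_apply, Module.End.one_apply, map_sub, map_smul, hi, hj]
    module
  rcases Nat.lt_or_ge (M i j) 3 with hm | hm
  · have h1 : M i j ≠ 1 := M.off_diagonal i j hij
    have : M i j = 0 ∨ M i j = 2 := by omega
    rcases this with h | h
    · rw [h, pow_zero]
    · have hc0 : c = 0 := by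
        rw [hc, gramEntry, h]
        simp
      rw [h, pow_two]
      apply LinearMap.ext
      intro x
      have ha : rootForm M i (Finsupp.single j 1) = 0 := by
        rw [rootForm_single, gramEntry_symm, ← hc, hc0]
      have hb : rootForm M j (Finsupp.single i 1) = 0 := by
        rw [rootForm_single, ← hc, hc0]
      rw [Module.End.mul_apply, Module.End.one_apply, hTx (T x), hTx x]
      simp only [map_add, map_sub, map_smul, ha, hb, rootForm_single, gramEntry_self, hc0,
        smul_eq_mul]
      module
  · set m := M i j with hmdef
    have hm0 : m ≠ 0 := by omega
    set ζ : ℂ := Complex.exp (2 * Real.pi * Complex.I / m) with hζ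
    have hprim : IsPrimitiveRoot ζ m := Complex.isPrimitiveRoot_exp m hm0
    have hz0 : ζ ≠ 0 := Complex.exp_ne_zero _
    have hc2 : 4 * c ^ 2 - 2 = ζ + ζ⁻¹ := by
      rw [hc, gramEntry, Complex.cos, hζ, ← Complex.exp_neg, ← hmdef]
      have e1 : Complex.exp (2 * Real.pi * Complex.I / m) =
          Complex.exp (Real.pi / m * Complex.I) ^ 2 := by
        rw [← Complex.exp_nat_mul]; congr 1; push_cast; ring
      have e2 : Complex.exp (-(2 * Real.pi * Complex.I / m)) =
          Complex.exp (-(Real.pi / m) * Complex.I) ^ 2 := by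
        rw [← Complex.exp_nat_mul]; congr 1; push_cast; ring
      have e3 : Complex.exp (Real.pi / m * Complex.I) * Complex.exp (-(Real.pi / m) * Complex.I)
          = 1 := by
        rw [← Complex.exp_add]; simp
      rw [e1, e2]
      linear_combination 2 * e3
    refine pow_eq_one_of_isPrimitiveRoot hm hprim T ?_
    rw [← hc2]
    apply LinearMap.ext
    intro x
    exact hE x

/-- The reflection of i negates e_i, whereas the reflection of j ≠ i keeps the coefficient of e_i
equal to 1. -/
theorem simple_injective {B W : Type v} [Group W] {M : CoxeterMatrix B} (cs : CoxeterSystem M W) :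
    Function.Injective cs.simple := by
  intro i j h
  have e : rootReflection M i = rootReflection M j := by
    rw [← cs.lift_apply_simple (rootReflection_liftable M) i, h,
      cs.lift_apply_simple (rootReflection_liftable M) j]
  by_contra hij
  have h1 := DFunLike.congr_fun (LinearMap.congr_fun e (Finsupp.single i 1)) i
  rw [rootReflection_apply, rootReflection_apply, rootForm_single, gramEntry_self] at h1
  simp [Ne.symm hij] at h1

end SimpleInjective

end Hecke

namespace Hecke

/-! ### Lengths and descents in cosets of parabolic subgroups -/

section Cosets

variable {B W : Type v} [Group W] {M : CoxeterMatrix B} (cs : CoxeterSystem M W)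

/-- The parity of the number of occurrences of `x` among the right inversions of `w`. -/
noncomputable def inversionParity (w x : W) : ZMod 2 := (inversionHom cs w (x, 0)).2

theorem inversionHom_apply (w x : W) (z : ZMod 2) :
    inversionHom cs w (x, z) = (w * x * w⁻¹, z + inversionParity cs w x) := by
  classical
  obtain ⟨ω, -, rfl⟩ := cs.exists_isReduced w
  rw [inversionParity, inversionHom_wordProd, inversionHom_wordProd]
  simp

/-- This is the cocycle relation N(w w') = N(w') + w'⁻¹ N(w) w' for right inversion sets modulo 2.
It compares descents of m y with descents of y when the inversions of m in W_I are known. -/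
theorem inversionParity_mul (w w' x : W) : inversionParity cs (w * w') x =
    inversionParity cs w' x + inversionParity cs w (w' * x * w'⁻¹) := by
  conv_lhs => rw [inversionParity, map_mul, Equiv.Perm.mul_apply, inversionHom_apply,
    inversionHom_apply]
  simp

theorem length_mul_lt_of_inversionParity {w x : W} (h : inversionParity cs w x ≠ 0) :
    cs.length (w * x) < cs.length w := by
  classical
  obtain ⟨ω, hω, rfl⟩ := cs.exists_isReduced w
  rw [inversionParity, inversionHom_wordProd] at h
  have hc : (cs.rightInvSeq ω).count x ≠ 0 := by
    intro h0; apply h; simp [h0]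
  exact (cs.isRightInversion_of_mem_rightInvSeq hω
    (List.count_pos_iff.mp (Nat.pos_of_ne_zero hc))).2

theorem inversionParity_simple_ne_zero_iff {w : W} {i : B} :
    inversionParity cs w (cs.simple i) ≠ 0 ↔ cs.length (w * cs.simple i) < cs.length w :=
  ⟨length_mul_lt_of_inversionParity cs, snd_of_length_mul_simple_lt cs⟩

theorem simple_mem_parabolicSubgroup {I : Set B} {i : B} (h : i ∈ I) :
    cs.simple i ∈ parabolicSubgroup cs I := Subgroup.subset_closure ⟨i, h, rfl⟩

theorem parabolicSubgroup_mono {I J : Set B} (h : I ⊆ J) :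
    parabolicSubgroup cs I ≤ parabolicSubgroup cs J :=
  Subgroup.closure_mono (Set.image_mono h)

/-- Induction on an element of a parabolic subgroup by right multiplications. -/
theorem parabolic_induction_right {I : Set B} {p : (y : W) → y ∈ parabolicSubgroup cs I → Prop}
    (one : p 1 (one_mem _))
    (mul : ∀ y (hy : y ∈ parabolicSubgroup cs I) i (hi : i ∈ I), p y hy →
      p (y * cs.simple i) (mul_mem hy (simple_mem_parabolicSubgroup cs hi))) {y : W}
    (hy : y ∈ parabolicSubgroup cs I) : p y hy := by
  induction hy using Subgroup.closure_induction_right with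
  | one => exact one
  | mul_right x hx y hy ih =>
    obtain ⟨i, hi, rfl⟩ := hy
    exact mul _ hx i hi ih
  | mul_inv_cancel x hx y hy ih =>
    obtain ⟨i, hi, rfl⟩ := hy
    simp only [cs.inv_simple]
    exact mul _ hx i hi ih

/-- Lengths add up in a product `m y` when `m` has minimal length in its coset. -/
theorem length_mul_of_minimal {I : Set B} {m : W}
    (hm : ∀ y ∈ parabolicSubgroup cs I, cs.length m ≤ cs.length (m * y)) {y : W}
    (hy : y ∈ parabolicSubgroup cs I) : cs.length (m * y) = cs.length m + cs.length y := by
  induction hy using parabolic_induction_right with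
  | one => simp
  | mul y hy i hi ih =>
    -- The reflection y s_i y⁻¹ belongs to W_I; if it were an inversion of m, it would give an
    -- element of m W_I shorter than m.
    have h0 : inversionParity cs m (y * cs.simple i * y⁻¹) = 0 := by
      by_contra h
      have h1 := length_mul_lt_of_inversionParity cs h
      have h2 := hm _ (mul_mem (mul_mem hy (simple_mem_parabolicSubgroup cs hi)) (inv_mem hy))
      omega
    have h1 := inversionParity_mul cs m y (cs.simple i)
    rw [h0, add_zero] at h1
    have h2 : cs.length (m * y * cs.simple i) < cs.length (m * y) ↔
        cs.length (y * cs.simple i) < cs.length y := by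
      rw [← inversionParity_simple_ne_zero_iff, ← inversionParity_simple_ne_zero_iff, h1]
    rw [← mul_assoc]
    rcases cs.length_mul_simple (m * y) i with h3 | h3 <;>
      rcases cs.length_mul_simple y i with h4 | h4 <;> omega

/-- Lengths subtract in a product `m y` when `m` has maximal length in its coset. -/
theorem length_mul_of_maximal {I : Set B} {m : W}
    (hm : ∀ y ∈ parabolicSubgroup cs I, cs.length (m * y) ≤ cs.length m) {y : W}
    (hy : y ∈ parabolicSubgroup cs I) : cs.length (m * y) + cs.length y = cs.length m := by
  induction hy using parabolic_induction_right with
  | one => simp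
  | mul y hy i hi ih =>
    have hr := mul_mem (mul_mem hy (simple_mem_parabolicSubgroup cs hi)) (inv_mem hy)
    -- A reflection is an inversion of itself. For r = x s_j x⁻¹ the cocycle relation splits the
    -- parity into three terms; those of x and x⁻¹ cancel, since x x⁻¹ = 1 has no inversion, and the
    -- term of s_j remains.
    have hinv : ∀ r : W, cs.IsReflection r → inversionParity cs r r ≠ 0 := by
      rintro _ ⟨x, j, rfl⟩
      have e1 := inversionParity_mul cs x (cs.simple j * x⁻¹) (x * cs.simple j * x⁻¹)
      have e2 := inversionParity_mul cs (cs.simple j) x⁻¹ (x * cs.simple j * x⁻¹)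
      have e3 := inversionParity_mul cs x x⁻¹ (x * cs.simple j * x⁻¹)
      have e4 : inversionParity cs (cs.simple j) (cs.simple j) ≠ 0 := by
        rw [inversionParity_simple_ne_zero_iff]; simp
      have e0 : inversionParity cs (x * x⁻¹) (x * cs.simple j * x⁻¹) = 0 := by
        by_contra h
        have := length_mul_lt_of_inversionParity cs h
        simp at this
      rw [e0] at e3
      have s1 : x⁻¹ * (x * cs.simple j * x⁻¹) * x⁻¹⁻¹ = cs.simple j := by group
      have s2 : cs.simple j * x⁻¹ * (x * cs.simple j * x⁻¹) * (cs.simple j * x⁻¹)⁻¹ =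
        cs.simple j := by group
      rw [s1] at e2 e3
      rw [s2] at e1
      rw [← mul_assoc] at e1
      rw [e1, e2]
      intro h
      apply e4
      have : inversionParity cs (cs.simple j) (cs.simple j) =
        (inversionParity cs x⁻¹ (x * cs.simple j * x⁻¹) +
          inversionParity cs (cs.simple j) (cs.simple j) +
          inversionParity cs x (cs.simple j)) -
          (inversionParity cs x⁻¹ (x * cs.simple j * x⁻¹) + inversionParity cs x (cs.simple j)) := by
        ring
      rw [this, h, ← e3, sub_zero]
    have hrefl : cs.IsReflection (y * cs.simple i * y⁻¹) := ⟨y, i, rfl⟩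
    -- Otherwise r = y s_i y⁻¹ would be an inversion of m r, and m = (m r) r would be shorter than m
    -- r, against maximality.
    have h0 : inversionParity cs m (y * cs.simple i * y⁻¹) ≠ 0 := by
      intro h
      have h1 := inversionParity_mul cs m (y * cs.simple i * y⁻¹) (y * cs.simple i * y⁻¹)
      have h4 : y * cs.simple i * y⁻¹ * (y * cs.simple i * y⁻¹) * (y * cs.simple i * y⁻¹)⁻¹ =
        y * cs.simple i * y⁻¹ := by group
      rw [h4, h, add_zero] at h1
      have h2 := length_mul_lt_of_inversionParity cs (h1.trans_ne (hinv _ hrefl))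
      rw [mul_assoc m, hrefl.mul_self, mul_one] at h2
      exact absurd (hm _ hr) (by omega)
    have h1 := inversionParity_mul cs m y (cs.simple i)
    have h2 : cs.length (m * y * cs.simple i) < cs.length (m * y) ↔
        ¬ cs.length (y * cs.simple i) < cs.length y := by
      rw [← inversionParity_simple_ne_zero_iff, ← inversionParity_simple_ne_zero_iff, h1]
      exact (by decide : ∀ a b : ZMod 2, b ≠ 0 → (a + b ≠ 0 ↔ ¬ a ≠ 0)) _ _ h0
    rw [← mul_assoc]
    rcases cs.length_mul_simple (m * y) i with h3 | h3 <;>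
      rcases cs.length_mul_simple y i with h4 | h4 <;> omega

/-- Elements of `W_I` have reduced words with letters in `I`. -/
theorem exists_isReduced_of_mem_parabolicSubgroup {I : Set B} {y : W}
    (hy : y ∈ parabolicSubgroup cs I) :
    ∃ ω : List B, cs.IsReduced ω ∧ y = cs.wordProd ω ∧ ∀ i ∈ ω, i ∈ I := by
  classical
  induction hy using parabolic_induction_right with
  | one => exact ⟨[], by simp [CoxeterSystem.IsReduced], by simp, by simp⟩
  | mul y hy i hi ih =>
    obtain ⟨ω, hω, rfl, hI⟩ := ih
    rcases cs.length_mul_simple (cs.wordProd ω) i with h | h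
    · refine ⟨ω ++ [i], ?_, by simp [cs.wordProd_append], ?_⟩
      · rw [CoxeterSystem.IsReduced, cs.wordProd_append, cs.wordProd_singleton, h, hω.eq]
        simp
      · intro j hj
        rcases List.mem_append.mp hj with hj | hj
        · exact hI j hj
        · rw [List.mem_singleton.mp hj]; exact hi
    -- Exchange condition: a descent s_i occurs in the right inversion sequence of the word, so y
    -- s_i is obtained by deleting a letter, and the remaining letters are still in I.
    · have h0 : inversionParity cs (cs.wordProd ω) (cs.simple i) ≠ 0 := by
        rw [inversionParity_simple_ne_zero_iff]; omega
      rw [inversionParity, inversionHom_wordProd] at h0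
      have hc : (cs.rightInvSeq ω).count (cs.simple i) ≠ 0 := by
        intro h1; apply h0; simp [h1]
      have hmem := List.count_pos_iff.mp (Nat.pos_of_ne_zero hc)
      obtain ⟨j, hj, hji⟩ := List.getElem_of_mem hmem
      have e := cs.wordProd_mul_getD_rightInvSeq ω j
      rw [List.getD_eq_getElem _ _ hj, hji] at e
      rw [cs.length_rightInvSeq] at hj
      refine ⟨ω.eraseIdx j, ?_, e, fun k hk => hI k (List.mem_of_mem_eraseIdx hk)⟩
      rw [CoxeterSystem.IsReduced, ← e, List.length_eraseIdx_of_lt hj, ← hω.eq]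
      omega

theorem exists_rightDescent_of_mem_parabolicSubgroup {I : Set B} {y : W}
    (hy : y ∈ parabolicSubgroup cs I) (h1 : y ≠ 1) :
    ∃ i ∈ I, cs.length (y * cs.simple i) < cs.length y := by
  obtain ⟨ω, hω, rfl, hI⟩ := exists_isReduced_of_mem_parabolicSubgroup cs hy
  rcases List.eq_nil_or_concat ω with rfl | ⟨ω', i, rfl⟩
  · simp at h1
  · refine ⟨i, hI i (by simp), ?_⟩
    rw [hω.eq, cs.wordProd_concat, cs.simple_mul_simple_cancel_right]
    have := cs.length_wordProd_le ω'
    simp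
    omega

theorem exists_leftDescent_of_mem_parabolicSubgroup {I : Set B} {y : W}
    (hy : y ∈ parabolicSubgroup cs I) (h1 : y ≠ 1) :
    ∃ i ∈ I, cs.length (cs.simple i * y) < cs.length y := by
  obtain ⟨i, hi, h⟩ := exists_rightDescent_of_mem_parabolicSubgroup cs (inv_mem hy)
    (inv_ne_one.mpr h1)
  refine ⟨i, hi, ?_⟩
  rw [← cs.length_inv (cs.simple i * y), ← cs.length_inv y]
  simpa using h

/-- A reduced word of s_i with letters in I has one letter j, and s_i = s_j forces i = j by
`simple_injective`. -/
theorem simple_mem_parabolicSubgroup_iff {I : Set B} {i : B} :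
    cs.simple i ∈ parabolicSubgroup cs I ↔ i ∈ I := by
  refine ⟨fun h => ?_, simple_mem_parabolicSubgroup cs⟩
  obtain ⟨ω, hω, h1, hI⟩ := exists_isReduced_of_mem_parabolicSubgroup cs h
  have h2 := hω.eq
  rw [← h1, cs.length_simple] at h2
  obtain ⟨j, rfl⟩ := List.length_eq_one_iff.mp h2.symm
  rw [cs.wordProd_singleton] at h1
  rw [simple_injective cs h1]
  exact hI j (by simp)

/-- If all elements of `I` are right descents of `v`, then `v` is maximal in `v W_I`. -/
theorem length_mul_of_rightDescents [Finite W] {I : Set B} {v : W}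
    (hv : ∀ i ∈ I, cs.length (v * cs.simple i) < cs.length v) {y : W}
    (hy : y ∈ parabolicSubgroup cs I) : cs.length (v * y) + cs.length y = cs.length v := by
  have : Nonempty (parabolicSubgroup cs I) := ⟨1⟩
  obtain ⟨⟨x, hx⟩, hmax⟩ := Finite.exists_max fun x : parabolicSubgroup cs I =>
    cs.length (v * x)
  have hm : ∀ y ∈ parabolicSubgroup cs I, cs.length (v * x * y) ≤ cs.length (v * x) := by
    intro y hy
    rw [mul_assoc]
    exact hmax ⟨x * y, mul_mem hx hy⟩
  have key := fun y hy => length_mul_of_maximal cs hm (y := y) hy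
  -- Here v x is the longest element of v W_I, and lengths subtract from it. A right descent i ∈ I
  -- of x⁻¹ would then make v s_i longer than v.
  have hx1 : x = 1 := by
    by_contra hne
    obtain ⟨i, hi, h⟩ := exists_rightDescent_of_mem_parabolicSubgroup cs (inv_mem hx)
      (inv_ne_one.mpr hne)
    have e1 := key _ (inv_mem hx)
    have e2 := key _ (mul_mem (inv_mem hx) (simple_mem_parabolicSubgroup cs hi))
    have e3 := hv i hi
    rw [mul_inv_cancel_right] at e1
    rw [← mul_assoc, mul_inv_cancel_right] at e2
    omega
  subst hx1
  simpa using key y hy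

theorem length_mul_of_leftDescents [Finite W] {I : Set B} {v : W}
    (hv : ∀ i ∈ I, cs.length (cs.simple i * v) < cs.length v) {y : W}
    (hy : y ∈ parabolicSubgroup cs I) : cs.length (y * v) + cs.length y = cs.length v := by
  have hv' : ∀ i ∈ I, cs.length (v⁻¹ * cs.simple i) < cs.length v⁻¹ := by
    intro i hi
    rw [← cs.length_inv (v⁻¹ * _), cs.length_inv v]
    simpa using hv i hi
  have := length_mul_of_rightDescents cs hv' (inv_mem hy)
  rw [← cs.length_inv (v⁻¹ * _)] at this
  simpa using this

/-- If the left descent status at `i` changes between `u` and `u y` with `y ∈ W_K`, then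
`s_i u ∈ u W_K`. -/
theorem exists_simple_mul_eq {K : Set B} {u y : W} {i : B} (hy : y ∈ parabolicSubgroup cs K)
    (h1 : cs.length u < cs.length (cs.simple i * u))
    (h2 : cs.length (cs.simple i * (u * y)) < cs.length (u * y)) :
    ∃ k ∈ parabolicSubgroup cs K, cs.simple i * u = u * k := by
  induction hy using parabolic_induction_right with
  | one => simp at h2; omega
  | mul y hy j hj ih =>
    by_cases h3 : cs.length (cs.simple i * (u * y)) < cs.length (u * y)
    · exact ih h3
    · have h4 := cs.length_simple_mul_ne (u * y) i
      -- The status of i changes at the letter j: s_i is not a left descent of u y but is one of u y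
      -- s_j. The exchange property is stated for right descents, so it is applied to inverses.
      have e : cs.simple j * (u * y)⁻¹ = (u * y)⁻¹ * cs.simple i := by
        apply simple_mul_eq_of_lt cs
        · rw [← cs.length_inv (_ * cs.simple i), cs.length_inv (u * y)]
          simp only [mul_inv_rev, inv_inv, cs.inv_simple, ← mul_assoc] at *
          omega
        · rw [← cs.length_inv (_ * cs.simple i), ← cs.length_inv (cs.simple j * _)]
          simpa [mul_assoc] using h2
      refine ⟨y * cs.simple j * y⁻¹,
        mul_mem (mul_mem hy (simple_mem_parabolicSubgroup cs hj)) (inv_mem hy), ?_⟩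
      have := congrArg (fun x => u * y * x * y⁻¹ * (y * y⁻¹)) e
      have e' : u * y * cs.simple j * y⁻¹ * u⁻¹ = cs.simple i := by
        have := congrArg (fun x => u * y * x) e
        simpa [mul_assoc] using this
      rw [← e']
      group

end Cosets

end Hecke

namespace Hecke

/-! ### Longest elements of double cosets and moving descents -/

section DoubleCosets

variable {B W : Type v} [Group W] {M : CoxeterMatrix B} (cs : CoxeterSystem M W)

/-- All elements of `P` are left descents of `v`, and all elements of `Q` are right descents. -/
def IsTop (P Q : Set B) (v : W) : Prop :=
  (∀ i ∈ P, cs.length (cs.simple i * v) < cs.length v) ∧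
    ∀ i ∈ Q, cs.length (v * cs.simple i) < cs.length v

/-- `w'` belongs to the double coset `W_P w W_Q`. -/
def SameDoubleCoset (P Q : Set B) (w w' : W) : Prop :=
  ∃ x ∈ parabolicSubgroup cs P, ∃ y ∈ parabolicSubgroup cs Q, w' = x * w * y

variable {cs}

theorem IsTop.mono {P Q P' Q' : Set B} {v : W} (h : IsTop cs P Q v) (hP : P' ⊆ P) (hQ : Q' ⊆ Q) :
    IsTop cs P' Q' v := ⟨fun i hi => h.1 i (hP hi), fun i hi => h.2 i (hQ hi)⟩

theorem SameDoubleCoset.refl {P Q : Set B} (w : W) : SameDoubleCoset cs P Q w w :=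
  ⟨1, one_mem _, 1, one_mem _, by simp⟩

theorem SameDoubleCoset.symm {P Q : Set B} {w w' : W} (h : SameDoubleCoset cs P Q w w') :
    SameDoubleCoset cs P Q w' w := by
  obtain ⟨x, hx, y, hy, rfl⟩ := h
  exact ⟨x⁻¹, inv_mem hx, y⁻¹, inv_mem hy, by group⟩

theorem SameDoubleCoset.trans {P Q : Set B} {w w' w'' : W} (h : SameDoubleCoset cs P Q w w')
    (h' : SameDoubleCoset cs P Q w' w'') : SameDoubleCoset cs P Q w w'' := by
  obtain ⟨x, hx, y, hy, rfl⟩ := h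
  obtain ⟨x', hx', y', hy', rfl⟩ := h'
  exact ⟨x' * x, mul_mem hx' hx, y * y', mul_mem hy hy', by group⟩

theorem SameDoubleCoset.mono {P Q P' Q' : Set B} {w w' : W} (h : SameDoubleCoset cs P Q w w')
    (hP : P ⊆ P') (hQ : Q ⊆ Q') : SameDoubleCoset cs P' Q' w w' := by
  obtain ⟨x, hx, y, hy, rfl⟩ := h
  exact ⟨x, parabolicSubgroup_mono cs hP hx, y, parabolicSubgroup_mono cs hQ hy, rfl⟩

theorem SameDoubleCoset.of_mul_right {P Q : Set B} (w : W) {y : W}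
    (hy : y ∈ parabolicSubgroup cs Q) : SameDoubleCoset cs P Q w (w * y) :=
  ⟨1, one_mem _, y, hy, by simp⟩

theorem SameDoubleCoset.of_mul_left {P Q : Set B} (w : W) {x : W}
    (hx : x ∈ parabolicSubgroup cs P) : SameDoubleCoset cs P Q w (x * w) :=
  ⟨x, hx, 1, one_mem _, by simp⟩

/-- Write v' = x v y and shorten x. A left descent t of x is an ascent of x v, because lengths
subtract from the top element v, but it is a descent of v'. By `exists_simple_mul_eq` it can be
absorbed into the factor of W_Q, which replaces x by t x. When x = 1, maximality of v and v' in
their common coset gives y = 1. -/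
theorem IsTop.eq_of_sameDoubleCoset [Finite W] {P Q : Set B} {v v' : W} (h : IsTop cs P Q v)
    (h' : IsTop cs P Q v') (hv : SameDoubleCoset cs P Q v v') : v = v' := by
  obtain ⟨x, hx, y, hy, e⟩ := hv
  induction hn : cs.length x using Nat.strong_induction_on generalizing x y with
  | _ n ih =>
    by_cases hx1 : x = 1
    · subst hx1
      rw [one_mul] at e
      have e1 := length_mul_of_rightDescents cs h.2 hy
      have e2 := length_mul_of_rightDescents cs h'.2 (inv_mem hy)
      rw [← e] at e1
      have e3 : v' * y⁻¹ = v := by rw [e]; group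
      rw [e3] at e2
      have : y = 1 := cs.length_eq_zero_iff.mp (by omega)
      rw [e, this, mul_one]
    · obtain ⟨t, ht, hlt⟩ := exists_leftDescent_of_mem_parabolicSubgroup cs hx hx1
      have hx' := mul_mem (simple_mem_parabolicSubgroup cs ht) hx
      have e1 := length_mul_of_leftDescents cs h.1 hx
      have e2 := length_mul_of_leftDescents cs h.1 hx'
      obtain ⟨k, hk, ek⟩ := exists_simple_mul_eq cs (u := x * v) (i := t) hy
        (by rw [← mul_assoc]; omega) (by rw [← e]; exact h'.1 t ht)
      refine ih _ (hn ▸ hlt) (cs.simple t * x) hx' (k⁻¹ * y) (mul_mem (inv_mem hk) hy) ?_ rfl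
      rw [mul_assoc (cs.simple t), ek, e]
      group

theorem exists_top [Finite W] (P Q : Set B) (w : W) :
    ∃ v, SameDoubleCoset cs P Q w v ∧ ∀ w', SameDoubleCoset cs P Q w w' →
      cs.length w' ≤ cs.length v := by
  have : Nonempty {v // SameDoubleCoset cs P Q w v} := ⟨⟨w, .refl w⟩⟩
  obtain ⟨v, hv⟩ := Finite.exists_max fun v : {v // SameDoubleCoset cs P Q w v} => cs.length v.1
  exact ⟨v.1, v.2, fun w' hw' => hv ⟨w', hw'⟩⟩

variable (cs) in
/-- The longest element of the double coset `W_P w W_Q`. -/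
noncomputable def top [Finite W] (P Q : Set B) (w : W) : W :=
  (exists_top (cs := cs) P Q w).choose

theorem sameDoubleCoset_top [Finite W] (P Q : Set B) (w : W) :
    SameDoubleCoset cs P Q w (top cs P Q w) := (exists_top P Q w).choose_spec.1

theorem length_le_top [Finite W] {P Q : Set B} {w w' : W} (h : SameDoubleCoset cs P Q w w') :
    cs.length w' ≤ cs.length (top cs P Q w) := (exists_top P Q w).choose_spec.2 w' h

theorem isTop_of_maximal {P Q : Set B} {v : W}
    (h : ∀ w', SameDoubleCoset cs P Q v w' → cs.length w' ≤ cs.length v) : IsTop cs P Q v :=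
  ⟨fun i hi => lt_of_le_of_ne (h _ (.of_mul_left v (simple_mem_parabolicSubgroup cs hi)))
      (cs.length_simple_mul_ne v i),
    fun i hi => lt_of_le_of_ne (h _ (.of_mul_right v (simple_mem_parabolicSubgroup cs hi)))
      (cs.length_mul_simple_ne v i)⟩

theorem isTop_top [Finite W] (P Q : Set B) (w : W) : IsTop cs P Q (top cs P Q w) :=
  isTop_of_maximal fun _ h => length_le_top ((sameDoubleCoset_top P Q w).trans h)

theorem IsTop.top_eq [Finite W] {P Q : Set B} {v w : W} (h : IsTop cs P Q v)
    (hw : SameDoubleCoset cs P Q v w) : top cs P Q w = v :=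
  ((h.eq_of_sameDoubleCoset (isTop_top P Q w)) (hw.trans (sameDoubleCoset_top P Q w))).symm

theorem top_eq_of_sameDoubleCoset [Finite W] {P Q : Set B} {w w' : W}
    (h : SameDoubleCoset cs P Q w w') : top cs P Q w' = top cs P Q w :=
  (isTop_top P Q w).top_eq ((sameDoubleCoset_top P Q w).symm.trans h)

/-- Tops of nested double cosets are equal as soon as they have the same length. -/
theorem top_eq_top_of_length [Finite W] {P Q P' Q' : Set B} {w w' : W} (hP : P ⊆ P') (hQ : Q ⊆ Q')
    (h : SameDoubleCoset cs P' Q' w w')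
    (hl : cs.length (top cs P' Q' w') ≤ cs.length (top cs P Q w)) :
    top cs P' Q' w' = top cs P Q w := by
  have h1 : SameDoubleCoset cs P' Q' (top cs P Q w) (top cs P' Q' w') :=
    (((sameDoubleCoset_top P Q w).mono hP hQ).symm.trans h).trans (sameDoubleCoset_top P' Q' w')
  refine (IsTop.eq_of_sameDoubleCoset ?_ (isTop_top P' Q' w') h1).symm
  exact isTop_of_maximal fun x hx => (length_le_top
    ((sameDoubleCoset_top P' Q' w').trans (h1.symm.trans hx))).trans hl

theorem length_top_mono [Finite W] {P Q P' Q' : Set B} {w w' : W} (hP : P ⊆ P') (hQ : Q ⊆ Q')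
    (h : SameDoubleCoset cs P' Q' w w') :
    cs.length (top cs P Q w) ≤ cs.length (top cs P' Q' w') :=
  length_le_top (h.symm.trans ((sameDoubleCoset_top P Q w).mono hP hQ))

/-- If the top element lies in W_Q, each s ∈ P is a left descent of an element of W_Q. Then
`exists_simple_mul_eq` with u = 1 puts s in W_Q, hence in Q. This separates the generators matched
along I from those matched along J. -/
theorem top_mem_iff [Finite W] {P Q : Set B} {w : W} :
    top cs P Q w ∈ parabolicSubgroup cs Q ↔ P ⊆ Q ∧ w ∈ parabolicSubgroup cs Q := by
  obtain ⟨x, hx, y, hy, e⟩ := sameDoubleCoset_top (cs := cs) P Q w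
  constructor
  · intro h
    have hPQ : P ⊆ Q := by
      intro i hi
      by_contra hiQ
      have h1 := (isTop_top (cs := cs) P Q w).1 i hi
      obtain ⟨k, hk, ek⟩ := exists_simple_mul_eq cs (u := 1) (i := i) h (by simp) (by simpa using h1)
      rw [mul_one, one_mul] at ek
      exact hiQ ((simple_mem_parabolicSubgroup_iff cs).mp (ek ▸ hk))
    refine ⟨hPQ, ?_⟩
    have : w = x⁻¹ * top cs P Q w * y⁻¹ := by rw [e]; group
    rw [this]
    exact mul_mem (mul_mem (inv_mem (parabolicSubgroup_mono cs hPQ hx)) h) (inv_mem hy)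
  · rintro ⟨hPQ, hw⟩
    rw [e]
    exact mul_mem (mul_mem (parabolicSubgroup_mono cs hPQ hx) hw) hy

/-- If `k v ∈ v W_Q` for some `k ∈ W_P`, with `v` top in its double coset, then `k` is a product
of elements `s` of `P` with the same property. -/
theorem IsTop.mem_parabolicSubgroup_diff [Finite W] {P Q : Set B} {v : W} (h : IsTop cs P Q v)
    {k x : W} (hk : k ∈ parabolicSubgroup cs P) (hx : x ∈ parabolicSubgroup cs Q)
    (e : k * v = v * x) {s : B} (hs : ∀ y ∈ parabolicSubgroup cs Q, cs.simple s * v ≠ v * y) :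
    k ∈ parabolicSubgroup cs (P \ {s}) := by
  induction hn : cs.length k using Nat.strong_induction_on generalizing k x with
  | _ n ih =>
    by_cases hk1 : k = 1
    · rw [hk1]; exact one_mem _
    · obtain ⟨t, ht, hlt⟩ := exists_leftDescent_of_mem_parabolicSubgroup cs hk hk1
      have hk' := mul_mem (simple_mem_parabolicSubgroup cs ht) hk
      have e1 := length_mul_of_leftDescents cs h.1 hk
      have e2 := length_mul_of_leftDescents cs h.1 hk'
      have e3 : k * v * x⁻¹ = v := by rw [e]; group
      -- The left descent t of k is an ascent of k v but a descent of v = k v x⁻¹. Hence t k v ∈ k v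
      -- W_Q = v W_Q: both the shorter element t k and t itself stabilize v W_Q, so t ≠ s.
      obtain ⟨y, hy, ey⟩ := exists_simple_mul_eq cs (u := k * v) (i := t) (inv_mem hx)
        (by rw [← mul_assoc]; omega) (by rw [e3]; exact h.1 t ht)
      have h1 := ih _ (hn ▸ hlt) hk' (mul_mem hx hy) (by rw [mul_assoc, ey, e]; group) rfl
      have hts : t ≠ s := by
        rintro rfl
        refine hs (x * y * x⁻¹) (mul_mem (mul_mem hx hy) (inv_mem hx)) ?_
        have : cs.simple t * v = cs.simple t * (k * v) * x⁻¹ := by rw [mul_assoc, e3]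
        rw [this, ey, e]; group
      have := mul_mem (simple_mem_parabolicSubgroup cs (I := P \ {s}) ⟨ht, by simpa using hts⟩) h1
      simpa using this

/-- `s` is a left descent of `v` which does not stabilize the coset `v W_Q`. -/
def IsMovingDescent (cs : CoxeterSystem M W) (Q : Set B) (v : W) (s : B) : Prop :=
  cs.length (cs.simple s * v) < cs.length v ∧
    ∀ y ∈ parabolicSubgroup cs Q, cs.simple s * v ≠ v * y

/-- Take the shortest element u of v W_Q, which is not 1 as v ∉ W_Q, and a left descent s of u.
Lengths add in v = u x⁻¹ with x⁻¹ ∈ W_Q, so s is a descent of v; and s u is too short to lie in v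
W_Q. -/
theorem exists_isMovingDescent [Finite W] {Q : Set B} {v : W}
    (hv : v ∉ parabolicSubgroup cs Q) : ∃ s, IsMovingDescent cs Q v s := by
  have : Nonempty (parabolicSubgroup cs Q) := ⟨1⟩
  obtain ⟨⟨x, hx⟩, hmin⟩ := Finite.exists_min fun x : parabolicSubgroup cs Q => cs.length (v * x)
  have hm : ∀ y ∈ parabolicSubgroup cs Q, cs.length (v * x) ≤ cs.length (v * x * y) := by
    intro y hy
    rw [mul_assoc]
    exact hmin ⟨x * y, mul_mem hx hy⟩
  have hne : v * x ≠ 1 := by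
    intro h1
    apply hv
    rw [eq_inv_of_mul_eq_one_left h1]
    exact inv_mem hx
  obtain ⟨s, hs⟩ := cs.exists_leftDescent_of_ne_one hne
  have hs' : cs.length (cs.simple s * (v * x)) < cs.length (v * x) := hs
  refine ⟨s, ?_, fun y hy e => ?_⟩
  · have e1 := length_mul_of_minimal cs hm (inv_mem hx)
    have e2 := cs.length_mul_le (cs.simple s * (v * x)) x⁻¹
    have e3 : v * x * x⁻¹ = v := by group
    have e4 : cs.simple s * (v * x) * x⁻¹ = cs.simple s * v := by group
    rw [e3] at e1
    rw [e4] at e2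
    omega
  · rw [← mul_assoc, e] at hs'
    have h1 := hm (x⁻¹ * y * x) (mul_mem (mul_mem (inv_mem hx) hy) hx)
    have h2 : v * x * (x⁻¹ * y * x) = v * y * x := by group
    rw [h2] at h1
    omega

theorem IsMovingDescent.isTop_insert {P Q : Set B} {v : W} {s : B} (h : IsMovingDescent cs Q v s)
    (hv : IsTop cs P Q v) : IsTop cs (insert s P) Q v :=
  ⟨fun i hi => by
    rcases hi with rfl | hi
    · exact h.1
    · exact hv.1 i hi, hv.2⟩

/-- Two elements of `W_P v W_Q` in the same coset of `W_{P ∪ {s}}` are in the same coset of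
`W_P`. -/
theorem IsMovingDescent.mem_parabolicSubgroup [Finite W] {P Q : Set B} {v : W} {s : B}
    (h : IsMovingDescent cs Q v s) (hv : IsTop cs P Q v) {w w' z : W}
    (hw : SameDoubleCoset cs (P \ {s}) Q v w) (hw' : SameDoubleCoset cs (P \ {s}) Q v w')
    (hz : z ∈ parabolicSubgroup cs P) (e : w' = z * w) :
    z ∈ parabolicSubgroup cs (P \ {s}) := by
  obtain ⟨x, hx, y, hy, rfl⟩ := hw
  obtain ⟨x', hx', y', hy', rfl⟩ := hw'
  have hsub : P \ {s} ⊆ P := Set.sdiff_subset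
  have h1 := hv.mem_parabolicSubgroup_diff (k := x'⁻¹ * z * x) (x := y' * y⁻¹)
    (mul_mem (mul_mem (inv_mem (parabolicSubgroup_mono cs hsub hx')) hz)
      (parabolicSubgroup_mono cs hsub hx)) (mul_mem hy' (inv_mem hy)) (by
        have : z * x * v = x' * v * y' * y⁻¹ := by rw [e]; group
        calc x'⁻¹ * z * x * v = x'⁻¹ * (z * x * v) := by group
          _ = v * (y' * y⁻¹) := by rw [this]; group) h.2
  have : z = x' * (x'⁻¹ * z * x) * x⁻¹ := by group
  rw [this]
  exact mul_mem (mul_mem hx' h1) (inv_mem hx)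

end DoubleCosets

end Hecke

namespace Hecke

/-! ### The trace form and the Frobenius structure over parabolic subalgebras -/

section HeckeAlgebra

variable {B W : Type v} [Group W] {M : CoxeterMatrix B} {cs : CoxeterSystem M W}
  {R : Type u} [CommRing R] (P : Parameters cs R)

namespace HeckeAlgebra

variable {P} in
theorem induction_basis {p : HeckeAlgebra P → Prop} (zero : p 0)
    (add : ∀ x y, p x → p y → p (x + y)) (smul_basis : ∀ (r : R) w, p (r • basis P w))
    (x : HeckeAlgebra P) : p x := by
  induction x using Finsupp.induction_linear with
  | zero => exact zero
  | add x y hx hy => exact add x y hx hy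
  | single w a =>
    have := smul_basis a w
    rw [basis_eq] at this
    exact (Finsupp.smul_single_one w a) ▸ this

theorem basis_mul_simple_of_lt {i : B} {w : W} (h : cs.length w < cs.length (w * cs.simple i)) :
    basis P w * basis P (cs.simple i) = basis P (w * cs.simple i) := by
  refine basis_mul_basis P ?_
  rcases cs.length_mul_simple w i with h' | h' <;> simp <;> omega

theorem basis_mul_simple_of_gt {i : B} {w : W} (h : cs.length (w * cs.simple i) < cs.length w) :
    basis P w * basis P (cs.simple i) =
      ((P.q i : R) - 1) • basis P w + (P.q i : R) • basis P (w * cs.simple i) := by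
  have e := basis_mul_simple_of_lt P (i := i) (w := w * cs.simple i) (by simpa using h)
  rw [CoxeterSystem.simple_mul_simple_cancel_right] at e
  rw [← e, mul_assoc, basis_simple_mul_self, mul_add, mul_smul_comm, mul_smul_comm, mul_one, e]

/-- `h_s` as a unit. -/
noncomputable def simpleUnit (i : B) : (HeckeAlgebra P)ˣ where
  val := basis P (cs.simple i)
  inv := (((P.q i)⁻¹ : Rˣ) : R) • (basis P (cs.simple i) - ((P.q i : R) - 1) • 1)
  val_inv := by
    rw [mul_smul_comm, mul_sub, basis_simple_mul_self, mul_smul_comm, mul_one, add_sub_cancel_left,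
      smul_smul, Units.inv_mul, one_smul]
  inv_val := by
    rw [smul_mul_assoc, sub_mul, basis_simple_mul_self, smul_mul_assoc, one_mul,
      add_sub_cancel_left, smul_smul, Units.inv_mul, one_smul]

theorem isUnit_basis (w : W) : IsUnit (basis P w) := by
  induction hn : cs.length w generalizing w with
  | zero => rw [cs.length_eq_zero_iff.mp hn, basis_one]; exact isUnit_one
  | succ n ih =>
    obtain ⟨i, hi⟩ := cs.exists_leftDescent_of_ne_one (w := w) (by rintro rfl; simp at hn)
    rw [cs.isLeftDescent_iff] at hi
    have e := basis_simple_mul_of_lt P (i := i) (w := cs.simple i * w) (by simp; omega)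
    rw [CoxeterSystem.simple_mul_simple_cancel_left] at e
    rw [← e]
    exact (simpleUnit P i).isUnit.mul (ih _ (by omega))

/-- `h_w` as a unit. -/
noncomputable def basisUnit (w : W) : (HeckeAlgebra P)ˣ := (isUnit_basis P w).unit

@[simp]
theorem val_basisUnit (w : W) : (basisUnit P w : HeckeAlgebra P) = basis P w := rfl

theorem inv_simpleUnit (i : B) : ((simpleUnit P i)⁻¹ : (HeckeAlgebra P)ˣ) =
    (((P.q i)⁻¹ : Rˣ) : R) • (basis P (cs.simple i) - ((P.q i : R) - 1) • 1) := rfl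

theorem basis_simple_eq (i : B) : basis P (cs.simple i) =
    ((P.q i : R) - 1) • 1 + (P.q i : R) • (((simpleUnit P i)⁻¹ : (HeckeAlgebra P)ˣ)) := by
  rw [inv_simpleUnit, smul_smul, Units.mul_inv, one_smul]
  abel

/-- The linear map `h_w ↦ h_{w⁻¹}`. -/
noncomputable def flip : HeckeAlgebra P →ₗ[R] HeckeAlgebra P :=
  (basis P).constr R fun w => basis P w⁻¹

theorem flip_basis (w : W) : flip P (basis P w) = basis P w⁻¹ := (basis P).constr_basis R _ w

theorem flip_simple_mul (i : B) (x : HeckeAlgebra P) :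
    flip P (basis P (cs.simple i) * x) = flip P x * basis P (cs.simple i) := by
  induction x using induction_basis with
  | zero => simp
  | add x y hx hy => rw [mul_add, map_add, hx, hy, map_add, add_mul]
  | smul_basis r w =>
    rw [mul_smul_comm, map_smul, map_smul, smul_mul_assoc, flip_basis]
    congr 1
    have hl : cs.length (w⁻¹ * cs.simple i) = cs.length (cs.simple i * w) := by
      rw [← cs.length_inv (cs.simple i * w)]; simp
    rcases lt_or_gt_of_ne (cs.length_simple_mul_ne w i) with h | h
    · rw [basis_simple_mul_of_gt P h, basis_mul_simple_of_gt P (by rwa [hl, cs.length_inv]),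
        map_add, map_smul, map_smul, flip_basis, flip_basis, mul_inv_rev, cs.inv_simple]
    · rw [basis_simple_mul_of_lt P h, basis_mul_simple_of_lt P (by rwa [hl, cs.length_inv]),
        flip_basis, mul_inv_rev, cs.inv_simple]

/-- This anti-automorphism exchanges left and right, and is used below to deduce one half of each
symmetric pair of statements from the other. -/
theorem flip_mul (x y : HeckeAlgebra P) : flip P (x * y) = flip P y * flip P x := by
  induction x using induction_basis with
  | zero => simp
  | add x x' hx hx' => rw [add_mul, map_add, hx, hx', map_add, mul_add]
  | smul_basis r w =>
    rw [smul_mul_assoc, map_smul, map_smul, mul_smul_comm]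
    congr 1
    induction hn : cs.length w generalizing w y with
    | zero =>
      rw [cs.length_eq_zero_iff.mp hn, flip_basis, inv_one, basis_one, one_mul, mul_one]
    | succ n ih =>
      obtain ⟨i, hi⟩ := cs.exists_leftDescent_of_ne_one (w := w) (by rintro rfl; simp at hn)
      rw [cs.isLeftDescent_iff] at hi
      have e := basis_simple_mul_of_lt P (i := i) (w := cs.simple i * w) (by simp; omega)
      rw [CoxeterSystem.simple_mul_simple_cancel_left] at e
      rw [← e, mul_assoc, flip_simple_mul, ih _ _ (by omega), flip_simple_mul, mul_assoc]

theorem flip_flip (x : HeckeAlgebra P) : flip P (flip P x) = x := by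
  induction x using induction_basis with
  | zero => simp
  | add x x' hx hx' => rw [map_add, map_add, hx, hx']
  | smul_basis r w => rw [map_smul, map_smul, flip_basis, flip_basis, inv_inv]

/-- The trace form, i.e. the coefficient of `h_1`. -/
noncomputable def trace : HeckeAlgebra P →ₗ[R] R := (basis P).coord 1

/-- The last letter s of a reduced word of x is moved to the other factor, h_x h_y = h_{xs} (h_s
h_y). When s is a descent of y, the extra term h_y of h_s h_y pairs to zero with h_{xs}: this could
fail only for y = s x⁻¹, of which s is an ascent. Each step contributes a factor q_s, so the total
factor is a unit. -/
theorem exists_trace_basis_mul_basis (x : W) : ∃ q : Rˣ, ∀ y,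
    trace P (basis P x * basis P y) = (q : R) * (basis P).repr (basis P y) x⁻¹ := by
  classical
  induction hn : cs.length x generalizing x with
  | zero =>
    refine ⟨1, fun y => ?_⟩
    rw [cs.length_eq_zero_iff.mp hn, basis_one, one_mul, Units.val_one, one_mul, inv_one]
    rfl
  | succ n ih =>
    obtain ⟨i, hi⟩ := cs.exists_rightDescent_of_ne_one (w := x) (by rintro rfl; simp at hn)
    rw [cs.isRightDescent_iff] at hi
    obtain ⟨q, hq⟩ := ih (x * cs.simple i) (by omega)
    refine ⟨q * P.q i, fun y => ?_⟩
    have e := basis_mul_simple_of_lt P (i := i) (w := x * cs.simple i) (by simp; omega)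
    rw [CoxeterSystem.simple_mul_simple_cancel_right] at e
    have hy1 : cs.simple i * y = cs.simple i * x⁻¹ ↔ y = x⁻¹ := mul_right_inj _
    have hl : cs.length (cs.simple i * x⁻¹) + 1 = cs.length x⁻¹ := by
      rw [← cs.length_inv (cs.simple i * x⁻¹), cs.length_inv x]
      simpa using hi
    rw [← e, mul_assoc]
    rcases lt_or_gt_of_ne (cs.length_simple_mul_ne y i) with h | h
    · have hne : y ≠ cs.simple i * x⁻¹ := by
        rintro rfl
        rw [cs.simple_mul_simple_cancel_left] at h
        omega
      rw [basis_simple_mul_of_gt P h, mul_add, mul_smul_comm, mul_smul_comm, map_add, map_smul,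
        map_smul, hq, hq, mul_inv_rev, cs.inv_simple]
      simp only [Module.Basis.repr_self, Finsupp.single_apply, hy1, hne, if_false, smul_eq_mul,
        Units.val_mul]
      ring
    · have hne : y ≠ x⁻¹ := by
        rintro rfl
        omega
      rw [basis_simple_mul_of_lt P h, hq, mul_inv_rev, cs.inv_simple]
      simp only [Module.Basis.repr_self, Finsupp.single_apply, hy1, hne, if_false, mul_zero]

/-- The parameter of `w`. -/
noncomputable def weight (w : W) : Rˣ := (exists_trace_basis_mul_basis P w⁻¹).choose

theorem trace_basis_inv_mul (w : W) (a : HeckeAlgebra P) :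
    trace P (basis P w⁻¹ * a) = (weight P w : R) * (basis P).repr a w := by
  induction a using induction_basis with
  | zero => simp
  | add x y hx hy => rw [mul_add, map_add, hx, hy, map_add, Finsupp.add_apply, mul_add]
  | smul_basis r y =>
    have h := (exists_trace_basis_mul_basis P w⁻¹).choose_spec y
    replace h : trace P (basis P w⁻¹ * basis P y) = (weight P w : R) * (basis P).repr (basis P y) w := by
      rw [h]; simp [weight]
    rw [mul_smul_comm, map_smul, h, map_smul, Finsupp.smul_apply, smul_eq_mul, smul_eq_mul]
    ring

theorem repr_basis_eq_ite [DecidableEq W] (w y : W) :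
    (basis P).repr (basis P w) y = if w = y then 1 else 0 := by
  rw [Module.Basis.repr_self, Finsupp.single_apply]

theorem weight_one : weight P 1 = 1 := by
  classical
  have h := trace_basis_inv_mul P 1 (basis P 1)
  rw [inv_one, basis_one, one_mul, ← basis_one, repr_basis_eq_ite, if_pos rfl, mul_one] at h
  have h' : trace P (basis P 1) = 1 := by
    change (basis P).repr (basis P 1) 1 = 1
    rw [repr_basis_eq_ite, if_pos rfl]
  rw [h'] at h
  exact Units.ext h.symm

/-- The linear map with `h_w ↦ h_w` for `w ∈ W_Q` and `h_w ↦ 0` for `w ∉ W_Q`. -/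
noncomputable def parabolicProj (Q : Set B) : HeckeAlgebra P →ₗ[R] HeckeAlgebra P :=
  open Classical in
  (basis P).constr R fun w => if w ∈ parabolicSubgroup cs Q then basis P w else 0

theorem parabolicProj_basis_of_mem {Q : Set B} {w : W} (h : w ∈ parabolicSubgroup cs Q) :
    parabolicProj P Q (basis P w) = basis P w := by
  rw [parabolicProj, Module.Basis.constr_basis, if_pos h]

theorem parabolicProj_basis_of_notMem {Q : Set B} {w : W} (h : w ∉ parabolicSubgroup cs Q) :
    parabolicProj P Q (basis P w) = 0 := by
  rw [parabolicProj, Module.Basis.constr_basis, if_neg h]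

variable {P} in
theorem basis_mem {Q : Set B} {w : W} (h : w ∈ parabolicSubgroup cs Q) :
    basis P w ∈ parabolicSubalgebra P Q := basis_mem_parabolicSubmodule P h

theorem parabolicProj_mem (Q : Set B) (x : HeckeAlgebra P) :
    parabolicProj P Q x ∈ parabolicSubalgebra P Q := by
  induction x using induction_basis with
  | zero => rw [map_zero]; exact zero_mem _
  | add x y hx hy => rw [map_add]; exact add_mem hx hy
  | smul_basis r w =>
    rw [map_smul]
    refine Subalgebra.smul_mem _ ?_ r
    by_cases h : w ∈ parabolicSubgroup cs Q
    · rw [parabolicProj_basis_of_mem P h]; exact basis_mem h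
    · rw [parabolicProj_basis_of_notMem P h]; exact zero_mem _

/-- Induction principle for the elements of `H_Q`, which is generated by the `h_s`, `s ∈ Q`. -/
theorem parabolicSubalgebra_induction {Q : Set B} {p : HeckeAlgebra P → Prop}
    (zero : p 0) (one : p 1) (add : ∀ x y, p x → p y → p (x + y))
    (smul : ∀ (r : R) x, p x → p (r • x))
    (mul_simple : ∀ x, ∀ i ∈ Q, p x → p (x * basis P (cs.simple i)))
    {x : HeckeAlgebra P} (hx : x ∈ parabolicSubalgebra P Q) : p x := by
  change x ∈ Submodule.span R _ at hx
  induction hx using Submodule.span_induction with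
  | zero => exact zero
  | add x y _ _ hx hy => exact add x y hx hy
  | smul r x _ hx => exact smul r x hx
  | mem x hx =>
    obtain ⟨w, hw, rfl⟩ := hx
    induction hw using parabolic_induction_right with
    | one => rw [basis_one]; exact one
    | mul y hy i hi ih =>
      rcases lt_or_gt_of_ne (cs.length_mul_simple_ne y i) with h | h
      · have e := basis_mul_simple_of_gt P h
        -- Going down in length uses that q_s is invertible: h_{ys} is a combination of h_y h_s and
        -- h_y.
        have e' : basis P (y * cs.simple i) = (((P.q i)⁻¹ : Rˣ) : R) •
            (basis P y * basis P (cs.simple i) + (-((P.q i : R) - 1)) • basis P y) := by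
          rw [e, neg_smul, ← sub_eq_add_neg, add_sub_cancel_left, smul_smul, Units.inv_mul, one_smul]
        rw [e']
        exact smul _ _ (add _ _ (mul_simple _ i hi ih) (smul _ _ ih))
      · rw [← basis_mul_simple_of_lt P h]
        exact mul_simple _ i hi ih

theorem flip_mem {Q : Set B} {x : HeckeAlgebra P} (hx : x ∈ parabolicSubalgebra P Q) :
    flip P x ∈ parabolicSubalgebra P Q := by
  change x ∈ Submodule.span R _ at hx
  induction hx using Submodule.span_induction with
  | zero => rw [map_zero]; exact zero_mem _
  | add x y _ _ hx hy => rw [map_add]; exact add_mem hx hy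
  | smul r x _ hx => rw [map_smul]; exact Subalgebra.smul_mem _ hx r
  | mem x hx =>
    obtain ⟨w, hw, rfl⟩ := hx
    rw [flip_basis]
    exact basis_mem (inv_mem hw)

theorem parabolicProj_flip (Q : Set B) (x : HeckeAlgebra P) :
    parabolicProj P Q (flip P x) = flip P (parabolicProj P Q x) := by
  induction x using induction_basis with
  | zero => simp
  | add x y hx hy => simp only [map_add, hx, hy]
  | smul_basis r w =>
    simp only [map_smul, flip_basis]
    congr 1
    by_cases h : w ∈ parabolicSubgroup cs Q
    · rw [parabolicProj_basis_of_mem P h, parabolicProj_basis_of_mem P (inv_mem h), flip_basis]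
    · rw [parabolicProj_basis_of_notMem P h, map_zero, parabolicProj_basis_of_notMem P]
      rwa [inv_mem_iff]

/-- Right multiplication by h_s with s ∈ Q stays in the span of each coset w W_Q, hence respects
both the span of W_Q and that of its complement. With `mul_parabolicProj`, the projection is a map
of H_Q-bimodules. -/
theorem parabolicProj_mul {Q : Set B} (x : HeckeAlgebra P) {c : HeckeAlgebra P}
    (hc : c ∈ parabolicSubalgebra P Q) :
    parabolicProj P Q (x * c) = parabolicProj P Q x * c := by
  refine parabolicSubalgebra_induction P (p := fun c => parabolicProj P Q (x * c) = parabolicProj P Q x * c) ?_ ?_ ?_ ?_ ?_ hc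
  · simp
  · simp
  · intro c c' hc hc'; simp only [mul_add, map_add, hc, hc']
  · intro r c hc; simp only [mul_smul_comm, map_smul, hc]
  · intro c i hi hc
    rw [← mul_assoc, ← mul_assoc, ← hc]
    generalize x * c = x
    induction x using induction_basis with
    | zero => simp
    | add x y hx hy => simp only [add_mul, map_add, hx, hy]
    | smul_basis r w =>
      simp only [smul_mul_assoc, map_smul]
      congr 1
      have hiQ := simple_mem_parabolicSubgroup cs hi
      by_cases hw : w ∈ parabolicSubgroup cs Q
      · have hwi := mul_mem hw hiQ
        rw [parabolicProj_basis_of_mem P hw]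
        rcases lt_or_gt_of_ne (cs.length_mul_simple_ne w i) with h | h
        · rw [basis_mul_simple_of_gt P h, map_add, map_smul, map_smul,
            parabolicProj_basis_of_mem P hw, parabolicProj_basis_of_mem P hwi]
        · rw [basis_mul_simple_of_lt P h, parabolicProj_basis_of_mem P hwi]
      · have hwi : w * cs.simple i ∉ parabolicSubgroup cs Q := by
          rwa [Subgroup.mul_mem_cancel_right _ hiQ]
        rw [parabolicProj_basis_of_notMem P hw, zero_mul]
        rcases lt_or_gt_of_ne (cs.length_mul_simple_ne w i) with h | h
        · rw [basis_mul_simple_of_gt P h, map_add, map_smul, map_smul,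
            parabolicProj_basis_of_notMem P hw, parabolicProj_basis_of_notMem P hwi, smul_zero,
            smul_zero, add_zero]
        · rw [basis_mul_simple_of_lt P h, parabolicProj_basis_of_notMem P hwi]

theorem mul_parabolicProj {Q : Set B} (x : HeckeAlgebra P) {c : HeckeAlgebra P}
    (hc : c ∈ parabolicSubalgebra P Q) :
    parabolicProj P Q (c * x) = c * parabolicProj P Q x := by
  have h := congrArg (flip P) (parabolicProj_mul P (flip P x) (flip_mem P hc))
  rwa [← flip_mul, ← parabolicProj_flip, flip_flip, flip_mul, parabolicProj_flip, flip_flip,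
    flip_flip] at h

end HeckeAlgebra

/-- `m` is an element of minimal length of `m W_Q`. -/
def IsMinRep (cs : CoxeterSystem M W) (Q : Set B) (m : W) : Prop :=
  ∀ y ∈ parabolicSubgroup cs Q, cs.length m ≤ cs.length (m * y)

theorem isMinRep_one (Q : Set B) : IsMinRep cs Q 1 := by
  intro y _; simp

theorem exists_isMinRep [Finite W] (Q : Set B) (w : W) :
    ∃ m, IsMinRep cs Q m ∧ ∃ y ∈ parabolicSubgroup cs Q, w = m * y := by
  have : Nonempty (parabolicSubgroup cs Q) := ⟨1⟩
  obtain ⟨⟨x, hx⟩, hmin⟩ := Finite.exists_min fun x : parabolicSubgroup cs Q => cs.length (w * x)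
  refine ⟨w * x, fun y hy => ?_, x⁻¹, inv_mem hx, by group⟩
  rw [mul_assoc]
  exact hmin ⟨x * y, mul_mem hx hy⟩

theorem IsMinRep.eq_one {Q : Set B} {m y : W} (h : IsMinRep cs Q m)
    (hy : y ∈ parabolicSubgroup cs Q) (h' : IsMinRep cs Q (m * y)) : y = 1 := by
  have e1 := length_mul_of_minimal cs h hy
  have e2 := h' _ (inv_mem hy)
  rw [mul_inv_cancel_right] at e2
  exact cs.length_eq_zero_iff.mp (by omega)

/-- An element of `W_Q` which is minimal for `Q' ⊆ Q` is minimal for the trivial reason. -/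
theorem IsMinRep.eq_one_of_mem {Q : Set B} {m : W} (h : IsMinRep cs Q m)
    (hm : m ∈ parabolicSubgroup cs Q) : m = 1 := by
  have := h m⁻¹ (inv_mem hm)
  rw [mul_inv_cancel, cs.length_one] at this
  exact cs.length_eq_zero_iff.mp (by omega)

namespace HeckeAlgebra

theorem basis_mul_of_isMinRep {Q : Set B} {m y : W} (h : IsMinRep cs Q m)
    (hy : y ∈ parabolicSubgroup cs Q) : basis P (m * y) = basis P m * basis P y :=
  (basis_mul_basis P (length_mul_of_minimal cs h hy)).symm

/-- The element of `H` dual to `h_m`. -/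
noncomputable def dualBasis (m : W) : HeckeAlgebra P :=
  (((weight P m)⁻¹ : Rˣ) : R) • basis P m⁻¹

theorem dualBasis_one : dualBasis P (1 : W) = 1 := by
  rw [dualBasis, weight_one, inv_one, inv_one, Units.val_one, one_smul, basis_one]

/-- The trace form reads off coefficients: as l(m y) = l(m) + l(y), the coefficient of h_y in
h_{m⁻¹} h_{m'}, for y ∈ W_Q, is up to a unit the trace of h_{(my)⁻¹} h_{m'}. It vanishes unless m' =
m y, and two minimal elements of one coset coincide. -/
theorem parabolicProj_dualBasis_mul [DecidableEq W] {Q : Set B} {m m' : W} (h : IsMinRep cs Q m)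
    (h' : IsMinRep cs Q m') :
    parabolicProj P Q (dualBasis P m * basis P m') = if m = m' then 1 else 0 := by
  suffices key : parabolicProj P Q (basis P m⁻¹ * basis P m') =
      if m = m' then (weight P m : R) • 1 else 0 by
    rw [dualBasis, smul_mul_assoc, map_smul, key]
    split_ifs
    · rw [smul_smul, Units.inv_mul, one_smul]
    · rw [smul_zero]
  have hrepr : ∀ y ∈ parabolicSubgroup cs Q, (basis P).repr (basis P m⁻¹ * basis P m') y =
      if m = m' ∧ y = 1 then (weight P m : R) else 0 := by
    intro y hy
    have h1 := trace_basis_inv_mul P y (basis P m⁻¹ * basis P m')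
    have e : basis P y⁻¹ * basis P m⁻¹ = basis P (m * y)⁻¹ := by
      rw [mul_inv_rev]
      refine basis_mul_basis P ?_
      rw [← mul_inv_rev, cs.length_inv, cs.length_inv, cs.length_inv,
        length_mul_of_minimal cs h hy, add_comm]
    rw [← mul_assoc, e, trace_basis_inv_mul, repr_basis_eq_ite] at h1
    by_cases hmy : m' = m * y
    · obtain rfl : y = 1 := h.eq_one hy (hmy ▸ h')
      rw [mul_one] at hmy
      subst hmy
      rw [weight_one, mul_one, if_pos rfl, mul_one, Units.val_one, one_mul] at h1
      rw [← h1, if_pos ⟨rfl, rfl⟩]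
    · rw [if_neg hmy, mul_zero] at h1
      rw [if_neg]
      · exact ((Units.mul_right_eq_zero _).mp h1.symm)
      · rintro ⟨rfl, rfl⟩
        exact hmy (mul_one _).symm
  have hproj : ∀ a y, (basis P).repr (parabolicProj P Q a) y =
      open Classical in if y ∈ parabolicSubgroup cs Q then (basis P).repr a y else 0 := by
    classical
    intro a y
    induction a using induction_basis with
    | zero => simp
    | add a b ha hb => simp only [map_add, Finsupp.add_apply, ha, hb]; split_ifs <;> simp
    | smul_basis r w =>
      simp only [map_smul, Finsupp.smul_apply, smul_eq_mul]
      by_cases hw : w ∈ parabolicSubgroup cs Q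
      · rw [parabolicProj_basis_of_mem P hw, repr_basis_eq_ite]
        split_ifs with h1 h2 h2
        · rfl
        · exact absurd (h1 ▸ hw) h2
        · rfl
        · rw [mul_zero]
      · rw [parabolicProj_basis_of_notMem P hw, repr_basis_eq_ite]
        split_ifs with h1 h2
        · exact absurd (h2 ▸ h1) hw
        · simp
        · simp
  apply (basis P).repr.injective
  ext y
  rw [hproj]
  split_ifs with hy hm hm
  · rw [hrepr y hy, ← basis_one, map_smul, Finsupp.smul_apply, repr_basis_eq_ite, smul_eq_mul]
    by_cases h1 : y = 1
    · simp [hm, h1]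
    · simp [h1, Ne.symm h1]
  · rw [hrepr y hy, if_neg (fun h => hm h.1)]
    simp
  · rw [← basis_one, map_smul, Finsupp.smul_apply, repr_basis_eq_ite, if_neg, smul_zero]
    rintro rfl
    exact hy (one_mem _)
  · simp

open Classical in
/-- The minimal representatives of the cosets `w W_Q`. -/
noncomputable def minReps (cs : CoxeterSystem M W) [Finite W] (Q : Set B) : Finset W :=
  have := Fintype.ofFinite W
  {m | IsMinRep cs Q m}

theorem mem_minReps [Finite W] {Q : Set B} {m : W} : m ∈ minReps cs Q ↔ IsMinRep cs Q m := by
  simp [minReps]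

/-- On h_w the decomposition w = m y with m minimal and y ∈ W_Q gives h_w = h_m h_y, and
orthogonality of the dual bases leaves only the term of m. -/
theorem sum_basis_mul_parabolicProj [Finite W] (Q : Set B) (a : HeckeAlgebra P) :
    ∑ m ∈ minReps cs Q, basis P m * parabolicProj P Q (dualBasis P m * a) = a := by
  classical
  induction a using induction_basis with
  | zero => simp
  | add a b ha hb => simp only [mul_add, map_add, Finset.sum_add_distrib, ha, hb]
  | smul_basis r w =>
    simp only [mul_smul_comm, map_smul, ← Finset.smul_sum]
    congr 1
    obtain ⟨m, hm, y, hy, rfl⟩ := exists_isMinRep (cs := cs) Q w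
    rw [basis_mul_of_isMinRep P hm hy, Finset.sum_eq_single m]
    · rw [← mul_assoc, parabolicProj_mul P _ (basis_mem hy), parabolicProj_dualBasis_mul P hm hm,
        if_pos rfl, one_mul]
    · intro m' hm' hne
      rw [← mul_assoc, parabolicProj_mul P _ (basis_mem hy),
        parabolicProj_dualBasis_mul P (mem_minReps.mp hm') hm, if_neg hne, zero_mul, mul_zero]
    · intro h
      exact absurd (mem_minReps.mpr hm) h

/-- Here the decomposition w⁻¹ = m y is flipped: h_w = h_{y⁻¹} h_{m⁻¹}, where h_{m⁻¹} is a multiple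
of the dual element of m. -/
theorem sum_parabolicProj_mul_dualBasis [Finite W] (Q : Set B) (a : HeckeAlgebra P) :
    ∑ m ∈ minReps cs Q, parabolicProj P Q (a * basis P m) * dualBasis P m = a := by
  classical
  induction a using induction_basis with
  | zero => simp
  | add a b ha hb => simp only [add_mul, map_add, Finset.sum_add_distrib, ha, hb]
  | smul_basis r w =>
    simp only [smul_mul_assoc, map_smul, ← Finset.smul_sum]
    congr 1
    obtain ⟨m, hm, y, hy, e⟩ := exists_isMinRep (cs := cs) Q w⁻¹
    have ew : basis P w = basis P y⁻¹ * ((weight P m : R) • dualBasis P m) := by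
      have := congrArg (flip P) (basis_mul_of_isMinRep P hm hy)
      rw [← e, flip_mul, flip_basis, flip_basis, flip_basis, inv_inv] at this
      rw [this, dualBasis, smul_smul, Units.mul_inv, one_smul]
    rw [ew, Finset.sum_eq_single m]
    · rw [mul_assoc, mul_parabolicProj P _ (basis_mem (inv_mem hy)), smul_mul_assoc, map_smul,
        parabolicProj_dualBasis_mul P hm hm, if_pos rfl, mul_assoc, smul_mul_assoc, one_mul]
    · intro m' hm' hne
      rw [mul_assoc, mul_parabolicProj P _ (basis_mem (inv_mem hy)), smul_mul_assoc, map_smul,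
        parabolicProj_dualBasis_mul P hm (mem_minReps.mp hm'), if_neg hne.symm, smul_zero, mul_zero,
        zero_mul]
    · intro h
      exact absurd (mem_minReps.mpr hm) h

/-- Products `h_w c` with `c ∈ H_Q` are combinations of the `h_{w'}`, `w' ∈ w W_Q`. -/
theorem basis_mul_mem_span {Q : Set B} (w : W) {c : HeckeAlgebra P}
    (hc : c ∈ parabolicSubalgebra P Q) :
    basis P w * c ∈ Submodule.span R
      {x | ∃ y ∈ parabolicSubgroup cs Q, x = basis P (w * y)} := by
  refine parabolicSubalgebra_induction P (p := fun c => basis P w * c ∈ Submodule.span R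
      {x | ∃ y ∈ parabolicSubgroup cs Q, x = basis P (w * y)}) ?_ ?_ ?_ ?_ ?_ hc
  · rw [mul_zero]; exact zero_mem _
  · exact Submodule.subset_span ⟨1, one_mem _, by rw [mul_one, mul_one]⟩
  · intro x y hx hy; rw [mul_add]; exact add_mem hx hy
  · intro r x hx; rw [mul_smul_comm]; exact Submodule.smul_mem _ _ hx
  · intro c i hi hc
    rw [← mul_assoc]
    generalize basis P w * c = z at hc
    induction hc using Submodule.span_induction with
    | zero => rw [zero_mul]; exact zero_mem _
    | add x y _ _ hx hy => rw [add_mul]; exact add_mem hx hy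
    | smul r x _ hx => rw [smul_mul_assoc]; exact Submodule.smul_mem _ _ hx
    | mem x hx =>
      obtain ⟨y, hy, rfl⟩ := hx
      have hyi := mul_mem hy (simple_mem_parabolicSubgroup cs hi)
      have h1 := Submodule.subset_span (R := R)
        (s := {x | ∃ y ∈ parabolicSubgroup cs Q, x = basis P (w * y)}) ⟨y, hy, rfl⟩
      have h2 := Submodule.subset_span (R := R)
        (s := {x | ∃ y ∈ parabolicSubgroup cs Q, x = basis P (w * y)}) ⟨_, hyi, rfl⟩
      rw [← mul_assoc] at h2
      rcases lt_or_gt_of_ne (cs.length_mul_simple_ne (w * y) i) with h | h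
      · rw [basis_mul_simple_of_gt P h]
        exact add_mem (Submodule.smul_mem _ _ h1) (Submodule.smul_mem _ _ h2)
      · rw [basis_mul_simple_of_lt P h]
        exact h2

end HeckeAlgebra

end HeckeAlgebra

end Hecke

namespace Hecke

/-! ### Additive maps out of tensor products -/

section LiftTensor

open TensorProduct MulOpposite

variable {R A N Y : Type*} [CommRing R] [Ring A] [Algebra R A] [AddCommGroup N] [Module A N]
  [AddCommGroup Y]

/-- The additive map on a quotient module given by an additive map. -/
def quotientLift {T X : Type*} [Ring T] [AddCommGroup X] [Module T X]
    (p : Submodule T X) (f : X →+ Y) (hf : ∀ x ∈ p, f x = 0) : X ⧸ p →+ Y :=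
  QuotientAddGroup.lift p.toAddSubgroup f hf

theorem mulLeft_balanced {β : A →+ N →+ Y} {c : A} (h : ∀ x n, β (x * c) n = β x (c • n)) (a x : A)
    (n : N) : (β.comp (AddMonoidHom.mulLeft a)) (x * c) n =
      (β.comp (AddMonoidHom.mulLeft a)) x (c • n) := by
  rw [AddMonoidHom.comp_apply, AddMonoidHom.comp_apply, AddMonoidHom.coe_mulLeft, ← mul_assoc]
  exact h (a * x) n

/-- The additive map `A ⊗_R Aᵐᵒᵖ → Y`, `x ⊗ y ↦ β x (y n)`. -/
noncomputable def liftTensor (β : A →+ N →+ Y)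
    (h : ∀ x (r : R) n, β (x * algebraMap R A r) n = β x (algebraMap R A r • n)) (n : N) :
    A ⊗[R] Aᵐᵒᵖ →+ Y :=
  TensorProduct.liftAddHom
    (AddMonoidHom.mk' (fun x => AddMonoidHom.mk' (fun y : Aᵐᵒᵖ => β x (y.unop • n))
        (fun y y' => by rw [MulOpposite.unop_add, add_smul, map_add]))
      (fun x x' => by ext y; simp))
    (fun r x y => by
      simp only [AddMonoidHom.mk'_apply, MulOpposite.unop_smul]
      rw [Algebra.smul_def, Algebra.smul_def, mul_smul, Algebra.commutes, h])

theorem liftTensor_tmul (β : A →+ N →+ Y)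
    (h : ∀ x (r : R) n, β (x * algebraMap R A r) n = β x (algebraMap R A r • n)) (n : N) (x y : A) :
    liftTensor β h n (x ⊗ₜ op y) = β x (y • n) := rfl

/-- Multiplying a tensor by a ⊗ b replaces β by β(a ·) and n by b n. Inductions over the
sub-bimodule of relations therefore keep β and n variable. -/
theorem liftTensor_tmul_mul (β : A →+ N →+ Y)
    (h : ∀ x (r : R) n, β (x * algebraMap R A r) n = β x (algebraMap R A r • n)) (n : N) (a b : A)
    (t : A ⊗[R] Aᵐᵒᵖ) :
    liftTensor β h n (a ⊗ₜ op b * t) =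
      liftTensor (β.comp (AddMonoidHom.mulLeft a))
        (fun x r n => mulLeft_balanced (fun x n => h x r n) a x n)
        (b • n) t := by
  induction t using TensorProduct.induction_on with
  | zero => rw [mul_zero, map_zero, map_zero]
  | add t t' ht ht' => rw [mul_add, map_add, map_add, ht, ht']
  | tmul x y =>
    obtain ⟨y, rfl⟩ := op_surjective y
    rw [Algebra.TensorProduct.tmul_mul_tmul, ← op_mul, liftTensor_tmul, liftTensor_tmul, mul_smul]
    rfl

theorem liftTensor_add (β : A →+ N →+ Y)
    (h : ∀ x (r : R) n, β (x * algebraMap R A r) n = β x (algebraMap R A r • n)) (n n' : N)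
    (t : A ⊗[R] Aᵐᵒᵖ) :
    liftTensor β h (n + n') t = liftTensor β h n t + liftTensor β h n' t := by
  induction t using TensorProduct.induction_on with
  | zero => rw [map_zero, map_zero, map_zero, add_zero]
  | add t t' ht ht' => rw [map_add, map_add, map_add, ht, ht']; abel
  | tmul x y =>
    obtain ⟨y, rfl⟩ := op_surjective y
    rw [liftTensor_tmul, liftTensor_tmul, liftTensor_tmul, smul_add, map_add]

/-- The additive map `X ⊗_ℤ N → Y` given by a biadditive map. -/
noncomputable def liftInt {X : Type*} [AddCommGroup X] (Ψ : X →+ N →+ Y) : X ⊗[ℤ] N →+ Y :=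
  TensorProduct.liftAddHom Ψ (fun r x n => by rw [map_zsmul, map_zsmul]; rfl)

theorem liftInt_tmul {X : Type*} [AddCommGroup X] (Ψ : X →+ N →+ Y) (x : X) (n : N) :
    liftInt Ψ (x ⊗ₜ n) = Ψ x n := rfl

end LiftTensor

/-! ### The functors A ⊗_C -, realized as (A ⊗_C A) ⊗_A - -/

section Square

open CategoryTheory TensorProduct MulOpposite

variable {R : Type u} {A : Type w} [CommRing R] [Ring A] [Algebra R A] (C : Subalgebra R A)

/-- The sub-bimodule of `A ⊗_R A` spanned by the `x b ⊗ y - x ⊗ b y` with `b ∈ C`. -/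
noncomputable def balancedIdeal : Submodule (A ⊗[R] Aᵐᵒᵖ) (A ⊗[R] Aᵐᵒᵖ) :=
  Submodule.span _ {t | ∃ x y, ∃ b ∈ C, t = (x * b) ⊗ₜ[R] op y - x ⊗ₜ[R] op (b * y)}

/-- The bimodule `A ⊗_C A`, see `square`. -/
noncomputable def bimod : ModuleCat.{w} (A ⊗[R] Aᵐᵒᵖ) :=
  ModuleCat.of _ ((A ⊗[R] Aᵐᵒᵖ) ⧸ balancedIdeal C)

/-- The class of a tensor in `A ⊗_{C} A`. -/
noncomputable def bimodMk (t : A ⊗[R] Aᵐᵒᵖ) : bimod C := (balancedIdeal C).mkQ t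

variable {C}

theorem smul_bimodMk (a t : A ⊗[R] Aᵐᵒᵖ) :
    a • bimodMk C t = bimodMk C (a * t) := rfl

theorem bimodMk_eq_iff {t t' : A ⊗[R] Aᵐᵒᵖ} :
    bimodMk C t = bimodMk C t' ↔ t - t' ∈ balancedIdeal C := Submodule.Quotient.eq _

/-- The bimodule map `A ⊗_{C} A ⟶ X` with `1 ⊗ 1 ↦ c`, for an element `c` which commutes with
`C`. -/
noncomputable def bimodLift {X : ModuleCat.{w} (A ⊗[R] Aᵐᵒᵖ)} (c : X)
    (hc : ∀ b ∈ C,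
      (b ⊗ₜ[R] (1 : Aᵐᵒᵖ)) • c = ((1 : A) ⊗ₜ[R] op b) • c) : bimod C ⟶ X :=
  ModuleCat.ofHom ((balancedIdeal C).liftQ (LinearMap.toSpanSingleton (A ⊗[R] Aᵐᵒᵖ) X c) (by
    rw [balancedIdeal, Submodule.span_le]
    rintro _ ⟨x, y, b, hb, rfl⟩
    have e1 : (x * b) ⊗ₜ[R] op y = x ⊗ₜ[R] op y * b ⊗ₜ[R] (1 : Aᵐᵒᵖ) := by
      rw [Algebra.TensorProduct.tmul_mul_tmul, mul_one]
    have e2 : x ⊗ₜ[R] op (b * y) = x ⊗ₜ[R] op y * (1 : A) ⊗ₜ[R] op b := by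
      rw [Algebra.TensorProduct.tmul_mul_tmul, mul_one, op_mul]
    simp only [SetLike.mem_coe, LinearMap.mem_ker, LinearMap.toSpanSingleton_apply]
    rw [e1, e2, sub_smul, mul_smul, mul_smul, hc b hb, sub_self]))

theorem bimod_hom_ext {X : ModuleCat.{w} (A ⊗[R] Aᵐᵒᵖ)}
    {f g : bimod C ⟶ X} (h : f.hom (bimodMk C 1) = g.hom (bimodMk C 1)) : f = g := by
  apply ModuleCat.hom_ext
  apply LinearMap.ext
  intro x
  obtain ⟨t, rfl⟩ := (balancedIdeal C).mkQ_surjective x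
  have e : (balancedIdeal C).mkQ t = t • bimodMk C 1 := by
    rw [smul_bimodMk, mul_one]; rfl
  rw [e, map_smul, map_smul, h]

variable (C) in
/-- The class of a tensor in `A ⊗_{C} A`, as an element of the underlying left module. -/
noncomputable def bimodMkLeft (t : A ⊗[R] Aᵐᵒᵖ) : leftModule (bimod C) :=
  bimodMk C t

theorem bimodMkLeft_add (t t' : A ⊗[R] Aᵐᵒᵖ) :
    bimodMkLeft C (t + t') = bimodMkLeft C t + bimodMkLeft C t' := rfl

theorem smul_bimodMkLeft (a : A) (t : A ⊗[R] Aᵐᵒᵖ) :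
    a • bimodMkLeft C t = bimodMkLeft C (a ⊗ₜ 1 * t) := rfl

theorem rightAct_bimodMkLeft (a : A) (t : A ⊗[R] Aᵐᵒᵖ) :
    rightAct (bimod C) a (bimodMkLeft C t) = bimodMkLeft C (1 ⊗ₜ op a * t) := rfl

theorem bimodMkLeft_surjective : Function.Surjective (bimodMkLeft C) :=
  (balancedIdeal C).mkQ_surjective

variable (C) in
/-- The functor `A ⊗_{C} -` on `A`-modules. -/
noncomputable def induced : ModuleCat.{w} A ⥤ ModuleCat.{w} A :=
  (tensorBifunctor.{u, w, w, w} R A A).obj (bimod C)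

instance : (induced C).Additive :=
  inferInstanceAs
    ((tensorBifunctor.{u, w, w, w} R A A).obj (bimod C)).Additive

variable (C) in
/-- The element `x ⊗ n` of `A ⊗_{C} N`. -/
noncomputable def inducedMk {N : ModuleCat.{w} A} (x : A) (n : N) :
    (induced C).obj N :=
  (tensorMk (bimodMkLeft C (x ⊗ₜ[R] op 1)) n : tensorObj (bimod C) N)

variable {N : ModuleCat.{w} A}

theorem tensorMk_bimodMkLeft (x y : A) (n : N) :
    tensorMk (bimodMkLeft C (x ⊗ₜ[R] op y)) n = inducedMk C x (y • n) := by
  have h : bimodMkLeft C (x ⊗ₜ[R] op y) =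
      rightAct (bimod C) y (bimodMkLeft C (x ⊗ₜ[R] op 1)) := by
    rw [rightAct_bimodMkLeft, Algebra.TensorProduct.tmul_mul_tmul, one_mul, op_one, mul_one]
  rw [h, ← tensorMk_smul_right]
  rfl

theorem inducedMk_add_left (x y : A) (n : N) :
    inducedMk C (x + y) n = inducedMk C x n + inducedMk C y n := by
  rw [inducedMk, TensorProduct.add_tmul, bimodMkLeft_add]
  exact tensorMk_add_left _ _ _

theorem inducedMk_add_right (x : A) (n m : N) :
    inducedMk C x (n + m) = inducedMk C x n + inducedMk C x m := tensorMk_add_right _ _ _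

theorem smul_inducedMk (a x : A) (n : N) : a • inducedMk C x n = inducedMk C (a * x) n := by
  have h := tensorMk_smul_left a (bimodMkLeft C (x ⊗ₜ[R] op 1)) n
  rw [smul_bimodMkLeft, Algebra.TensorProduct.tmul_mul_tmul, one_mul] at h
  exact h.symm

theorem inducedMk_mul (x : A) {c : A} (hc : c ∈ C) (n : N) :
    inducedMk C (x * c) n = inducedMk C x (c • n) := by
  have h : bimodMkLeft C ((x * c) ⊗ₜ[R] op 1) = bimodMkLeft C (x ⊗ₜ[R] op c) :=
    bimodMk_eq_iff.mpr (Submodule.subset_span ⟨x, 1, c, hc, by rw [mul_one]⟩)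
  rw [← tensorMk_bimodMkLeft, inducedMk, h]

theorem inducedMk_of_mem {c : A} (hc : c ∈ C) (n : N) :
    inducedMk C c n = inducedMk C 1 (c • n) := by
  rw [← inducedMk_mul 1 hc, one_mul]

variable (C N) in
/-- `inducedMk` as a biadditive map. -/
noncomputable def inducedMkHom : A →+ N →+ (induced C).obj N :=
  AddMonoidHom.mk' (fun x => AddMonoidHom.mk' (fun n => inducedMk C x n) (inducedMk_add_right x))
    fun x y => AddMonoidHom.ext fun n => inducedMk_add_left x y n

theorem inducedMkHom_apply (x : A) (n : N) : inducedMkHom C N x n = inducedMk C x n := rfl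

theorem induced_induction {p : (induced C).obj N → Prop} (h0 : p 0)
    (hadd : ∀ x y, p x → p y → p (x + y)) (hmk : ∀ x n, p (inducedMk C x n))
    (y : (induced C).obj N) : p y := by
  refine tensor_induction (X := bimod C) h0 hadd (fun x n => ?_) y
  obtain ⟨t, rfl⟩ := bimodMkLeft_surjective x
  induction t using TensorProduct.induction_on with
  | zero =>
    have h := tensorMk_add_left (bimodMkLeft C 0) (bimodMkLeft C 0) n
    rw [← bimodMkLeft_add, add_zero] at h
    rw [left_eq_add.mp h]
    exact h0
  | add t t' h h' =>
    rw [bimodMkLeft_add, tensorMk_add_left]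
    exact hadd _ _ h h'
  | tmul x y =>
    obtain ⟨y, rfl⟩ := op_surjective y
    rw [tensorMk_bimodMkLeft]
    exact hmk _ _

theorem induced_map_mk {N' : ModuleCat.{w} A} (f : N ⟶ N') (x : A) (n : N) :
    ((induced C).map f).hom (inducedMk C x n) = inducedMk C x (f.hom n) := rfl

section Lift

variable {Y : Type z} [AddCommGroup Y]

theorem liftTensor_eq_zero (β : A →+ N →+ Y)
    (h : ∀ x, ∀ c ∈ C, ∀ n, β (x * c) n = β x (c • n)) (n : N)
    {t : A ⊗[R] Aᵐᵒᵖ} (ht : t ∈ balancedIdeal C) :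
    liftTensor β (fun x r n => h x _ (algebraMap_mem _ r) n) n t = 0 := by
  induction ht using Submodule.span_induction generalizing β n with
  | zero => rw [map_zero]
  | add t t' _ _ ht ht' => rw [map_add, ht β h, ht' β h, add_zero]
  | mem t ht =>
    obtain ⟨x, y, b, hb, rfl⟩ := ht
    rw [map_sub, liftTensor_tmul, liftTensor_tmul, h x b hb, mul_smul, sub_self]
  | smul a t _ ht =>
    rw [smul_eq_mul]
    induction a using TensorProduct.induction_on with
    | zero => rw [zero_mul, map_zero]
    | add a a' ha ha' => rw [add_mul, map_add, ha, ha', add_zero]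
    | tmul a b =>
      obtain ⟨b, rfl⟩ := op_surjective b
      rw [liftTensor_tmul_mul]
      exact ht (β.comp (AddMonoidHom.mulLeft a))
        (fun x c hc n => mulLeft_balanced (fun x n => h x c hc n) a x n) _

/-- The biadditive map on `(A ⊗_{C} A) × N` given by a balanced biadditive map. -/
noncomputable def liftSquare (β : A →+ N →+ Y)
    (h : ∀ x, ∀ c ∈ C, ∀ n, β (x * c) n = β x (c • n)) :
    leftModule (bimod C) →+ N →+ Y :=
  quotientLift (balancedIdeal C)
    (AddMonoidHom.mk' (fun t => AddMonoidHom.mk'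
        (fun n => liftTensor β (fun x r n => h x _ (algebraMap_mem _ r) n) n t)
        (fun n n' => liftTensor_add β _ n n' t))
      (fun t t' => AddMonoidHom.ext fun n => map_add
        (liftTensor β (fun x r n => h x _ (algebraMap_mem _ r) n) n) t t'))
    (fun _ ht => AddMonoidHom.ext fun n => liftTensor_eq_zero β h n ht)

theorem liftSquare_mk (β : A →+ N →+ Y)
    (h : ∀ x, ∀ c ∈ C, ∀ n, β (x * c) n = β x (c • n)) (t : A ⊗[R] Aᵐᵒᵖ)
    (n : N) : liftSquare β h (bimodMkLeft C t) n =
      liftTensor β (fun x r n => h x _ (algebraMap_mem _ r) n) n t := rfl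

theorem liftSquare_rightAct (β : A →+ N →+ Y)
    (h : ∀ x, ∀ c ∈ C, ∀ n, β (x * c) n = β x (c • n)) (b : A)
    (x : leftModule (bimod C)) (n : N) :
    liftSquare β h (rightAct (bimod C) b x) n = liftSquare β h x (b • n) := by
  obtain ⟨t, rfl⟩ := bimodMkLeft_surjective x
  rw [rightAct_bimodMkLeft, liftSquare_mk, liftSquare_mk, liftTensor_tmul_mul]
  congr 2
  ext x
  simp

theorem liftSquare_smul (β : A →+ N →+ Y)
    (h : ∀ x, ∀ c ∈ C, ∀ n, β (x * c) n = β x (c • n)) (a : A)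
    (x : leftModule (bimod C)) (n : N) :
    liftSquare β h (a • x) n = liftSquare (β.comp (AddMonoidHom.mulLeft a))
      (fun x c hc n => mulLeft_balanced (fun x n => h x c hc n) a x n) x n := by
  obtain ⟨t, rfl⟩ := bimodMkLeft_surjective x
  rw [smul_bimodMkLeft, liftSquare_mk, liftSquare_mk, ← op_one, liftTensor_tmul_mul, one_smul]

theorem liftInt_smul (β : A →+ N →+ Y)
    (h : ∀ x, ∀ c ∈ C, ∀ n, β (x * c) n = β x (c • n)) (a : A)
    (t : leftModule (bimod C) ⊗[ℤ] N) :
    liftInt (liftSquare β h) (a • t) = liftInt (liftSquare (β.comp (AddMonoidHom.mulLeft a))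
      (fun x c hc n => mulLeft_balanced (fun x n => h x c hc n) a x n)) t := by
  induction t using TensorProduct.induction_on with
  | zero => rw [smul_zero, map_zero, map_zero]
  | add t t' ht ht' => rw [smul_add, map_add, map_add, ht, ht']
  | tmul x n => rw [TensorProduct.smul_tmul', liftInt_tmul, liftInt_tmul, liftSquare_smul]

theorem liftInt_eq_zero (β : A →+ N →+ Y)
    (h : ∀ x, ∀ c ∈ C, ∀ n, β (x * c) n = β x (c • n))
    {t : leftModule (bimod C) ⊗[ℤ] N} (ht : t ∈ balancedRel (bimod C) N) :
    liftInt (liftSquare β h) t = 0 := by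
  induction ht using Submodule.span_induction generalizing β with
  | zero => rw [map_zero]
  | add t t' _ _ ht ht' => rw [map_add, ht β h, ht' β h, add_zero]
  | mem t ht =>
    obtain ⟨x, b, n, rfl⟩ := ht
    rw [map_sub, liftInt_tmul, liftInt_tmul, liftSquare_rightAct, sub_self]
  | smul a t _ ht => rw [liftInt_smul, ht]

/-- The additive map on `A ⊗_{C} N` given by a balanced biadditive map. -/
noncomputable def inducedLift (β : A →+ N →+ Y)
    (h : ∀ x, ∀ c ∈ C, ∀ n, β (x * c) n = β x (c • n)) :
    (induced C).obj N →+ Y :=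
  quotientLift (balancedRel (bimod C) N) (liftInt (liftSquare β h))
    fun _ => liftInt_eq_zero β h

theorem inducedLift_mk (β : A →+ N →+ Y)
    (h : ∀ x, ∀ c ∈ C, ∀ n, β (x * c) n = β x (c • n)) (x : A) (n : N) :
    inducedLift β h (inducedMk C x n) = β x n := by
  refine (liftTensor_tmul β (fun x r n => h x _ (algebraMap_mem _ r) n) n x 1).trans ?_
  rw [one_smul]

end Lift

end Square

end Hecke

namespace Hecke

/-! ### Frobenius extensions and the bimodule maps given by Casimir elements -/

section Frobenius

open CategoryTheory TensorProduct MulOpposite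

/-- The map `t ↦ t ⊗ n` from `A ⊗_R Aᵐᵒᵖ` to `A ⊗_C N = (A ⊗_C A) ⊗_A N`. -/
noncomputable def bimodTensorHom {R : Type u} [CommRing R] {A : Type w} [Ring A] [Algebra R A]
    (C : Subalgebra R A) {N : ModuleCat.{w} A} (n : N) : A ⊗[R] Aᵐᵒᵖ →+ (induced C).obj N :=
  AddMonoidHom.mk' (fun t => (tensorMk (bimodMkLeft C t) n : tensorObj (bimod C) N))
    (fun t t' => tensorMk_add_left (bimodMkLeft C t) (bimodMkLeft C t') n)

theorem bimodTensorHom_tmul {R : Type u} [CommRing R] {A : Type w} [Ring A] [Algebra R A]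
    (C : Subalgebra R A) {N : ModuleCat.{w} A} (n : N) (x y : A) :
    bimodTensorHom C n (x ⊗ₜ op y) = inducedMk C x (y • n) := tensorMk_bimodMkLeft x y n

/-- A family of subalgebras `C_j` of `A` with bimodule projections `A → C_j` which make the
`A / C_j` Frobenius extensions. -/
structure FrobeniusSystem (R : Type u) [CommRing R] (A : Type w) [Ring A] [Algebra R A]
    {J : Type v} (C : J → Subalgebra R A) (κ : Type z) where
  /-- the projection to `C_j` -/
  proj : J → A →ₗ[R] A
  /-- the bases of `A` over `C_j` are families of members of this family -/
  base : κ → A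
  /-- the dual bases of `A` over `C_j` are families of members of this family -/
  dual : κ → A
  /-- the indices of the basis of `A` over `C_j` -/
  index : J → Finset κ
  proj_mem : ∀ j a, proj j a ∈ C j
  proj_mul : ∀ j a, ∀ c ∈ C j, proj j (a * c) = proj j a * c
  mul_proj : ∀ j a, ∀ c ∈ C j, proj j (c * a) = c * proj j a
  sum_base_mul : ∀ j a, ∑ m ∈ index j, base m * proj j (dual m * a) = a
  sum_mul_dual : ∀ j a, ∑ m ∈ index j, proj j (a * base m) * dual m = a

namespace FrobeniusSystem

variable {R : Type u} [CommRing R] {A : Type w} [Ring A] [Algebra R A]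
  {J : Type v} {C : J → Subalgebra R A} {κ : Type z} (F : FrobeniusSystem R A C κ)

/-- The action `a ⊗ b ↦ (x ↦ p_j(x a) b)` of `A ⊗_R Aᵐᵒᵖ` through `p_j : A → C_j`. -/
noncomputable def action (j : J) : A ⊗[R] Aᵐᵒᵖ →ₗ[R] (A →ₗ[R] A) :=
  TensorProduct.lift <| LinearMap.mk₂ R
    (fun a (b : Aᵐᵒᵖ) => LinearMap.mulRight R b.unop ∘ₗ F.proj j ∘ₗ LinearMap.mulRight R a)
    (fun a a' b => by ext x; simp [mul_add, add_mul])
    (fun r a b => by ext x; simp)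
    (fun a b b' => by ext x; simp [mul_add])
    (fun r a b => by ext x; simp)

theorem action_tmul (j : J) (a b x : A) :
    F.action j (a ⊗ₜ op b) x = F.proj j (x * a) * b := rfl

theorem action_tmul_mul (j : J) (a b x : A) (t : A ⊗[R] Aᵐᵒᵖ) :
    F.action j (a ⊗ₜ op b * t) x = F.action j t (x * a) * b := by
  induction t using TensorProduct.induction_on with
  | zero => simp
  | add t t' ht ht' => simp only [mul_add, map_add, LinearMap.add_apply, add_mul, ht, ht']
  | tmul a' b' =>
    obtain ⟨b', rfl⟩ := op_surjective b'
    rw [Algebra.TensorProduct.tmul_mul_tmul, ← op_mul, action_tmul, action_tmul, mul_assoc x a,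
      mul_assoc]

theorem action_eq_zero {j : J} {t : A ⊗[R] Aᵐᵒᵖ} (ht : t ∈ balancedIdeal (C j)) :
    F.action j t = 0 := by
  induction ht using Submodule.span_induction with
  | zero => rw [map_zero]
  | add t t' _ _ ht ht' => rw [map_add, ht, ht', add_zero]
  | mem t ht =>
    obtain ⟨x, y, b, hb, rfl⟩ := ht
    ext a
    rw [map_sub, LinearMap.sub_apply, action_tmul, action_tmul, ← mul_assoc, F.proj_mul j _ b hb,
      mul_assoc, sub_self, LinearMap.zero_apply]
  | smul a t _ ht =>
    rw [smul_eq_mul]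
    induction a using TensorProduct.induction_on with
    | zero => rw [zero_mul, map_zero]
    | add a a' ha ha' => rw [add_mul, map_add, ha, ha', add_zero]
    | tmul a b =>
      obtain ⟨b, rfl⟩ := op_surjective b
      ext x
      rw [action_tmul_mul, ht, LinearMap.zero_apply, zero_mul, LinearMap.zero_apply]

/-- Expanding a = ∑ e_m p(f_m a) and moving the coefficients across the tensor sign gives a normal
form: modulo the relations, t is determined by the values of its action on the dual basis. -/
theorem sub_sum_mem (j : J) (t : A ⊗[R] Aᵐᵒᵖ) :
    t - ∑ m ∈ F.index j, F.base m ⊗ₜ[R] op (F.action j t (F.dual m)) ∈ balancedIdeal (C j) := by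
  induction t using TensorProduct.induction_on with
  | zero => simp
  | add t t' ht ht' =>
    have h := add_mem ht ht'
    simp only [map_add, LinearMap.add_apply, MulOpposite.op_add, TensorProduct.tmul_add,
      Finset.sum_add_distrib]
    rwa [add_sub_add_comm]
  | tmul a b =>
    obtain ⟨b, rfl⟩ := op_surjective b
    have e : a ⊗ₜ[R] op b = ∑ m ∈ F.index j, (F.base m * F.proj j (F.dual m * a)) ⊗ₜ[R] op b := by
      rw [← TensorProduct.sum_tmul, F.sum_base_mul]
    nth_rewrite 1 [e]
    rw [← Finset.sum_sub_distrib]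
    refine sum_mem fun m _ => Submodule.subset_span
      ⟨F.base m, b, F.proj j (F.dual m * a), F.proj_mem j _, ?_⟩
    rw [action_tmul]

/-- The relations act by zero, and conversely the normal form of `sub_sum_mem` depends on the action
only. Thus A ⊗_C A embeds into the linear endomorphisms of A, and identities between Casimir
elements become identities between projections. -/
theorem bimodMk_eq_iff {j : J} {t t' : A ⊗[R] Aᵐᵒᵖ} :
    bimodMk (C j) t = bimodMk (C j) t' ↔ F.action j t = F.action j t' := by
  rw [Hecke.bimodMk_eq_iff, ← sub_eq_zero (a := F.action j t), ← map_sub]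
  refine ⟨F.action_eq_zero, fun h => ?_⟩
  have := F.sub_sum_mem j (t - t')
  rw [h] at this
  simpa using this

/-- The Casimir tensor `∑_m e_m ⊗ p_k(f_m)`, which represents a bimodule map
`A ⊗_{C_k} A ⟶ A ⊗_{C_j} A` for `C_j ≤ C_k`. -/
noncomputable def casimir (k j : J) : A ⊗[R] Aᵐᵒᵖ :=
  ∑ m ∈ F.index j, F.base m ⊗ₜ[R] op (F.proj k (F.dual m))

/-- As C_j ≤ C_k, the coefficient p_j(x e_m) enters p_k, and ∑ p_j(x e_m) p_k(f_m) = p_k(∑ p_j(x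
e_m) f_m) = p_k(x). -/
theorem action_casimir {k j : J} (h : C j ≤ C k) : F.action j (F.casimir k j) = F.proj k := by
  ext x
  rw [casimir, map_sum, LinearMap.sum_apply]
  simp only [action_tmul]
  calc _ = F.proj k (∑ m ∈ F.index j, F.proj j (x * F.base m) * F.dual m) := by
        rw [map_sum]
        exact Finset.sum_congr rfl fun m _ => (F.mul_proj k _ _ (h (F.proj_mem j _))).symm
    _ = F.proj k x := by rw [F.sum_mul_dual]

/-- The bimodule map `A ⊗_{C_k} A ⟶ A ⊗_{C_j} A` given by the Casimir element, for
`C_j ≤ C_k`. -/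
noncomputable def transfer {k j : J} (h : C j ≤ C k) : bimod (C k) ⟶ bimod (C j) :=
  bimodLift (bimodMk (C j) (F.casimir k j)) (fun b hb => by
    -- By `action_casimir`, commutation of the Casimir element with b ∈ C_k amounts to the right
    -- C_k-linearity of p_k.
    rw [smul_bimodMk, smul_bimodMk, F.bimodMk_eq_iff]
    ext x
    rw [← op_one, action_tmul_mul, action_tmul_mul, F.action_casimir h, mul_one, mul_one,
      F.proj_mul k x b hb])

theorem transfer_mk {k j : J} (h : C j ≤ C k) (t : A ⊗[R] Aᵐᵒᵖ) :
    (F.transfer h).hom (bimodMk (C k) t) = bimodMk (C j) (t * F.casimir k j) := rfl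

theorem transfer_refl (j : J) : F.transfer (le_refl (C j)) = 𝟙 _ := by
  apply bimod_hom_ext
  rw [transfer_mk, one_mul]
  change _ = bimodMk (C j) 1
  rw [F.bimodMk_eq_iff, F.action_casimir le_rfl, Algebra.TensorProduct.one_def, ← op_one]
  ext x
  rw [action_tmul, mul_one, mul_one]

/-- Both maps are determined by the image of 1 ⊗ 1, and both images act on A as the projection p_k.
-/
theorem transfer_comp {i j k : J} (h : C j ≤ C k) (h' : C i ≤ C j) :
    F.transfer h ≫ F.transfer h' = F.transfer (h'.trans h) := by
  apply bimod_hom_ext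
  rw [ModuleCat.comp_apply, transfer_mk, one_mul, transfer_mk, transfer_mk, one_mul,
    F.bimodMk_eq_iff, F.action_casimir (h'.trans h)]
  ext x
  conv_lhs => rw [casimir, Finset.sum_mul, map_sum, LinearMap.sum_apply]
  simp only [action_tmul_mul, F.action_casimir h']
  have := LinearMap.congr_fun (F.action_casimir h) x
  rw [casimir, map_sum, LinearMap.sum_apply] at this
  exact this

theorem transfer_app_mk {k j : J} (h : C j ≤ C k) (N : ModuleCat.{w} A) (x : A) (n : N) :
    (((tensorBifunctor.{u, w, w, w} R A A).map (F.transfer h)).app N).hom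
      (inducedMk (C k) x n : (induced (C k)).obj N) =
    (∑ m ∈ F.index j, inducedMk (C j) (x * F.base m) (F.proj k (F.dual m) • n) :
      (induced (C j)).obj N) := by
  have h1 : (((tensorBifunctor.{u, w, w, w} R A A).map (F.transfer h)).app N).hom
      (inducedMk (C k) x n : (induced (C k)).obj N) =
      bimodTensorHom (C j) n (x ⊗ₜ op 1 * F.casimir k j) := rfl
  rw [h1, casimir, Finset.mul_sum, map_sum]
  refine Finset.sum_congr rfl fun m _ => ?_
  rw [Algebra.TensorProduct.tmul_mul_tmul, ← op_mul, mul_one, bimodTensorHom_tmul]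

end FrobeniusSystem

end Frobenius

end Hecke

namespace Hecke

/-! ### Systems of cells, total complexes and contractions -/

section Cells

open CategoryTheory

/-- A system of cells: additive functors `G k` of degree `deg k` and natural transformations
`D k r`, `r ∈ act k`, of degree one between them, with signs. -/
structure CellSystem (A : Type u) [Ring A] (κ : Type v) (ρ : Type w) where
  /-- the degree of a cell -/
  deg : κ → ℤ
  /-- the labels of the components of the differential -/
  act : κ → Finset ρ
  /-- the targets of the components of the differential -/
  tgt : κ → ρ → κ
  /-- the signs in the differential -/
  sgn : κ → ρ → ℤ
  /-- the functor attached to a cell -/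
  G : κ → ModuleCat.{z} A ⥤ ModuleCat.{z} A
  additive : ∀ k, (G k).Additive
  /-- the components of the differential -/
  D : ∀ k r, G k ⟶ G (tgt k r)
  deg_tgt : ∀ k, ∀ r ∈ act k, deg (tgt k r) = deg k + 1

attribute [instance] CellSystem.additive

variable {A : Type u} [Ring A] {κ : Type v} [Fintype κ] {ρ : Type w}

/-- A description of an endofunctor of the category of complexes as the total complex attached to
a system of cells. -/
structure Presentation (𝒮 : CellSystem.{u, v, w, z} A κ ρ)
    (Θ : CochainComplex (ModuleCat.{z} A) ℤ ⥤ CochainComplex (ModuleCat.{z} A) ℤ) where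
  /-- the inclusions of the cells -/
  ι : ∀ (L : CochainComplex (ModuleCat.{z} A) ℤ) k a n, (𝒮.G k).obj (L.X a) ⟶ (Θ.obj L).X n
  /-- the projections to the cells -/
  π : ∀ (L : CochainComplex (ModuleCat.{z} A) ℤ) k a n, (Θ.obj L).X n ⟶ (𝒮.G k).obj (L.X a)
  ι_eq_zero : ∀ L k a n, 𝒮.deg k + a ≠ n → ι L k a n = 0
  ι_π : ∀ L k a n, 𝒮.deg k + a = n → ι L k a n ≫ π L k a n = 𝟙 _
  ι_π_of_ne : ∀ L k k' a a' n, k ≠ k' → ι L k a n ≫ π L k' a' n = 0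
  sum_π_ι : ∀ L n, ∑ k, π L k (n - 𝒮.deg k) n ≫ ι L k (n - 𝒮.deg k) n = 𝟙 _
  ι_d : ∀ L k a n, 𝒮.deg k + a = n → ι L k a n ≫ (Θ.obj L).d n (n + 1) =
    ∑ r ∈ 𝒮.act k, 𝒮.sgn k r • (𝒮.D k r).app (L.X a) ≫ ι L (𝒮.tgt k r) a (n + 1) +
      ((𝒮.deg k).negOnePow : ℤ) • (𝒮.G k).map (L.d a (a + 1)) ≫ ι L k (a + 1) (n + 1)
  ι_map : ∀ {L L'} (φ : L ⟶ L') k a n, ι L k a n ≫ (Θ.map φ).f n =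
    (𝒮.G k).map (φ.f a) ≫ ι L' k a n

/-- Natural transformations of degree `-1` between the functors attached to the cells. -/
structure Contraction (𝒮 : CellSystem.{u, v, w, z} A κ ρ) (l : Type w) where
  /-- the labels of the components of the contraction -/
  act : κ → Finset l
  /-- the targets of the components of the contraction -/
  tgt : κ → l → κ
  /-- the components of the contraction -/
  S : ∀ k i, 𝒮.G k ⟶ 𝒮.G (tgt k i)
  deg_tgt : ∀ k, ∀ i ∈ act k, 𝒮.deg (tgt k i) + 1 = 𝒮.deg k

namespace Contraction

variable {𝒮 : CellSystem.{u, v, w, z} A κ ρ} {l : Type w} (σ : Contraction 𝒮 l)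

/-- The part of `dσ + σd` which does not involve the differential of the complex of
coefficients, in terms of maps `j` from the cells to a given module. -/
noncomputable def laplacian {N V : ModuleCat.{z} A} (j : ∀ k, (𝒮.G k).obj N ⟶ V) (k : κ)
    (y : (𝒮.G k).obj N) : V :=
  ∑ i ∈ σ.act k, ∑ r ∈ 𝒮.act (σ.tgt k i), 𝒮.sgn (σ.tgt k i) r •
      (j (𝒮.tgt (σ.tgt k i) r)).hom (((𝒮.D (σ.tgt k i) r).app N).hom (((σ.S k i).app N).hom y)) +
    ∑ r ∈ 𝒮.act k, ∑ i ∈ σ.act (𝒮.tgt k r), 𝒮.sgn k r •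
      (j (σ.tgt (𝒮.tgt k r) i)).hom (((σ.S (𝒮.tgt k r) i).app N).hom (((𝒮.D k r).app N).hom y))

end Contraction

namespace Presentation

variable {𝒮 : CellSystem.{u, v, w, z} A κ ρ}
  {Θ : CochainComplex (ModuleCat.{z} A) ℤ ⥤ CochainComplex (ModuleCat.{z} A) ℤ}
  (p : Presentation 𝒮 Θ) {l : Type w} (σ : Contraction 𝒮 l)

theorem hom_ext {L : CochainComplex (ModuleCat.{z} A) ℤ} {n : ℤ} {V : ModuleCat.{z} A}
    {f g : (Θ.obj L).X n ⟶ V}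
    (h : ∀ k a, 𝒮.deg k + a = n → p.ι L k a n ≫ f = p.ι L k a n ≫ g) : f = g := by
  rw [← Category.id_comp f, ← Category.id_comp g, ← p.sum_π_ι, Preadditive.sum_comp,
    Preadditive.sum_comp]
  refine Finset.sum_congr rfl fun k _ => ?_
  rw [Category.assoc, Category.assoc, h _ _ (by omega)]

/-- The homotopy attached to a contraction. -/
noncomputable def homotopyMap (L : CochainComplex (ModuleCat.{z} A) ℤ) (i j : ℤ) :
    (Θ.obj L).X i ⟶ (Θ.obj L).X j :=
  ∑ k, ∑ m ∈ σ.act k, p.π L k (i - 𝒮.deg k) i ≫ (σ.S k m).app _ ≫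
    p.ι L (σ.tgt k m) (i - 𝒮.deg k) j

theorem homotopyMap_eq_zero (L : CochainComplex (ModuleCat.{z} A) ℤ) (i j : ℤ) (h : j + 1 ≠ i) :
    p.homotopyMap σ L i j = 0 := by
  refine Finset.sum_eq_zero fun k _ => Finset.sum_eq_zero fun m hm => ?_
  have := σ.deg_tgt k m hm
  rw [p.ι_eq_zero _ _ _ _ (by omega), Limits.comp_zero, Limits.comp_zero]

theorem ι_homotopyMap (L : CochainComplex (ModuleCat.{z} A) ℤ) (k : κ) (a i j : ℤ)
    (h : 𝒮.deg k + a = i) : p.ι L k a i ≫ p.homotopyMap σ L i j =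
      ∑ m ∈ σ.act k, (σ.S k m).app _ ≫ p.ι L (σ.tgt k m) a j := by
  obtain rfl : a = i - 𝒮.deg k := by omega
  rw [homotopyMap, Preadditive.comp_sum, Finset.sum_eq_single k]
  · rw [Preadditive.comp_sum]
    refine Finset.sum_congr rfl fun m _ => ?_
    rw [reassoc_of% p.ι_π _ _ _ _ h]
  · intro k' _ hk
    rw [Preadditive.comp_sum]
    refine Finset.sum_eq_zero fun m _ => ?_
    rw [← Category.assoc, p.ι_π_of_ne _ _ _ _ _ _ hk.symm, Limits.zero_comp]
  · simp

/-- The contraction consists of natural transformations. This is what makes the final reduction an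
isomorphism of functors rather than of single complexes. -/
theorem homotopyMap_naturality {L L' : CochainComplex (ModuleCat.{z} A) ℤ} (φ : L ⟶ L') (i j : ℤ) :
    (Θ.map φ).f i ≫ p.homotopyMap σ L' i j = p.homotopyMap σ L i j ≫ (Θ.map φ).f j := by
  apply p.hom_ext
  intro k a h
  rw [reassoc_of% p.ι_map, p.ι_homotopyMap σ _ _ _ _ _ h, ← Category.assoc,
    p.ι_homotopyMap σ _ _ _ _ _ h, Preadditive.comp_sum, Preadditive.sum_comp]
  refine Finset.sum_congr rfl fun m _ => ?_
  rw [Category.assoc, p.ι_map, ← Category.assoc, (σ.S k m).naturality, Category.assoc]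

/-- The null-homotopic endomorphism `dσ + σd`. -/
noncomputable def nullMap (L : CochainComplex (ModuleCat.{z} A) ℤ) : Θ.obj L ⟶ Θ.obj L :=
  Homotopy.nullHomotopicMap (p.homotopyMap σ L)

theorem nullMap_f (L : CochainComplex (ModuleCat.{z} A) ℤ) (n : ℤ) : (p.nullMap σ L).f n =
    (Θ.obj L).d n (n + 1) ≫ p.homotopyMap σ L (n + 1) n +
      p.homotopyMap σ L n (n - 1) ≫ (Θ.obj L).d (n - 1) n := by
  rw [nullMap, Homotopy.nullHomotopicMap_f (k₀ := n + 1) (k₁ := n) (k₂ := n - 1) (by simp) (by simp)]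

theorem nullMap_naturality {L L' : CochainComplex (ModuleCat.{z} A) ℤ} (φ : L ⟶ L') :
    Θ.map φ ≫ p.nullMap σ L' = p.nullMap σ L ≫ Θ.map φ := by
  ext n : 1
  simp only [HomologicalComplex.comp_f, nullMap_f, Preadditive.comp_add, Preadditive.add_comp,
    Category.assoc]
  rw [(Θ.map φ).comm_assoc, p.homotopyMap_naturality, reassoc_of% p.homotopyMap_naturality,
    (Θ.map φ).comm]

/-- The terms of dσ and σd which contain the differential of L cancel: σ commutes with it by
naturality and changes the degree of the cell by one, so the two signs (-1)^deg are opposite. -/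
theorem nullMap_apply (L : CochainComplex (ModuleCat.{z} A) ℤ) (k : κ) (a n : ℤ)
    (h : 𝒮.deg k + a = n) (y : (𝒮.G k).obj (L.X a)) :
    ((p.nullMap σ L).f n).hom ((p.ι L k a n).hom y) =
      σ.laplacian (fun k => p.ι L k a n) k y := by
  have key : p.ι L k a n ≫ (p.nullMap σ L).f n =
      ∑ i ∈ σ.act k, ∑ r ∈ 𝒮.act (σ.tgt k i), 𝒮.sgn (σ.tgt k i) r •
        (σ.S k i).app _ ≫ (𝒮.D (σ.tgt k i) r).app _ ≫ p.ι L (𝒮.tgt (σ.tgt k i) r) a n +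
      ∑ r ∈ 𝒮.act k, ∑ i ∈ σ.act (𝒮.tgt k r), 𝒮.sgn k r •
        (𝒮.D k r).app _ ≫ (σ.S (𝒮.tgt k r) i).app _ ≫ p.ι L (σ.tgt (𝒮.tgt k r) i) a n := by
    rw [nullMap_f, Preadditive.comp_add, reassoc_of% p.ι_d _ _ _ _ h, reassoc_of% p.ι_homotopyMap σ _ _ _ _ _ h,
      Preadditive.sum_comp, add_comm, Preadditive.add_comp, Preadditive.sum_comp]
    have e1 : ∀ r ∈ 𝒮.act k, (𝒮.sgn k r • (𝒮.D k r).app (L.X a) ≫ p.ι L (𝒮.tgt k r) a (n + 1)) ≫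
        p.homotopyMap σ L (n + 1) n = ∑ i ∈ σ.act (𝒮.tgt k r), 𝒮.sgn k r •
        (𝒮.D k r).app _ ≫ (σ.S (𝒮.tgt k r) i).app _ ≫ p.ι L (σ.tgt (𝒮.tgt k r) i) a n := by
      intro r hr
      rw [Preadditive.zsmul_comp, Category.assoc,
        p.ι_homotopyMap σ _ _ _ _ _ (by rw [𝒮.deg_tgt k r hr]; omega), Preadditive.comp_sum,
        Finset.smul_sum]
    have e2 : ∀ i ∈ σ.act k, (((σ.S k i).app (L.X a) ≫ p.ι L (σ.tgt k i) a (n - 1)) ≫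
        (Θ.obj L).d (n - 1) n) = ∑ r ∈ 𝒮.act (σ.tgt k i), 𝒮.sgn (σ.tgt k i) r •
        (σ.S k i).app _ ≫ (𝒮.D (σ.tgt k i) r).app _ ≫ p.ι L (𝒮.tgt (σ.tgt k i) r) a n -
        ((𝒮.deg k).negOnePow : ℤ) • (𝒮.G k).map (L.d a (a + 1)) ≫ (σ.S k i).app _ ≫
          p.ι L (σ.tgt k i) (a + 1) n := by
      intro i hi
      have hd := σ.deg_tgt k i hi
      have e := p.ι_d L (σ.tgt k i) a (n - 1) (by omega)
      rw [sub_add_cancel] at e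
      rw [Category.assoc, e, Preadditive.comp_add, Preadditive.comp_sum, sub_eq_add_neg]
      refine congrArg₂ (· + ·) ?_ ?_
      · exact Finset.sum_congr rfl fun r _ => by rw [Preadditive.comp_zsmul]
      · rw [Preadditive.comp_zsmul, ← hd, Int.negOnePow_succ, Units.val_neg, neg_smul, neg_neg,
          (σ.S k i).naturality_assoc]
    have e3 : (((𝒮.deg k).negOnePow : ℤ) • (𝒮.G k).map (L.d a (a + 1)) ≫
        p.ι L k (a + 1) (n + 1)) ≫ p.homotopyMap σ L (n + 1) n = ∑ i ∈ σ.act k,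
        ((𝒮.deg k).negOnePow : ℤ) • (𝒮.G k).map (L.d a (a + 1)) ≫ (σ.S k i).app _ ≫
          p.ι L (σ.tgt k i) (a + 1) n := by
      rw [Preadditive.zsmul_comp, Category.assoc, p.ι_homotopyMap σ _ _ _ _ _ (by omega),
        Preadditive.comp_sum, Finset.smul_sum]
    rw [Finset.sum_congr rfl e1, Finset.sum_congr rfl e2, e3, Finset.sum_sub_distrib]
    abel
  have := ConcreteCategory.congr_hom key y
  rw [ModuleCat.comp_apply] at this
  refine this.trans ?_
  rw [Contraction.laplacian]
  simp only [ModuleCat.hom_add, ModuleCat.hom_sum, LinearMap.add_apply, LinearMap.sum_apply,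
    ModuleCat.hom_zsmul, LinearMap.smul_apply, ModuleCat.hom_comp, LinearMap.comp_apply]

end Presentation

end Cells

end Hecke

namespace Hecke

/-! ### Algebraic Morse theory with a single critical cell -/

section Morse

open CategoryTheory

variable {A : Type u} [Ring A] {κ : Type v} [Fintype κ] {ρ l : Type w}

/-- A filtration of a system of cells for which a contraction is an acyclic matching, with the
cell `crit` as only critical cell. -/
structure MorseFiltration {𝒮 : CellSystem.{u, v, w, z} A κ ρ} (σ : Contraction 𝒮 l) where
  /-- the filtration -/
  Fil : ℕ → ∀ k (N : ModuleCat.{z} A), Submodule A ((𝒮.G k).obj N)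
  mono : ∀ {h h' : ℕ}, h ≤ h' → ∀ k N, Fil h k N ≤ Fil h' k N
  Fil_zero : ∀ k N, Fil 0 k N = ⊥
  /-- the height of the filtration -/
  height : ℕ
  Fil_height : ∀ k N, Fil height k N = ⊤
  /-- the critical cell -/
  crit : κ
  /-- the level of the critical cell -/
  level : ℕ
  deg_crit : 𝒮.deg crit = 0
  /-- the functor attached to the critical cell is the identity functor -/
  iso : 𝟭 _ ≅ 𝒮.G crit
  Fil_crit : ∀ N, Fil level crit N = ⊥
  Fil_succ : ∀ k N, k ≠ crit → Fil (level + 1) k N ≤ Fil level k N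
  -- Each step lowers the filtration, except at the critical level. The elements are compared after
  -- maps j into a common module V because they lie in cells which agree only up to an equality of
  -- indices; V will be a term of the total complex and j the inclusions of the cells.
  lower : ∀ h, h ≠ level → ∀ k (N : ModuleCat.{z} A), ∀ y ∈ Fil (h + 1) k N,
    ∀ (V : ModuleCat.{z} A) (j : ∀ k, (𝒮.G k).obj N ⟶ V),
      (j k).hom y - σ.laplacian j k y ∈ ⨆ k', (Fil h k' N).map (j k').hom
  critical : ∀ (N : ModuleCat.{z} A) (y : (𝒮.G crit).obj N)
    (V : ModuleCat.{z} A) (j : ∀ k, (𝒮.G k).obj N ⟶ V),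
      σ.laplacian j crit y ∈ ⨆ k', (Fil level k' N).map (j k').hom
  D_mem : ∀ k N, ∀ r ∈ 𝒮.act k, ∀ y ∈ Fil level k N,
    ((𝒮.D k r).app N).hom y ∈ Fil level (𝒮.tgt k r) N
  D_crit_mem : ∀ N, ∀ r ∈ 𝒮.act crit, ∀ y,
    ((𝒮.D crit r).app N).hom y ∈ Fil level (𝒮.tgt crit r) N
  map_mem : ∀ k {N N'} (φ : N ⟶ N'), ∀ y ∈ Fil level k N,
    ((𝒮.G k).map φ).hom y ∈ Fil level k N'

namespace MorseFiltration

variable {𝒮 : CellSystem.{u, v, w, z} A κ ρ} {σ : Contraction 𝒮 l} (m : MorseFiltration σ)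
  {Θ : CochainComplex (ModuleCat.{z} A) ℤ ⥤ CochainComplex (ModuleCat.{z} A) ℤ}
  (p : Presentation 𝒮 Θ)

/-- The filtration of the total complex. -/
noncomputable def total (L : CochainComplex (ModuleCat.{z} A) ℤ) (h : ℕ) (n : ℤ) :
    Submodule A ((Θ.obj L).X n) :=
  ⨆ k, ⨆ a, (m.Fil h k (L.X a)).map (p.ι L k a n).hom

variable {L : CochainComplex (ModuleCat.{z} A) ℤ} {h : ℕ} {n : ℤ}

theorem ι_mem_total {k : κ} {a : ℤ} {y : (𝒮.G k).obj (L.X a)} (hy : y ∈ m.Fil h k (L.X a)) :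
    (p.ι L k a n).hom y ∈ m.total p L h n :=
  Submodule.mem_iSup_of_mem k (Submodule.mem_iSup_of_mem a ⟨y, hy, rfl⟩)

variable {p} in
theorem total_induction {q : ∀ x : (Θ.obj L).X n, x ∈ m.total p L h n → Prop}
    (zero : q 0 (zero_mem _)) (add : ∀ x y hx hy, q x hx → q y hy → q (x + y) (add_mem hx hy))
    (ι : ∀ k a, 𝒮.deg k + a = n → ∀ y (hy : y ∈ m.Fil h k (L.X a)),
      q ((p.ι L k a n).hom y) (m.ι_mem_total p hy))
    {x : (Θ.obj L).X n} (hx : x ∈ m.total p L h n) : q x hx := by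
  suffices h' : ∃ hx, q x hx from h'.2
  have zero' : ∃ hx, q 0 hx := ⟨_, zero⟩
  have add' : ∀ x y, (∃ hx, q x hx) → (∃ hy, q y hy) → ∃ hxy, q (x + y) hxy :=
    fun x y ⟨hx, h1⟩ ⟨hy, h2⟩ => ⟨_, add x y hx hy h1 h2⟩
  refine Submodule.iSup_induction _ (motive := fun x => ∃ hx, q x hx) hx (fun k x hx => ?_) zero' add'
  refine Submodule.iSup_induction _ (motive := fun x => ∃ hx, q x hx) hx (fun a x hx => ?_) zero' add'
  obtain ⟨y, hy, rfl⟩ := hx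
  by_cases hn : 𝒮.deg k + a = n
  · exact ⟨_, ι k a hn y hy⟩
  · rw [p.ι_eq_zero _ _ _ _ hn]
    exact zero'

theorem iSup_le_total (a : ℤ) :
    ⨆ k, (m.Fil h k (L.X a)).map (p.ι L k a n).hom ≤ m.total p L h n :=
  iSup_mono fun k => le_iSup (fun a => (m.Fil h k (L.X a)).map (p.ι L k a n).hom) a

theorem total_mono {h' : ℕ} (hh : h ≤ h') : m.total p L h n ≤ m.total p L h' n := by
  intro x hx
  induction hx using total_induction with
  | zero => exact zero_mem _
  | add x y _ _ hx hy => exact add_mem hx hy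
  | ι k a _ y hy => exact m.ι_mem_total p (m.mono hh _ _ hy)

theorem total_zero : m.total p L 0 n = ⊥ := by
  simp [total, m.Fil_zero]

theorem total_height (x : (Θ.obj L).X n) : x ∈ m.total p L m.height n := by
  have hx : x = (∑ k, p.π L k (n - 𝒮.deg k) n ≫ p.ι L k (n - 𝒮.deg k) n).hom x := by
    rw [p.sum_π_ι]; rfl
  rw [hx, ModuleCat.hom_sum, LinearMap.sum_apply]
  refine sum_mem fun k _ => ?_
  rw [ModuleCat.comp_apply]
  exact m.ι_mem_total p (by rw [m.Fil_height]; trivial)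

/-- By `Fil_succ`, the only thing added between `level` and `level + 1` is the critical cell. -/
theorem exists_eq_add (x : (Θ.obj L).X n) (hx : x ∈ m.total p L (m.level + 1) n) :
    ∃ z, ∃ y ∈ m.total p L m.level n, x = (p.ι L m.crit n n).hom z + y := by
  induction hx using total_induction with
  | zero => exact ⟨0, 0, zero_mem _, by simp⟩
  | add x y _ _ hx hy =>
    obtain ⟨z, y, h1, rfl⟩ := hx
    obtain ⟨z', y', h2, rfl⟩ := hy
    exact ⟨z + z', y + y', add_mem h1 h2, by rw [map_add]; abel⟩
  | ι k a ha y hy =>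
    by_cases hk : k = m.crit
    · subst hk
      obtain rfl : a = n := by have := m.deg_crit; omega
      exact ⟨y, 0, zero_mem _, by rw [add_zero]⟩
    · exact ⟨0, _, m.ι_mem_total p (m.Fil_succ k _ hk hy), by rw [map_zero, zero_add]⟩

theorem π_crit_eq_zero (x : (Θ.obj L).X n) (hx : x ∈ m.total p L m.level n) :
    (p.π L m.crit n n).hom x = 0 := by
  induction hx using total_induction with
  | zero => rw [map_zero]
  | add x y _ _ hx hy => rw [map_add, hx, hy, add_zero]
  | ι k a ha y hy =>
    by_cases hk : k = m.crit
    · subst hk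
      rw [m.Fil_crit] at hy
      rw [(Submodule.mem_bot A).mp hy, map_zero, map_zero]
    · exact ConcreteCategory.congr_hom (p.ι_π_of_ne L k m.crit a n n hk) y

theorem π_ι_crit (z : (𝒮.G m.crit).obj (L.X n)) :
    (p.π L m.crit n n).hom ((p.ι L m.crit n n).hom z) = z :=
  ConcreteCategory.congr_hom (p.ι_π L m.crit n n (by rw [m.deg_crit, zero_add])) z

theorem d_mem_total (x : (Θ.obj L).X n) (hx : x ∈ m.total p L m.level n) :
    ((Θ.obj L).d n (n + 1)).hom x ∈ m.total p L m.level (n + 1) := by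
  induction hx using total_induction with
  | zero => rw [map_zero]; exact zero_mem _
  | add x y _ _ hx hy => rw [map_add]; exact add_mem hx hy
  | ι k a ha y hy =>
    have e := ConcreteCategory.congr_hom (p.ι_d L k a n ha) y
    rw [ModuleCat.comp_apply] at e
    rw [e]
    simp only [ModuleCat.hom_add, ModuleCat.hom_sum, LinearMap.add_apply, LinearMap.sum_apply,
      ModuleCat.hom_zsmul, LinearMap.smul_apply, ModuleCat.hom_comp, LinearMap.comp_apply]
    refine add_mem (sum_mem fun r hr => zsmul_mem (m.ι_mem_total p (m.D_mem k _ r hr y hy)) _)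
      (zsmul_mem (m.ι_mem_total p (m.map_mem k _ y hy)) _)

/-- Modulo the subcomplex at `level`, the differential of the critical cell is the one of L: the
other components fall into `level` by `D_crit_mem`, and no sign appears because the cell has degree
0. -/
theorem d_ι_crit (z : (𝒮.G m.crit).obj (L.X n)) :
    ∃ y ∈ m.total p L m.level (n + 1),
      ((Θ.obj L).d n (n + 1)).hom ((p.ι L m.crit n n).hom z) =
        (p.ι L m.crit (n + 1) (n + 1)).hom (((𝒮.G m.crit).map (L.d n (n + 1))).hom z) + y := by
  have e := ConcreteCategory.congr_hom
    (p.ι_d L m.crit n n (by rw [m.deg_crit, zero_add])) z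
  rw [ModuleCat.comp_apply] at e
  rw [e]
  simp only [ModuleCat.hom_add, ModuleCat.hom_sum, LinearMap.add_apply, LinearMap.sum_apply,
    ModuleCat.hom_zsmul, LinearMap.smul_apply, ModuleCat.hom_comp, LinearMap.comp_apply,
    m.deg_crit, Int.negOnePow_zero, Units.val_one, one_smul]
  rw [add_comm (∑ r ∈ _, _)]
  exact ⟨_, sum_mem fun r hr => zsmul_mem (m.ι_mem_total p (m.D_crit_mem _ r hr z)) _, rfl⟩

/-- The powers of `1 - (dσ + σd)`. -/
noncomputable def flow (L : CochainComplex (ModuleCat.{z} A) ℤ) : ℕ → (Θ.obj L ⟶ Θ.obj L)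
  | 0 => 𝟙 _
  | i + 1 => flow L i ≫ (𝟙 _ - p.nullMap σ L)

variable (σ) in
theorem flow_succ_apply (i : ℕ) (x : (Θ.obj L).X n) :
    ((flow (σ := σ) p L (i + 1)).f n).hom x = ((flow (σ := σ) p L i).f n).hom x -
      ((p.nullMap σ L).f n).hom (((flow (σ := σ) p L i).f n).hom x) := rfl

variable (σ) in
theorem flow_naturality {L' : CochainComplex (ModuleCat.{z} A) ℤ} (φ : L ⟶ L') (i : ℕ) :
    Θ.map φ ≫ flow (σ := σ) p L' i = flow (σ := σ) p L i ≫ Θ.map φ := by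
  induction i with
  | zero => simp [flow]
  | succ i ih =>
    rw [flow, reassoc_of% ih, flow, Category.assoc, Preadditive.comp_sub, Preadditive.sub_comp,
      p.nullMap_naturality, Category.comp_id, Category.id_comp]

variable (σ) in
-- The map dσ + σd is null-homotopic, so each power of 1 - (dσ + σd) is the identity up to homotopy.
theorem quotient_map_flow (i : ℕ) : (HomotopyCategory.quotient _ _).map (flow (σ := σ) p L i) =
    𝟙 ((HomotopyCategory.quotient (ModuleCat.{z} A) (ComplexShape.up ℤ)).obj (Θ.obj L)) := by
  induction i with
  | zero => exact CategoryTheory.Functor.map_id _ _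
  | succ i ih =>
    have h0 : (HomotopyCategory.quotient _ _).map (p.nullMap σ L) = 0 := by
      rw [← Functor.map_zero]
      exact HomotopyCategory.eq_of_homotopy _ _ (Homotopy.nullHomotopy (p.homotopyMap σ L)
        (fun i j hij => p.homotopyMap_eq_zero σ L i j hij))
    rw [flow, Functor.map_comp, ih, Functor.map_sub, h0, sub_zero, CategoryTheory.Functor.map_id,
      Category.id_comp]

theorem sub_nullMap_mem (hh : h ≠ m.level) (x : (Θ.obj L).X n)
    (hx : x ∈ m.total p L (h + 1) n) :
    x - ((p.nullMap σ L).f n).hom x ∈ m.total p L h n := by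
  induction hx using total_induction with
  | zero => rw [map_zero, sub_zero]; exact zero_mem _
  | add x y _ _ hx hy => rw [map_add, add_sub_add_comm]; exact add_mem hx hy
  | ι k a ha y hy =>
    rw [p.nullMap_apply σ L k a n ha]
    exact m.iSup_le_total p a (m.lower h hh k _ y hy _ (fun k => p.ι L k a n))

theorem nullMap_crit_mem (z : (𝒮.G m.crit).obj (L.X n)) :
    ((p.nullMap σ L).f n).hom ((p.ι L m.crit n n).hom z) ∈ m.total p L m.level n := by
  rw [p.nullMap_apply σ L m.crit n n (by rw [m.deg_crit, zero_add])]
  exact m.iSup_le_total p n (m.critical _ z _ (fun k => p.ι L k n n))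

/-- Below the critical level each step gains one level; truncated subtraction expresses that level
0, which is zero, absorbs. -/
theorem flow_mem_of_le (i : ℕ) (hh : h ≤ m.level) (x : (Θ.obj L).X n)
    (hx : x ∈ m.total p L h n) :
    ((flow (σ := σ) p L i).f n).hom x ∈ m.total p L (h - i) n := by
  induction i with
  | zero => exact hx
  | succ i ih =>
    rw [flow_succ_apply]
    rcases Nat.eq_zero_or_pos (h - i) with h0 | h0
    · rw [h0, total_zero, Submodule.mem_bot] at ih
      rw [ih, map_zero, sub_zero]
      exact zero_mem _
    · refine m.sub_nullMap_mem p (by omega) _ ?_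
      rwa [show h - (i + 1) + 1 = h - i by omega]

/-- One level above, the descent may stop, since the critical cell survives: it is moved by
`critical` only inside `level`, so `level + 1` is merely stable. -/
theorem flow_mem_succ (i : ℕ) (x : (Θ.obj L).X n) (hx : x ∈ m.total p L (m.level + 1) n) :
    ((flow (σ := σ) p L i).f n).hom x ∈ m.total p L (m.level + 1) n := by
  induction i with
  | zero => exact hx
  | succ i ih =>
    rw [flow_succ_apply]
    refine sub_mem ih ?_
    obtain ⟨z, y, hy, e⟩ := m.exists_eq_add p _ ih
    rw [e, map_add]
    refine add_mem (m.total_mono p (by omega) (m.nullMap_crit_mem p z)) ?_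
    have h1 := m.flow_mem_of_le p 1 le_rfl y hy
    rw [flow_succ_apply] at h1
    have h2 := sub_mem (m.total_mono p (h' := m.level + 1) (by omega) hy)
      (m.total_mono p (h' := m.level + 1) (by omega) h1)
    convert h2 using 1
    simp [flow]

/-- Above the critical cell each step gains one level until `level + 1` is reached, where the
descent stops. -/
theorem flow_mem (i : ℕ) (x : (Θ.obj L).X n) (hx : x ∈ m.total p L (m.level + 1 + h) n) :
    ((flow (σ := σ) p L i).f n).hom x ∈ m.total p L (m.level + 1 + (h - i)) n := by
  induction i with
  | zero => exact hx
  | succ i ih =>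
    rcases Nat.eq_zero_or_pos (h - i) with h0 | h0
    · rw [h0] at ih
      rw [show h - (i + 1) = 0 by omega]
      have := m.flow_mem_succ p 1 _ ih
      rwa [flow_succ_apply] at this
    · rw [flow_succ_apply]
      refine m.sub_nullMap_mem p (by omega) _ ?_
      rwa [show m.level + 1 + (h - (i + 1)) + 1 = m.level + 1 + (h - i) by omega]

/-- Each step changes an element of the critical cell by an element of `level`, and `level` is
preserved by the flow; so the critical component never changes. -/
theorem flow_crit (i : ℕ) (z : (𝒮.G m.crit).obj (L.X n)) :
    ((flow (σ := σ) p L i).f n).hom ((p.ι L m.crit n n).hom z) - (p.ι L m.crit n n).hom z ∈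
      m.total p L m.level n := by
  induction i with
  | zero =>
    have : ((flow (σ := σ) p L 0).f n).hom ((p.ι L m.crit n n).hom z) =
      (p.ι L m.crit n n).hom z := rfl
    rw [this, sub_self]; exact zero_mem _
  | succ i ih =>
    rw [flow_succ_apply]
    set x := ((flow (σ := σ) p L i).f n).hom ((p.ι L m.crit n n).hom z)
    have h1 := m.flow_mem_of_le p 1 le_rfl _ ih
    rw [flow_succ_apply] at h1
    have h2 := sub_mem (m.total_mono p (by omega) h1) (m.nullMap_crit_mem p z)
    have e : ((flow (σ := σ) p L 0).f n).hom (x - (p.ι L m.crit n n).hom z) =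
      x - (p.ι L m.crit n n).hom z := rfl
    rw [e, map_sub] at h2
    convert h2 using 1
    abel

/-- The stable power of `1 - (dσ + σd)`. -/
noncomputable abbrev stable (L : CochainComplex (ModuleCat.{z} A) ℤ) : Θ.obj L ⟶ Θ.obj L :=
  -- The exponent serves two purposes: `height` steps bring everything into `level + 1`, and `level`
  -- steps annihilate everything in `level`.
  flow (σ := σ) p L (m.height + m.level)

theorem stable_eq_zero (x : (Θ.obj L).X n) (hx : x ∈ m.total p L m.level n) :
    ((m.stable p L).f n).hom x = 0 := by
  have := m.flow_mem_of_le p (m.height + m.level) le_rfl x hx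
  rwa [show m.level - (m.height + m.level) = 0 by omega, total_zero, Submodule.mem_bot] at this

theorem stable_mem (x : (Θ.obj L).X n) :
    ((m.stable p L).f n).hom x ∈ m.total p L (m.level + 1) n := by
  have h1 := m.total_mono p (h' := m.level + 1 + m.height) (by omega) (m.total_height p x)
  have h2 := m.flow_mem p (m.height + m.level) x h1
  rwa [show m.height - (m.height + m.level) = 0 by omega] at h2

theorem comm_apply {K K' : CochainComplex (ModuleCat.{z} A) ℤ} (f : K ⟶ K') (i j : ℤ) (x : K.X i) :
    (K'.d i j).hom ((f.f i).hom x) = (f.f j).hom ((K.d i j).hom x) :=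
  ConcreteCategory.congr_hom (f.comm i j) x

/-- The map from a complex of coefficients to the total complex. -/
noncomputable def toTotal (L : CochainComplex (ModuleCat.{z} A) ℤ) : L ⟶ Θ.obj L where
  f n := m.iso.hom.app (L.X n) ≫ p.ι L m.crit n n ≫ (m.stable p L).f n
  comm' := by
    rintro n _ rfl
    ext z
    simp only [ModuleCat.hom_comp, LinearMap.comp_apply]
    rw [comm_apply]
    -- The part of the differential which leaves the critical cell lies in `level`, hence is
    -- annihilated by `stable`.
    obtain ⟨y, hy, e⟩ := m.d_ι_crit p ((m.iso.hom.app (L.X n)).hom z)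
    rw [e, map_add, m.stable_eq_zero p y hy, add_zero]
    have := ConcreteCategory.congr_hom (m.iso.hom.naturality (L.d n (n + 1))) z
    simp only [ModuleCat.comp_apply] at this
    rw [← this]
    rfl

/-- The map from the total complex to the complex of coefficients. -/
noncomputable def ofTotal (L : CochainComplex (ModuleCat.{z} A) ℤ) : Θ.obj L ⟶ L where
  f n := (m.stable p L).f n ≫ p.π L m.crit n n ≫ m.iso.inv.app (L.X n)
  comm' := by
    rintro n _ rfl
    ext x
    simp only [ModuleCat.hom_comp, LinearMap.comp_apply]
    rw [← comm_apply]
    obtain ⟨z, y, hy, e⟩ := m.exists_eq_add p _ (m.stable_mem p x)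
    have h1 : (p.π L m.crit n n).hom ((p.ι L m.crit n n).hom z + y) = z := by
      rw [map_add, m.π_crit_eq_zero p y hy, add_zero, m.π_ι_crit]
    rw [e, h1, map_add, map_add, m.π_crit_eq_zero p _ (m.d_mem_total p y hy), add_zero]
    obtain ⟨y', hy', e'⟩ := m.d_ι_crit p z
    rw [e', map_add, m.π_crit_eq_zero p _ hy', add_zero, m.π_ι_crit]
    have := ConcreteCategory.congr_hom (m.iso.inv.naturality (L.d n (n + 1))) z
    simp only [ModuleCat.comp_apply] at this
    rw [this]
    rfl

/-- Applied to an element of the critical cell, `stable` adds a term of `level`, which it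
annihilates when applied again and which is invisible to the projection. The composite is therefore
the identity on the nose. -/
theorem toTotal_ofTotal (L : CochainComplex (ModuleCat.{z} A) ℤ) :
    m.toTotal p L ≫ m.ofTotal p L = 𝟙 L := by
  ext n z
  change (m.iso.inv.app (L.X n)).hom ((p.π L m.crit n n).hom (((m.stable p L).f n).hom
    (((m.stable p L).f n).hom ((p.ι L m.crit n n).hom ((m.iso.hom.app (L.X n)).hom z))))) = z
  set z' := (m.iso.hom.app (L.X n)).hom z
  have h1 := m.flow_crit p (m.height + m.level) z'
  have h2 := m.stable_eq_zero p _ h1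
  rw [map_sub, sub_eq_zero] at h2
  rw [h2]
  have h3 := m.π_crit_eq_zero p _ h1
  rw [map_sub, sub_eq_zero, m.π_ι_crit] at h3
  rw [h3]
  exact ConcreteCategory.congr_hom (m.iso.hom_inv_id_app (L.X n)) z

/-- The value of `stable` is a critical component plus a term of `level`. Keeping the critical
component and applying `stable` again gives the square of `stable`, which is homotopic to the
identity. -/
theorem ofTotal_toTotal (L : CochainComplex (ModuleCat.{z} A) ℤ) :
    m.ofTotal p L ≫ m.toTotal p L = m.stable p L ≫ m.stable p L := by
  ext n x
  change ((m.stable p L).f n).hom ((p.ι L m.crit n n).hom ((m.iso.hom.app (L.X n)).hom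
    ((m.iso.inv.app (L.X n)).hom ((p.π L m.crit n n).hom (((m.stable p L).f n).hom x))))) =
      ((m.stable p L).f n).hom (((m.stable p L).f n).hom x)
  obtain ⟨z, y, hy, e⟩ := m.exists_eq_add p _ (m.stable_mem p x)
  have h1 : (p.π L m.crit n n).hom ((p.ι L m.crit n n).hom z + y) = z := by
    rw [map_add, m.π_crit_eq_zero p y hy, add_zero, m.π_ι_crit]
  rw [e, h1, map_add, m.stable_eq_zero p y hy, add_zero]
  exact congrArg (fun x => ((m.stable p L).f n).hom ((p.ι L m.crit n n).hom x))
    (ConcreteCategory.congr_hom (m.iso.inv_hom_id_app (L.X n)) z)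

theorem toTotal_naturality {L' : CochainComplex (ModuleCat.{z} A) ℤ} (φ : L ⟶ L') :
    φ ≫ m.toTotal p L' = m.toTotal p L ≫ Θ.map φ := by
  ext n : 1
  have h := congrArg (fun f => f.f n) (flow_naturality σ p φ (m.height + m.level))
  simp only [HomologicalComplex.comp_f] at h
  simp only [HomologicalComplex.comp_f, toTotal, Category.assoc]
  rw [← h, reassoc_of% p.ι_map]
  exact m.iso.hom.naturality_assoc (φ.f n) _

/-- Up to homotopy, the total complex is isomorphic to the complex of coefficients. -/
noncomputable def quotientIso :
    HomotopyCategory.quotient (ModuleCat.{z} A) (ComplexShape.up ℤ) ≅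
      Θ ⋙ HomotopyCategory.quotient _ _ :=
  NatIso.ofComponents (fun L =>
    { hom := (HomotopyCategory.quotient _ _).map (m.toTotal p L)
      inv := (HomotopyCategory.quotient _ _).map (m.ofTotal p L)
      hom_inv_id := by rw [← Functor.map_comp, toTotal_ofTotal, CategoryTheory.Functor.map_id]
      inv_hom_id := by
        rw [← Functor.map_comp, ofTotal_toTotal, Functor.map_comp, quotient_map_flow,
          Category.id_comp]; rfl })
    (fun φ => by
      rw [← Functor.map_comp, toTotal_naturality, Functor.map_comp]; rfl)

end MorseFiltration

end Morse

end Hecke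

namespace Hecke

set_option linter.unusedSectionVars false

/-! ### Axioms for the two double complexes, and the height function -/

section BiSystem

open CategoryTheory

variable {B W : Type v} [Group W] {M : CoxeterMatrix B}

open Classical in
/-- A choice of a moving descent of `v`, for `v ∉ W_Q`. -/
noncomputable def descent [Finite W] (cs : CoxeterSystem M W) (Q : Set B) (v : W) : Option B :=
  if h : v ∉ parabolicSubgroup cs Q then some (exists_isMovingDescent h).choose else none

theorem descent_eq_none [Finite W] {cs : CoxeterSystem M W} {Q : Set B} {v : W}
    (h : v ∈ parabolicSubgroup cs Q) : descent cs Q v = none := by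
  rw [descent, dif_neg (not_not.mpr h)]

theorem exists_descent_eq [Finite W] {cs : CoxeterSystem M W} {Q : Set B} {v : W}
    (h : v ∉ parabolicSubgroup cs Q) : ∃ s, descent cs Q v = some s :=
  ⟨_, dif_pos h⟩

theorem isMovingDescent_of_descent [Finite W] {cs : CoxeterSystem M W} {Q : Set B} {v : W} {s : B}
    (h : descent cs Q v = some s) :
    v ∉ parabolicSubgroup cs Q ∧ IsMovingDescent cs Q v s := by
  by_cases hv : v ∈ parabolicSubgroup cs Q
  · rw [descent_eq_none hv] at h
    cases h
  · refine ⟨hv, ?_⟩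
    rw [descent, dif_pos hv, Option.some_inj] at h
    rw [← h]
    exact (exists_isMovingDescent hv).choose_spec

open Classical in
/-- A choice of an element which does not belong to a finite set. -/
noncomputable def fresh (P : Finset B) : Option B :=
  if h : ∃ t, t ∉ P then some h.choose else none

theorem notMem_of_fresh {P : Finset B} {t : B} (h : fresh P = some t) : t ∉ P := by
  by_cases hP : ∃ t, t ∉ P
  · rw [fresh, dif_pos hP, Option.some_inj] at h
    rw [← h]
    exact hP.choose_spec
  · rw [fresh, dif_neg hP] at h
    cases h

theorem exists_fresh_eq [Fintype B] {P : Finset B} (h : P ≠ Finset.univ) : ∃ t, fresh P = some t := by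
  have : ∃ t, t ∉ P := by
    by_contra! h'
    exact h (Finset.eq_univ_of_forall h')
  exact ⟨_, dif_pos this⟩

variable [DecidableEq B]

/-- The target of a component of the differential of a double complex. -/
def insertLabel (k : Finset B × Finset B) : B ⊕ B → Finset B × Finset B :=
  Sum.elim (fun s => (insert s k.1, k.2)) (fun t => (k.1, insert t k.2))

/-- The target of a component of the contraction of a double complex. -/
def eraseLabel (k : Finset B × Finset B) : B ⊕ B → Finset B × Finset B :=
  Sum.elim (fun s => (k.1.erase s, k.2)) (fun t => (k.1, k.2.erase t))

theorem insertLabel_eraseLabel {k : Finset B × Finset B} {r : B ⊕ B}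
    (h : r ∈ k.1.disjSum k.2) : insertLabel (eraseLabel k r) r = k := by
  rcases r with s | t
  · simp only [insertLabel, eraseLabel, Sum.elim_inl]
    rw [Finset.insert_erase (Finset.inl_mem_disjSum.mp h)]
  · simp only [insertLabel, eraseLabel, Sum.elim_inr]
    rw [Finset.insert_erase (Finset.inr_mem_disjSum.mp h)]

theorem eraseLabel_insertLabel [Fintype B] {k : Finset B × Finset B} {r : B ⊕ B}
    (h : r ∈ k.1ᶜ.disjSum k.2ᶜ) : eraseLabel (insertLabel k r) r = k := by
  rcases r with s | t
  · simp only [insertLabel, eraseLabel, Sum.elim_inl]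
    rw [Finset.erase_insert (by simpa using h)]
  · simp only [insertLabel, eraseLabel, Sum.elim_inr]
    rw [Finset.erase_insert (by simpa using h)]

/-- Double complexes, with cells indexed by the pairs `(I, J)` of sets of simple reflections,
which look like `H ⊗_{H_I} H ⊗_{H_Q} -`, with `Q` the complement of `J`. -/
structure BiSystem [Fintype B] [Finite W] (cs : CoxeterSystem M W) (A : Type u) [Ring A] where
  /-- the signs -/
  sgn : Finset B × Finset B → B ⊕ B → ℤ
  sgn_mul_self : ∀ k r, sgn k r * sgn k r = 1
  /-- the functors attached to the cells -/
  G : Finset B × Finset B → ModuleCat.{z} A ⥤ ModuleCat.{z} A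
  additive : ∀ k, (G k).Additive
  /-- the components of the differential -/
  D : ∀ k r, G k ⟶ G (insertLabel k r)
  /-- the generators of the cells -/
  gen : ∀ k (N : ModuleCat.{z} A), W → N → (G k).obj N
  map_gen : ∀ k {N N' : ModuleCat.{z} A} (φ : N ⟶ N') w n,
    ((G k).map φ).hom (gen k N w n) = gen k N' w (φ.hom n)
  span_gen : ∀ k N, Submodule.span A {y | ∃ w n, y = gen k N w n} = ⊤
  -- This models the possibility of moving h_w, for w ∈ W_Q, out of the middle factor, into n in one
  -- double complex and to the front in the other. Only w = 1 is then needed.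
  gen_mem : ∀ k N w n, (k.1 : Set B) ⊆ (↑k.2)ᶜ → w ∈ parabolicSubgroup cs (↑k.2)ᶜ →
    gen k N w n ∈ Submodule.span A {y | ∃ n', y = gen k N 1 n'}
  D_inl : ∀ k N w n, ∀ s ∉ k.1,
    ((D k (.inl s)).app N).hom (gen k N w n) = gen (insertLabel k (.inl s)) N w n
  -- The Casimir element involves elements of H_Q only, so the coset w W_Q is preserved.
  D_inr_mem : ∀ k N w n, ∀ t ∉ k.2, ((D k (.inr t)).app N).hom (gen k N w n) ∈
    Submodule.span A {y | ∃ x ∈ parabolicSubgroup cs (↑k.2)ᶜ, ∃ n',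
      y = gen (insertLabel k (.inr t)) N (w * x) n'}
  -- In the Casimir sum the term m = 1 gives the generator itself, and the other terms come from m ∈
  -- W_Q outside the smaller parabolic subgroup.
  D_inr_one_sub_mem : ∀ k N n, ∀ t ∉ k.2,
    ((D k (.inr t)).app N).hom (gen k N 1 n) - gen (insertLabel k (.inr t)) N 1 n ∈
      Submodule.span A {y | ∃ w m, w ∈ parabolicSubgroup cs (↑k.2)ᶜ ∧
        w ∉ parabolicSubgroup cs (↑(insertLabel k (.inr t)).2)ᶜ ∧
          y = gen (insertLabel k (.inr t)) N w m}
  /-- the components of the contraction -/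
  S : ∀ k r, G k ⟶ G (eraseLabel k r)
  -- The contraction along s only sees the double cosets whose chosen moving descent is s. On these,
  -- `D_S_inl` and `S_inl_insert` say that it is inverse to the component of the differential along
  -- s.
  S_inl_eq_zero : ∀ k N w n, ∀ s ∈ k.1, descent cs (↑k.2)ᶜ (top cs k.1 (↑k.2)ᶜ w) ≠ some s →
    ((S k (.inl s)).app N).hom (gen k N w n) = 0
  S_inl_mem : ∀ k N w n, ∀ s ∈ k.1, descent cs (↑k.2)ᶜ (top cs k.1 (↑k.2)ᶜ w) = some s →
    ((S k (.inl s)).app N).hom (gen k N w n) ∈ Submodule.span A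
      {y | ∃ w' n', top cs ↑(k.1.erase s) (↑k.2)ᶜ w' = top cs k.1 (↑k.2)ᶜ w ∧
        y = gen (eraseLabel k (.inl s)) N w' n'}
  D_S_inl : ∀ k N w n, ∀ s ∈ k.1, descent cs (↑k.2)ᶜ (top cs k.1 (↑k.2)ᶜ w) = some s →
    ((D (eraseLabel k (.inl s)) (.inl s)).app N).hom (((S k (.inl s)).app N).hom (gen k N w n)) =
      gen (insertLabel (eraseLabel k (.inl s)) (.inl s)) N w n
  S_inl_insert : ∀ k N w n, ∀ s ∉ k.1,
    descent cs (↑k.2)ᶜ (top cs k.1 (↑k.2)ᶜ w) = some s →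
    ((S (insertLabel k (.inl s)) (.inl s)).app N).hom (gen (insertLabel k (.inl s)) N w n) =
      gen (eraseLabel (insertLabel k (.inl s)) (.inl s)) N w n
  -- The contraction along t only sees the generators whose top lies in W_Q, which by `top_mem_iff`
  -- means I ⊆ Q and w ∈ W_Q, and uses the chosen t ∉ I.
  S_inr_of_mem : ∀ k N w n, ∀ t ∈ k.2, fresh k.1 = some t → (k.1 : Set B) ⊆ (↑k.2)ᶜ →
    w ∈ parabolicSubgroup cs (↑k.2)ᶜ →
    ((S k (.inr t)).app N).hom (gen k N w n) = gen (eraseLabel k (.inr t)) N w n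
  S_inr_eq_zero : ∀ k N w n, ∀ t ∈ k.2, ¬ (fresh k.1 = some t ∧ (k.1 : Set B) ⊆ (↑k.2)ᶜ ∧
    w ∈ parabolicSubgroup cs (↑k.2)ᶜ) → ((S k (.inr t)).app N).hom (gen k N w n) = 0
  /-- the cell `(S, ∅)` is the identity functor -/
  iso : 𝟭 _ ≅ G (Finset.univ, ∅)

namespace BiSystem

variable [Fintype B] [Finite W] {cs : CoxeterSystem M W} {A : Type u} [Ring A]
  (b : BiSystem.{u, v, z} cs A)

theorem span_map_mem {X Y : Type*} [AddCommGroup X] [AddCommGroup Y] [Module A X] [Module A Y]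
    (f : X →ₗ[A] Y) {s : Set X} {p : Submodule A Y} (h : ∀ x ∈ s, f x ∈ p) {x : X}
    (hx : x ∈ Submodule.span A s) : f x ∈ p :=
  (Submodule.span_le (p := p.comap f)).mpr h hx

/-- The system of cells. -/
def cells : CellSystem.{u, v, v, z} A (Finset B × Finset B) (B ⊕ B) where
  -- The inverse complex is shifted by |S|, so that the cell (S, ∅) has degree 0.
  deg k := (k.1.card : ℤ) + ((k.2.card : ℤ) - Fintype.card B)
  act k := k.1ᶜ.disjSum k.2ᶜ
  tgt k r := insertLabel k r
  sgn := b.sgn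
  G := b.G
  additive := b.additive
  D := b.D
  deg_tgt k r hr := by
    rcases r with s | t
    · simp only [insertLabel, Sum.elim_inl]
      rw [Finset.card_insert_of_notMem (by simpa using hr)]
      push_cast; ring
    · simp only [insertLabel, Sum.elim_inr]
      rw [Finset.card_insert_of_notMem (by simpa using hr)]
      push_cast; ring

/-- The contraction. -/
def contraction : Contraction b.cells (B ⊕ B) where
  act k := k.1.disjSum k.2
  tgt := eraseLabel
  -- The sign is that of the matched component of the differential, so the product of the two signs
  -- is 1.
  S k i := b.sgn (eraseLabel k i) i • b.S k i
  deg_tgt k i hi := by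
    rcases i with s | t
    · simp only [cells, eraseLabel, Sum.elim_inl]
      rw [Finset.card_erase_of_mem (by simpa using hi), Nat.cast_sub
        (Finset.card_pos.mpr ⟨s, by simpa using hi⟩)]
      push_cast; ring
    · simp only [cells, eraseLabel, Sum.elim_inr]
      rw [Finset.card_erase_of_mem (by simpa using hi), Nat.cast_sub
        (Finset.card_pos.mpr ⟨t, by simpa using hi⟩)]
      push_cast; ring

section Height

variable (cs) in
/-- The greatest length of an element of `W`. -/
noncomputable def maxLength : ℕ :=
  letI := Fintype.ofFinite W
  Finset.univ.sup cs.length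

theorem length_le_maxLength (w : W) : cs.length w ≤ maxLength cs :=
  letI := Fintype.ofFinite W
  Finset.le_sup (f := cs.length) (Finset.mem_univ w)

variable (cs) in
/-- The base used in the definition of heights. -/
noncomputable def heightBase : ℕ := maxLength cs + Fintype.card B + 1

variable (cs) in
/-- The height of the critical cell. -/
noncomputable def critHeight : ℕ := (Fintype.card B + 1) * heightBase cs * heightBase cs

variable (cs) in
open Classical in
/-- The height of the generators attached to a cell and an element of `W`. -/
noncomputable def height (k : Finset B × Finset B) (w : W) : ℕ :=
  -- Generators with top v ∉ W_Q lie below the critical cell, ordered lexicographically by |Q|, then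
  -- by the defect of l(v) from the maximal length, then by the number of labels not counted in {s ∈
  -- I : s is not the chosen descent}. Those with v ∈ W_Q and I ≠ S lie above it, ordered by |S \
  -- I|, then by the number of elements of Q other than the chosen t. Neither third nor last entry
  -- sees the label along which the generator is matched.
  if top cs k.1 (↑k.2)ᶜ w ∈ parabolicSubgroup cs (↑k.2)ᶜ then
    if k.1 = Finset.univ then critHeight cs else
      critHeight cs + 1 + ((Fintype.card B - k.1.card) * (Fintype.card B + 1) +
        (k.2ᶜ.filter fun t => fresh k.1 ≠ some t).card)
  else (k.2ᶜ.card * heightBase cs + (maxLength cs - cs.length (top cs k.1 (↑k.2)ᶜ w))) *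
    heightBase cs + (Fintype.card B -
      (k.1.filter fun s => descent cs (↑k.2)ᶜ (top cs k.1 (↑k.2)ᶜ w) ≠ some s).card)

/-- Heights are lexicographic triples written as numbers in base x; a smaller leading entry wins as
soon as the last entry is below the base. -/
theorem lex_lt {a c a' c' x : ℕ} (h : a < a') (hc : c < x) : a * x + c < a' * x + c' := by
  have : (a + 1) * x ≤ a' * x := Nat.mul_le_mul_right x h
  rw [add_mul] at this
  omega

variable {k k' : Finset B × Finset B} {w w' : W}

theorem height_of_notMem (h : top cs k.1 (↑k.2)ᶜ w ∉ parabolicSubgroup cs (↑k.2)ᶜ) :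
    height cs k w =
      (k.2ᶜ.card * heightBase cs + (maxLength cs - cs.length (top cs k.1 (↑k.2)ᶜ w))) *
        heightBase cs + (Fintype.card B -
      (k.1.filter fun s => descent cs (↑k.2)ᶜ (top cs k.1 (↑k.2)ᶜ w) ≠ some s).card) := by
  classical
  rw [height, if_neg h]

theorem height_of_mem (h : top cs k.1 (↑k.2)ᶜ w ∈ parabolicSubgroup cs (↑k.2)ᶜ)
    (h' : k.1 ≠ Finset.univ) :
    height cs k w = critHeight cs + 1 + ((Fintype.card B - k.1.card) * (Fintype.card B + 1) +
        (k.2ᶜ.filter fun t => fresh k.1 ≠ some t).card) := by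
  classical
  rw [height, if_pos h, if_neg h']

theorem height_lt_critHeight (h : top cs k.1 (↑k.2)ᶜ w ∉ parabolicSubgroup cs (↑k.2)ᶜ) :
    height cs k w < critHeight cs := by
  rw [height_of_notMem h, critHeight]
  have h1 := Finset.card_le_univ k.2ᶜ
  have h2 : k.2ᶜ.card * heightBase cs + (maxLength cs - cs.length (top cs k.1 (↑k.2)ᶜ w)) <
      (Fintype.card B + 1) * heightBase cs + 0 := lex_lt (by omega) (by rw [heightBase]; omega)
  exact lex_lt (c' := 0) h2 (by rw [heightBase]; omega)

theorem height_lt_iff : height cs k w < critHeight cs ↔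
    top cs k.1 (↑k.2)ᶜ w ∉ parabolicSubgroup cs (↑k.2)ᶜ := by
  refine ⟨fun h h' => ?_, height_lt_critHeight⟩
  by_cases hk : k.1 = Finset.univ
  · rw [height, if_pos h', if_pos hk] at h
    omega
  · rw [height_of_mem h' hk] at h
    omega

theorem height_of_eq_univ (hk : k.1 = Finset.univ)
    (h : top cs k.1 (↑k.2)ᶜ w ∈ parabolicSubgroup cs (↑k.2)ᶜ) :
    height cs k w = critHeight cs := by
  rw [height, if_pos h, if_pos hk]

/-- A bound for the heights. -/
theorem height_lt (k : Finset B × Finset B) (w : W) : height cs k w <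
    critHeight cs + 1 + (Fintype.card B + 1) * (Fintype.card B + 1) := by
  by_cases h : top cs k.1 (↑k.2)ᶜ w ∈ parabolicSubgroup cs (↑k.2)ᶜ
  · by_cases hk : k.1 = Finset.univ
    · rw [height_of_eq_univ hk h]
      have : 0 < (Fintype.card B + 1) * (Fintype.card B + 1) := by positivity
      omega
    · rw [height_of_mem h hk]
      have h1 : (k.2ᶜ.filter fun t => fresh k.1 ≠ some t).card ≤ Fintype.card B :=
        Finset.card_le_univ _
      have h2 := lex_lt (a := Fintype.card B - k.1.card) (a' := Fintype.card B + 1)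
        (c := (k.2ᶜ.filter fun t => fresh k.1 ≠ some t).card) (c' := 0) (x := Fintype.card B + 1)
        (by omega) (by omega)
      omega
  · have := height_lt_critHeight h
    omega

theorem height_lt_of_card_lt (h : top cs k.1 (↑k.2)ᶜ w ∉ parabolicSubgroup cs (↑k.2)ᶜ)
    (h' : top cs k'.1 (↑k'.2)ᶜ w' ∉ parabolicSubgroup cs (↑k'.2)ᶜ)
    (hc : k'.2ᶜ.card < k.2ᶜ.card) : height cs k' w' < height cs k w := by
  rw [height_of_notMem h, height_of_notMem h']
  exact lex_lt (lex_lt hc (by rw [heightBase]; omega)) (by rw [heightBase]; omega)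

/-- A top inside W_Q would force I ∪ {r} ⊆ Q by `top_mem_iff`, hence I ⊆ Q. -/
theorem top_insert_notMem {r : B} (h : top cs k.1 (↑k.2)ᶜ w ∉ parabolicSubgroup cs (↑k.2)ᶜ) :
    top cs ↑(insert r k.1) (↑k.2)ᶜ w ∉ parabolicSubgroup cs (↑k.2)ᶜ := by
  rw [top_mem_iff] at h ⊢
  exact fun h' => h ⟨(Finset.coe_subset.mpr (Finset.subset_insert r k.1)).trans h'.1, h'.2⟩

/-- Adding r to I either makes the top longer, or leaves it unchanged. In the second case the chosen
descent is the same, and r is a new label different from it, so the last entry decreases. -/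
theorem height_insert_lt {r : B} (hr : r ∉ k.1)
    (h : top cs k.1 (↑k.2)ᶜ w ∉ parabolicSubgroup cs (↑k.2)ᶜ)
    (hd : descent cs (↑k.2)ᶜ (top cs k.1 (↑k.2)ᶜ w) ≠ some r) :
    height cs (insert r k.1, k.2) w < height cs k w := by
  have h' := top_insert_notMem (r := r) h
  have hsub := Finset.coe_subset.mpr (Finset.subset_insert r k.1)
  have hl : cs.length (top cs k.1 (↑k.2)ᶜ w) ≤ cs.length (top cs ↑(insert r k.1) (↑k.2)ᶜ w) :=
    length_top_mono hsub subset_rfl (.refl w)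
  rw [height_of_notMem h, height_of_notMem h']
  rcases hl.lt_or_eq with hl | hl
  · have hm := length_le_maxLength (cs := cs) (top cs ↑(insert r k.1) (↑k.2)ᶜ w)
    refine lex_lt ?_ (by rw [heightBase]; omega)
    simp only
    omega
  · have e := top_eq_top_of_length (cs := cs) (Q := (↑k.2)ᶜ) (Q' := (↑k.2)ᶜ) hsub
      subset_rfl (SameDoubleCoset.refl w) hl.symm.le
    simp only [e]
    refine Nat.add_lt_add_left ?_ _
    rw [Finset.filter_insert, if_pos hd, Finset.card_insert_of_notMem
      (fun hr' => hr (Finset.mem_of_mem_filter r hr'))]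
    have : (insert r (k.1.filter fun s =>
      descent cs (↑k.2)ᶜ (top cs k.1 (↑k.2)ᶜ w) ≠ some s)).card ≤ Fintype.card B :=
        Finset.card_le_univ _
    rw [Finset.card_insert_of_notMem
      (fun hr' => hr (Finset.mem_of_mem_filter r hr'))] at this
    omega

/-- The chosen descent s is excluded from the count of labels in I, so removing it changes none of
the entries. -/
theorem height_eq_of_erase {s : B} (hs : descent cs (↑k.2)ᶜ (top cs k.1 (↑k.2)ᶜ w) = some s)
    (hw : top cs ↑(k.1.erase s) (↑k.2)ᶜ w' = top cs k.1 (↑k.2)ᶜ w) :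
    height cs (k.1.erase s, k.2) w' = height cs k w := by
  have h := (isMovingDescent_of_descent hs).1
  rw [height_of_notMem h, height_of_notMem (by simp only; rwa [hw])]
  simp only [hw]
  congr 3
  ext x
  simp only [Finset.mem_filter, Finset.mem_erase]
  constructor
  · exact fun hx => ⟨hx.1.2, hx.2⟩
  · exact fun hx => ⟨⟨fun e => hx.2 (e ▸ hs), hx.1⟩, hx.2⟩

end Height

end BiSystem

end BiSystem

end Hecke

namespace Hecke

set_option linter.unusedSectionVars false

/-! ### Differential and contraction against the height filtration -/

section BiSystem

open CategoryTheory

variable {B W : Type v} [Group W] {M : CoxeterMatrix B} [DecidableEq B]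

namespace BiSystem

variable [Fintype B] [Finite W] {cs : CoxeterSystem M W} {A : Type u} [Ring A]
  (b : BiSystem.{u, v, z} cs A)

section Moves

variable {k k' : Finset B × Finset B} {w w' : W}

variable (cs) in
/-- The generators attached to `k` and `w` are matched along the label `m`. -/
def Moves (k : Finset B × Finset B) (w : W) (m : B ⊕ B) : Prop :=
  Sum.elim (fun s => descent cs (↑k.2)ᶜ (top cs k.1 (↑k.2)ᶜ w) = some s)
    (fun t => w = 1 ∧ (k.1 : Set B) ⊆ (↑k.2)ᶜ ∧ fresh k.1 = some t) m

theorem top_one_mem (h : (k.1 : Set B) ⊆ (↑k.2)ᶜ) :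
    top cs k.1 (↑k.2)ᶜ 1 ∈ parabolicSubgroup cs (↑k.2)ᶜ :=
  top_mem_iff.mpr ⟨h, one_mem _⟩

theorem ne_univ_of_fresh {P : Finset B} {t : B} (h : fresh P = some t) : P ≠ Finset.univ :=
  fun h' => notMem_of_fresh h (h' ▸ Finset.mem_univ t)

variable (cs) in
theorem height_inr (h : (k.1 : Set B) ⊆ (↑k.2)ᶜ) {t : B} (ht : fresh k.1 = some t) :
    height cs k 1 = critHeight cs + 1 + ((Fintype.card B - k.1.card) * (Fintype.card B + 1) +
        (k.2ᶜ.filter fun t => fresh k.1 ≠ some t).card) :=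
  height_of_mem (top_one_mem h) (ne_univ_of_fresh ht)

theorem compl_insert_subset (t : B) (J : Finset B) : ((↑(insert t J) : Set B))ᶜ ⊆ (↑J)ᶜ :=
  Set.compl_subset_compl.mpr (Finset.coe_subset.mpr (Finset.subset_insert t J))

theorem insertLabel_notMem {r : B ⊕ B} {x : W} (hr : r ∈ k.1ᶜ.disjSum k.2ᶜ)
    (hx : x ∈ parabolicSubgroup cs (↑k.2)ᶜ)
    (h : top cs k.1 (↑k.2)ᶜ w ∉ parabolicSubgroup cs (↑k.2)ᶜ) :
    top cs (insertLabel k r).1 (↑(insertLabel k r).2)ᶜ (w * x) ∉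
      parabolicSubgroup cs (↑(insertLabel k r).2)ᶜ := by
  rw [top_mem_iff] at h ⊢
  rintro ⟨h1, h2⟩
  rcases r with s | t
  · exact h ⟨(Finset.coe_subset.mpr (Finset.subset_insert s k.1)).trans h1,
      (Subgroup.mul_mem_cancel_right _ hx).mp h2⟩
  · exact h ⟨h1.trans (compl_insert_subset t k.2), (Subgroup.mul_mem_cancel_right _ hx).mp
      (parabolicSubgroup_mono cs (compl_insert_subset t k.2) h2)⟩

theorem card_insert_compl_lt {t : B} {J : Finset B} (ht : t ∉ J) :
    (insert t J)ᶜ.card < Jᶜ.card := by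
  refine Finset.card_lt_card ?_
  rw [Finset.compl_insert]
  exact Finset.erase_ssubset (by simpa using ht)

/-- Enlarging I decreases |S \ I|, the leading entry above the critical cell; if I becomes S, or if
I leaves Q, the height falls to the critical one or below. -/
theorem height_inr_inl_lt (h : (k.1 : Set B) ⊆ (↑k.2)ᶜ) {t : B} (ht : fresh k.1 = some t)
    {s : B} (hs : s ∉ k.1) : height cs (insert s k.1, k.2) 1 < height cs k 1 := by
  rw [height_inr cs h ht]
  by_cases h1 : top cs ↑(insert s k.1) (↑k.2)ᶜ 1 ∈ parabolicSubgroup cs (↑k.2)ᶜ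
  · by_cases h2 : insert s k.1 = Finset.univ
    · rw [height_of_eq_univ h2 h1]; omega
    · rw [height_of_mem h1 h2]
      refine Nat.add_lt_add_left (lex_lt ?_ ?_) _
      · have := Finset.card_le_univ (insert s k.1)
        simp only
        rw [Finset.card_insert_of_notMem hs] at this ⊢
        omega
      · exact Nat.lt_succ_of_le (Finset.card_le_univ _)
  · have := height_lt_critHeight (k := (insert s k.1, k.2)) h1
    omega

/-- Removing t' from Q either removes an element different from the chosen t from the count, or
takes the top out of the parabolic subgroup, which drops below the critical height. -/
theorem height_inr_inr_lt (h : (k.1 : Set B) ⊆ (↑k.2)ᶜ) {t : B} (ht : fresh k.1 = some t)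
    {t' : B} (ht' : t' ∉ k.2) (hne : t' ≠ t) :
    height cs (k.1, insert t' k.2) 1 < height cs k 1 := by
  rw [height_inr cs h ht]
  by_cases h1 : top cs ↑k.1 (↑(insert t' k.2))ᶜ 1 ∈ parabolicSubgroup cs (↑(insert t' k.2))ᶜ
  · rw [height_of_mem (k := (k.1, insert t' k.2)) h1 (ne_univ_of_fresh ht)]
    have : ((insert t' k.2)ᶜ.filter fun t => fresh k.1 ≠ some t).card <
        (k.2ᶜ.filter fun t => fresh k.1 ≠ some t).card := by
      refine Finset.card_lt_card ?_
      rw [Finset.compl_insert, Finset.filter_erase]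
      refine Finset.erase_ssubset ?_
      rw [Finset.mem_filter, ht]
      exact ⟨by simpa using ht', by simpa using hne.symm⟩
    dsimp only
    omega
  · have := height_lt_critHeight (k := (k.1, insert t' k.2)) h1
    omega

/-- The chosen t is not counted in the height, and t ∉ I, so I stays inside Q when t leaves Q. -/
theorem height_inr_insert (h : (k.1 : Set B) ⊆ (↑k.2)ᶜ) {t : B} (ht : fresh k.1 = some t) :
    (k.1 : Set B) ⊆ (↑(insert t k.2))ᶜ ∧
      height cs (k.1, insert t k.2) 1 = height cs k 1 := by
  have h' : (k.1 : Set B) ⊆ (↑(insert t k.2))ᶜ := by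
    intro x hx
    have := h hx
    rw [Finset.coe_insert, Set.mem_compl_iff, Set.mem_insert_iff]
    rintro (rfl | h2)
    · exact notMem_of_fresh ht hx
    · exact this h2
  refine ⟨h', ?_⟩
  rw [height_inr cs h ht, height_inr (k := (k.1, insert t k.2)) cs h' ht]
  congr 3
  ext x
  simp only [Finset.mem_filter, Finset.mem_compl, Finset.mem_insert, ht, ne_eq, Option.some_inj]
  constructor
  · exact fun hx => ⟨fun h2 => hx.1 (.inr h2), hx.2⟩
  · exact fun hx => ⟨fun h2 => h2.elim (fun h3 => hx.2 h3.symm) hx.1, hx.2⟩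

theorem height_inr_erase (h : (k.1 : Set B) ⊆ (↑k.2)ᶜ) {t : B} (ht : fresh k.1 = some t) :
    (k.1 : Set B) ⊆ (↑(k.2.erase t))ᶜ ∧
      height cs (k.1, k.2.erase t) 1 = height cs k 1 := by
  have h' : (k.1 : Set B) ⊆ (↑(k.2.erase t))ᶜ :=
    h.trans (Set.compl_subset_compl.mpr (Finset.coe_subset.mpr (Finset.erase_subset t k.2)))
  refine ⟨h', ?_⟩
  rw [height_inr cs h ht, height_inr (k := (k.1, k.2.erase t)) cs h' ht]
  congr 3
  ext x
  simp only [Finset.mem_filter, Finset.mem_compl, Finset.mem_erase, ht, ne_eq, Option.some_inj]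
  constructor
  · exact fun hx => ⟨fun h2 => hx.1 ⟨fun e => hx.2 e.symm, h2⟩, hx.2⟩
  · exact fun hx => ⟨fun h2 => hx.1 h2.2, hx.2⟩

end Moves

/-- The filtration of the cells. -/
def fil (h : ℕ) (k : Finset B × Finset B) (N : ModuleCat.{z} A) : Submodule A ((b.G k).obj N) :=
  Submodule.span A {y | ∃ w n, height cs k w < h ∧ y = b.gen k N w n}

variable {b} {k : Finset B × Finset B} {w w' : W} {N : ModuleCat.{z} A}

theorem fil_mono {h h' : ℕ} (hh : h ≤ h') : b.fil h k N ≤ b.fil h' k N := by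
  refine Submodule.span_mono ?_
  rintro _ ⟨w, n, hw, rfl⟩
  exact ⟨w, n, hw.trans_le hh, rfl⟩

theorem gen_mem_fil {h : ℕ} (hw : height cs k w < h) (n : N) : b.gen k N w n ∈ b.fil h k N :=
  Submodule.subset_span ⟨w, n, hw, rfl⟩

/-- The generators which are not critical can be replaced by generators which are matched. -/
theorem gen_mem_span_moves (hk : k ≠ (Finset.univ, ∅)) (w : W) (n : N) :
    b.gen k N w n ∈ Submodule.span A
      {y | ∃ w' n', height cs k w' = height cs k w ∧ (∃ m, Moves cs k w' m) ∧
        y = b.gen k N w' n'} := by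
  by_cases h : top cs k.1 (↑k.2)ᶜ w ∈ parabolicSubgroup cs (↑k.2)ᶜ
  · obtain ⟨h1, h2⟩ := top_mem_iff.mp h
    have hu : k.1 ≠ Finset.univ := by
      intro h3
      refine hk (Prod.ext h3 (Finset.eq_empty_of_forall_notMem fun x hx => ?_))
      exact h1 (h3 ▸ Finset.mem_coe.mpr (Finset.mem_univ x)) hx
    obtain ⟨t, ht⟩ := exists_fresh_eq hu
    refine Submodule.span_mono ?_ (b.gen_mem k N w n h1 h2)
    rintro _ ⟨n', rfl⟩
    refine ⟨1, n', ?_, ⟨.inr t, rfl, h1, ht⟩, rfl⟩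
    rw [height_of_mem h hu, height_of_mem (top_one_mem h1) hu]
  · obtain ⟨s, hs⟩ := exists_descent_eq h
    exact Submodule.subset_span ⟨w, n, rfl, ⟨.inl s, hs⟩, rfl⟩

/-- The generators whose top lies outside W_Q span a subcomplex: by `top_mem_iff`, enlarging I or
shrinking Q cannot bring the top into the parabolic subgroup. -/
theorem D_mem_of_notMem (h : top cs k.1 (↑k.2)ᶜ w ∉ parabolicSubgroup cs (↑k.2)ᶜ) {r : B ⊕ B}
    (hr : r ∈ k.1ᶜ.disjSum k.2ᶜ) (n : N) :
    ((b.D k r).app N).hom (b.gen k N w n) ∈ b.fil (critHeight cs) (insertLabel k r) N := by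
  rcases r with s | t
  · rw [b.D_inl k N w n s (by simpa using hr)]
    refine gen_mem_fil (height_lt_critHeight ?_) n
    have := insertLabel_notMem (r := .inl s) hr (one_mem (parabolicSubgroup cs (↑k.2)ᶜ)) h
    rwa [mul_one] at this
  · refine Submodule.span_mono ?_ (b.D_inr_mem k N w n t (by simpa using hr))
    rintro _ ⟨x, hx, n', rfl⟩
    exact ⟨_, n', height_lt_critHeight (insertLabel_notMem hr hx h), rfl⟩

/-- For tops outside W_Q the leading entry is |Q|, which decreases when J grows. -/
theorem D_inr_mem_fil (h : top cs k.1 (↑k.2)ᶜ w ∉ parabolicSubgroup cs (↑k.2)ᶜ) {t : B}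
    (ht : t ∉ k.2) (n : N) :
    ((b.D k (.inr t)).app N).hom (b.gen k N w n) ∈
      b.fil (height cs k w) (insertLabel k (.inr t)) N := by
  refine Submodule.span_mono ?_ (b.D_inr_mem k N w n t ht)
  rintro _ ⟨x, hx, n', rfl⟩
  exact ⟨_, n', height_lt_of_card_lt h (insertLabel_notMem (by simpa using ht) hx h)
    (card_insert_compl_lt ht), rfl⟩

theorem D_inr_one_sub_mem_fil {h : ℕ} (hh : critHeight cs ≤ h) {t : B} (ht : t ∉ k.2) (n : N) :
    ((b.D k (.inr t)).app N).hom (b.gen k N 1 n) - b.gen (insertLabel k (.inr t)) N 1 n ∈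
      b.fil h (insertLabel k (.inr t)) N := by
  refine Submodule.span_mono ?_ (b.D_inr_one_sub_mem k N n t ht)
  rintro _ ⟨w, n', hw, hw', rfl⟩
  refine ⟨w, n', (height_lt_critHeight ?_).trans_le hh, rfl⟩
  rw [top_mem_iff]
  exact fun h => hw' h.2

theorem critHeight_lt_of_inr {t : B} (hm : Moves cs k w (.inr t)) :
    critHeight cs < height cs k w := by
  obtain ⟨rfl, h1, h2⟩ := hm
  rw [height_inr cs h1 h2]
  omega

/-- This is the acyclicity of the matching: every component of the differential other than the
matched one strictly lowers heights. For a generator matched along J, the correction terms of the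
Casimir map already lie below the critical height. -/
theorem D_mem_of_ne {m r : B ⊕ B} (hm : Moves cs k w m) (hr : r ∈ k.1ᶜ.disjSum k.2ᶜ)
    (hne : r ≠ m) (n : N) :
    ((b.D k r).app N).hom (b.gen k N w n) ∈ b.fil (height cs k w) (insertLabel k r) N := by
  rcases m with s | t
  · have h := (isMovingDescent_of_descent hm).1
    rcases r with r | r
    · have hr : r ∉ k.1 := by simpa using hr
      rw [b.D_inl k N w n r hr]
      refine gen_mem_fil (height_insert_lt hr h ?_) n
      rw [show descent _ _ _ = some s from hm]
      simpa using fun e : s = r => hne (by rw [e])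
    · exact D_inr_mem_fil h (by simpa using hr) n
  · have hc := critHeight_lt_of_inr hm
    obtain ⟨rfl, h1, h2⟩ := hm
    rcases r with r | r
    · have hr : r ∉ k.1 := by simpa using hr
      rw [b.D_inl k N 1 n r hr]
      exact gen_mem_fil (height_inr_inl_lt h1 h2 hr) n
    · have hr : r ∉ k.2 := by simpa using hr
      rw [← sub_add_cancel (((b.D k (.inr r)).app N).hom (b.gen k N 1 n))
        (b.gen (insertLabel k (.inr r)) N 1 n)]
      exact add_mem (D_inr_one_sub_mem_fil hc.le hr n)
        (gen_mem_fil (height_inr_inr_lt h1 h2 hr fun e => hne (by rw [e])) n)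

/-- In the first case s is a descent of the top, so the top is still maximal after s is added to I,
and its chosen descent is still s. In the second case the choice of t depends on I alone. -/
theorem Moves.insertLabel_moves {m : B ⊕ B} (hm : Moves cs k w m) :
    Moves cs (insertLabel k m) w m ∧ height cs (insertLabel k m) w = height cs k w := by
  rcases m with s | t
  · have h := (isMovingDescent_of_descent hm).2
    have e : top cs ↑(insert s k.1) (↑k.2)ᶜ w = top cs k.1 (↑k.2)ᶜ w := by
      have h1 := h.isTop_insert (isTop_top (k.1 : Set B) (↑k.2)ᶜ w)
      rw [← Finset.coe_insert] at h1
      exact h1.top_eq ((sameDoubleCoset_top _ _ w).symm.mono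
        (Finset.coe_subset.mpr (Finset.subset_insert s k.1)) subset_rfl)
    have hm' : Moves cs (insertLabel k (.inl s)) w (.inl s) := by
      change descent cs _ (top cs ↑(insert s k.1) (↑k.2)ᶜ w) = _
      rw [e]
      exact hm
    refine ⟨hm', ?_⟩
    by_cases hs : s ∈ k.1
    · rw [insertLabel, Sum.elim_inl, Finset.insert_eq_self.mpr hs]
    · rw [← height_eq_of_erase (k := insertLabel k (.inl s)) (w := w) (w' := w) hm' (by
        simp only [insertLabel, Sum.elim_inl]
        rw [Finset.erase_insert hs, e])]
      simp only [insertLabel, Sum.elim_inl, Finset.erase_insert hs]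
  · obtain ⟨rfl, h1, h2⟩ := hm
    obtain ⟨h3, h4⟩ := height_inr_insert (cs := cs) h1 h2
    exact ⟨⟨rfl, h3, h2⟩, h4⟩

theorem D_moves_sub_mem {m : B ⊕ B} (hm : Moves cs k w m) (hr : m ∈ k.1ᶜ.disjSum k.2ᶜ) (n : N) :
    ((b.D k m).app N).hom (b.gen k N w n) - b.gen (insertLabel k m) N w n ∈
      b.fil (height cs k w) (insertLabel k m) N := by
  rcases m with s | t
  · rw [b.D_inl k N w n s (by simpa using hr), sub_self]
    exact zero_mem _
  · have hc := critHeight_lt_of_inr hm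
    obtain ⟨rfl, h1, h2⟩ := hm
    exact D_inr_one_sub_mem_fil hc.le (by simpa using hr) n

/-- A generator is matched along one label only. The two types of labels exclude each other, since
the top is outside W_Q for the first and inside for the second. -/
theorem S_eq_zero {m i : B ⊕ B} (hm : Moves cs k w m) (hi : i ∈ k.1.disjSum k.2) (hne : i ≠ m)
    (n : N) : ((b.S k i).app N).hom (b.gen k N w n) = 0 := by
  rcases i with s | t
  · refine b.S_inl_eq_zero k N w n s (by simpa using hi) fun h => ?_
    rcases m with s' | t'
    · have h2 : descent cs _ _ = some s' := hm
      rw [h, Option.some_inj] at h2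
      exact hne (by rw [h2])
    · obtain ⟨rfl, h1, h2⟩ := hm
      rw [descent_eq_none (top_one_mem h1)] at h
      cases h
  · refine b.S_inr_eq_zero k N w n t (by simpa using hi) ?_
    rintro ⟨h1, h2, h3⟩
    rcases m with s' | t'
    · exact (isMovingDescent_of_descent hm).1 (top_mem_iff.mpr ⟨h2, h3⟩)
    · have h4 : fresh k.1 = some t' := hm.2.2
      rw [h1, Option.some_inj] at h4
      exact hne (by rw [h4])

theorem S_moves_mem {m : B ⊕ B} (hm : Moves cs k w m) (hi : m ∈ k.1.disjSum k.2) (n : N) :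
    ((b.S k m).app N).hom (b.gen k N w n) ∈ Submodule.span A
      {y | ∃ w' n', height cs (eraseLabel k m) w' = height cs k w ∧
        Moves cs (eraseLabel k m) w' m ∧ y = b.gen (eraseLabel k m) N w' n'} := by
  rcases m with s | t
  · refine Submodule.span_mono ?_ (b.S_inl_mem k N w n s (by simpa using hi) hm)
    rintro _ ⟨w', n', h, rfl⟩
    refine ⟨w', n', height_eq_of_erase hm h, ?_, rfl⟩
    change descent cs _ (top cs ↑(k.1.erase s) (↑k.2)ᶜ w') = _
    rw [h]
    exact hm
  · obtain ⟨rfl, h1, h2⟩ := hm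
    rw [b.S_inr_of_mem k N 1 n t (by simpa using hi) h2 h1 (one_mem _)]
    obtain ⟨h3, h4⟩ := height_inr_erase (cs := cs) h1 h2
    exact Submodule.subset_span ⟨1, n, h4, ⟨rfl, h3, h2⟩, rfl⟩

theorem D_S_sub_mem {m : B ⊕ B} (hm : Moves cs k w m) (hi : m ∈ k.1.disjSum k.2) (n : N) :
    ((b.D (eraseLabel k m) m).app N).hom (((b.S k m).app N).hom (b.gen k N w n)) -
      b.gen (insertLabel (eraseLabel k m) m) N w n ∈
        b.fil (height cs k w) (insertLabel (eraseLabel k m) m) N := by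
  rcases m with s | t
  · rw [b.D_S_inl k N w n s (by simpa using hi) hm, sub_self]
    exact zero_mem _
  · have hc := critHeight_lt_of_inr hm
    obtain ⟨rfl, h1, h2⟩ := hm
    rw [b.S_inr_of_mem k N 1 n t (by simpa using hi) h2 h1 (one_mem _)]
    exact D_inr_one_sub_mem_fil hc.le (by simp [eraseLabel]) n

theorem S_insert {m : B ⊕ B} (hm : Moves cs k w m) (hr : m ∈ k.1ᶜ.disjSum k.2ᶜ) (n : N) :
    ((b.S (insertLabel k m) m).app N).hom (b.gen (insertLabel k m) N w n) =
      b.gen (eraseLabel (insertLabel k m) m) N w n := by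
  rcases m with s | t
  · exact b.S_inl_insert k N w n s (by simpa using hr) hm
  · have h := hm.insertLabel_moves
    obtain ⟨rfl, h1, h2⟩ := h.1
    exact b.S_inr_of_mem _ N 1 n t (by simp [insertLabel]) h2 h1 (one_mem _)

/-- For I = Q = S every top lies in W_Q, so there is no moving descent, and J has no element to
remove. -/
theorem S_crit (w : W) (i : B ⊕ B) (hi : i ∈ k.1.disjSum k.2) (hk : k = (Finset.univ, ∅)) (n : N) :
    ((b.S k i).app N).hom (b.gen k N w n) = 0 := by
  subst hk
  rcases i with s | t
  · refine b.S_inl_eq_zero _ N w n s (by simp) ?_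
    rw [descent_eq_none]
    · simp
    · rw [top_mem_iff]
      simp only [Finset.coe_empty, Set.compl_empty, Finset.coe_univ, Set.subset_univ, true_and]
      have : parabolicSubgroup cs (Set.univ : Set B) = ⊤ := by
        rw [parabolicSubgroup, Set.image_univ, cs.subgroup_closure_range_simple]
      rw [this]
      trivial
  · simp at hi

/-- Outside the critical cell every generator is a combination of matched generators of the same
height. On these the contraction is zero or moves along the matched pair, which preserves heights.
-/
theorem S_mem_fil {h : ℕ} {i : B ⊕ B} (hi : i ∈ k.1.disjSum k.2) {y : (b.G k).obj N}
    (hy : y ∈ b.fil h k N) : ((b.S k i).app N).hom y ∈ b.fil h (eraseLabel k i) N := by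
  refine span_map_mem _ ?_ hy
  rintro _ ⟨w, n, hw, rfl⟩
  by_cases hk : k = (Finset.univ, ∅)
  · rw [S_crit w i hi hk]
    exact zero_mem _
  · refine span_map_mem _ ?_ (gen_mem_span_moves hk w n)
    rintro _ ⟨w', n', hw', ⟨m, hm⟩, rfl⟩
    by_cases hne : i = m
    · subst hne
      refine Submodule.span_mono ?_ (S_moves_mem hm hi n')
      rintro _ ⟨w'', n'', h1, -, rfl⟩
      exact ⟨w'', n'', by omega, rfl⟩
    · rw [S_eq_zero hm hi hne]
      exact zero_mem _

end BiSystem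

end BiSystem

end Hecke

namespace Hecke

/-! ### The contraction is an acyclic matching -/

section BiSystem

open CategoryTheory

theorem Contraction.exists_laplacian_eq {A : Type u} [Ring A] {κ : Type v} {ρ l : Type w}
    {𝒮 : CellSystem.{u, v, w, z} A κ ρ} (σ : Contraction 𝒮 l) {N V : ModuleCat.{z} A}
    (j : ∀ k, (𝒮.G k).obj N ⟶ V) (k : κ) :
    ∃ f : (𝒮.G k).obj N →ₗ[A] V, ∀ y, f y = σ.laplacian j k y := by
  refine ⟨∑ i ∈ σ.act k, ∑ r ∈ 𝒮.act (σ.tgt k i), 𝒮.sgn (σ.tgt k i) r •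
      (j (𝒮.tgt (σ.tgt k i) r)).hom ∘ₗ ((𝒮.D (σ.tgt k i) r).app N).hom ∘ₗ ((σ.S k i).app N).hom +
    ∑ r ∈ 𝒮.act k, ∑ i ∈ σ.act (𝒮.tgt k r), 𝒮.sgn k r •
      (j (σ.tgt (𝒮.tgt k r) i)).hom ∘ₗ ((σ.S (𝒮.tgt k r) i).app N).hom ∘ₗ ((𝒮.D k r).app N).hom,
    fun y => ?_⟩
  rw [Contraction.laplacian]
  simp only [LinearMap.add_apply, LinearMap.sum_apply, LinearMap.smul_apply, LinearMap.comp_apply]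

theorem sum_sub_mem {A V ι : Type*} [Ring A] [AddCommGroup V] [Module A V] {L : Submodule A V}
    {s : Finset ι} {f : ι → V} {i : ι} (hi : i ∈ s) {x : V} (h : f i - x ∈ L)
    (h' : ∀ j ∈ s, j ≠ i → f j ∈ L) : ∑ j ∈ s, f j - x ∈ L := by
  classical
  rw [← Finset.add_sum_erase s f hi, add_sub_right_comm]
  exact add_mem h (sum_mem fun j hj => h' j (Finset.mem_of_mem_erase hj) (Finset.ne_of_mem_erase hj))

variable {B W : Type v} [Group W] {M : CoxeterMatrix B} [DecidableEq B]

namespace BiSystem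

variable [Fintype B] [Finite W] {cs : CoxeterSystem M W} {A : Type u} [Ring A]
  {b : BiSystem.{u, v, z} cs A} {k : Finset B × Finset B} {w : W} {N V : ModuleCat.{z} A}

theorem laplacian_apply (j : ∀ k, (b.G k).obj N ⟶ V) (k : Finset B × Finset B)
    (y : (b.G k).obj N) : (b.contraction).laplacian j k y =
      ∑ i ∈ k.1.disjSum k.2, ∑ r ∈ (eraseLabel k i).1ᶜ.disjSum (eraseLabel k i).2ᶜ,
        (b.sgn (eraseLabel k i) r * b.sgn (eraseLabel k i) i) •
          (j (insertLabel (eraseLabel k i) r)).hom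
            (((b.D (eraseLabel k i) r).app N).hom (((b.S k i).app N).hom y)) +
      ∑ r ∈ k.1ᶜ.disjSum k.2ᶜ, ∑ i ∈ (insertLabel k r).1.disjSum (insertLabel k r).2,
        (b.sgn k r * b.sgn (eraseLabel (insertLabel k r) i) i) •
          (j (eraseLabel (insertLabel k r) i)).hom
            (((b.S (insertLabel k r) i).app N).hom (((b.D k r).app N).hom y)) := by
  have hS : ∀ k i (y : (b.G k).obj N), (((b.contraction).S k i).app N).hom y =
      b.sgn (eraseLabel k i) i •
        (((b.S k i).app N).hom y : (b.G (eraseLabel k i)).obj N) := fun _ _ _ => rfl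
  change HAdd.hAdd _ _ = _
  refine congrArg₂ (· + ·) (Finset.sum_congr rfl fun i _ => Finset.sum_congr rfl fun r _ => ?_)
    (Finset.sum_congr rfl fun r _ => Finset.sum_congr rfl fun i _ => ?_)
  · rw [mul_smul]
    refine congrArg (b.sgn (eraseLabel k i) r • ·) ?_
    exact (congrArg _ ((congrArg _ (hS k i y)).trans (map_zsmul _ _ _))).trans (map_zsmul _ _ _)
  · rw [mul_smul]
    refine congrArg (b.sgn k r • ·) ?_
    exact (congrArg _ (hS (insertLabel k r) i _)).trans (map_zsmul _ _ _)

theorem apply_gen_congr (j : ∀ k, (b.G k).obj N ⟶ V) {k k' : Finset B × Finset B} (h : k = k')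
    (w : W) (n : N) : (j k).hom (b.gen k N w n) = (j k').hom (b.gen k' N w n) := by
  subst h; rfl

theorem apply_mem_iSup (j : ∀ k, (b.G k).obj N ⟶ V) {h : ℕ} {y : (b.G k).obj N}
    (hy : y ∈ b.fil h k N) : (j k).hom y ∈ ⨆ k', (b.fil h k' N).map (j k').hom :=
  Submodule.mem_iSup_of_mem k ⟨y, hy, rfl⟩

/-- Among all terms of dσ + σd exactly one returns to the given matched generator, with coefficient
1 because its sign is squared. The others contain a vanishing component of σ, or an unmatched
component of d, which lowers the height while σ preserves it. -/
theorem apply_gen_sub_laplacian_mem (j : ∀ k, (b.G k).obj N ⟶ V) {m : B ⊕ B}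
    (hm : Moves cs k w m) (n : N) :
    (j k).hom (b.gen k N w n) - (b.contraction).laplacian j k (b.gen k N w n) ∈
      ⨆ k', (b.fil (height cs k w) k' N).map (j k').hom := by
  set L := ⨆ k', (b.fil (height cs k w) k' N).map (j k').hom with hL
  have h0 : ∀ i ∈ k.1.disjSum k.2, i ≠ m → ∑ r ∈ (eraseLabel k i).1ᶜ.disjSum (eraseLabel k i).2ᶜ,
        (b.sgn (eraseLabel k i) r * b.sgn (eraseLabel k i) i) •
          (j (insertLabel (eraseLabel k i) r)).hom (((b.D (eraseLabel k i) r).app N).hom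
            (((b.S k i).app N).hom (b.gen k N w n))) ∈ L := by
    intro i hi hne
    refine sum_mem fun r _ => zsmul_mem ?_ _
    rw [S_eq_zero hm hi hne, map_zero, map_zero]
    exact zero_mem _
  have h1 : ∀ r ∈ k.1ᶜ.disjSum k.2ᶜ, r ≠ m →
      ∑ i ∈ (insertLabel k r).1.disjSum (insertLabel k r).2,
        (b.sgn k r * b.sgn (eraseLabel (insertLabel k r) i) i) •
          (j (eraseLabel (insertLabel k r) i)).hom (((b.S (insertLabel k r) i).app N).hom
            (((b.D k r).app N).hom (b.gen k N w n))) ∈ L := by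
    intro r hr hne
    exact sum_mem fun i hi => zsmul_mem
      (apply_mem_iSup j (S_mem_fil hi (D_mem_of_ne hm hr hne n))) _
  rw [laplacian_apply, ← neg_mem_iff, neg_sub]
  -- If the label m is present, the generator is the upper end of its pair and is recovered by dσ.
  -- Otherwise it is the lower end and is recovered by σd.
  by_cases hmk : m ∈ k.1.disjSum k.2
  · have hr : ∀ r ∈ k.1ᶜ.disjSum k.2ᶜ, r ≠ m := by
      rintro r hr rfl
      rcases r with s | t <;>
        simp only [Finset.inl_mem_disjSum, Finset.inr_mem_disjSum, Finset.mem_compl] at hr hmk <;>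
        exact hr hmk
    rw [add_sub_right_comm]
    refine add_mem (sum_sub_mem hmk (sum_sub_mem (i := m) ?_ ?_ ?_) h0)
      (sum_mem fun r h => h1 r h (hr r h))
    · rcases m with s | t <;> simp [eraseLabel]
    · have h2 := apply_mem_iSup j (D_S_sub_mem (b := b) hm hmk n)
      rw [map_sub, apply_gen_congr j (insertLabel_eraseLabel hmk)] at h2
      rwa [b.sgn_mul_self, one_smul]
    · intro r hr hne
      refine zsmul_mem ?_ _
      refine span_map_mem ((j _).hom ∘ₗ ((b.D (eraseLabel k m) r).app N).hom) ?_
        (S_moves_mem hm hmk n)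
      rintro _ ⟨w', n', e, hm', rfl⟩
      have := D_mem_of_ne (b := b) hm' hr hne n'
      rw [e] at this
      exact apply_mem_iSup j this
  · have hmk' : m ∈ k.1ᶜ.disjSum k.2ᶜ := by
      rcases m with s | t <;> simpa using hmk
    have hS : ∀ i ∈ (insertLabel k m).1.disjSum (insertLabel k m).2,
        (j (eraseLabel (insertLabel k m) i)).hom (((b.S (insertLabel k m) i).app N).hom
          (((b.D k m).app N).hom (b.gen k N w n))) -
        (j (eraseLabel (insertLabel k m) i)).hom (((b.S (insertLabel k m) i).app N).hom
          (b.gen (insertLabel k m) N w n)) ∈ L := by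
      intro i hi
      have := apply_mem_iSup j (S_mem_fil hi (D_moves_sub_mem (b := b) hm hmk' n))
      rwa [map_sub, map_sub] at this
    rw [add_sub_assoc]
    refine add_mem (sum_mem fun i hi => h0 i hi fun e => hmk (e ▸ hi))
      (sum_sub_mem hmk' (sum_sub_mem (i := m) ?_ ?_ ?_) h1)
    · rcases m with s | t <;> simp [insertLabel]
    · have hk := eraseLabel_insertLabel hmk'
      have h2 := hS m (by rcases m with s | t <;> simp [insertLabel])
      rw [S_insert hm hmk', apply_gen_congr j hk] at h2
      rwa [show b.sgn (eraseLabel (insertLabel k m) m) m = b.sgn k m by rw [hk],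
        b.sgn_mul_self, one_smul]
    · intro i hi hne
      refine zsmul_mem ?_ _
      have h2 := hS i hi
      rw [S_eq_zero hm.insertLabel_moves.1 hi hne, map_zero, sub_zero] at h2
      exact h2

theorem eq_univ_of_height {k : Finset B × Finset B} {w : W} (h : height cs k w = critHeight cs) :
    k = (Finset.univ, ∅) := by
  have h1 : top cs k.1 (↑k.2)ᶜ w ∈ parabolicSubgroup cs (↑k.2)ᶜ := by
    by_contra h'
    exact (height_lt_critHeight h').ne h
  have hu : k.1 = Finset.univ := by
    by_contra h'
    rw [height_of_mem h1 h'] at h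
    omega
  refine Prod.ext hu (Finset.eq_empty_of_forall_notMem fun x hx => ?_)
  exact (top_mem_iff.mp h1).1 (hu ▸ Finset.mem_coe.mpr (Finset.mem_univ x)) hx

theorem height_crit (w : W) : height cs ((Finset.univ, ∅) : Finset B × Finset B) w =
    critHeight cs := by
  refine height_of_eq_univ rfl ?_
  rw [top_mem_iff]
  simp only [Finset.coe_empty, Set.compl_empty, Finset.coe_univ, Set.subset_univ, true_and]
  have : parabolicSubgroup cs (Set.univ : Set B) = ⊤ := by
    rw [parabolicSubgroup, Set.image_univ, cs.subgroup_closure_range_simple]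
  rw [this]
  trivial

/-- From (S, ∅) the differential can only enlarge J. Then Q no longer contains I = S, so the tops
are outside W_Q and the heights are below critical. -/
theorem D_crit_mem (r : B ⊕ B) (hk : k = (Finset.univ, ∅)) (hr : r ∈ k.1ᶜ.disjSum k.2ᶜ) (y : (b.G k).obj N) :
    ((b.D k r).app N).hom y ∈ b.fil (critHeight cs) (insertLabel k r) N := by
  have hy : y ∈ Submodule.span A {y | ∃ w n, y = b.gen k N w n} := by
    rw [b.span_gen]; trivial
  refine span_map_mem _ ?_ hy
  rintro _ ⟨w, n, rfl⟩
  subst hk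
  rcases r with s | t
  · simp at hr
  · refine Submodule.span_mono ?_ (b.D_inr_mem _ N w n t (by simp))
    rintro _ ⟨x, _, n', rfl⟩
    refine ⟨_, n', height_lt_critHeight fun h => ?_, rfl⟩
    have := (top_mem_iff.mp h).1 (show t ∈ _ by simp [insertLabel])
    simp [insertLabel] at this

/-- On the critical cell σ vanishes, which removes dσ; the differential already lands below the
critical height, and σ preserves heights, which takes care of σd. -/
theorem laplacian_crit_mem (j : ∀ k, (b.G k).obj N ⟶ V) (hk : k = (Finset.univ, ∅))
    (y : (b.G k).obj N) : (b.contraction).laplacian j k y ∈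
      ⨆ k', (b.fil (critHeight cs) k' N).map (j k').hom := by
  rw [laplacian_apply]
  refine add_mem (sum_mem fun i hi => sum_mem fun r _ => zsmul_mem ?_ _)
    (sum_mem fun r hr => sum_mem fun i hi => zsmul_mem
      (apply_mem_iSup j (S_mem_fil hi (D_crit_mem r hk hr y))) _)
  have hy : y ∈ Submodule.span A {y | ∃ w n, y = b.gen k N w n} := by
    rw [b.span_gen]; trivial
  have h0 : ((b.S k i).app N).hom y ∈ (⊥ : Submodule A _) := by
    refine span_map_mem _ ?_ hy
    rintro _ ⟨w, n, rfl⟩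
    rw [S_crit w i hi hk]
    exact zero_mem _
  rw [(Submodule.mem_bot A).mp h0, map_zero, map_zero]
  exact zero_mem _

theorem sub_laplacian_mem (j : ∀ k, (b.G k).obj N ⟶ V) {h : ℕ} (hh : h ≠ critHeight cs)
    {y : (b.G k).obj N} (hy : y ∈ b.fil (h + 1) k N) :
    (j k).hom y - (b.contraction).laplacian j k y ∈ ⨆ k', (b.fil h k' N).map (j k').hom := by
  obtain ⟨f, hf⟩ : ∃ f : (b.G k).obj N →ₗ[A] V, ∀ y, f y = (b.contraction).laplacian j k y :=
    (b.contraction).exists_laplacian_eq j k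
  have hmono : ∀ {h h' : ℕ}, h ≤ h' → ⨆ k', (b.fil h k' N).map (j k').hom ≤
      ⨆ k', (b.fil h' k' N).map (j k').hom :=
    fun h => iSup_mono fun k' => Submodule.map_mono (fil_mono h)
  suffices h' : ((j k).hom - f) y ∈ ⨆ k', (b.fil h k' N).map (j k').hom by
    rw [LinearMap.sub_apply] at h'
    rwa [← hf y]
  refine span_map_mem _ ?_ hy
  rintro _ ⟨w, n, hw, rfl⟩
  by_cases hk : k = (Finset.univ, ∅)
  · have e : height cs k w = critHeight cs := by rw [hk, height_crit]
    rw [LinearMap.sub_apply]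
    refine sub_mem (apply_mem_iSup j (gen_mem_fil (by omega) n)) ?_
    have := laplacian_crit_mem j hk (b.gen k N w n)
    rw [← hf (b.gen k N w n)] at this
    exact hmono (by omega) this
  · refine span_map_mem _ ?_ (gen_mem_span_moves hk w n)
    rintro _ ⟨w', n', e, ⟨m, hm⟩, rfl⟩
    have := apply_gen_sub_laplacian_mem j hm n'
    rw [← hf (b.gen k N w' n')] at this
    exact hmono (by omega) this

theorem fil_eq_bot {h : ℕ} (hh : ∀ w, h ≤ height cs k w) : b.fil h k N = ⊥ := by
  rw [fil, Submodule.span_eq_bot]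
  rintro _ ⟨w, n, hw, rfl⟩
  have := hh w
  omega

theorem map_mem_fil {h : ℕ} {N' : ModuleCat.{z} A} (φ : N ⟶ N') {y : (b.G k).obj N}
    (hy : y ∈ b.fil h k N) : ((b.G k).map φ).hom y ∈ b.fil h k N' := by
  refine span_map_mem _ ?_ hy
  rintro _ ⟨w, n, h, rfl⟩
  exact Submodule.subset_span ⟨w, φ.hom n, h, b.map_gen k φ w n⟩

variable (b) in
/-- The contraction is an acyclic matching, with only one critical cell. -/
noncomputable def morseFiltration : MorseFiltration b.contraction where
  Fil := b.fil
  mono h _ _ := fil_mono h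
  Fil_zero k N := fil_eq_bot fun _ => Nat.zero_le _
  height := critHeight cs + 1 + (Fintype.card B + 1) * (Fintype.card B + 1)
  Fil_height k N := by
    refine top_unique ((b.span_gen k N).symm.le.trans (Submodule.span_mono ?_))
    rintro _ ⟨w, n, rfl⟩
    exact ⟨w, n, height_lt k w, rfl⟩
  crit := (Finset.univ, ∅)
  level := critHeight cs
  deg_crit := by simp [cells]
  iso := b.iso
  Fil_crit N := fil_eq_bot fun w => (height_crit w).ge
  Fil_succ k N hk := by
    refine Submodule.span_mono ?_
    rintro _ ⟨w, n, h, rfl⟩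
    refine ⟨w, n, lt_of_le_of_ne (by omega) fun h' => hk (eq_univ_of_height h'), rfl⟩
  lower h hh k N y hy V j := sub_laplacian_mem j hh hy
  critical N y V j := laplacian_crit_mem j rfl y
  D_mem k N r hr y hy := by
    refine span_map_mem _ ?_ hy
    rintro _ ⟨w, n, h, rfl⟩
    exact D_mem_of_notMem (height_lt_iff.mp h) hr n
  D_crit_mem N r hr y := D_crit_mem r rfl hr y
  map_mem k N N' φ y hy := map_mem_fil φ hy

end BiSystem

end BiSystem

end Hecke

namespace Hecke

set_option linter.unusedSectionVars false

/-! ### Bimodule splittings built from the elements h_n⁻¹ ⊗ h_n -/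

section Translation

variable {B W : Type v} [Group W] {M : CoxeterMatrix B} {cs : CoxeterSystem M W}

/-- `n` is an element of `v W_Q ∩ W_P w`, for `v` the longest element of `W_P w W_Q`. -/
def IsAdjacent [Finite W] (cs : CoxeterSystem M W) (P Q : Set B) (w n : W) : Prop :=
  (∃ x ∈ parabolicSubgroup cs P, n = x * w) ∧
    ∃ y ∈ parabolicSubgroup cs Q, n = top cs P Q w * y

section Adjacent

variable [Finite W] {P Q : Set B} {w n : W}

theorem exists_isAdjacent (P Q : Set B) (w : W) : ∃ n, IsAdjacent cs P Q w n := by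
  obtain ⟨x, hx, y, hy, e⟩ := sameDoubleCoset_top (cs := cs) P Q w
  exact ⟨x * w, ⟨x, hx, rfl⟩, y⁻¹, inv_mem hy, by rw [e]; group⟩

theorem IsAdjacent.mul_left (h : IsAdjacent cs P Q w n) {z : W}
    (hz : z ∈ parabolicSubgroup cs P) : IsAdjacent cs P Q (z * w) n := by
  obtain ⟨⟨x, hx, e⟩, y, hy, e'⟩ := h
  refine ⟨⟨x * z⁻¹, mul_mem hx (inv_mem hz), by rw [e]; group⟩, y, hy, ?_⟩
  rw [top_eq_of_sameDoubleCoset (.of_mul_left w hz), e']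

theorem IsAdjacent.mul_right (h : IsAdjacent cs P Q w n) {z : W}
    (hz : z ∈ parabolicSubgroup cs Q) : IsAdjacent cs P Q (w * z) (n * z) := by
  obtain ⟨⟨x, hx, e⟩, y, hy, e'⟩ := h
  refine ⟨⟨x, hx, by rw [e, mul_assoc]⟩, y * z, mul_mem hy hz, ?_⟩
  rw [top_eq_of_sameDoubleCoset (.of_mul_right w hz), e', mul_assoc]

/-- Both elements lie in v W_Q and differ by an element of W_P on the left. As s is a moving descent
of the top v, this element belongs to W_{P \ {s}}. -/
theorem IsAdjacent.exists_mul_eq {n' : W} {s : B} (h : IsAdjacent cs P Q w n)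
    (h' : IsAdjacent cs P Q w n') (hs : descent cs Q (top cs P Q w) = some s) :
    ∃ z ∈ parabolicSubgroup cs (P \ {s}), n' = z * n := by
  obtain ⟨⟨x, hx, e⟩, y, hy, e1⟩ := h
  obtain ⟨⟨x', hx', e'⟩, y', hy', e1'⟩ := h'
  have hz : n' = x' * x⁻¹ * n := by rw [e', e]; group
  refine ⟨x' * x⁻¹, ?_, hz⟩
  refine (isMovingDescent_of_descent hs).2.mem_parabolicSubgroup (isTop_top P Q w) (w := n)
    (w' := n') ?_ ?_ (mul_mem hx' (inv_mem hx)) hz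
  · rw [e1]; exact .of_mul_right _ hy
  · rw [e1']; exact .of_mul_right _ hy'

/-- If the descent status of t changed inside the coset W_P w, then `exists_simple_mul_eq`, applied
to inverses, would give w t ∈ W_P w. -/
theorem length_mul_simple_lt_of_isAdjacent {x : W} (hx : x ∈ parabolicSubgroup cs P) {t : B}
    (hw : ∀ z ∈ parabolicSubgroup cs P, w * cs.simple t ≠ z * w)
    (h : cs.length w < cs.length (w * cs.simple t)) :
    cs.length (x * w) < cs.length (x * w * cs.simple t) := by
  by_contra h'
  have h2 : cs.length (x * w * cs.simple t) < cs.length (x * w) :=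
    lt_of_le_of_ne (not_lt.mp h') (cs.length_mul_simple_ne _ _)
  rw [← cs.length_inv w, ← cs.length_inv (w * _), mul_inv_rev, cs.inv_simple] at h
  rw [← cs.length_inv (x * w), ← cs.length_inv (x * w * _), mul_inv_rev, mul_inv_rev,
    cs.inv_simple] at h2
  obtain ⟨k, hk, e⟩ := exists_simple_mul_eq cs (inv_mem hx) h h2
  refine hw k⁻¹ (inv_mem hk) ?_
  have := congrArg (·⁻¹) e
  simpa using this

end Adjacent

variable {R : Type u} [CommRing R] (P : Parameters cs R)

open HeckeAlgebra in
/-- A bimodule with elements `E n` which behave like the elements `h_n⁻¹ ⊗ h_n` of `H ⊗_{H_K} H`. -/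
structure Translation (K : Set B) (U : Type w) [AddCommGroup U] where
  /-- the action of the algebra -/
  act : HeckeAlgebra P →+* AddMonoid.End U
  /-- the right action of the algebra -/
  op : HeckeAlgebra P →+ AddMonoid.End U
  op_one : op 1 = 1
  op_mul : ∀ a b u, op (a * b) u = op b (op a u)
  op_smul_one : ∀ r : R, op (r • 1) = act (r • 1)
  op_act : ∀ a b u, op a (act b u) = act b (op a u)
  /-- the elements -/
  E : W → U
  E_mul : ∀ y ∈ parabolicSubgroup cs K, ∀ n, E (y * n) = E n
  -- For E n = h_n⁻¹ ⊗ h_n both rules come from rewriting h_n h_t in the right factor and adjusting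
  -- the left factor by h_t or by its inverse.
  op_of_lt : ∀ t n, cs.length n < cs.length (n * cs.simple t) →
    op (basis P (cs.simple t)) (E n) = act (basis P (cs.simple t)) (E (n * cs.simple t))
  op_of_gt : ∀ t n, cs.length (n * cs.simple t) < cs.length n →
    op (basis P (cs.simple t)) (E n) = act (((P.q t : R) - 1) • 1) (E n) +
      act ((P.q t : R) • (((simpleUnit P t)⁻¹ : (HeckeAlgebra P)ˣ))) (E (n * cs.simple t))

namespace Translation

open HeckeAlgebra

variable [Finite W] {P} {U : Type w} [AddCommGroup U] (K Q : Set B) (s : B)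
  {K' : Set B} (T : Translation P K' U)

open Classical in
/-- The element `E n`, for `n` adjacent to `w`. -/
noncomputable def adjacentE (w : W) : U :=
  if descent cs Q (top cs K Q w) = some s then T.E (exists_isAdjacent (cs := cs) K Q w).choose
  else 0

variable {K Q s}

/-- The choice of the adjacent element is irrelevant: two of them differ by W_{K \ {s}}, under which
E is invariant. -/
theorem adjacentE_eq (hK : K \ {s} ⊆ K') {w n : W} (hs : descent cs Q (top cs K Q w) = some s)
    (h : IsAdjacent cs K Q w n) : T.adjacentE K Q s w = T.E n := by
  rw [adjacentE, if_pos hs]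
  obtain ⟨z, hz, e⟩ := h.exists_mul_eq (exists_isAdjacent (cs := cs) K Q w).choose_spec hs
  rw [e, T.E_mul z (parabolicSubgroup_mono cs hK hz)]

theorem adjacentE_eq_zero {w : W} (hs : descent cs Q (top cs K Q w) ≠ some s) :
    T.adjacentE K Q s w = 0 := by
  rw [adjacentE, if_neg hs]

theorem adjacentE_mul_left (hK : K \ {s} ⊆ K') {z : W} (hz : z ∈ parabolicSubgroup cs K) (w : W) :
    T.adjacentE K Q s (z * w) = T.adjacentE K Q s w := by
  have e := top_eq_of_sameDoubleCoset (SameDoubleCoset.of_mul_left (cs := cs) (Q := Q) w hz)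
  by_cases hs : descent cs Q (top cs K Q w) = some s
  · obtain ⟨n, hn⟩ := exists_isAdjacent (cs := cs) K Q w
    rw [T.adjacentE_eq hK hs hn, T.adjacentE_eq hK (by rwa [e]) (hn.mul_left hz)]
  · rw [T.adjacentE_eq_zero hs, T.adjacentE_eq_zero (by rwa [e])]

variable (K Q s)

/-- The map `h_w ↦ h_w E(n)`, for `n` adjacent to `w`. -/
noncomputable def splitting : HeckeAlgebra P →+ U :=
  letI := Fintype.ofFinite W
  ∑ w, (AddMonoidHom.flip (T.act : HeckeAlgebra P →+ AddMonoid.End U) (T.adjacentE K Q s w)).comp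
    ((LinearMap.toSpanSingleton R (HeckeAlgebra P) (basis P w)).toAddMonoidHom.comp
      ((basis P).coord w).toAddMonoidHom)

variable {K Q s}

theorem splitting_smul_basis (r : R) (w : W) :
    T.splitting K Q s (r • basis P w) = T.act (r • basis P w) (T.adjacentE K Q s w) := by
  classical
  let _ := Fintype.ofFinite W
  have er : ∀ w', (basis P).repr (r • basis P w) w' = r * if w = w' then 1 else 0 := fun w' => by
    rw [map_smul, Finsupp.smul_apply, repr_basis_eq_ite, smul_eq_mul]
  have h : ∀ w', ((AddMonoidHom.flip (T.act : HeckeAlgebra P →+ AddMonoid.End U)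
      (T.adjacentE K Q s w')).comp ((LinearMap.toSpanSingleton R (HeckeAlgebra P)
        (basis P w')).toAddMonoidHom.comp ((basis P).coord w').toAddMonoidHom)) (r • basis P w) =
      T.act ((basis P).repr (r • basis P w) w' • basis P w') (T.adjacentE K Q s w') :=
    fun _ => rfl
  rw [splitting, AddMonoidHom.finsetSum_apply, Finset.sum_eq_single w]
  · rw [h, er, if_pos rfl, mul_one]
  · intro w' _ hw
    rw [h, er, if_neg hw.symm, mul_zero, zero_smul, map_zero]
    rfl
  · intro h
    exact absurd (Finset.mem_univ _) h

theorem splitting_basis (w : W) :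
    T.splitting K Q s (basis P w) = T.act (basis P w) (T.adjacentE K Q s w) := by
  have := T.splitting_smul_basis (K := K) (Q := Q) (s := s) 1 w
  rwa [one_smul] at this

theorem act_mul (a b : HeckeAlgebra P) (y : U) : T.act (a * b) y = T.act a (T.act b y) := by
  rw [map_mul]; rfl

theorem act_add (a b : HeckeAlgebra P) (y : U) : T.act (a + b) y = T.act a y + T.act b y := by
  rw [map_add]; rfl

theorem act_smul (r : R) (x : HeckeAlgebra P) (y : U) :
    T.act (r • x) y = T.act (r • 1) (T.act x y) := by
  rw [← act_mul, smul_mul_assoc, one_mul]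

theorem act_smul_comm (r : R) (a : HeckeAlgebra P) (y : U) :
    T.act (r • 1) (T.act a y) = T.act a (T.act (r • 1) y) := by
  rw [← act_mul, ← act_mul, smul_mul_assoc, one_mul, mul_smul_comm, mul_one]

theorem splitting_smul (r : R) (x : HeckeAlgebra P) :
    T.splitting K Q s (r • x) = T.act (r • 1) (T.splitting K Q s x) := by
  induction x using induction_basis with
  | zero => simp
  | add x y hx hy => rw [smul_add, map_add, map_add, map_add, hx, hy]
  | smul_basis r' w => rw [smul_smul, splitting_smul_basis, splitting_smul_basis, ← act_smul,
      smul_smul]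

/-- The elements w and s_i w share their adjacent elements, so only the factor h_w in h_w E(n)
changes. -/
theorem splitting_simple_mul (hK : K \ {s} ⊆ K') {i : B} (hi : i ∈ K) (x : HeckeAlgebra P) :
    T.splitting K Q s (basis P (cs.simple i) * x) =
      T.act (basis P (cs.simple i)) (T.splitting K Q s x) := by
  induction x using induction_basis with
  | zero => simp
  | add x y hx hy => rw [mul_add, map_add, map_add, map_add, hx, hy]
  | smul_basis r w =>
    rw [mul_smul_comm, splitting_smul, splitting_smul, ← act_smul_comm]
    refine congrArg (T.act (r • 1)) ?_
    rw [splitting_basis, ← act_mul]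
    have e := T.adjacentE_mul_left (Q := Q) hK (simple_mem_parabolicSubgroup cs hi) w
    rcases lt_or_gt_of_ne (cs.length_simple_mul_ne w i) with h | h
    · rw [basis_simple_mul_of_gt P h, map_add, splitting_smul_basis, splitting_smul_basis, e,
        act_add]
    · rw [basis_simple_mul_of_lt P h, splitting_basis, e]

theorem splitting_mul_of_mem (hK : K \ {s} ⊆ K') {c : HeckeAlgebra P} (hc : c ∈ parabolicSubalgebra P K)
    (x : HeckeAlgebra P) : T.splitting K Q s (c * x) = T.act c (T.splitting K Q s x) := by
  revert x
  refine parabolicSubalgebra_induction P (p := fun c => ∀ x, T.splitting K Q s (c * x) =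
    T.act c (T.splitting K Q s x)) ?_ ?_ ?_ ?_ ?_ hc
  · intro x; simp
  · intro x; rw [one_mul, map_one]; rfl
  · intro c c' h h' x; rw [add_mul, map_add, h, h', act_add]
  · intro r c h x; rw [smul_mul_assoc, splitting_smul, h, ← act_smul]
  · intro c i hi h x; rw [mul_assoc, h, T.splitting_simple_mul hK hi, act_mul]

/-- If n is adjacent to w, then n t is adjacent to w t, so both sides are expressed by E(n) and E(n
t). They are compared by the multiplication rules of w and of n with t. -/
theorem splitting_mul_simple (hK : K \ {s} ⊆ K') {t : B} (ht : t ∈ Q) (x : HeckeAlgebra P) :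
    T.splitting K Q s (x * basis P (cs.simple t)) = T.op (basis P (cs.simple t)) (T.splitting K Q s x) := by
  induction x using induction_basis with
  | zero => simp
  | add x y hx hy => rw [add_mul, map_add, map_add, map_add, hx, hy]
  | smul_basis r w =>
    rw [smul_mul_assoc, splitting_smul, splitting_smul, T.op_act]
    refine congrArg (T.act (r • 1)) ?_
    rw [splitting_basis, T.op_act]
    have ht' := simple_mem_parabolicSubgroup cs ht
    have etop := top_eq_of_sameDoubleCoset (SameDoubleCoset.of_mul_right (cs := cs) (P := K) w ht')
    by_cases hs : descent cs Q (top cs K Q w) = some s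
    · obtain ⟨n, hn⟩ := exists_isAdjacent (cs := cs) K Q w
      have hn' := hn.mul_right ht'
      have e1 := T.adjacentE_eq hK hs hn
      have e2 := T.adjacentE_eq hK (by rwa [etop]) hn'
      -- If w t ∈ W_K w, then E(n t) = E(n), so h_t acts on E(n) in the same way on both sides and
      -- the lengths of n and n t do not matter. Otherwise t has the same descent status for w and
      -- for n ∈ W_K w, and the two rules match term by term.
      by_cases hw : ∃ z ∈ parabolicSubgroup cs K, w * cs.simple t = z * w
      · obtain ⟨z, hz, ez⟩ := hw
        have e3 : T.adjacentE K Q s (w * cs.simple t) = T.E n := by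
          rw [ez, T.adjacentE_mul_left hK hz, e1]
        rw [e3] at e2
        have e4 : T.op (basis P (cs.simple t)) (T.E n) = T.act (basis P (cs.simple t)) (T.E n) := by
          rcases lt_or_gt_of_ne (cs.length_mul_simple_ne n t) with h | h
          · rw [T.op_of_gt t n h, ← e2, ← act_add, ← basis_simple_eq]
          · rw [T.op_of_lt t n h, ← e2]
        rw [e1, e4, ← act_mul]
        rcases lt_or_gt_of_ne (cs.length_mul_simple_ne w t) with h | h
        · rw [basis_mul_simple_of_gt P h, map_add, splitting_smul_basis, splitting_smul_basis, e1,
            e3, act_add]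
        · rw [basis_mul_simple_of_lt P h, splitting_basis, e3]
      · push Not at hw
        obtain ⟨⟨x, hx, rfl⟩, -⟩ := hn
        rw [e1]
        rcases lt_or_gt_of_ne (cs.length_mul_simple_ne w t) with h | h
        · have h' : cs.length (x * w * cs.simple t) < cs.length (x * w) := by
            have := length_mul_simple_lt_of_isAdjacent (cs := cs) (P := K) (w := w * cs.simple t)
              (t := t) hx (fun z hz e => hw z⁻¹ (inv_mem hz) (by
                rw [CoxeterSystem.simple_mul_simple_cancel_right] at e
                exact eq_inv_mul_iff_mul_eq.mpr e.symm)) (by simpa using h)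
            simpa [mul_assoc] using this
          rw [basis_mul_simple_of_gt P h, map_add, splitting_smul_basis, splitting_smul_basis, e1,
            e2, T.op_of_gt t _ h', map_add, ← act_mul, ← act_mul, mul_smul_comm, mul_smul_comm,
            mul_one]
          have e5 : basis P w * (((simpleUnit P t)⁻¹ : (HeckeAlgebra P)ˣ) : HeckeAlgebra P) =
              basis P (w * cs.simple t) := by
            rw [Units.mul_inv_eq_iff_eq_mul]
            change _ = _ * basis P (cs.simple t)
            rw [basis_mul_simple_of_lt P (by simpa using h),
              CoxeterSystem.simple_mul_simple_cancel_right]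
          rw [e5]
        · rw [basis_mul_simple_of_lt P h, splitting_basis, e2,
            T.op_of_lt t _ (length_mul_simple_lt_of_isAdjacent hx hw h), ← act_mul,
            basis_mul_simple_of_lt P h]
    · rw [T.adjacentE_eq_zero hs, map_zero, map_zero]
      have e2 := T.adjacentE_eq_zero (w := w * cs.simple t) (by rwa [etop])
      rcases lt_or_gt_of_ne (cs.length_mul_simple_ne w t) with h | h
      · rw [basis_mul_simple_of_gt P h, map_add, splitting_smul_basis, splitting_smul_basis,
          e2, T.adjacentE_eq_zero hs, map_zero, map_zero, add_zero]
      · rw [basis_mul_simple_of_lt P h, splitting_basis, e2, map_zero]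

theorem op_smul (r : R) (x : HeckeAlgebra P) (y : U) :
    T.op (r • x) y = T.act (r • 1) (T.op x y) := by
  rw [← T.op_smul_one, ← T.op_mul, mul_smul_comm, mul_one]

theorem splitting_mul (hK : K \ {s} ⊆ K') {c : HeckeAlgebra P} (hc : c ∈ parabolicSubalgebra P Q)
    (x : HeckeAlgebra P) : T.splitting K Q s (x * c) = T.op c (T.splitting K Q s x) := by
  revert x
  refine parabolicSubalgebra_induction P (p := fun c => ∀ x, T.splitting K Q s (x * c) =
    T.op c (T.splitting K Q s x)) ?_ ?_ ?_ ?_ ?_ hc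
  · intro x; simp
  · intro x; rw [mul_one, T.op_one]; rfl
  · intro c c' h h' x; rw [mul_add, map_add, h, h', map_add]; rfl
  · intro r c h x; rw [mul_smul_comm, splitting_smul, h, op_smul]
  · intro c i hi h x; rw [← mul_assoc, T.splitting_mul_simple hK hi, h, T.op_mul]

/-- The value of the splitting, in terms of an adjacent element. -/
theorem splitting_basis_eq (hK : K \ {s} ⊆ K') {w n : W}
    (hs : descent cs Q (top cs K Q w) = some s) (h : IsAdjacent cs K Q w n) :
    T.splitting K Q s (basis P w) = T.act (basis P w) (T.E n) := by
  rw [splitting_basis, T.adjacentE_eq hK hs h]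

theorem splitting_basis_eq_zero {w : W} (hs : descent cs Q (top cs K Q w) ≠ some s) :
    T.splitting K Q s (basis P w) = 0 := by
  rw [splitting_basis, T.adjacentE_eq_zero hs, map_zero]

end Translation

end Translation

end Hecke

namespace Hecke

set_option linter.unusedSectionVars false

/-! ### Maps out of A ⊗_C M and the two actions on A ⊗_C A -/

section InducedMaps

open CategoryTheory

variable {R : Type u} {A : Type w} [CommRing R] [Ring A] [Algebra R A] {C : Subalgebra R A}
  {M N Y : ModuleCat.{w} A}

theorem induced_hom_ext {f g : (induced C).obj N ⟶ Y}
    (h : ∀ n, f.hom (inducedMk C 1 n) = g.hom (inducedMk C 1 n)) : f = g := by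
  apply ModuleCat.hom_ext
  apply LinearMap.ext
  intro y
  induction y using induced_induction with
  | h0 => rw [map_zero, map_zero]
  | hadd x y hx hy => rw [map_add, map_add, hx, hy]
  | hmk x n =>
    have e : inducedMk C x n = x • inducedMk C 1 n := by rw [smul_inducedMk, mul_one]
    rw [e, map_smul, map_smul, h]

/-- The biadditive map `(x, m) ↦ x f(m)`. -/
def smulComp (f : M →+ Y) : A →+ M →+ Y :=
  AddMonoidHom.mk' (fun x => AddMonoidHom.mk' (fun m => x • f m)
      (fun m m' => by rw [map_add, smul_add]))
    (fun x x' => AddMonoidHom.ext fun m => add_smul x x' (f m))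

theorem smulComp_apply (f : M →+ Y) (x : A) (m : M) : smulComp f x m = x • f m := rfl

theorem smulComp_mul (f : M →+ Y) (hf : ∀ c ∈ C, ∀ m, f (c • m) = c • f m) :
    ∀ x, ∀ c ∈ C, ∀ m, smulComp f (x * c) m = smulComp f x (c • m) := fun x c hc m => by
  rw [smulComp_apply, smulComp_apply, hf c hc, mul_smul]

theorem inducedLift_smulComp_smul (f : M →+ Y) (hf : ∀ c ∈ C, ∀ m, f (c • m) = c • f m) (a : A)
    (y : (induced C).obj M) : inducedLift (smulComp f) (smulComp_mul f hf) (a • y) =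
      a • inducedLift (smulComp f) (smulComp_mul f hf) y := by
  induction y using induced_induction with
  | h0 => rw [smul_zero, map_zero, smul_zero]
  | hadd x y hx hy => rw [smul_add, map_add, map_add, smul_add, hx, hy]
  | hmk x n =>
    rw [smul_inducedMk, inducedLift_mk, inducedLift_mk, smulComp_apply, smulComp_apply, mul_smul]

/-- The map `A ⊗_C M ⟶ Y` given by a `C`-linear map. -/
noncomputable def inducedDesc (f : M →+ Y) (hf : ∀ c ∈ C, ∀ m, f (c • m) = c • f m) :
    (induced C).obj M ⟶ Y :=
  ModuleCat.ofHom
    { toFun := inducedLift (smulComp f) (smulComp_mul f hf)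
      map_add' := fun y y' => map_add _ y y'
      map_smul' := fun a y => inducedLift_smulComp_smul f hf a y }

theorem inducedDesc_mk (f : M →+ Y) (hf : ∀ c ∈ C, ∀ m, f (c • m) = c • f m) (x : A) (m : M) :
    (inducedDesc f hf).hom (inducedMk C x m) = x • f m := inducedLift_mk (smulComp f) (smulComp_mul f hf) x m

variable (N) in
/-- The map `a ↦ a n`. -/
def orbitMap (n : N) : ModuleCat.of A A ⟶ N := ModuleCat.ofHom (LinearMap.toSpanSingleton A N n)

/-- Right multiplication by `a`. -/
def mulRightMap (a : A) : ModuleCat.of A A ⟶ ModuleCat.of A A :=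
  ModuleCat.ofHom (LinearMap.toSpanSingleton A A a)

variable (C N) in
/-- The map `a ↦ a ⊗ n` to `A ⊗_C N`. -/
noncomputable def inducedOrbit (n : N) : ModuleCat.of A A ⟶ (induced C).obj N :=
  ModuleCat.ofHom
    { toFun := fun a => inducedMk C a n
      map_add' := fun a b => inducedMk_add_left a b n
      map_smul' := fun a b => (smul_inducedMk a b n).symm }

variable (C) in
/-- The action of `A` on the left factor of `A ⊗_C A`. -/
noncomputable def leftAction : A →+* AddMonoid.End ((induced C).obj (ModuleCat.of A A)) :=
  Module.toAddMonoidEnd A _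

theorem leftAction_apply (a : A) (y : (induced C).obj (ModuleCat.of A A)) :
    leftAction C a y = a • y := rfl

variable (C) in
/-- The right action of `A` on the right factor of `A ⊗_C A`. -/
noncomputable def rightAction : A →+ AddMonoid.End ((induced C).obj (ModuleCat.of A A)) :=
  AddMonoidHom.mk' (fun a => (((induced C).map (mulRightMap a)).hom :
      (induced C).obj (ModuleCat.of A A) →+ (induced C).obj (ModuleCat.of A A)))
    (fun a b => by
      refine AddMonoidHom.ext fun y => ?_
      change ((induced C).map (mulRightMap (a + b))).hom y =
        ((induced C).map (mulRightMap a)).hom y + ((induced C).map (mulRightMap b)).hom y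
      have e : mulRightMap (a + b) = mulRightMap a + mulRightMap b := by
        ext
        exact mul_add 1 a b
      rw [e, Functor.map_add]
      rfl)

theorem rightAction_apply (a : A) (y : (induced C).obj (ModuleCat.of A A)) :
    rightAction C a y = ((induced C).map (mulRightMap a)).hom y := rfl

theorem rightAction_mk (a x : A) (y : ModuleCat.of A A) :
    rightAction C a (inducedMk C x y) = inducedMk C x (N := ModuleCat.of A A) (y * a : A) := rfl

theorem rightAction_one : rightAction C (1 : A) = 1 := by
  ext y
  induction y using induced_induction with
  | h0 => rw [map_zero, map_zero]
  | hadd x y hx hy => rw [map_add, map_add, hx, hy]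
  | hmk x n => rw [rightAction_mk, mul_one]; rfl

theorem rightAction_mul (a b : A) (y : (induced C).obj (ModuleCat.of A A)) :
    rightAction C (a * b) y = rightAction C b (rightAction C a y) := by
  induction y using induced_induction with
  | h0 => simp only [map_zero]
  | hadd x y hx hy => simp only [map_add, hx, hy]
  | hmk x n => rw [rightAction_mk, rightAction_mk, rightAction_mk, mul_assoc]

theorem rightAction_smul (a b : A) (y : (induced C).obj (ModuleCat.of A A)) :
    rightAction C a (b • y) = b • rightAction C a y := map_smul ((induced C).map (mulRightMap a)).hom b y

theorem inducedMk_smul_self (r : R) (x y : A) :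
    inducedMk C (r • x) (N := ModuleCat.of A A) y =
      inducedMk C x (N := ModuleCat.of A A) (r • y : A) := by
  have h := inducedMk_mul (N := ModuleCat.of A A) x (Subalgebra.smul_mem C (one_mem _) r) y
  rw [mul_smul_comm, mul_one] at h
  refine h.trans (congrArg _ ?_)
  change (r • (1 : A)) * y = _
  rw [smul_mul_assoc, one_mul]

theorem rightAction_smul_one (r : R) (y : (induced C).obj (ModuleCat.of A A)) :
    rightAction C (r • 1) y = (r • 1 : A) • y := by
  induction y using induced_induction with
  | h0 => rw [map_zero, smul_zero]
  | hadd x y hx hy => rw [map_add, smul_add, hx, hy]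
  | hmk x n =>
    rw [rightAction_mk, smul_inducedMk, mul_smul_comm, mul_one, smul_mul_assoc, one_mul,
      inducedMk_smul_self]

end InducedMaps

/-! ### The elements h_n⁻¹ ⊗ h_n and their mirror images -/

section Instances

open CategoryTheory HeckeAlgebra

variable {B W : Type v} [Group W] {M : CoxeterMatrix B} {cs : CoxeterSystem M W}
  {R : Type u} [CommRing R] (P : Parameters cs R) (K : Set B)

/-- The element `h_n⁻¹ ⊗ h_n`. -/
noncomputable def invTensor (n : W) :
    (induced (parabolicSubalgebra P K)).obj (ModuleCat.of _ (HeckeAlgebra P)) :=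
  inducedMk (parabolicSubalgebra P K) (((basisUnit P n)⁻¹ : (HeckeAlgebra P)ˣ) : HeckeAlgebra P)
    (N := ModuleCat.of _ (HeckeAlgebra P)) (basis P n)

/-- The element `h_{n⁻¹} ⊗ h_{n⁻¹}⁻¹`. -/
noncomputable def tensorInv (n : W) :
    (induced (parabolicSubalgebra P K)).obj (ModuleCat.of _ (HeckeAlgebra P)) :=
  inducedMk (parabolicSubalgebra P K) (basis P n⁻¹)
    (N := ModuleCat.of _ (HeckeAlgebra P))
    (((basisUnit P n⁻¹)⁻¹ : (HeckeAlgebra P)ˣ) : HeckeAlgebra P)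

/-- Invariance needs checking only when s_i n is longer than n: the other case is the same identity
read backwards. -/
theorem eq_of_simple_mul {U : Type*} (E : W → U)
    (h : ∀ i ∈ K, ∀ n, cs.length n < cs.length (cs.simple i * n) → E (cs.simple i * n) = E n)
    {y : W} (hy : y ∈ parabolicSubgroup cs K) (n : W) : E (y * n) = E n := by
  have h' : ∀ i ∈ K, ∀ n, E (cs.simple i * n) = E n := by
    intro i hi n
    rcases lt_or_gt_of_ne (cs.length_simple_mul_ne n i) with h1 | h1
    · have := h i hi (cs.simple i * n) (by simpa using h1)
      rw [CoxeterSystem.simple_mul_simple_cancel_left] at this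
      exact this.symm
    · exact h i hi n h1
  induction hy using parabolic_induction_right generalizing n with
  | one => rw [one_mul]
  | mul y hy i hi ih => rw [mul_assoc, ih, h' i hi]

theorem basisUnit_mul_simple {n : W} {t : B} (h : cs.length n < cs.length (n * cs.simple t)) :
    basisUnit P (n * cs.simple t) = basisUnit P n * simpleUnit P t :=
  Units.ext (basis_mul_simple_of_lt P h).symm

theorem basisUnit_simple_mul {n : W} {t : B} (h : cs.length n < cs.length (cs.simple t * n)) :
    basisUnit P (cs.simple t * n) = simpleUnit P t * basisUnit P n :=
  Units.ext (basis_simple_mul_of_lt P h).symm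

theorem simpleUnit_mem {i : B} (hi : i ∈ K) :
    ((simpleUnit P i : (HeckeAlgebra P)ˣ) : HeckeAlgebra P) ∈ parabolicSubalgebra P K :=
  basis_mem (simple_mem_parabolicSubgroup cs hi)

/-- For s n longer than n the element is h_n⁻¹ h_s⁻¹ ⊗ h_s h_n, and h_s ∈ H_K slides across the
tensor sign and cancels. -/
theorem invTensor_mul {y : W} (hy : y ∈ parabolicSubgroup cs K) (n : W) :
    invTensor P K (y * n) = invTensor P K n := by
  refine eq_of_simple_mul K (invTensor P K) (fun i hi n h => ?_) hy n
  have h1 := basis_simple_mul_of_lt P h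
  rw [invTensor, invTensor, basisUnit_simple_mul P h, mul_inv_rev, Units.val_mul, ← h1]
  have e := inducedMk_mul (C := parabolicSubalgebra P K) (N := ModuleCat.of _ (HeckeAlgebra P))
    ((((basisUnit P n)⁻¹ : (HeckeAlgebra P)ˣ) : HeckeAlgebra P) *
      (((simpleUnit P i)⁻¹ : (HeckeAlgebra P)ˣ) : HeckeAlgebra P))
    (simpleUnit_mem P K hi) (basis P n)
  rw [mul_assoc, Units.inv_mul, mul_one] at e
  exact e.symm

theorem tensorInv_mul {y : W} (hy : y ∈ parabolicSubgroup cs K) (n : W) :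
    tensorInv P K (y * n) = tensorInv P K n := by
  refine eq_of_simple_mul K (tensorInv P K) (fun i hi n h => ?_) hy n
  have h' : cs.length n⁻¹ < cs.length (n⁻¹ * cs.simple i) := by
    rw [cs.length_inv, ← cs.length_inv (n⁻¹ * _)]
    simpa using h
  have h1 := basis_mul_simple_of_lt P h'
  rw [tensorInv, tensorInv, mul_inv_rev, cs.inv_simple, basisUnit_mul_simple P h', mul_inv_rev,
    Units.val_mul, ← h1]
  refine (inducedMk_mul (C := parabolicSubalgebra P K) (N := ModuleCat.of _ (HeckeAlgebra P))
    (basis P n⁻¹) (simpleUnit_mem P K hi) _).trans ?_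
  congr 1
  change _ * (_ * _) = _
  rw [← mul_assoc, Units.mul_inv, one_mul]

/-- The elements `h_n⁻¹ ⊗ h_n`. -/
noncomputable def leftTranslation : Translation P K
    ((induced (parabolicSubalgebra P K)).obj (ModuleCat.of _ (HeckeAlgebra P))) where
  act := leftAction _
  op := rightAction _
  op_one := rightAction_one
  op_mul := rightAction_mul
  op_smul_one r := AddMonoidHom.ext (rightAction_smul_one r)
  op_act a b u := rightAction_smul a b u
  E := invTensor P K
  E_mul y hy n := invTensor_mul P K hy n
  op_of_lt t n h := by
    rw [leftAction_apply, invTensor, invTensor, rightAction_mk, smul_inducedMk,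
      basis_mul_simple_of_lt P h, basisUnit_mul_simple P h, mul_inv_rev, Units.val_mul,
      ← mul_assoc]
    change _ = inducedMk _ (((simpleUnit P t : (HeckeAlgebra P)ˣ) : HeckeAlgebra P) * _ * _) _
    rw [Units.mul_inv, one_mul]
  op_of_gt t n h := by
    have h' : cs.length (n * cs.simple t) < cs.length (n * cs.simple t * cs.simple t) := by
      simpa using h
    have e := basisUnit_mul_simple P h'
    rw [CoxeterSystem.simple_mul_simple_cancel_right] at e
    have e2 : (((simpleUnit P t)⁻¹ : (HeckeAlgebra P)ˣ) : HeckeAlgebra P) *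
        (((basisUnit P (n * cs.simple t))⁻¹ : (HeckeAlgebra P)ˣ) : HeckeAlgebra P) =
        (((basisUnit P n)⁻¹ : (HeckeAlgebra P)ˣ) : HeckeAlgebra P) := by
      rw [e, mul_inv_rev, Units.val_mul]
    rw [leftAction_apply, leftAction_apply, invTensor, invTensor, rightAction_mk, smul_inducedMk,
      smul_inducedMk, smul_mul_assoc, smul_mul_assoc, one_mul, e2, basis_mul_simple_of_gt P h]
    refine (inducedMk_add_right _ _ _).trans ?_
    rw [inducedMk_smul_self, inducedMk_smul_self]

theorem flip_one : flip P 1 = 1 := by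
  rw [← basis_one, flip_basis, inv_one]

/-- The elements `h_{n⁻¹} ⊗ h_{n⁻¹}⁻¹`. -/
noncomputable def rightTranslation : Translation P K
    ((induced (parabolicSubalgebra P K)).obj (ModuleCat.of _ (HeckeAlgebra P))) where
  -- The two actions are exchanged and twisted by the anti-automorphism, so that the general
  -- construction of splittings also produces the mirrored one.
  act :=
    { toFun := fun a => rightAction _ (flip P a)
      map_one' := by rw [flip_one]; exact rightAction_one
      map_mul' := fun a b => AddMonoidHom.ext fun u => by
        rw [flip_mul]; exact rightAction_mul _ _ _
      map_zero' := by rw [map_zero, map_zero]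
      map_add' := fun a b => by rw [map_add, map_add] }
  op := ((leftAction (parabolicSubalgebra P K) : HeckeAlgebra P →+* _) : HeckeAlgebra P →+ _).comp
    (flip P).toAddMonoidHom
  op_one := by
    change leftAction _ (flip P 1) = 1
    rw [flip_one, map_one]
  op_mul a b u := by
    change leftAction _ (flip P (a * b)) u = leftAction _ (flip P b) (leftAction _ (flip P a) u)
    rw [flip_mul, leftAction_apply, mul_smul]
    rfl
  op_smul_one r := by
    refine AddMonoidHom.ext fun u => ?_
    change (flip P (r • 1)) • u = rightAction _ (flip P (r • 1)) u
    rw [map_smul, flip_one, rightAction_smul_one]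
  op_act a b u := (rightAction_smul (HeckeAlgebra.flip P b) (HeckeAlgebra.flip P a) u).symm
  E := tensorInv P K
  E_mul y hy n := tensorInv_mul P K hy n
  op_of_lt t n h := by
    have h' : cs.length n⁻¹ < cs.length (cs.simple t * n⁻¹) := by
      rw [cs.length_inv, ← cs.length_inv (_ * n⁻¹)]
      simpa using h
    change flip P (basis P (cs.simple t)) • tensorInv P K n =
      rightAction _ (flip P (basis P (cs.simple t))) (tensorInv P K (n * cs.simple t))
    rw [flip_basis, cs.inv_simple, tensorInv, tensorInv, rightAction_mk, smul_inducedMk,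
      mul_inv_rev, cs.inv_simple, basis_simple_mul_of_lt P h', basisUnit_simple_mul P h',
      mul_inv_rev, Units.val_mul, mul_assoc]
    change _ = inducedMk _ _ (_ * (_ * ((simpleUnit P t : (HeckeAlgebra P)ˣ) : HeckeAlgebra P)))
    rw [Units.inv_mul, mul_one]
  op_of_gt t n h := by
    have h' : cs.length (cs.simple t * n⁻¹) < cs.length n⁻¹ := by
      rw [cs.length_inv, ← cs.length_inv (_ * n⁻¹)]
      simpa using h
    have e := basisUnit_simple_mul P (n := cs.simple t * n⁻¹) (t := t) (by simpa using h')
    rw [CoxeterSystem.simple_mul_simple_cancel_left] at e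
    have e2 : (((basisUnit P (cs.simple t * n⁻¹))⁻¹ : (HeckeAlgebra P)ˣ) : HeckeAlgebra P) *
        (((simpleUnit P t)⁻¹ : (HeckeAlgebra P)ˣ) : HeckeAlgebra P) =
        (((basisUnit P n⁻¹)⁻¹ : (HeckeAlgebra P)ˣ) : HeckeAlgebra P) := by
      rw [e, mul_inv_rev, Units.val_mul]
    have e3 : flip P (((simpleUnit P t)⁻¹ : (HeckeAlgebra P)ˣ) : HeckeAlgebra P) =
        (((simpleUnit P t)⁻¹ : (HeckeAlgebra P)ˣ) : HeckeAlgebra P) := by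
      rw [inv_simpleUnit, map_smul, map_sub, map_smul, flip_one, flip_basis, cs.inv_simple]
    change flip P (basis P (cs.simple t)) • tensorInv P K n =
      rightAction _ (flip P (((P.q t : R) - 1) • 1)) (tensorInv P K n) +
        rightAction _ (flip P ((P.q t : R) •
          (((simpleUnit P t)⁻¹ : (HeckeAlgebra P)ˣ) : HeckeAlgebra P)))
          (tensorInv P K (n * cs.simple t))
    have e4 : flip P (((P.q t : R) - 1) • 1) = ((P.q t : R) - 1) • 1 := by
      rw [map_smul, flip_one]
    rw [e4, map_smul (flip P), e3, flip_basis, cs.inv_simple, tensorInv, tensorInv,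
      rightAction_mk, rightAction_mk, smul_inducedMk, mul_inv_rev, cs.inv_simple, mul_smul_comm,
      mul_smul_comm, mul_one, e2, basis_simple_mul_of_gt P h', inducedMk_add_left,
      inducedMk_smul_self, inducedMk_smul_self]

end Instances

end Hecke

namespace Hecke

/-! ### Cells of a complex of bimodules and of the functor it defines -/

section Decomposition

open CategoryTheory TensorProduct

/-- A description of a complex of modules in terms of cells. -/
structure CellDecomposition {T : Type u} [Ring T] (Z : CochainComplex (ModuleCat.{z} T) ℤ)
    (κ : Type v) [Fintype κ] (ρ : Type w) where
  /-- the degree of a cell -/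
  deg : κ → ℤ
  /-- the labels of the components of the differential -/
  act : κ → Finset ρ
  /-- the targets of the components of the differential -/
  tgt : κ → ρ → κ
  /-- the signs in the differential -/
  sgn : κ → ρ → ℤ
  /-- the module attached to a cell -/
  F : κ → ModuleCat.{z} T
  /-- the components of the differential -/
  δ : ∀ k r, F k ⟶ F (tgt k r)
  deg_tgt : ∀ k, ∀ r ∈ act k, deg (tgt k r) = deg k + 1
  /-- the inclusions of the cells -/
  ι : ∀ k n, F k ⟶ Z.X n
  /-- the projections to the cells -/
  π : ∀ k n, Z.X n ⟶ F k
  ι_eq_zero : ∀ k n, deg k ≠ n → ι k n = 0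
  ι_π : ∀ k n, deg k = n → ι k n ≫ π k n = 𝟙 _
  ι_π_of_ne : ∀ k k' n, k ≠ k' → ι k n ≫ π k' n = 0
  sum_π_ι : ∀ n, ∑ k, π k n ≫ ι k n = 𝟙 _
  ι_d : ∀ k n, deg k = n → ι k n ≫ Z.d n (n + 1) =
    ∑ r ∈ act k, sgn k r • δ k r ≫ ι (tgt k r) (n + 1)

namespace CellDecomposition

variable {A : Type u₂} [Ring A] {T : Type u₁} [Ring T]
  {Z : CochainComplex (ModuleCat.{u₅} T) ℤ} {κ : Type u₃} [Fintype κ] {ρ : Type u₄}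
  (c : CellDecomposition Z κ ρ)
  (b : ModuleCat.{u₅} T ⥤ ModuleCat.{u₅} A ⥤ ModuleCat.{u₅} A) [b.Additive]
  [∀ X, (b.obj X).Additive]

/-- The system of cells which describes the functor `b(Z, -)`. -/
def cellSystem : CellSystem.{u₂, u₃, u₄, u₅} A κ ρ where
  deg := c.deg
  act := c.act
  tgt := c.tgt
  sgn := c.sgn
  G k := b.obj (c.F k)
  additive _ := inferInstance
  D k r := b.map (c.δ k r)
  deg_tgt := c.deg_tgt

variable (L L' : CochainComplex (ModuleCat.{u₅} A) ℤ) (k k' : κ) (a a' n : ℤ)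

/-- The inclusions of the cells in `b(Z, L)`. -/
noncomputable def totalι : (b.obj (c.F k)).obj (L.X a) ⟶
    (HomologicalComplex.mapBifunctor Z L b (ComplexShape.up ℤ)).X n :=
  (b.map (c.ι k (c.deg k))).app (L.X a) ≫
    HomologicalComplex.ιMapBifunctorOrZero Z L b (ComplexShape.up ℤ) (c.deg k) a n

/-- The projections to the cells of `b(Z, L)`. -/
noncomputable def totalπ : (HomologicalComplex.mapBifunctor Z L b (ComplexShape.up ℤ)).X n ⟶
    (b.obj (c.F k)).obj (L.X a) :=
  HomologicalComplex.mapBifunctorDesc (K₁ := Z) (K₂ := L)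
    (F := b) (c := ComplexShape.up ℤ) fun i j _ =>
      if h : j = a then (b.map (c.π k i)).app (L.X j) ≫
        (b.obj (c.F k)).map (L.XIsoOfEq h).hom else 0

variable {a n} in
theorem totalι_eq (h : c.deg k + a = n) : c.totalι b L k a n =
    (b.map (c.ι k (c.deg k))).app (L.X a) ≫
      HomologicalComplex.ιMapBifunctor Z L b (ComplexShape.up ℤ) (c.deg k) a n h := by
  rw [totalι, HomologicalComplex.ιMapBifunctorOrZero_eq _ _ _ _ _ _ _ h]

theorem totalι_eq_zero (h : c.deg k + a ≠ n) : c.totalι b L k a n = 0 := by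
  rw [totalι, HomologicalComplex.ιMapBifunctorOrZero_eq_zero _ _ _ _ _ _ _ h, Limits.comp_zero]

theorem ιMapBifunctor_totalπ (i j : ℤ) (h : i + j = n) :
    HomologicalComplex.ιMapBifunctor Z L b (ComplexShape.up ℤ) i j n h ≫ c.totalπ b L k a n =
      if h : j = a then (b.map (c.π k i)).app (L.X j) ≫
        (b.obj (c.F k)).map (L.XIsoOfEq h).hom else 0 :=
  HomologicalComplex.ι_mapBifunctorDesc _ _ _ _

theorem ιMapBifunctor_totalπ_self (i : ℤ) (h : i + a = n) :
    HomologicalComplex.ιMapBifunctor Z L b (ComplexShape.up ℤ) i a n h ≫ c.totalπ b L k a n =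
      (b.map (c.π k i)).app (L.X a) := by
  rw [ιMapBifunctor_totalπ, dif_pos rfl, HomologicalComplex.XIsoOfEq_rfl, Iso.refl_hom,
    CategoryTheory.Functor.map_id, Category.comp_id]

theorem totalι_totalπ (h : c.deg k + a = n) : c.totalι b L k a n ≫ c.totalπ b L k a n = 𝟙 _ := by
  rw [c.totalι_eq b L k h, Category.assoc, ιMapBifunctor_totalπ_self, ← NatTrans.comp_app,
    ← Functor.map_comp, c.ι_π _ _ rfl, CategoryTheory.Functor.map_id, NatTrans.id_app]

theorem totalι_totalπ_of_ne (h : k ≠ k') :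
    c.totalι b L k a n ≫ c.totalπ b L k' a' n = 0 := by
  by_cases hn : c.deg k + a = n
  · rw [c.totalι_eq b L k hn, Category.assoc, ιMapBifunctor_totalπ]
    split_ifs with ha
    · rw [← Category.assoc, ← NatTrans.comp_app, ← Functor.map_comp, c.ι_π_of_ne _ _ _ h,
        Functor.map_zero, NatTrans.app_zero, Limits.zero_comp]
    · exact Limits.comp_zero
  · rw [c.totalι_eq_zero b L k a n hn, Limits.zero_comp]

theorem sum_totalπ_totalι :
    ∑ k, c.totalπ b L k (n - c.deg k) n ≫ c.totalι b L k (n - c.deg k) n = 𝟙 _ := by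
  refine HomologicalComplex.mapBifunctor.hom_ext fun i j h => ?_
  have h : i + j = n := h
  rw [Preadditive.comp_sum]
  have key : ∀ k, HomologicalComplex.ιMapBifunctor Z L b
      (ComplexShape.up ℤ) i j n h ≫ c.totalπ b L k (n - c.deg k) n ≫
        c.totalι b L k (n - c.deg k) n =
      (b.map (c.π k i ≫ c.ι k i)).app (L.X j) ≫
        HomologicalComplex.ιMapBifunctor Z L b (ComplexShape.up ℤ) i j n h := by
    intro k
    by_cases hk : c.deg k = i
    · subst hk
      obtain rfl : j = n - c.deg k := by omega
      rw [← Category.assoc, ιMapBifunctor_totalπ_self, c.totalι_eq b L k h, ← Category.assoc,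
        ← NatTrans.comp_app, ← Functor.map_comp]
    · rw [← Category.assoc, ιMapBifunctor_totalπ, dif_neg (by omega), Limits.zero_comp,
        c.ι_eq_zero k i hk, Limits.comp_zero, Functor.map_zero, NatTrans.app_zero,
        Limits.zero_comp]
  rw [Finset.sum_congr rfl fun k _ => key k, ← Preadditive.sum_comp, ← NatTrans.app_sum,
    ← Functor.map_sum, c.sum_π_ι, CategoryTheory.Functor.map_id, NatTrans.id_app,
    Category.id_comp, Category.comp_id]

/-- The sign conventions of total complexes leave the differential of Z unchanged and multiply the
differential of L by (-1)^(deg k). -/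
theorem totalι_d (h : c.deg k + a = n) :
    c.totalι b L k a n ≫ (HomologicalComplex.mapBifunctor Z L b (ComplexShape.up ℤ)).d n (n + 1) =
      ∑ r ∈ c.act k, c.sgn k r • (b.map (c.δ k r)).app (L.X a) ≫
        c.totalι b L (c.tgt k r) a (n + 1) +
      ((c.deg k).negOnePow : ℤ) • (b.obj (c.F k)).map (L.d a (a + 1)) ≫
        c.totalι b L k (a + 1) (n + 1) := by
  rw [c.totalι_eq b L k h, Category.assoc, HomologicalComplex.mapBifunctor.d_eq,
    Preadditive.comp_add, HomologicalComplex.mapBifunctor.ι_D₁,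
    HomologicalComplex.mapBifunctor.ι_D₂, Preadditive.comp_add,
    HomologicalComplex.mapBifunctor.d₁_eq (i₁' := c.deg k + 1) _ _ _ _ (by simp) _ _
      (show c.deg k + 1 + a = n + 1 by omega),
    HomologicalComplex.mapBifunctor.d₂_eq (i₂' := a + 1) _ _ _ _ _ (by simp) _
      (show c.deg k + (a + 1) = n + 1 by omega)]
  refine congrArg₂ (· + ·) ?_ ?_
  · have e : ∀ r ∈ c.act k, c.sgn k r • (b.map (c.δ k r)).app (L.X a) ≫
        c.totalι b L (c.tgt k r) a (n + 1) =
        (b.map (c.sgn k r • c.δ k r ≫ c.ι (c.tgt k r) (c.deg k + 1))).app (L.X a) ≫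
          HomologicalComplex.ιMapBifunctor Z L b (ComplexShape.up ℤ) (c.deg k + 1) a (n + 1)
            (show c.deg k + 1 + a = n + 1 by omega) := by
      intro r hr
      have hd := c.deg_tgt k r hr
      rw [totalι, hd, HomologicalComplex.ιMapBifunctorOrZero_eq _ _ _ _ _ _ _
        (show c.deg k + 1 + a = n + 1 by omega), Functor.map_zsmul, NatTrans.app_zsmul,
        Preadditive.zsmul_comp, Functor.map_comp, NatTrans.comp_app, Category.assoc]
    rw [Finset.sum_congr rfl e, ← Preadditive.sum_comp, ← NatTrans.app_sum, ← Functor.map_sum,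
      ← c.ι_d k _ rfl, Functor.map_comp, NatTrans.comp_app, Category.assoc,
      show ComplexShape.ε₁ (ComplexShape.up ℤ) (ComplexShape.up ℤ) (ComplexShape.up ℤ)
        (c.deg k, a) = 1 from rfl, one_smul]
  · rw [c.totalι_eq b L k (show c.deg k + (a + 1) = n + 1 by omega),
      show ComplexShape.ε₂ (ComplexShape.up ℤ) (ComplexShape.up ℤ) (ComplexShape.up ℤ)
        (c.deg k, a) = (c.deg k).negOnePow from rfl, Units.smul_def, Preadditive.comp_zsmul,
      ← NatTrans.naturality_assoc]

theorem totalι_map {L L' : CochainComplex (ModuleCat.{u₅} A) ℤ} (φ : L ⟶ L') :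
    c.totalι b L k a n ≫ (HomologicalComplex.mapBifunctorMap (𝟙 Z) φ b (ComplexShape.up ℤ)).f n =
      (b.obj (c.F k)).map (φ.f a) ≫ c.totalι b L' k a n := by
  by_cases h : c.deg k + a = n
  · rw [c.totalι_eq b L k h, c.totalι_eq b L' k h, Category.assoc,
      HomologicalComplex.ι_mapBifunctorMap, HomologicalComplex.id_f,
      CategoryTheory.Functor.map_id, NatTrans.id_app, Category.id_comp,
      NatTrans.naturality_assoc]
  · rw [c.totalι_eq_zero b L k a n h, c.totalι_eq_zero b L' k a n h, Limits.zero_comp,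
      Limits.comp_zero]

/-- The description of `b(Z, -)` in terms of cells. -/
noncomputable def presentation :
    Presentation (c.cellSystem b) (b.map₂CochainComplex.obj Z) where
  ι := c.totalι b
  π := c.totalπ b
  ι_eq_zero := c.totalι_eq_zero b
  ι_π := c.totalι_totalπ b
  ι_π_of_ne := fun L k k' a a' n => c.totalι_totalπ_of_ne b L k k' a a' n
  sum_π_ι := c.sum_totalπ_totalι b
  ι_d := c.totalι_d b
  ι_map φ k a n := c.totalι_map b k a n φ

end CellDecomposition

end Decomposition

end Hecke

namespace Hecke

/-! ### Cells of a composition of total complex functors -/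

section Composition

open CategoryTheory

variable {A : Type u} [Ring A] {κ : Type v} [Fintype κ] {ρ : Type w} {κ' : Type u₁} [Fintype κ']
  {ρ' : Type u₂}

/-- The system of cells which describes a composition of functors, where the first system
describes the functor which is applied last. -/
def CellSystem.comp (𝒮 : CellSystem.{u, v, w, z} A κ ρ) (𝒮' : CellSystem.{u, u₁, u₂, z} A κ' ρ') :
    CellSystem.{u, max v u₁, max w u₂, z} A (κ × κ') (ρ ⊕ ρ') where
  deg k := 𝒮.deg k.1 + 𝒮'.deg k.2
  act k := (𝒮.act k.1).disjSum (𝒮'.act k.2)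
  tgt k := Sum.elim (fun r => (𝒮.tgt k.1 r, k.2)) (fun r => (k.1, 𝒮'.tgt k.2 r))
  -- The differential of the inner cell is part of the coefficients of the outer one, hence carries
  -- the sign of the outer degree.
  sgn k := Sum.elim (fun r => 𝒮.sgn k.1 r) (fun r => (𝒮.deg k.1).negOnePow * 𝒮'.sgn k.2 r)
  G k := 𝒮'.G k.2 ⋙ 𝒮.G k.1
  additive k := inferInstance
  D k r := match r with
    | .inl r => Functor.whiskerLeft (𝒮'.G k.2) (𝒮.D k.1 r)
    | .inr r => Functor.whiskerRight (𝒮'.D k.2 r) (𝒮.G k.1)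
  deg_tgt k r hr := by
    rcases r with r | r
    · have := 𝒮.deg_tgt k.1 r (Finset.inl_mem_disjSum.mp hr)
      simp only [Sum.elim_inl]
      omega
    · have := 𝒮'.deg_tgt k.2 r (Finset.inr_mem_disjSum.mp hr)
      simp only [Sum.elim_inr]
      omega

/-- The system of cells which describes a composition of functors, where the first system
describes the functor which is applied first. -/
def CellSystem.compSwap (𝒮' : CellSystem.{u, u₁, u₂, z} A κ' ρ')
    (𝒮 : CellSystem.{u, v, w, z} A κ ρ) :
    CellSystem.{u, max v u₁, max w u₂, z} A (κ' × κ) (ρ' ⊕ ρ) where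
  deg k := 𝒮'.deg k.1 + 𝒮.deg k.2
  act k := (𝒮'.act k.1).disjSum (𝒮.act k.2)
  tgt k := Sum.elim (fun r => (𝒮'.tgt k.1 r, k.2)) (fun r => (k.1, 𝒮.tgt k.2 r))
  -- Only the order of the indices differs from `CellSystem.comp`: the inner cell comes first and
  -- again carries the sign of the outer degree. Both compositions of X and Y thus get cells indexed
  -- by (I, J) in this order.
  sgn k := Sum.elim (fun r => (𝒮.deg k.2).negOnePow * 𝒮'.sgn k.1 r) (fun r => 𝒮.sgn k.2 r)
  G k := 𝒮'.G k.1 ⋙ 𝒮.G k.2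
  additive k := inferInstance
  D k r := match r with
    | .inl r => Functor.whiskerRight (𝒮'.D k.1 r) (𝒮.G k.2)
    | .inr r => Functor.whiskerLeft (𝒮'.G k.1) (𝒮.D k.2 r)
  deg_tgt k r hr := by
    rcases r with r | r
    · have := 𝒮'.deg_tgt k.1 r (Finset.inl_mem_disjSum.mp hr)
      simp only [Sum.elim_inl]
      omega
    · have := 𝒮.deg_tgt k.2 r (Finset.inr_mem_disjSum.mp hr)
      simp only [Sum.elim_inr]
      omega

namespace Presentation

variable {𝒮 : CellSystem.{u, v, w, z} A κ ρ} {𝒮' : CellSystem.{u, u₁, u₂, z} A κ' ρ'}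
  {Θ Θ' : CochainComplex (ModuleCat.{z} A) ℤ ⥤ CochainComplex (ModuleCat.{z} A) ℤ}
  (p : Presentation 𝒮 Θ) (p' : Presentation 𝒮' Θ')

variable (L : CochainComplex (ModuleCat.{z} A) ℤ) (k : κ) (k' : κ') (a n : ℤ)

/-- The inclusions of the cells of a composition. -/
def compι : (𝒮.G k).obj ((𝒮'.G k').obj (L.X a)) ⟶ (Θ.obj (Θ'.obj L)).X n :=
  (𝒮.G k).map (p'.ι L k' a (𝒮'.deg k' + a)) ≫ p.ι (Θ'.obj L) k (𝒮'.deg k' + a) n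

open Classical in
/-- The projections to the cells of a composition. -/
noncomputable def compπ : (Θ.obj (Θ'.obj L)).X n ⟶ (𝒮.G k).obj ((𝒮'.G k').obj (L.X a)) :=
  if 𝒮.deg k + 𝒮'.deg k' + a = n then
    p.π (Θ'.obj L) k (𝒮'.deg k' + a) n ≫ (𝒮.G k).map (p'.π L k' a (𝒮'.deg k' + a)) else 0

variable {k' a} in
theorem compι_eq {m : ℤ} (h : 𝒮'.deg k' + a = m) : p.compι p' L k k' a n =
    (𝒮.G k).map (p'.ι L k' a m) ≫ p.ι (Θ'.obj L) k m n := by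
  subst h
  rfl

variable {k k' a n} in
theorem compπ_eq {m : ℤ} (h : 𝒮'.deg k' + a = m) (hn : 𝒮.deg k + m = n) :
    p.compπ p' L k k' a n = p.π (Θ'.obj L) k m n ≫ (𝒮.G k).map (p'.π L k' a m) := by
  subst h
  rw [compπ, if_pos (by omega)]

theorem compι_compπ (h : 𝒮.deg k + 𝒮'.deg k' + a = n) :
    p.compι p' L k k' a n ≫ p.compπ p' L k k' a n = 𝟙 _ := by
  rw [compι, compπ, if_pos h, Category.assoc, reassoc_of% p.ι_π _ _ _ _ (by omega),
    ← Functor.map_comp, p'.ι_π _ _ _ _ rfl, CategoryTheory.Functor.map_id]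

theorem compι_eq_zero (h : 𝒮.deg k + 𝒮'.deg k' + a ≠ n) : p.compι p' L k k' a n = 0 := by
  rw [compι, p.ι_eq_zero _ _ _ _ (by omega), Limits.comp_zero]

theorem compι_compπ_of_ne (k₂ : κ) (k₂' : κ') (a' : ℤ) (h : (k, k') ≠ (k₂, k₂')) :
    p.compι p' L k k' a n ≫ p.compπ p' L k₂ k₂' a' n = 0 := by
  by_cases hn : 𝒮.deg k + 𝒮'.deg k' + a = n
  · rw [compπ]
    split_ifs with hn'
    · rw [compι, Category.assoc]
      by_cases hk : k = k₂
      · subst hk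
        have hk' : k' ≠ k₂' := fun e => h (by rw [e])
        rw [show 𝒮'.deg k₂' + a' = 𝒮'.deg k' + a by omega,
          reassoc_of% p.ι_π _ _ _ _ (by omega), ← Functor.map_comp,
          p'.ι_π_of_ne _ _ _ _ _ _ hk', Functor.map_zero]
      · rw [← Category.assoc (p.ι _ _ _ _), p.ι_π_of_ne _ _ _ _ _ _ hk, Limits.zero_comp,
          Limits.comp_zero]
    · exact Limits.comp_zero
  · rw [p.compι_eq_zero p' L k k' a n hn, Limits.zero_comp]

theorem sum_compπ_compι : ∑ k : κ × κ', p.compπ p' L k.1 k.2 (n - (𝒮.deg k.1 + 𝒮'.deg k.2)) n ≫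
    p.compι p' L k.1 k.2 (n - (𝒮.deg k.1 + 𝒮'.deg k.2)) n = 𝟙 _ := by
  rw [Fintype.sum_prod_type, ← p.sum_π_ι]
  refine Finset.sum_congr rfl fun k _ => ?_
  have e : ∀ k', p.compπ p' L k k' (n - (𝒮.deg k + 𝒮'.deg k')) n ≫
      p.compι p' L k k' (n - (𝒮.deg k + 𝒮'.deg k')) n =
      p.π (Θ'.obj L) k (n - 𝒮.deg k) n ≫ (𝒮.G k).map
        (p'.π L k' (n - 𝒮.deg k - 𝒮'.deg k') (n - 𝒮.deg k) ≫
          p'.ι L k' (n - 𝒮.deg k - 𝒮'.deg k') (n - 𝒮.deg k)) ≫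
        p.ι (Θ'.obj L) k (n - 𝒮.deg k) n := by
    intro k'
    rw [← sub_sub, p.compπ_eq p' L (k := k) (m := n - 𝒮.deg k) (by omega) (by omega),
      p.compι_eq p' L k n (m := n - 𝒮.deg k) (by omega), Functor.map_comp]
    simp only [Category.assoc]
  rw [Finset.sum_congr rfl fun k' _ => e k', ← Preadditive.comp_sum, ← Preadditive.sum_comp,
    ← Functor.map_sum, p'.sum_π_ι, CategoryTheory.Functor.map_id, Category.id_comp]

theorem compι_d (h : 𝒮.deg k + 𝒮'.deg k' + a = n) :
    p.compι p' L k k' a n ≫ (Θ.obj (Θ'.obj L)).d n (n + 1) =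
      (∑ r ∈ 𝒮.act k, 𝒮.sgn k r • (𝒮.D k r).app ((𝒮'.G k').obj (L.X a)) ≫
          p.compι p' L (𝒮.tgt k r) k' a (n + 1) +
        ∑ r ∈ 𝒮'.act k', (((𝒮.deg k).negOnePow : ℤ) * 𝒮'.sgn k' r) •
          (𝒮.G k).map ((𝒮'.D k' r).app (L.X a)) ≫ p.compι p' L k (𝒮'.tgt k' r) a (n + 1)) +
      ((𝒮.deg k + 𝒮'.deg k').negOnePow : ℤ) • (𝒮.G k).map ((𝒮'.G k').map (L.d a (a + 1))) ≫
        p.compι p' L k k' (a + 1) (n + 1) := by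
  rw [compι, Category.assoc, p.ι_d _ _ _ _ (by omega), Preadditive.comp_add,
    Preadditive.comp_sum]
  refine (congrArg₂ (· + ·) (Finset.sum_congr rfl fun r hr => ?_) ?_).trans (add_assoc _ _ _).symm
  · rw [Preadditive.comp_zsmul, NatTrans.naturality_assoc, compι]
  · rw [Preadditive.comp_zsmul, ← Category.assoc, ← Functor.map_comp, p'.ι_d _ _ _ _ rfl,
      Functor.map_add, Preadditive.add_comp, smul_add, Functor.map_sum, Preadditive.sum_comp,
      Finset.smul_sum]
    refine congrArg₂ (· + ·) (Finset.sum_congr rfl fun r hr => ?_) ?_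
    · have := 𝒮'.deg_tgt k' r hr
      rw [p.compι_eq p' L k (n + 1) (k' := 𝒮'.tgt k' r) (m := 𝒮'.deg k' + a + 1) (by omega),
        mul_smul, Functor.map_zsmul, Preadditive.zsmul_comp, Functor.map_comp, Category.assoc]
    · rw [p.compι_eq p' L k (n + 1) (k' := k') (m := 𝒮'.deg k' + a + 1) (by omega),
        Int.negOnePow_add, Units.val_mul, mul_smul, Functor.map_zsmul, Preadditive.zsmul_comp,
        Functor.map_comp, Category.assoc]

theorem compι_map {L L' : CochainComplex (ModuleCat.{z} A) ℤ} (φ : L ⟶ L') :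
    p.compι p' L k k' a n ≫ (Θ.map (Θ'.map φ)).f n =
      (𝒮.G k).map ((𝒮'.G k').map (φ.f a)) ≫ p.compι p' L' k k' a n := by
  rw [compι, compι, Category.assoc, p.ι_map, ← Category.assoc, ← Functor.map_comp, p'.ι_map,
    Functor.map_comp, Category.assoc]

/-- The description of a composition in terms of cells. -/
noncomputable def comp : Presentation (𝒮.comp 𝒮') (Θ' ⋙ Θ) where
  ι L k := p.compι p' L k.1 k.2
  π L k := p.compπ p' L k.1 k.2
  ι_eq_zero L k := p.compι_eq_zero p' L k.1 k.2
  ι_π L k := p.compι_compπ p' L k.1 k.2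
  ι_π_of_ne L k k₂ a a' n := p.compι_compπ_of_ne p' L k.1 k.2 a n k₂.1 k₂.2 a'
  sum_π_ι L n := p.sum_compπ_compι p' L n
  ι_d L k a n h := by
    refine (p.compι_d p' L k.1 k.2 a n h).trans ?_
    refine congrArg (· + _) (Finset.sum_disjSum (𝒮.act k.1) (𝒮'.act k.2) fun r =>
      (𝒮.comp 𝒮').sgn k r • ((𝒮.comp 𝒮').D k r).app (L.X a) ≫ p.compι p' L
        ((𝒮.comp 𝒮').tgt k r).1 ((𝒮.comp 𝒮').tgt k r).2 a (n + 1)).symm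
  ι_map φ k a n := p.compι_map p' k.1 k.2 a n φ

/-- The description of a composition in terms of cells. -/
noncomputable def compSwap : Presentation (𝒮'.compSwap 𝒮) (Θ' ⋙ Θ) where
  ι L k := p.compι p' L k.2 k.1
  π L k := p.compπ p' L k.2 k.1
  ι_eq_zero L k a n h := p.compι_eq_zero p' L k.2 k.1 a n (by
    rwa [add_comm (𝒮.deg k.2)])
  ι_π L k a n h := p.compι_compπ p' L k.2 k.1 a n (by rwa [add_comm (𝒮.deg k.2)])
  ι_π_of_ne L k k₂ a a' n h := p.compι_compπ_of_ne p' L k.2 k.1 a n k₂.2 k₂.1 a' fun e =>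
    h (Prod.ext (congrArg Prod.snd e) (congrArg Prod.fst e))
  sum_π_ι L n := by
    refine ((Equiv.prodComm κ κ').sum_comp _).symm.trans
      ((Finset.sum_congr rfl fun k _ => ?_).trans (p.sum_compπ_compι p' L n))
    change p.compπ p' L k.1 k.2 (n - (𝒮'.deg k.2 + 𝒮.deg k.1)) n ≫
      p.compι p' L k.1 k.2 (n - (𝒮'.deg k.2 + 𝒮.deg k.1)) n = _
    rw [add_comm (𝒮'.deg k.2)]
  ι_d L k a n h := by
    refine (p.compι_d p' L k.2 k.1 a n (by rw [add_comm (𝒮.deg k.2)]; exact h)).trans ?_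
    rw [add_comm (𝒮.deg k.2)]
    refine congrArg (· + _) ((add_comm _ _).trans
      (Finset.sum_disjSum (𝒮'.act k.1) (𝒮.act k.2) fun r =>
      (𝒮'.compSwap 𝒮).sgn k r • ((𝒮'.compSwap 𝒮).D k r).app (L.X a) ≫ p.compι p' L
        ((𝒮'.compSwap 𝒮).tgt k r).2 ((𝒮'.compSwap 𝒮).tgt k r).1 a (n + 1)).symm)
  ι_map φ k a n := p.compι_map p' k.2 k.1 a n φ

end Presentation

end Composition

end Hecke

namespace Hecke

/-! ### Cells of the complex of a coefficient system -/

section CoefficientCells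

open CategoryTheory

variable {T : Type u} [Ring T] {S : Type v} [LinearOrder S]
  (F : Finset S ⥤ ModuleCat.{max v w} T)

/-- The inclusion of `M^I` in a term of the complex of a coefficient system. -/
noncomputable def coeffι (I : Finset S) (n : ℤ) :
    F.obj I ⟶ ModuleCat.of T (∀ I : {I : Finset S // (I.card : ℤ) = n}, F.obj I.1) :=
  if h : (I.card : ℤ) = n then
    ModuleCat.ofHom (LinearMap.single T (fun I : {I : Finset S // (I.card : ℤ) = n} => F.obj I.1)
      ⟨I, h⟩) else 0

/-- The projection to `M^I` from a term of the complex of a coefficient system. -/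
noncomputable def coeffπ (I : Finset S) (n : ℤ) :
    ModuleCat.of T (∀ I : {I : Finset S // (I.card : ℤ) = n}, F.obj I.1) ⟶ F.obj I :=
  if h : (I.card : ℤ) = n then
    ModuleCat.ofHom (LinearMap.proj (φ := fun I : {I : Finset S // (I.card : ℤ) = n} => F.obj I.1)
      ⟨I, h⟩) else 0

theorem coeffι_eq_zero (I : Finset S) (n : ℤ) (h : (I.card : ℤ) ≠ n) : coeffι F I n = 0 :=
  dif_neg h

theorem coeffι_coeffπ (I : Finset S) (n : ℤ) (h : (I.card : ℤ) = n) :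
    coeffι F I n ≫ coeffπ F I n = 𝟙 _ := by
  rw [coeffι, coeffπ, dif_pos h, dif_pos h, ← ModuleCat.ofHom_comp, LinearMap.proj_comp_single_same]
  rfl

theorem coeffι_coeffπ_of_ne (I J : Finset S) (n : ℤ) (h : I ≠ J) :
    coeffι F I n ≫ coeffπ F J n = 0 := by
  rw [coeffι, coeffπ]
  split_ifs with h1 h2
  · rw [← ModuleCat.ofHom_comp, LinearMap.proj_comp_single_ne]
    · rfl
    · exact fun e => h (congrArg Subtype.val e).symm
  · exact Limits.comp_zero
  · exact Limits.zero_comp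
  · exact Limits.zero_comp

theorem coeffι_apply_same (I : Finset S) {n : ℤ} (h : (I.card : ℤ) = n) (x : F.obj I) :
    (coeffι F I n).hom x ⟨I, h⟩ = x := by
  rw [coeffι, dif_pos h]
  exact Pi.single_eq_same _ _

theorem coeffι_apply_of_ne (I : Finset S) {n : ℤ} (J : {J : Finset S // (J.card : ℤ) = n})
    (h : J.1 ≠ I) (x : F.obj I) : (coeffι F I n).hom x J = 0 := by
  rw [coeffι]
  split_ifs with h1
  · exact Pi.single_eq_of_ne (fun e => h (congrArg Subtype.val e)) _
  · rfl

theorem sum_coeffπ_coeffι [Fintype S] (n : ℤ) :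
    ∑ I : Finset S, coeffπ F I n ≫ coeffι F I n = 𝟙 _ := by
  apply ModuleCat.hom_ext
  apply LinearMap.ext
  intro x
  rw [ModuleCat.hom_sum, LinearMap.sum_apply]
  funext J
  rw [Finset.sum_apply, Finset.sum_eq_single J.1]
  · obtain ⟨J, hJ⟩ := J
    rw [ModuleCat.comp_apply, coeffι_apply_same, coeffπ, dif_pos hJ]
    rfl
  · intro I _ hI
    rw [ModuleCat.comp_apply, coeffι_apply_of_ne F I J hI.symm]
  · simp

theorem coeffι_comp_coeffD [Fintype S] (I : Finset S) {m : ℤ} (n : ℤ)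
    (hm : (I.card : ℤ) = m) :
    coeffι F I m ≫ ModuleCat.ofHom (coeffD F m n) = ∑ r ∈ Iᶜ, coeffSign I r •
      F.map (homOfLE (Finset.subset_insert r I)) ≫ coeffι F (insert r I) n := by
  apply ModuleCat.hom_ext
  apply LinearMap.ext
  intro x
  rw [ModuleCat.hom_sum, LinearMap.sum_apply, ModuleCat.comp_apply]
  funext J
  rw [Finset.sum_apply]
  refine (coeffD_apply F m n _ J).trans ?_
  obtain ⟨J, hJ⟩ := J
  -- The differential is defined through its components on the targets J, while cells need its
  -- restriction to the source I. Both sums are compared with the sum over all labels of this term,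
  -- which vanishes unless J = I ∪ {s} with s ∉ I.
  let g : S → F.obj J := fun s => if h : s ∉ I ∧ J = insert s I then
    coeffSign I s • (F.map (homOfLE (h.2 ▸ Finset.subset_insert s I : I ⊆ J))).hom x else 0
  have h1 : ∀ s ∈ J, (if h : ((J.erase s).card : ℤ) = m then coeffSign (J.erase s) s •
      (F.map (homOfLE (Finset.erase_subset s J))).hom ((coeffι F I m).hom x ⟨J.erase s, h⟩)
      else 0) = g s := by
    intro s hs
    by_cases h : J.erase s = I
    · subst h
      simp only [g]
      rw [dif_pos hm, dif_pos ⟨Finset.notMem_erase s J, (Finset.insert_erase hs).symm⟩,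
        coeffι_apply_same]
    · have h2 : ¬ (s ∉ I ∧ J = insert s I) := fun h' => h (by
        rw [h'.2, Finset.erase_insert h'.1])
      simp only [g]
      rw [dif_neg h2]
      split_ifs with h3
      · rw [coeffι_apply_of_ne F I ⟨J.erase s, h3⟩ h, map_zero, smul_zero]
      · rfl
  have h2 : ∀ r ∈ Iᶜ, (coeffSign I r • F.map (homOfLE (Finset.subset_insert r I)) ≫
      coeffι F (insert r I) n).hom x ⟨J, hJ⟩ = g r := by
    intro r hr
    rw [Finset.mem_compl] at hr
    rw [ModuleCat.hom_zsmul, LinearMap.smul_apply, ModuleCat.comp_apply, Pi.smul_apply]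
    by_cases h : J = insert r I
    · subst h
      rw [show g r = _ from dif_pos ⟨hr, rfl⟩, coeffι_apply_same]
    · rw [show g r = 0 from dif_neg fun h' : r ∉ I ∧ J = insert r I => h h'.2, coeffι_apply_of_ne F _ ⟨J, hJ⟩ h, smul_zero]
  rw [Finset.sum_congr rfl h1]
  refine Eq.trans ?_ (Finset.sum_congr rfl h2).symm
  rw [Finset.sum_subset (Finset.subset_univ J), Finset.sum_subset (Finset.subset_univ Iᶜ)]
  · intro s _ hs
    exact dif_neg fun h : s ∉ I ∧ J = insert s I => hs (Finset.mem_compl.mpr h.1)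
  · intro s _ hs
    exact dif_neg fun h : s ∉ I ∧ J = insert s I => hs (h.2 ▸ Finset.mem_insert_self s I)

/-- The cells of the complex of a coefficient system. -/
noncomputable def coeffCells [Fintype S] :
    CellDecomposition (coeffComplex.{u, w, v} F) (Finset S) S where
  deg I := I.card
  act I := Iᶜ
  tgt I r := insert r I
  sgn I r := coeffSign I r
  F := F.obj
  δ I r := F.map (homOfLE (Finset.subset_insert r I))
  deg_tgt I r hr := by
    rw [Finset.card_insert_of_notMem (Finset.mem_compl.mp hr)]
    push_cast
    rfl
  ι := coeffι F
  π := coeffπ F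
  ι_eq_zero := coeffι_eq_zero F
  ι_π := coeffι_coeffπ F
  ι_π_of_ne := coeffι_coeffπ_of_ne F
  sum_π_ι := sum_coeffπ_coeffι F
  ι_d I _ h := coeffι_comp_coeffD F I _ h

/-- The complex of a coefficient system, shifted by `m`, without signs. -/
noncomputable def shiftedCoeffComplex [Finite S] (m : ℤ) :
    CochainComplex (ModuleCat.{max v w} T) ℤ where
  X n := (coeffComplex.{u, w, v} F).X (n + m)
  d i j := (coeffComplex.{u, w, v} F).d (i + m) (j + m)
  shape i j h := (coeffComplex.{u, w, v} F).shape _ _ fun h' => h (by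
    simp only [ComplexShape.up_Rel] at h' ⊢
    omega)
  d_comp_d' i j k _ _ := (coeffComplex.{u, w, v} F).d_comp_d _ _ _

/-- The cells of the shifted complex of a coefficient system. -/
noncomputable def shiftedCoeffCells [Fintype S] (m : ℤ) :
    CellDecomposition (shiftedCoeffComplex.{u, v, w} F m) (Finset S) S where
  deg I := I.card - m
  act I := Iᶜ
  tgt I r := insert r I
  sgn I r := coeffSign I r
  F := F.obj
  δ I r := F.map (homOfLE (Finset.subset_insert r I))
  deg_tgt I r hr := by
    rw [Finset.card_insert_of_notMem (Finset.mem_compl.mp hr)]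
    push_cast
    omega
  ι I n := coeffι F I (n + m)
  π I n := coeffπ F I (n + m)
  ι_eq_zero I n h := coeffι_eq_zero F I _ (by omega)
  ι_π I n h := coeffι_coeffπ F I _ (by omega)
  ι_π_of_ne I J n := coeffι_coeffπ_of_ne F I J _
  sum_π_ι n := sum_coeffπ_coeffι F (n + m)
  ι_d I n h := coeffι_comp_coeffD F I _ (by omega)

theorem isBounded_shiftedCoeffComplex [Finite S] (m : ℤ) :
    IsBounded (shiftedCoeffComplex.{u, v, w} F m) := by
  have := Fintype.ofFinite S
  refine ⟨-m, Fintype.card S - m, fun n hn => ?_⟩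
  have : IsEmpty {I : Finset S // (I.card : ℤ) = n + m} := by
    refine ⟨fun I => ?_⟩
    have h1 := I.1.card_le_univ
    have h2 := I.2
    omega
  have h0 : Subsingleton (∀ I : {I : Finset S // (I.card : ℤ) = n + m}, F.obj I.1) := inferInstance
  exact ModuleCat.isZero_of_iff_subsingleton.mpr h0

theorem coeffSign_mul_self (I : Finset S) (s : S) : coeffSign I s * coeffSign I s = 1 := by
  rw [coeffSign, ← pow_add, Even.neg_one_pow ⟨_, rfl⟩]

end CoefficientCells

end Hecke

namespace Hecke

set_option linter.unusedSectionVars false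

/-! ### Identities in A ⊗_C N and the case C = A -/

section InducedSums

open CategoryTheory

variable {R : Type u} {A : Type w} [CommRing R] [Ring A] [Algebra R A] {C : Subalgebra R A}
  {N : ModuleCat.{w} A}

theorem inducedMk_zero_left (n : N) : inducedMk C 0 n = 0 := by
  rw [← inducedMkHom_apply, map_zero, AddMonoidHom.zero_apply]

theorem inducedMk_zero_right (x : A) : inducedMk C x (0 : N) = 0 := by
  rw [← inducedMkHom_apply, map_zero]

theorem inducedMk_sum_right {ι : Type*} (s : Finset ι) (x : A) (f : ι → N) :
    inducedMk C x (∑ i ∈ s, f i) = ∑ i ∈ s, inducedMk C x (f i) := by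
  simp only [← inducedMkHom_apply, map_sum]

theorem inducedMk_smul_left (r : R) (x : A) (n : N) :
    inducedMk C (r • x) n = inducedMk C x ((r • (1 : A)) • n) := by
  rw [← inducedMk_mul x (Subalgebra.smul_mem C (one_mem _) r), mul_smul_comm, mul_one]

theorem inducedMk_eq_smul (x : A) (n : N) : inducedMk C x n = x • inducedMk C 1 n := by
  rw [smul_inducedMk, mul_one]

theorem inducedMk_one_smul {c : A} (hc : c ∈ C) (n : N) :
    inducedMk C 1 (c • n) = c • inducedMk C 1 n := by
  rw [← inducedMk_of_mem hc, ← inducedMk_eq_smul]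

/-- The map `n ↦ 1 ⊗ n`, when `C = A`. -/
noncomputable def inducedUnit (h : ∀ a, a ∈ C) (N : ModuleCat.{w} A) : N ⟶ (induced C).obj N :=
  ModuleCat.ofHom
    { toFun := fun n => inducedMk C 1 n
      map_add' := inducedMk_add_right 1
      map_smul' := fun a n => inducedMk_one_smul (h a) n }

/-- The map `x ⊗ n ↦ x n`. -/
noncomputable def inducedCounit (C : Subalgebra R A) (N : ModuleCat.{w} A) :
    (induced C).obj N ⟶ N :=
  inducedDesc (AddMonoidHom.id N) fun _ _ _ => rfl

theorem inducedCounit_mk (x : A) (n : N) : (inducedCounit C N).hom (inducedMk C x n) = x • n :=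
  inducedDesc_mk (AddMonoidHom.id N) (fun _ _ _ => rfl) x n

theorem inducedUnit_comp_inducedCounit (h : ∀ a, a ∈ C) (N : ModuleCat.{w} A) :
    inducedUnit h N ≫ inducedCounit C N = 𝟙 _ := by
  apply ModuleCat.hom_ext
  apply LinearMap.ext
  intro n
  exact (inducedCounit_mk 1 n).trans (one_smul A n)

theorem inducedCounit_comp_inducedUnit (h : ∀ a, a ∈ C) (N : ModuleCat.{w} A) :
    inducedCounit C N ≫ inducedUnit h N = 𝟙 _ :=
  induced_hom_ext fun n => congrArg (inducedUnit h N).hom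
    ((inducedCounit_mk 1 n).trans (one_smul A n))

/-- `A ⊗_C N` is `N` when `C = A`. -/
noncomputable def inducedIso (h : ∀ a, a ∈ C) : 𝟭 (ModuleCat.{w} A) ≅ induced C :=
  NatIso.ofComponents (fun N =>
    { hom := inducedUnit h N
      inv := inducedCounit C N
      hom_inv_id := inducedUnit_comp_inducedCounit h N
      inv_hom_id := inducedCounit_comp_inducedUnit h N }) fun _ => rfl

end InducedSums

section Transformations

open CategoryTheory TensorProduct

variable {R : Type u} {A : Type max u v} [CommRing R] [Ring A] [Algebra R A]

/-- The natural transformation `x ⊗_C n ↦ x ⊗_D n`, for `C ≤ D`. -/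
noncomputable def inducedMap {C D : Subalgebra R A} (h : C ≤ D) : induced C ⟶ induced D :=
  (tensorBifunctor.{u, max u v, max u v, max u v} R A A).map (squareMap.{u, v} h)

variable {J : Type z} {C : J → Subalgebra R A} {κ : Type z} (F : FrobeniusSystem R A C κ)

/-- The natural transformation attached to a Frobenius system. -/
noncomputable def FrobeniusSystem.trans {j k : J} (h : C j ≤ C k) : induced (C k) ⟶ induced (C j) :=
  (tensorBifunctor.{u, max u v, max u v, max u v} R A A).map (F.transfer h)

theorem FrobeniusSystem.trans_app_mk {j k : J} (h : C j ≤ C k) (N : ModuleCat.{max u v} A) (x : A)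
    (n : N) : ((F.trans h).app N).hom (inducedMk (C k) x n) =
      ∑ m ∈ F.index j, inducedMk (C j) (x * F.base m) (F.proj k (F.dual m) • n) :=
  F.transfer_app_mk h N x n

end Transformations

/-! ### Adjacent elements when the left parabolic subgroup varies -/

section Adjacency

variable {B W : Type v} [Group W] {M : CoxeterMatrix B} {cs : CoxeterSystem M W} [Finite W]
  {P P' Q : Set B} {w n : W} {s : B}

/-- An adjacent element lies in v W_Q, and v, having all of P as descents, remains top for the
smaller set P'. Hence n, unlike w itself, has top v already for P'. -/
theorem IsAdjacent.top_eq (h : IsAdjacent cs P Q w n) (hP : P' ⊆ P) :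
    top cs P' Q n = top cs P Q w := by
  obtain ⟨-, y, hy, e⟩ := h
  exact ((isTop_top P Q w).mono hP subset_rfl).top_eq (e ▸ .of_mul_right _ hy)

theorem top_insert_eq (h : descent cs Q (top cs P Q w) = some s) :
    top cs (insert s P) Q w = top cs P Q w :=
  ((isMovingDescent_of_descent h).2.isTop_insert (isTop_top P Q w)).top_eq
    ((sameDoubleCoset_top P Q w).symm.mono (Set.subset_insert s P) subset_rfl)

theorem IsAdjacent.mono (h : IsAdjacent cs P Q w n) (hP : P ⊆ P')
    (ht : top cs P' Q w = top cs P Q w) : IsAdjacent cs P' Q w n := by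
  obtain ⟨⟨x, hx, e⟩, y, hy, e'⟩ := h
  exact ⟨⟨x, parabolicSubgroup_mono cs hP hx, e⟩, y, hy, by rw [ht, e']⟩

end Adjacency

/-! ### The Frobenius system formed by the parabolic subalgebras -/

section HeckeFrobenius

open HeckeAlgebra CategoryTheory

variable {B W : Type v} [Group W] {M : CoxeterMatrix B} {cs : CoxeterSystem M W}
  {R : Type u} [CommRing R] (P : Parameters cs R)

theorem parabolicProj_dualBasis_of_notMem {Q : Set B} {m : W} (h : m ∉ parabolicSubgroup cs Q) :
    parabolicProj P Q (dualBasis P m) = 0 := by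
  rw [dualBasis, map_smul, parabolicProj_basis_of_notMem P fun h' => h (by
    simpa using inv_mem h'), smul_zero]

theorem parabolicProj_dualBasis_of_mem {Q : Set B} {m : W} (h : m ∈ parabolicSubgroup cs Q) :
    parabolicProj P Q (dualBasis P m) = dualBasis P m := by
  rw [dualBasis, map_smul, parabolicProj_basis_of_mem P (inv_mem h)]

/-- The Hecke algebra is a Frobenius extension of its parabolic subalgebras. -/
noncomputable def heckeFrobenius [Finite W] : FrobeniusSystem R (HeckeAlgebra P)
    (fun J : Finset B => parabolicSubalgebra P ((J : Set B)ᶜ)) W where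
  proj J := parabolicProj P (J : Set B)ᶜ
  base := basis P
  dual := dualBasis P
  index J := minReps cs (J : Set B)ᶜ
  proj_mem _ a := parabolicProj_mem P _ a
  proj_mul _ a _ hc := parabolicProj_mul P a hc
  mul_proj _ a _ hc := mul_parabolicProj P a hc
  sum_base_mul _ a := sum_basis_mul_parabolicProj P _ a
  sum_mul_dual _ a := sum_parabolicProj_mul_dualBasis P _ a

theorem compl_mono {J J' : Finset B} (h : J ⊆ J') : ((J' : Set B)ᶜ) ⊆ ((J : Set B)ᶜ) :=
  Set.compl_subset_compl.mpr (Finset.coe_subset.mpr h)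

/-- An element `x ⊗ n` of an induced module is a combination of the `h_w ⊗ n`. -/
theorem induced_basis_induction {C : Subalgebra R (HeckeAlgebra P)}
    {N : ModuleCat.{max u v} (HeckeAlgebra P)} {s : Set W} {q : (induced C).obj N → Prop}
    (h0 : q 0) (hadd : ∀ y z, q y → q z → q (y + z))
    (hmk : ∀ w ∈ s, ∀ n : N, q (inducedMk C (basis P w) n)) {x : HeckeAlgebra P}
    (hx : x ∈ Submodule.span R (basis P '' s)) (n : N) : q (inducedMk C x n) := by
  induction hx using Submodule.span_induction generalizing n with
  | zero => rw [inducedMk_zero_left]; exact h0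
  | add x y _ _ hx hy => rw [inducedMk_add_left]; exact hadd _ _ (hx n) (hy n)
  | smul r x _ hx => rw [inducedMk_smul_left]; exact hx _
  | mem x hx =>
    obtain ⟨w, hw, rfl⟩ := hx
    exact hmk w hw n

theorem mem_span_basis (x : HeckeAlgebra P) :
    x ∈ Submodule.span R (basis P '' Set.univ) := by
  rw [Set.image_univ, (basis P).span_eq]
  trivial

theorem basis_mul_mem_span_image {Q : Set B} (w : W) {c : HeckeAlgebra P}
    (hc : c ∈ parabolicSubalgebra P Q) : basis P w * c ∈ Submodule.span R
      (basis P '' {x | ∃ y ∈ parabolicSubgroup cs Q, x = w * y}) := by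
  refine Submodule.span_mono ?_ (basis_mul_mem_span P w hc)
  rintro _ ⟨y, hy, rfl⟩
  exact ⟨_, ⟨y, hy, rfl⟩, rfl⟩

theorem mul_basis_mem_span_image {Q : Set B} (w : W) {c : HeckeAlgebra P}
    (hc : c ∈ parabolicSubalgebra P Q) : c * basis P w⁻¹ ∈ Submodule.span R
      (basis P '' {x | ∃ y ∈ parabolicSubgroup cs Q, x = (w * y)⁻¹}) := by
  have h := Submodule.mem_map_of_mem (f := HeckeAlgebra.flip P)
    (basis_mul_mem_span_image P w (flip_mem P hc))
  rw [flip_mul, HeckeAlgebra.flip_flip, flip_basis, Submodule.map_span, Set.image_image] at h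
  refine Submodule.span_mono ?_ h
  rintro _ ⟨_, ⟨y, hy, rfl⟩, rfl⟩
  exact ⟨_, ⟨y, hy, rfl⟩, (flip_basis P _).symm⟩

end HeckeFrobenius

end Hecke

namespace Hecke

/-! ### Natural transformations between the functors A ⊗_C A ⊗_D - -/

section DoubleInduced

open CategoryTheory

variable {R : Type u} {A : Type w} [CommRing R] [Ring A] [Algebra R A] {C D C' E : Subalgebra R A}
  {N N' Y : ModuleCat.{w} A}

theorem induced_induced_hom_ext {f g : (induced C).obj ((induced D).obj N) ⟶ Y}
    (h : ∀ y n, f.hom (inducedMk C 1 (inducedMk D y n)) = g.hom (inducedMk C 1 (inducedMk D y n))) :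
    f = g := by
  refine induced_hom_ext fun z => ?_
  induction z using induced_induction with
  | h0 => rw [inducedMk_zero_right, map_zero, map_zero]
  | hadd x y hx hy => rw [inducedMk_add_right, map_add, map_add, hx, hy]
  | hmk y n => exact h y n

/-- The elements `1 ⊗ y ⊗ n` generate. -/
theorem span_induced_induced {s : Set ((induced C).obj ((induced D).obj N))}
    (h : ∀ y n, inducedMk C 1 (inducedMk D y n) ∈ Submodule.span A s) : Submodule.span A s = ⊤ := by
  rw [eq_top_iff]
  rintro x -
  induction x using induced_induction with
  | h0 => exact zero_mem _
  | hadd x y hx hy => exact add_mem hx hy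
  | hmk x z =>
    rw [inducedMk_eq_smul]
    refine Submodule.smul_mem _ _ ?_
    induction z using induced_induction with
    | h0 => rw [inducedMk_zero_right]; exact zero_mem _
    | hadd x y hx hy => rw [inducedMk_add_right]; exact add_mem hx hy
    | hmk y n => exact h y n

theorem orbitMap_naturality (f : N ⟶ N') (n : N) : orbitMap N n ≫ f = orbitMap N' (f.hom n) := by
  apply ModuleCat.hom_ext
  apply LinearMap.ext
  intro a
  exact map_smul f.hom a n

theorem inducedOrbit_naturality (f : N ⟶ N') (n : N) :
    inducedOrbit D N n ≫ (induced D).map f = inducedOrbit D N' (f.hom n) := rfl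

theorem mulRightMap_comp_orbitMap (c : A) (n : N) :
    mulRightMap c ≫ orbitMap N n = orbitMap N (c • n) := by
  apply ModuleCat.hom_ext
  apply LinearMap.ext
  intro a
  exact mul_smul a c n

theorem mulRightMap_comp_inducedOrbit {c : A} (hc : c ∈ D) (n : N) :
    mulRightMap c ≫ inducedOrbit D N n = inducedOrbit D N (c • n) := by
  apply ModuleCat.hom_ext
  apply LinearMap.ext
  intro a
  exact inducedMk_mul a hc n

theorem orbitMap_add (m n : N) : orbitMap N (m + n) = orbitMap N m + orbitMap N n := by
  apply ModuleCat.hom_ext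
  apply LinearMap.ext
  intro a
  exact smul_add a m n

theorem inducedOrbit_add (m n : N) :
    inducedOrbit D N (m + n) = inducedOrbit D N m + inducedOrbit D N n := by
  apply ModuleCat.hom_ext
  apply LinearMap.ext
  intro a
  exact inducedMk_add_right a m n

theorem induced_map_comp_apply {X Y Z : ModuleCat.{w} A} (f : X ⟶ Y) (g : Y ⟶ Z)
    (x : (induced C).obj X) : ((induced C).map g).hom (((induced C).map f).hom x) =
      ((induced C).map (f ≫ g)).hom x := by
  rw [Functor.map_comp]
  rfl

section Split

variable (σ : A →+ (induced C').obj (ModuleCat.of A A))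

/-- The biadditive map `(y, n) ↦ σ(y) (1 ⊗ n)`. -/
noncomputable def splitLeftHom (D : Subalgebra R A) (N : ModuleCat.{w} A) :
    A →+ N →+ (induced C').obj ((induced D).obj N) :=
  AddMonoidHom.mk' (fun y => AddMonoidHom.mk'
      (fun n => ((induced C').map (inducedOrbit D N n)).hom (σ y))
      (fun m n => by rw [inducedOrbit_add, Functor.map_add]; rfl))
    (fun x y => AddMonoidHom.ext fun n => by
      simp only [AddMonoidHom.mk'_apply, AddMonoidHom.add_apply, map_add])

theorem splitLeftHom_apply (y : A) (n : N) :
    splitLeftHom σ D N y n = ((induced C').map (inducedOrbit D N n)).hom (σ y) := rfl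

/-- The biadditive map `(y, n) ↦ σ(y) n`. -/
noncomputable def splitRightHom (N : ModuleCat.{w} A) :
    A →+ N →+ (induced C').obj N :=
  AddMonoidHom.mk' (fun y => AddMonoidHom.mk'
      (fun n => ((induced C').map (orbitMap N n)).hom (σ y))
      (fun m n => by rw [orbitMap_add, Functor.map_add]; rfl))
    (fun x y => AddMonoidHom.ext fun n => by
      simp only [AddMonoidHom.mk'_apply, AddMonoidHom.add_apply, map_add])

theorem splitRightHom_apply (y : A) (n : N) :
    splitRightHom σ N y n = ((induced C').map (orbitMap N n)).hom (σ y) := rfl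

variable {σ}

theorem splitLeftHom_mul (h2 : ∀ c ∈ D, ∀ x, σ (x * c) = rightAction C' c (σ x))
    (x c : A) (hc : c ∈ D) (n : N) :
    splitLeftHom σ D N (x * c) n = splitLeftHom σ D N x (c • n) := by
  rw [splitLeftHom_apply, splitLeftHom_apply, h2 c hc, rightAction_apply, induced_map_comp_apply,
    mulRightMap_comp_inducedOrbit hc]

theorem splitRightHom_mul (h2 : ∀ c ∈ D, ∀ x, σ (x * c) = rightAction C' c (σ x))
    (x c : A) (hc : c ∈ D) (n : N) :
    splitRightHom σ N (x * c) n = splitRightHom σ N x (c • n) := by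
  rw [splitRightHom_apply, splitRightHom_apply, h2 c hc, rightAction_apply, induced_map_comp_apply,
    mulRightMap_comp_orbitMap]

theorem inducedLift_splitLeftHom_smul (h1 : ∀ c ∈ C, ∀ x, σ (c * x) = c • σ x)
    (h2 : ∀ c ∈ D, ∀ x, σ (x * c) = rightAction C' c (σ x)) (c : A) (hc : c ∈ C)
    (z : (induced D).obj N) :
    inducedLift (splitLeftHom σ D N) (fun x c hc n => splitLeftHom_mul h2 x c hc n) (c • z) =
      c • inducedLift (splitLeftHom σ D N) (fun x c hc n => splitLeftHom_mul h2 x c hc n) z := by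
  induction z using induced_induction with
  | h0 => rw [smul_zero, map_zero, smul_zero]
  | hadd x y hx hy => rw [smul_add, map_add, map_add, smul_add, hx, hy]
  | hmk x n =>
    rw [smul_inducedMk, inducedLift_mk, inducedLift_mk, splitLeftHom_apply, splitLeftHom_apply,
      h1 c hc, map_smul]

theorem inducedLift_splitRightHom_smul (h1 : ∀ c ∈ C, ∀ x, σ (c * x) = c • σ x)
    (h2 : ∀ c ∈ D, ∀ x, σ (x * c) = rightAction C' c (σ x)) (c : A) (hc : c ∈ C)
    (z : (induced D).obj N) :
    inducedLift (splitRightHom σ N) (fun x c hc n => splitRightHom_mul h2 x c hc n) (c • z) =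
      c • inducedLift (splitRightHom σ N) (fun x c hc n => splitRightHom_mul h2 x c hc n) z := by
  induction z using induced_induction with
  | h0 => rw [smul_zero, map_zero, smul_zero]
  | hadd x y hx hy => rw [smul_add, map_add, map_add, smul_add, hx, hy]
  | hmk x n =>
    rw [smul_inducedMk, inducedLift_mk, inducedLift_mk, splitRightHom_apply, splitRightHom_apply,
      h1 c hc, map_smul]

variable (h1 : ∀ c ∈ C, ∀ x, σ (c * x) = c • σ x)
  (h2 : ∀ c ∈ D, ∀ x, σ (x * c) = rightAction C' c (σ x))

/-- The map `A ⊗_C (A ⊗_D N) ⟶ A ⊗_{C'} (A ⊗_D N)` attached to a `C`-`D`-bimodule map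
`A ⟶ A ⊗_{C'} A`. -/
noncomputable def splitLeftApp (N : ModuleCat.{w} A) :
    (induced C).obj ((induced D).obj N) ⟶ (induced C').obj ((induced D).obj N) :=
  inducedDesc (inducedLift (splitLeftHom σ D N) (fun x c hc n => splitLeftHom_mul h2 x c hc n))
    (inducedLift_splitLeftHom_smul h1 h2)

theorem splitLeftApp_mk (y : A) (n : N) :
    (splitLeftApp h1 h2 N).hom (inducedMk C 1 (inducedMk D y n)) =
      ((induced C').map (inducedOrbit D N n)).hom (σ y) := by
  rw [splitLeftApp, inducedDesc_mk, one_smul, inducedLift_mk]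
  rfl

theorem splitLeftApp_naturality (f : N ⟶ N') :
    (induced C).map ((induced D).map f) ≫ splitLeftApp h1 h2 N' =
      splitLeftApp h1 h2 N ≫ (induced C').map ((induced D).map f) :=
  induced_induced_hom_ext fun y n => by
    change (splitLeftApp h1 h2 N').hom (inducedMk C 1 (inducedMk D y (f.hom n))) =
      ((induced C').map ((induced D).map f)).hom
        ((splitLeftApp h1 h2 N).hom (inducedMk C 1 (inducedMk D y n)))
    rw [splitLeftApp_mk, splitLeftApp_mk, induced_map_comp_apply, inducedOrbit_naturality]

/-- The natural transformation attached to a `C`-`D`-bimodule map `A ⟶ A ⊗_{C'} A`. -/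
noncomputable def splitLeft : induced D ⋙ induced C ⟶ induced D ⋙ induced C' where
  app N := splitLeftApp h1 h2 N
  naturality _ _ f := splitLeftApp_naturality h1 h2 f

/-- The map `A ⊗_C (A ⊗_D N) ⟶ A ⊗_C (A ⊗_{C'} N)` attached to a `C`-`D`-bimodule map
`A ⟶ A ⊗_{C'} A`. -/
noncomputable def splitRightApp (N : ModuleCat.{w} A) :
    (induced C).obj ((induced D).obj N) ⟶ (induced C).obj ((induced C').obj N) :=
  inducedDesc ((inducedMkHom C _ 1).comp
      (inducedLift (splitRightHom σ N) (fun x c hc n => splitRightHom_mul h2 x c hc n)))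
    (fun c hc z => by
      rw [AddMonoidHom.comp_apply, AddMonoidHom.comp_apply,
        inducedLift_splitRightHom_smul h1 h2 c hc, inducedMkHom_apply, inducedMkHom_apply,
        inducedMk_one_smul hc])

theorem splitRightApp_mk (y : A) (n : N) :
    (splitRightApp h1 h2 N).hom (inducedMk C 1 (inducedMk D y n)) =
      inducedMk C 1 (((induced C').map (orbitMap N n)).hom (σ y)) := by
  rw [splitRightApp, inducedDesc_mk, one_smul, AddMonoidHom.comp_apply, inducedLift_mk]
  rfl

theorem splitRightApp_naturality (f : N ⟶ N') :
    (induced C).map ((induced D).map f) ≫ splitRightApp h1 h2 N' =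
      splitRightApp h1 h2 N ≫ (induced C).map ((induced C').map f) :=
  induced_induced_hom_ext fun y n => by
    change (splitRightApp h1 h2 N').hom (inducedMk C 1 (inducedMk D y (f.hom n))) =
      ((induced C).map ((induced C').map f)).hom
        ((splitRightApp h1 h2 N).hom (inducedMk C 1 (inducedMk D y n)))
    rw [splitRightApp_mk, splitRightApp_mk, induced_map_mk, induced_map_comp_apply,
      orbitMap_naturality]

/-- The natural transformation attached to a `C`-`D`-bimodule map `A ⟶ A ⊗_{C'} A`. -/
noncomputable def splitRight : induced D ⋙ induced C ⟶ induced C' ⋙ induced C where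
  app N := splitRightApp h1 h2 N
  naturality _ _ f := splitRightApp_naturality h1 h2 f

end Split

section Project

variable (p : A →ₗ[R] A)

/-- The biadditive map `(y, n) ↦ 1 ⊗ p(y) n`. -/
noncomputable def projectLeftHom (E : Subalgebra R A) (N : ModuleCat.{w} A) :
    A →+ N →+ (induced E).obj N :=
  AddMonoidHom.mk' (fun y => AddMonoidHom.mk' (fun n => inducedMk E 1 (p y • n))
      (fun m n => by rw [smul_add, inducedMk_add_right]))
    (fun x y => AddMonoidHom.ext fun n => by
      simp only [AddMonoidHom.mk'_apply, AddMonoidHom.add_apply, map_add, add_smul,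
        inducedMk_add_right])

theorem projectLeftHom_apply (y : A) (n : N) :
    projectLeftHom p E N y n = inducedMk E 1 (p y • n) := rfl

/-- The biadditive map `(y, n) ↦ p(y) ⊗ n`. -/
noncomputable def projectRightHom (E : Subalgebra R A) (N : ModuleCat.{w} A) :
    A →+ N →+ (induced E).obj N :=
  (inducedMkHom E N).comp p.toAddMonoidHom

theorem projectRightHom_apply (y : A) (n : N) :
    projectRightHom p E N y n = inducedMk E (p y) n := rfl

variable {p}

theorem projectLeftHom_mul (h2 : ∀ c ∈ D, ∀ x, p (x * c) = p x * c)
    (x c : A) (hc : c ∈ D) (n : N) :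
    projectLeftHom p E N (x * c) n = projectLeftHom p E N x (c • n) := by
  rw [projectLeftHom_apply, projectLeftHom_apply, h2 c hc, mul_smul]

theorem projectRightHom_mul (h2 : ∀ c ∈ D, ∀ x, p (x * c) = p x * c) (h : C ≤ D)
    (x c : A) (hc : c ∈ C) (n : N) :
    projectRightHom p C N (x * c) n = projectRightHom p C N x (c • n) := by
  rw [projectRightHom_apply, projectRightHom_apply, h2 c (h hc), inducedMk_mul _ hc]

theorem inducedLift_projectLeftHom_smul (h1 : ∀ c ∈ D, ∀ x, p (c * x) = c * p x)
    (h2 : ∀ c ∈ D, ∀ x, p (x * c) = p x * c) (h : D ≤ E) (c : A) (hc : c ∈ D)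
    (z : (induced D).obj N) :
    inducedLift (projectLeftHom p E N) (fun x c hc n => projectLeftHom_mul h2 x c hc n) (c • z) =
      c • inducedLift (projectLeftHom p E N) (fun x c hc n => projectLeftHom_mul h2 x c hc n) z := by
  induction z using induced_induction with
  | h0 => rw [smul_zero, map_zero, smul_zero]
  | hadd x y hx hy => rw [smul_add, map_add, map_add, smul_add, hx, hy]
  | hmk x n =>
    rw [smul_inducedMk, inducedLift_mk, inducedLift_mk, projectLeftHom_apply, projectLeftHom_apply,
      h1 c hc, mul_smul, inducedMk_one_smul (h hc)]

theorem inducedLift_projectRightHom_smul (h1 : ∀ c ∈ D, ∀ x, p (c * x) = c * p x)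
    (h2 : ∀ c ∈ D, ∀ x, p (x * c) = p x * c) (h : C ≤ D) (c : A) (hc : c ∈ D)
    (z : (induced C).obj N) :
    inducedLift (projectRightHom p C N) (fun x c hc n => projectRightHom_mul h2 h x c hc n) (c • z) =
      c • inducedLift (projectRightHom p C N)
        (fun x c hc n => projectRightHom_mul h2 h x c hc n) z := by
  induction z using induced_induction with
  | h0 => rw [smul_zero, map_zero, smul_zero]
  | hadd x y hx hy => rw [smul_add, map_add, map_add, smul_add, hx, hy]
  | hmk x n =>
    rw [smul_inducedMk, inducedLift_mk, inducedLift_mk, projectRightHom_apply,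
      projectRightHom_apply, h1 c hc, smul_inducedMk]

variable (h1 : ∀ c ∈ D, ∀ x, p (c * x) = c * p x) (h2 : ∀ c ∈ D, ∀ x, p (x * c) = p x * c)
  (hC : C ≤ D) (hD : D ≤ E)

/-- The map `x ⊗ y ⊗ n ↦ x ⊗ 1 ⊗ p(y) n`, for a projection `p` to `D`. -/
noncomputable def projectLeftApp (N : ModuleCat.{w} A) :
    (induced C).obj ((induced D).obj N) ⟶ (induced C).obj ((induced E).obj N) :=
  inducedDesc ((inducedMkHom C _ 1).comp
      (inducedLift (projectLeftHom p E N) (fun x c hc n => projectLeftHom_mul h2 x c hc n)))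
    (fun c hc z => by
      rw [AddMonoidHom.comp_apply, AddMonoidHom.comp_apply,
        inducedLift_projectLeftHom_smul h1 h2 hD c (hC hc), inducedMkHom_apply, inducedMkHom_apply,
        inducedMk_one_smul hc])

theorem projectLeftApp_mk (y : A) (n : N) :
    (projectLeftApp h1 h2 hC hD N).hom (inducedMk C 1 (inducedMk D y n)) =
      inducedMk C 1 (inducedMk E 1 (p y • n)) := by
  rw [projectLeftApp, inducedDesc_mk, one_smul, AddMonoidHom.comp_apply, inducedLift_mk]
  rfl

theorem projectLeftApp_naturality (f : N ⟶ N') :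
    (induced C).map ((induced D).map f) ≫ projectLeftApp h1 h2 hC hD N' =
      projectLeftApp h1 h2 hC hD N ≫ (induced C).map ((induced E).map f) :=
  induced_induced_hom_ext fun y n => by
    change (projectLeftApp h1 h2 hC hD N').hom (inducedMk C 1 (inducedMk D y (f.hom n))) =
      ((induced C).map ((induced E).map f)).hom
        ((projectLeftApp h1 h2 hC hD N).hom (inducedMk C 1 (inducedMk D y n)))
    rw [projectLeftApp_mk, projectLeftApp_mk, induced_map_mk, induced_map_mk, map_smul]

/-- The natural transformation `x ⊗ y ⊗ n ↦ x ⊗ 1 ⊗ p(y) n`. -/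
noncomputable def projectLeft : induced D ⋙ induced C ⟶ induced E ⋙ induced C where
  app N := projectLeftApp h1 h2 hC hD N
  naturality _ _ f := projectLeftApp_naturality h1 h2 hC hD f

/-- The map `x ⊗ y ⊗ n ↦ x ⊗ p(y) ⊗ n`, for a projection `p` to `D`. -/
noncomputable def projectRightApp (N : ModuleCat.{w} A) :
    (induced D).obj ((induced C).obj N) ⟶ (induced E).obj ((induced C).obj N) :=
  inducedDesc ((inducedMkHom E _ 1).comp
      (inducedLift (projectRightHom p C N) (fun x c hc n => projectRightHom_mul h2 hC x c hc n)))
    (fun c hc z => by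
      rw [AddMonoidHom.comp_apply, AddMonoidHom.comp_apply,
        inducedLift_projectRightHom_smul h1 h2 hC c hc, inducedMkHom_apply, inducedMkHom_apply,
        inducedMk_one_smul (hD hc)])

theorem projectRightApp_mk (y : A) (n : N) :
    (projectRightApp h1 h2 hC hD N).hom (inducedMk D 1 (inducedMk C y n)) =
      inducedMk E 1 (inducedMk C (p y) n) := by
  rw [projectRightApp, inducedDesc_mk, one_smul, AddMonoidHom.comp_apply, inducedLift_mk]
  rfl

theorem projectRightApp_naturality (f : N ⟶ N') :
    (induced D).map ((induced C).map f) ≫ projectRightApp h1 h2 hC hD N' =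
      projectRightApp h1 h2 hC hD N ≫ (induced E).map ((induced C).map f) :=
  induced_induced_hom_ext fun y n => by
    change (projectRightApp h1 h2 hC hD N').hom (inducedMk D 1 (inducedMk C y (f.hom n))) =
      ((induced E).map ((induced C).map f)).hom
        ((projectRightApp h1 h2 hC hD N).hom (inducedMk D 1 (inducedMk C y n)))
    rw [projectRightApp_mk, projectRightApp_mk, induced_map_mk, induced_map_mk]

/-- The natural transformation `x ⊗ y ⊗ n ↦ x ⊗ p(y) ⊗ n`. -/
noncomputable def projectRight : induced C ⋙ induced D ⟶ induced C ⋙ induced E where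
  app N := projectRightApp h1 h2 hC hD N
  naturality _ _ f := projectRightApp_naturality h1 h2 hC hD f

end Project

end DoubleInduced

end Hecke

namespace Hecke

set_option linter.unusedSectionVars false

/-! ### Generators and maps for H ⊗_{H_K} H ⊗_{H_Q} - -/

section LeftSystem

open CategoryTheory HeckeAlgebra

variable {B W : Type v} [Group W] {M : CoxeterMatrix B} {cs : CoxeterSystem M W}
  {R : Type u} [CommRing R] (P : Parameters cs R) [Finite W] {N : ModuleCat.{max u v} (HeckeAlgebra P)}

theorem parabolicProj_left_linear (Q : Set B) : ∀ c ∈ parabolicSubalgebra P Q, ∀ x,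
    parabolicProj P Q (c * x) = c * parabolicProj P Q x :=
  fun _ hc x => mul_parabolicProj P x hc

theorem parabolicProj_right_linear (Q : Set B) : ∀ c ∈ parabolicSubalgebra P Q, ∀ x,
    parabolicProj P Q (x * c) = parabolicProj P Q x * c :=
  fun _ hc x => parabolicProj_mul P x hc

theorem leftTranslation_splitting_mul {K K' Q : Set B} {s : B} (hK : K \ {s} ⊆ K') :
    ∀ c ∈ parabolicSubalgebra P K, ∀ x, (leftTranslation P K').splitting K Q s (c * x) =
      c • (leftTranslation P K').splitting K Q s x :=
  fun _ hc x => (leftTranslation P K').splitting_mul_of_mem hK hc x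

theorem leftTranslation_splitting_mul' {K K' Q : Set B} {s : B} (hK : K \ {s} ⊆ K') :
    ∀ c ∈ parabolicSubalgebra P Q, ∀ x, (leftTranslation P K').splitting K Q s (x * c) =
      rightAction _ c ((leftTranslation P K').splitting K Q s x) :=
  fun _ hc x => (leftTranslation P K').splitting_mul hK hc x

/-- The component of the contraction which removes `s` from `K`. -/
noncomputable abbrev leftSplit {K K' : Set B} (Q : Set B) {s : B} (hK : K \ {s} ⊆ K') :
    induced (parabolicSubalgebra P Q) ⋙ induced (parabolicSubalgebra P K) ⟶
      induced (parabolicSubalgebra P Q) ⋙ induced (parabolicSubalgebra P K') :=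
  splitLeft (leftTranslation_splitting_mul P (Q := Q) hK) (leftTranslation_splitting_mul' P hK)

/-- The element `1 ⊗ h_w ⊗ n`. -/
noncomputable def leftGen (K Q : Set B) (w : W) (n : N) : (induced (parabolicSubalgebra P K)).obj
    ((induced (parabolicSubalgebra P Q)).obj N) :=
  inducedMk _ 1 (inducedMk _ (basis P w) n)

variable {P} {K K' Q Q' : Set B} {s : B} {w m x : W} (n : N)

theorem leftSplit_gen (hK : K \ {s} ⊆ K') (hs : descent cs Q (top cs K Q w) = some s)
    (h : IsAdjacent cs K Q w m) : ((leftSplit P Q hK).app N).hom (leftGen P K Q w n) =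
      (basis P w * ((basisUnit P m)⁻¹ : (HeckeAlgebra P)ˣ)) • leftGen P K' Q m n := by
  refine (splitLeftApp_mk (leftTranslation_splitting_mul P (Q := Q) hK)
    (leftTranslation_splitting_mul' P hK) (basis P w) n).trans ?_
  rw [(leftTranslation P K').splitting_basis_eq hK hs h]
  refine (map_smul _ (basis P w) _).trans ?_
  rw [mul_smul]
  congr 1
  exact inducedMk_eq_smul _ _

theorem leftSplit_gen_eq_zero (hK : K \ {s} ⊆ K') (hs : descent cs Q (top cs K Q w) ≠ some s) :
    ((leftSplit P Q hK).app N).hom (leftGen P K Q w n) = 0 := by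
  refine (splitLeftApp_mk (leftTranslation_splitting_mul P (Q := Q) hK)
    (leftTranslation_splitting_mul' P hK) (basis P w) n).trans ?_
  rw [(leftTranslation P K').splitting_basis_eq_zero hs, map_zero]

/-- Invariance of h_m⁻¹ ⊗ h_m under W_K on the left allows m to be replaced by w, and h_w (h_w⁻¹ ⊗
h_w) = 1 ⊗ h_w. This is why the splitting is inverse to the canonical map. -/
theorem smul_leftGen (hx : x ∈ parabolicSubgroup cs K) (hm : m = x * w) :
    (basis P w * ((basisUnit P m)⁻¹ : (HeckeAlgebra P)ˣ)) • leftGen P K Q m n =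
      leftGen P K Q w n := by
  have h1 := congrArg (fun y => basis P w • ((induced (parabolicSubalgebra P K)).map
    (inducedOrbit (parabolicSubalgebra P Q) N n)).hom y) (invTensor_mul P K hx w)
  rw [← hm] at h1
  have h2 : ∀ m, basis P w • ((induced (parabolicSubalgebra P K)).map
      (inducedOrbit (parabolicSubalgebra P Q) N n)).hom (invTensor P K m) =
      (basis P w * ((basisUnit P m)⁻¹ : (HeckeAlgebra P)ˣ)) • leftGen P K Q m n := by
    intro m
    rw [mul_smul]
    congr 1
    exact inducedMk_eq_smul _ _
  refine (h2 m).symm.trans (h1.trans ((h2 w).trans ?_))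
  rw [← val_basisUnit, Units.mul_inv, one_smul]

theorem leftGen_mem (hw : w ∈ parabolicSubgroup cs Q) :
    leftGen P K Q w n = leftGen P K Q 1 (basis P w • n) := by
  rw [leftGen, leftGen, inducedMk_of_mem (basis_mem hw), basis_one]

theorem leftGen_mem_span {x : HeckeAlgebra P} {s : Set W}
    (hx : x ∈ Submodule.span R (basis P '' s)) :
    (inducedMk _ 1 (inducedMk _ x n) : (induced (parabolicSubalgebra P K)).obj
      ((induced (parabolicSubalgebra P Q)).obj N)) ∈
      Submodule.span (HeckeAlgebra P) {y | ∃ w ∈ s, ∃ n' : N, y = leftGen P K Q w n'} := by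
  refine induced_basis_induction P (C := parabolicSubalgebra P Q) (N := N)
    (q := fun z => (inducedMk _ 1 z : (induced (parabolicSubalgebra P K)).obj
      ((induced (parabolicSubalgebra P Q)).obj N)) ∈
      Submodule.span (HeckeAlgebra P) {y | ∃ w ∈ s, ∃ n' : N, y = leftGen P K Q w n'}) ?_ ?_ ?_ hx n
  · rw [inducedMk_zero_right]; exact zero_mem _
  · intro y z hy hz
    rw [inducedMk_add_right]; exact add_mem hy hz
  · intro w hw n
    exact Submodule.subset_span ⟨w, hw, n, rfl⟩

theorem span_leftGen (K Q : Set B) (N : ModuleCat.{max u v} (HeckeAlgebra P)) :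
    Submodule.span (HeckeAlgebra P) {y | ∃ w, ∃ n : N, y = leftGen P K Q w n} = ⊤ := by
  refine span_induced_induced fun y n => ?_
  refine Submodule.span_mono ?_ (leftGen_mem_span n (mem_span_basis P y))
  rintro _ ⟨w, -, n, rfl⟩
  exact ⟨w, n, rfl⟩

variable (P) in
/-- The natural transformation which represents the differential of the dual complex. -/
noncomputable def heckeTransfer {J J' : Finset B} (hJ : J ⊆ J') :
    induced (parabolicSubalgebra P ((J : Set B)ᶜ)) ⟶
      induced (parabolicSubalgebra P ((J' : Set B)ᶜ)) :=
  (heckeFrobenius P).trans (parabolicSubalgebra_mono P (compl_mono hJ))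

variable {J J' : Finset B} (hJ : J ⊆ J')

theorem heckeTransfer_app_mk (x : HeckeAlgebra P) :
    ((heckeTransfer P hJ).app N).hom (inducedMk _ x n) =
      ∑ m ∈ minReps cs ((J' : Set B)ᶜ), inducedMk (parabolicSubalgebra P ((J' : Set B)ᶜ))
        (x * basis P m) (parabolicProj P (J : Set B)ᶜ (dualBasis P m) • n) :=
  (heckeFrobenius P).trans_app_mk (parabolicSubalgebra_mono P (compl_mono hJ)) N x n

theorem trans_leftGen : ((induced (parabolicSubalgebra P K)).map
      ((heckeTransfer P hJ).app N)).hom (leftGen P K (J : Set B)ᶜ w n) =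
    ∑ m ∈ minReps cs ((J' : Set B)ᶜ), inducedMk _ 1 (inducedMk _ (basis P w * basis P m)
      (parabolicProj P (J : Set B)ᶜ (dualBasis P m) • n)) := by
  rw [← inducedMk_sum_right]
  exact congrArg (inducedMk (parabolicSubalgebra P K) 1) (heckeTransfer_app_mk n hJ _)

/-- Terms with m outside the larger parabolic subgroup are annihilated by the projection; for the
others, h_w h_m stays in the span of the coset of w. -/
theorem trans_leftGen_mem : ((induced (parabolicSubalgebra P K)).map
      ((heckeTransfer P hJ).app N)).hom (leftGen P K (J : Set B)ᶜ w n) ∈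
    Submodule.span (HeckeAlgebra P) {y | ∃ x ∈ parabolicSubgroup cs ((J : Set B)ᶜ), ∃ n' : N,
      y = leftGen P K (J' : Set B)ᶜ (w * x) n'} := by
  rw [trans_leftGen]
  refine sum_mem fun m _ => ?_
  by_cases hm : m ∈ parabolicSubgroup cs ((J : Set B)ᶜ)
  · refine Submodule.span_mono ?_ (leftGen_mem_span _ (basis_mul_mem_span_image P w (basis_mem hm)))
    rintro _ ⟨_, ⟨y, hy, rfl⟩, n, rfl⟩
    exact ⟨y, hy, n, rfl⟩
  · rw [parabolicProj_dualBasis_of_notMem P hm, zero_smul, inducedMk_zero_right,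
      inducedMk_zero_right]
    exact zero_mem _

/-- The term m = 1 of the Casimir sum is the generator itself. A minimal representative m ≠ 1 cannot
lie in the smaller parabolic subgroup, and those outside the larger one contribute zero. -/
theorem trans_leftGen_one_sub_mem : ((induced (parabolicSubalgebra P K)).map
      ((heckeTransfer P hJ).app N)).hom (leftGen P K (J : Set B)ᶜ 1 n) -
        leftGen P K (J' : Set B)ᶜ 1 n ∈
    Submodule.span (HeckeAlgebra P) {y | ∃ w, ∃ n' : N, w ∈ parabolicSubgroup cs ((J : Set B)ᶜ) ∧
      w ∉ parabolicSubgroup cs ((J' : Set B)ᶜ) ∧ y = leftGen P K (J' : Set B)ᶜ w n'} := by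
  classical
  have e (m : W) : (inducedMk _ 1 (inducedMk _ (basis P 1 * basis P m)
      (parabolicProj P (J : Set B)ᶜ (dualBasis P m) • n)) :
        (induced (parabolicSubalgebra P K)).obj
          ((induced (parabolicSubalgebra P ((J' : Set B)ᶜ))).obj N)) =
      leftGen P K (J' : Set B)ᶜ m (parabolicProj P (J : Set B)ᶜ (dualBasis P m) • n) := by
    rw [leftGen, basis_one, one_mul]
  have e1 : parabolicProj P (J : Set B)ᶜ (dualBasis P 1) • n = n := by
    rw [dualBasis_one, ← basis_one, parabolicProj_basis_of_mem P (one_mem _), basis_one, one_smul]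
  have h1 : (1 : W) ∈ minReps cs ((J' : Set B)ᶜ) := mem_minReps.mpr (isMinRep_one _)
  rw [trans_leftGen, Finset.sum_congr rfl fun m _ => e m, ← Finset.add_sum_erase _ _ h1, e1,
    add_sub_cancel_left]
  refine sum_mem fun m hm => ?_
  obtain ⟨hm1, hm⟩ := Finset.mem_erase.mp hm
  by_cases hmJ : m ∈ parabolicSubgroup cs ((J : Set B)ᶜ)
  · exact Submodule.subset_span ⟨m, _, hmJ, fun h => hm1 ((mem_minReps.mp hm).eq_one_of_mem h), rfl⟩
  · rw [parabolicProj_dualBasis_of_notMem P hmJ, zero_smul, leftGen, inducedMk_zero_right,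
      inducedMk_zero_right]
    exact zero_mem _

/-- The component of the contraction which enlarges `Q`. -/
noncomputable abbrev leftProject (hK : K ⊆ Q) (hQ : Q ⊆ Q') :
    induced (parabolicSubalgebra P Q) ⋙ induced (parabolicSubalgebra P K) ⟶
      induced (parabolicSubalgebra P Q') ⋙ induced (parabolicSubalgebra P K) :=
  projectLeft (parabolicProj_left_linear P Q) (parabolicProj_right_linear P Q)
    (parabolicSubalgebra_mono P hK)
    (parabolicSubalgebra_mono P hQ)

theorem leftProject_gen_of_mem (hK : K ⊆ Q) (hQ : Q ⊆ Q') (hw : w ∈ parabolicSubgroup cs Q) :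
    ((leftProject (P := P) hK hQ).app N).hom (leftGen P K Q w n) = leftGen P K Q' w n := by
  refine (projectLeftApp_mk (parabolicProj_left_linear P Q) (parabolicProj_right_linear P Q)
    (parabolicSubalgebra_mono P hK) (parabolicSubalgebra_mono P hQ) (basis P w) n).trans ?_
  rw [parabolicProj_basis_of_mem P hw, leftGen,
    inducedMk_of_mem (basis_mem (parabolicSubgroup_mono cs hQ hw))]

theorem leftProject_gen_of_notMem (hK : K ⊆ Q) (hQ : Q ⊆ Q') (hw : w ∉ parabolicSubgroup cs Q) :
    ((leftProject (P := P) hK hQ).app N).hom (leftGen P K Q w n) = 0 := by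
  refine (projectLeftApp_mk (parabolicProj_left_linear P Q) (parabolicProj_right_linear P Q)
    (parabolicSubalgebra_mono P hK) (parabolicSubalgebra_mono P hQ) (basis P w) n).trans ?_
  rw [parabolicProj_basis_of_notMem P hw, zero_smul, inducedMk_zero_right, inducedMk_zero_right]

end LeftSystem

end Hecke

namespace Hecke

set_option linter.unusedSectionVars false

/-! ### Generators and maps for H ⊗_{H_Q} H ⊗_{H_K} - -/

section RightSystem

open CategoryTheory HeckeAlgebra

variable {B W : Type v} [Group W] {M : CoxeterMatrix B} {cs : CoxeterSystem M W}
  {R : Type u} [CommRing R] (P : Parameters cs R) [Finite W] {N : ModuleCat.{max u v} (HeckeAlgebra P)}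

/-- The splitting attached to the elements `h_{n⁻¹} ⊗ h_{n⁻¹}⁻¹`. -/
noncomputable def rightSplitting (K K' Q : Set B) (s : B) : HeckeAlgebra P →+
    (induced (parabolicSubalgebra P K')).obj (ModuleCat.of _ (HeckeAlgebra P)) :=
  ((rightTranslation P K').splitting K Q s).comp (HeckeAlgebra.flip P).toAddMonoidHom

theorem rightSplitting_apply (K K' Q : Set B) (s : B) (x : HeckeAlgebra P) :
    rightSplitting P K K' Q s x =
      (rightTranslation P K').splitting K Q s (HeckeAlgebra.flip P x) := rfl

theorem rightSplitting_mul_left {K K' Q : Set B} {s : B} (hK : K \ {s} ⊆ K') :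
    ∀ c ∈ parabolicSubalgebra P Q, ∀ x, rightSplitting P K K' Q s (c * x) =
      c • rightSplitting P K K' Q s x := fun c hc x => by
  rw [rightSplitting_apply, rightSplitting_apply, flip_mul,
    (rightTranslation P K').splitting_mul hK (flip_mem P hc)]
  change (HeckeAlgebra.flip P (HeckeAlgebra.flip P c)) •
    ((rightTranslation P K').splitting K Q s (HeckeAlgebra.flip P x)) = _
  rw [HeckeAlgebra.flip_flip]

theorem rightSplitting_mul_right {K K' Q : Set B} {s : B} (hK : K \ {s} ⊆ K') :
    ∀ c ∈ parabolicSubalgebra P K, ∀ x, rightSplitting P K K' Q s (x * c) =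
      rightAction _ c (rightSplitting P K K' Q s x) := fun c hc x => by
  rw [rightSplitting_apply, rightSplitting_apply, flip_mul,
    (rightTranslation P K').splitting_mul_of_mem hK (flip_mem P hc)]
  change rightAction _ (HeckeAlgebra.flip P (HeckeAlgebra.flip P c)) _ = _
  rw [HeckeAlgebra.flip_flip]

/-- The component of the contraction which removes `s` from `K`. -/
noncomputable abbrev rightSplit {K K' : Set B} (Q : Set B) {s : B} (hK : K \ {s} ⊆ K') :
    induced (parabolicSubalgebra P K) ⋙ induced (parabolicSubalgebra P Q) ⟶
      induced (parabolicSubalgebra P K') ⋙ induced (parabolicSubalgebra P Q) :=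
  splitRight (rightSplitting_mul_left P (Q := Q) hK) (rightSplitting_mul_right P hK)

/-- The element `1 ⊗ h_{w⁻¹} ⊗ n`. -/
noncomputable def rightGen (K Q : Set B) (w : W) (n : N) : (induced (parabolicSubalgebra P Q)).obj
    ((induced (parabolicSubalgebra P K)).obj N) :=
  inducedMk _ 1 (inducedMk _ (basis P w⁻¹) n)

variable {P} {K K' Q Q' : Set B} {s : B} {w m x : W} (n : N)

theorem map_orbitMap_tensorInv (K : Set B) (m : W) (a : HeckeAlgebra P) :
    ((induced (parabolicSubalgebra P K)).map (orbitMap N n)).hom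
      (rightAction _ a (tensorInv P K m)) =
    inducedMk _ (basis P m⁻¹) (((((basisUnit P m⁻¹)⁻¹ : (HeckeAlgebra P)ˣ) : HeckeAlgebra P) * a) • n) :=
  rfl

theorem rightSplit_gen (hK : K \ {s} ⊆ K') (hs : descent cs Q (top cs K Q w) = some s)
    (h : IsAdjacent cs K Q w m) : ((rightSplit P Q hK).app N).hom (rightGen P K Q w n) =
      rightGen P K' Q m
        (((((basisUnit P m⁻¹)⁻¹ : (HeckeAlgebra P)ˣ) : HeckeAlgebra P) * basis P w⁻¹) • n) := by
  refine (splitRightApp_mk (rightSplitting_mul_left P (Q := Q) hK)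
    (rightSplitting_mul_right P hK) (basis P w⁻¹) n).trans ?_
  rw [rightSplitting_apply, flip_basis, inv_inv,
    (rightTranslation P K').splitting_basis_eq hK hs h]
  change inducedMk _ 1 (((induced (parabolicSubalgebra P K')).map (orbitMap N n)).hom
      (rightAction _ (HeckeAlgebra.flip P (basis P w)) (tensorInv P K' m))) = _
  rw [map_orbitMap_tensorInv, flip_basis]
  rfl

theorem rightSplit_gen_eq_zero (hK : K \ {s} ⊆ K') (hs : descent cs Q (top cs K Q w) ≠ some s) :
    ((rightSplit P Q hK).app N).hom (rightGen P K Q w n) = 0 := by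
  refine (splitRightApp_mk (rightSplitting_mul_left P (Q := Q) hK)
    (rightSplitting_mul_right P hK) (basis P w⁻¹) n).trans ?_
  rw [rightSplitting_apply, flip_basis, inv_inv,
    (rightTranslation P K').splitting_basis_eq_zero hs, map_zero, inducedMk_zero_right]

/-- Mirror image of `smul_leftGen`: the tensor h_{m⁻¹} ⊗ h_{m⁻¹}⁻¹ may be replaced by the one of w,
and h_{w⁻¹}⁻¹ h_{w⁻¹} = 1. -/
theorem rightGen_smul (hx : x ∈ parabolicSubgroup cs K) (hm : m = x * w) :
    rightGen P K Q m
        (((((basisUnit P m⁻¹)⁻¹ : (HeckeAlgebra P)ˣ) : HeckeAlgebra P) * basis P w⁻¹) • n) =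
      rightGen P K Q w n := by
  have h1 := congrArg (fun y => ((induced (parabolicSubalgebra P K)).map (orbitMap N n)).hom
      (rightAction _ (basis P w⁻¹) y)) (tensorInv_mul P K hx w)
  rw [← hm] at h1
  have h2 := (map_orbitMap_tensorInv n K m (basis P w⁻¹)).symm.trans
    (h1.trans (map_orbitMap_tensorInv n K w (basis P w⁻¹)))
  rw [← val_basisUnit P w⁻¹, Units.inv_mul, one_smul, val_basisUnit] at h2
  exact congrArg (inducedMk (parabolicSubalgebra P Q) 1) h2

theorem rightGen_mem (hw : w ∈ parabolicSubgroup cs Q) :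
    rightGen P K Q w n = basis P w⁻¹ • rightGen P K Q 1 n := by
  rw [rightGen, rightGen, inducedMk_eq_smul (basis P w⁻¹), inducedMk_one_smul
    (basis_mem (inv_mem hw)), inv_one, basis_one]

theorem rightGen_mem_span {x : HeckeAlgebra P} {s : Set W}
    (hx : x ∈ Submodule.span R (basis P '' {y | ∃ w ∈ s, y = w⁻¹})) :
    (inducedMk _ 1 (inducedMk _ x n) : (induced (parabolicSubalgebra P Q)).obj
      ((induced (parabolicSubalgebra P K)).obj N)) ∈
      Submodule.span (HeckeAlgebra P) {y | ∃ w ∈ s, ∃ n' : N, y = rightGen P K Q w n'} := by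
  refine induced_basis_induction P (C := parabolicSubalgebra P K) (N := N)
    (q := fun z => (inducedMk _ 1 z : (induced (parabolicSubalgebra P Q)).obj
      ((induced (parabolicSubalgebra P K)).obj N)) ∈
      Submodule.span (HeckeAlgebra P) {y | ∃ w ∈ s, ∃ n' : N, y = rightGen P K Q w n'}) ?_ ?_ ?_ hx n
  · rw [inducedMk_zero_right]; exact zero_mem _
  · intro y z hy hz
    rw [inducedMk_add_right]; exact add_mem hy hz
  · rintro _ ⟨w, hw, rfl⟩ n
    exact Submodule.subset_span ⟨w, hw, n, rfl⟩

theorem span_rightGen (K Q : Set B) (N : ModuleCat.{max u v} (HeckeAlgebra P)) :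
    Submodule.span (HeckeAlgebra P) {y | ∃ w, ∃ n : N, y = rightGen P K Q w n} = ⊤ := by
  refine span_induced_induced fun y n => ?_
  have hy : y ∈ Submodule.span R (basis P '' {y | ∃ w ∈ Set.univ, y = w⁻¹}) := by
    refine Submodule.span_mono (Set.image_mono ?_) (mem_span_basis P y)
    exact fun w _ => ⟨w⁻¹, trivial, (inv_inv w).symm⟩
  refine Submodule.span_mono ?_ (rightGen_mem_span n hy)
  rintro _ ⟨w, -, n, rfl⟩
  exact ⟨w, n, rfl⟩

variable {J J' : Finset B} (hJ : J ⊆ J')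

theorem heckeTransfer_rightGen : ((heckeTransfer P hJ).app
      ((induced (parabolicSubalgebra P K)).obj N)).hom (rightGen P K (J : Set B)ᶜ w n) =
    ∑ m ∈ minReps cs ((J' : Set B)ᶜ), basis P m • inducedMk _ 1 (inducedMk _
      (parabolicProj P (J : Set B)ᶜ (dualBasis P m) * basis P w⁻¹) n) := by
  refine (heckeTransfer_app_mk _ hJ _).trans (Finset.sum_congr rfl fun m _ => ?_)
  rw [one_mul, inducedMk_eq_smul (basis P m), smul_inducedMk _ _ n]

theorem heckeTransfer_rightGen_mem : ((heckeTransfer P hJ).app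
      ((induced (parabolicSubalgebra P K)).obj N)).hom (rightGen P K (J : Set B)ᶜ w n) ∈
    Submodule.span (HeckeAlgebra P) {y | ∃ x ∈ parabolicSubgroup cs ((J : Set B)ᶜ), ∃ n' : N,
      y = rightGen P K (J' : Set B)ᶜ (w * x) n'} := by
  rw [heckeTransfer_rightGen]
  refine sum_mem fun m _ => Submodule.smul_mem _ _ ?_
  have h := mul_basis_mem_span_image P w (parabolicProj_mem P (J : Set B)ᶜ (dualBasis P m))
  have h' : parabolicProj P (J : Set B)ᶜ (dualBasis P m) * basis P w⁻¹ ∈ Submodule.span R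
      (basis P '' {z | ∃ x ∈ {x | ∃ y ∈ parabolicSubgroup cs ((J : Set B)ᶜ), x = w * y},
        z = x⁻¹}) := by
    refine Submodule.span_mono (Set.image_mono ?_) h
    rintro _ ⟨y, hy, rfl⟩
    exact ⟨_, ⟨y, hy, rfl⟩, rfl⟩
  refine Submodule.span_mono ?_ (rightGen_mem_span n h')
  rintro _ ⟨_, ⟨y, hy, rfl⟩, n, rfl⟩
  exact ⟨y, hy, n, rfl⟩

/-- In the m-th term h_m is pulled out to the front. What remains in the middle is the dual element
of m, a multiple of h_{m⁻¹}, which is the generator attached to m; this explains the inverse in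
`rightGen`. -/
theorem heckeTransfer_rightGen_one_sub_mem : ((heckeTransfer P hJ).app
      ((induced (parabolicSubalgebra P K)).obj N)).hom (rightGen P K (J : Set B)ᶜ 1 n) -
        rightGen P K (J' : Set B)ᶜ 1 n ∈
    Submodule.span (HeckeAlgebra P) {y | ∃ w, ∃ n' : N, w ∈ parabolicSubgroup cs ((J : Set B)ᶜ) ∧
      w ∉ parabolicSubgroup cs ((J' : Set B)ᶜ) ∧ y = rightGen P K (J' : Set B)ᶜ w n'} := by
  classical
  have e1 : basis P 1 • (inducedMk _ 1 (inducedMk _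
      (parabolicProj P (J : Set B)ᶜ (dualBasis P 1) * basis P 1⁻¹) n) :
        (induced (parabolicSubalgebra P ((J' : Set B)ᶜ))).obj
          ((induced (parabolicSubalgebra P K)).obj N)) = rightGen P K (J' : Set B)ᶜ 1 n := by
    rw [rightGen, dualBasis_one, ← basis_one, parabolicProj_basis_of_mem P (one_mem _), basis_one,
      one_smul, one_mul]
  have h1 : (1 : W) ∈ minReps cs ((J' : Set B)ᶜ) := mem_minReps.mpr (isMinRep_one _)
  rw [heckeTransfer_rightGen, ← Finset.add_sum_erase _ _ h1, e1, add_sub_cancel_left]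
  refine sum_mem fun m hm => Submodule.smul_mem _ _ ?_
  obtain ⟨hm1, hm⟩ := Finset.mem_erase.mp hm
  rw [inv_one, basis_one, mul_one]
  by_cases hmJ : m ∈ parabolicSubgroup cs ((J : Set B)ᶜ)
  · rw [parabolicProj_dualBasis_of_mem P hmJ, dualBasis, inducedMk_smul_left]
    exact Submodule.subset_span ⟨m, _, hmJ, fun h => hm1 ((mem_minReps.mp hm).eq_one_of_mem h), rfl⟩
  · rw [parabolicProj_dualBasis_of_notMem P hmJ, inducedMk_zero_left, inducedMk_zero_right]
    exact zero_mem _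

/-- The component of the contraction which enlarges `Q`. -/
noncomputable abbrev rightProject (hK : K ⊆ Q) (hQ : Q ⊆ Q') :
    induced (parabolicSubalgebra P K) ⋙ induced (parabolicSubalgebra P Q) ⟶
      induced (parabolicSubalgebra P K) ⋙ induced (parabolicSubalgebra P Q') :=
  projectRight (parabolicProj_left_linear P Q) (parabolicProj_right_linear P Q)
    (parabolicSubalgebra_mono P hK) (parabolicSubalgebra_mono P hQ)

theorem rightProject_gen_of_mem (hK : K ⊆ Q) (hQ : Q ⊆ Q') (hw : w ∈ parabolicSubgroup cs Q) :
    ((rightProject (P := P) hK hQ).app N).hom (rightGen P K Q w n) = rightGen P K Q' w n := by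
  refine (projectRightApp_mk (parabolicProj_left_linear P Q) (parabolicProj_right_linear P Q)
    (parabolicSubalgebra_mono P hK) (parabolicSubalgebra_mono P hQ) (basis P w⁻¹) n).trans ?_
  rw [parabolicProj_basis_of_mem P (inv_mem hw), rightGen]

theorem rightProject_gen_of_notMem (hK : K ⊆ Q) (hQ : Q ⊆ Q') (hw : w ∉ parabolicSubgroup cs Q) :
    ((rightProject (P := P) hK hQ).app N).hom (rightGen P K Q w n) = 0 := by
  refine (projectRightApp_mk (parabolicProj_left_linear P Q) (parabolicProj_right_linear P Q)
    (parabolicSubalgebra_mono P hK) (parabolicSubalgebra_mono P hQ) (basis P w⁻¹) n).trans ?_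
  rw [parabolicProj_basis_of_notMem P fun h => hw (by simpa using inv_mem h), inducedMk_zero_left,
    inducedMk_zero_right]

end RightSystem

end Hecke

namespace Hecke

set_option linter.unusedSectionVars false

/-! ### Both double complexes satisfy the axioms of the matching -/

section HeckeBiSystems

open CategoryTheory HeckeAlgebra

variable {B W : Type v} [Group W] {M : CoxeterMatrix B} {cs : CoxeterSystem M W}
  {R : Type u} [CommRing R] (P : Parameters cs R) [Finite W] [LinearOrder B]

/-- The natural transformation which represents the differential of `X(H)`. -/
noncomputable def heckeInclusion {I I' : Finset B} (h : I ⊆ I') :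
    induced (parabolicSubalgebra P (I : Set B)) ⟶ induced (parabolicSubalgebra P (I' : Set B)) :=
  inducedMap.{u, v} (parabolicSubalgebra_mono P (Finset.coe_subset.mpr h))

theorem negOnePow_mul_coeffSign_mul_self (n : ℤ) (I : Finset B) (s : B) :
    ((n.negOnePow : ℤ) * coeffSign I s) * ((n.negOnePow : ℤ) * coeffSign I s) = 1 := by
  rw [mul_mul_mul_comm, coeffSign_mul_self, mul_one, ← Units.val_mul, ← Int.negOnePow_add,
    Int.negOnePow_even _ ⟨n, rfl⟩]
  rfl

theorem coe_sdiff_subset_erase (I : Finset B) (s : B) :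
    (I : Set B) \ {s} ⊆ ((I.erase s : Finset B) : Set B) := by
  rw [Finset.coe_erase]

theorem mem_parabolicSubalgebra_univ (a : HeckeAlgebra P) :
    a ∈ parabolicSubalgebra P (Set.univ : Set B) := by
  refine induction_basis (p := fun a => a ∈ parabolicSubalgebra P (Set.univ : Set B))
    (zero_mem _) (fun _ _ h h' => add_mem h h') (fun r w => ?_) a
  refine Subalgebra.smul_mem (parabolicSubalgebra P (Set.univ : Set B)) (basis_mem ?_) r
  rw [parabolicSubgroup, Set.image_univ, cs.subgroup_closure_range_simple]
  trivial

section

variable (k : Finset B × Finset B) {s : B} {w : W}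

theorem subset_insertLabel_erase (hs : s ∉ k.1) :
    (k.1 : Set B) ⊆ ((insert s k.1).erase s : Finset B) := by
  rw [Finset.erase_insert hs]

theorem descent_insert (h : descent cs (↑k.2)ᶜ (top cs k.1 (↑k.2)ᶜ w) = some s) :
    top cs ((insert s k.1 : Finset B) : Set B) (↑k.2)ᶜ w = top cs k.1 (↑k.2)ᶜ w := by
  rw [Finset.coe_insert]
  exact top_insert_eq h

end

open Classical in
/-- The component of the contraction which removes `t` from `k.2`. -/
noncomputable def leftEnlarge (k : Finset B × Finset B) (t : B) :
    induced (parabolicSubalgebra P ((k.2 : Set B)ᶜ)) ⋙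
        induced (parabolicSubalgebra P (k.1 : Set B)) ⟶
      induced (parabolicSubalgebra P (((k.2.erase t : Finset B) : Set B)ᶜ)) ⋙
        induced (parabolicSubalgebra P (k.1 : Set B)) :=
  -- The map 1 ⊗ y ⊗ n ↦ 1 ⊗ 1 ⊗ p_Q(y) n is compatible with H_I only if I ⊆ Q. On all other cells,
  -- and for labels which are not the chosen one, the contraction is zero.
  if h : fresh k.1 = some t ∧ (k.1 : Set B) ⊆ (↑k.2)ᶜ then
    leftProject h.2 (compl_mono (Finset.erase_subset t k.2)) else 0

open Classical in
/-- The component of the contraction which removes `t` from `k.2`. -/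
noncomputable def rightEnlarge (k : Finset B × Finset B) (t : B) :
    induced (parabolicSubalgebra P (k.1 : Set B)) ⋙
        induced (parabolicSubalgebra P ((k.2 : Set B)ᶜ)) ⟶
      induced (parabolicSubalgebra P (k.1 : Set B)) ⋙
        induced (parabolicSubalgebra P (((k.2.erase t : Finset B) : Set B)ᶜ)) :=
  if h : fresh k.1 = some t ∧ (k.1 : Set B) ⊆ (↑k.2)ᶜ then
    rightProject h.2 (compl_mono (Finset.erase_subset t k.2)) else 0

section

variable {P} {k : Finset B × Finset B} {t : B} {N : ModuleCat.{max u v} (HeckeAlgebra P)} {w : W}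
  (n : N)

theorem leftEnlarge_gen_of_mem (h1 : fresh k.1 = some t) (h2 : (k.1 : Set B) ⊆ (↑k.2)ᶜ)
    (hw : w ∈ parabolicSubgroup cs (↑k.2)ᶜ) :
    ((leftEnlarge P k t).app N).hom (leftGen P k.1 (↑k.2)ᶜ w n) =
      leftGen P k.1 (↑(k.2.erase t))ᶜ w n := by
  rw [leftEnlarge, dif_pos ⟨h1, h2⟩]
  exact leftProject_gen_of_mem n h2 (compl_mono (Finset.erase_subset t k.2)) hw

theorem leftEnlarge_gen_eq_zero (h : ¬ (fresh k.1 = some t ∧ (k.1 : Set B) ⊆ (↑k.2)ᶜ ∧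
    w ∈ parabolicSubgroup cs (↑k.2)ᶜ)) :
    ((leftEnlarge P k t).app N).hom (leftGen P k.1 (↑k.2)ᶜ w n) = 0 := by
  rw [leftEnlarge]
  split_ifs with h1
  · exact leftProject_gen_of_notMem n h1.2 (compl_mono (Finset.erase_subset t k.2))
      fun hw => h ⟨h1.1, h1.2, hw⟩
  · rfl

theorem rightEnlarge_gen_of_mem (h1 : fresh k.1 = some t) (h2 : (k.1 : Set B) ⊆ (↑k.2)ᶜ)
    (hw : w ∈ parabolicSubgroup cs (↑k.2)ᶜ) :
    ((rightEnlarge P k t).app N).hom (rightGen P k.1 (↑k.2)ᶜ w n) =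
      rightGen P k.1 (↑(k.2.erase t))ᶜ w n := by
  rw [rightEnlarge, dif_pos ⟨h1, h2⟩]
  exact rightProject_gen_of_mem n h2 (compl_mono (Finset.erase_subset t k.2)) hw

theorem rightEnlarge_gen_eq_zero (h : ¬ (fresh k.1 = some t ∧ (k.1 : Set B) ⊆ (↑k.2)ᶜ ∧
    w ∈ parabolicSubgroup cs (↑k.2)ᶜ)) :
    ((rightEnlarge P k t).app N).hom (rightGen P k.1 (↑k.2)ᶜ w n) = 0 := by
  rw [rightEnlarge]
  split_ifs with h1
  · exact rightProject_gen_of_notMem n h1.2 (compl_mono (Finset.erase_subset t k.2))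
      fun hw => h ⟨h1.1, h1.2, hw⟩
  · rfl

end

variable [Fintype B]

/-- The double complex `A ⊗_{H_I} A ⊗_{H_Q} -`. -/
noncomputable def leftBiSystem : BiSystem.{max u v, v, max u v} cs (HeckeAlgebra P) where
  sgn k := Sum.elim (fun r => coeffSign k.1 r)
    (fun r => ((k.1.card : ℤ).negOnePow : ℤ) * coeffSign k.2 r)
  sgn_mul_self k r := by
    rcases r with r | r
    · exact coeffSign_mul_self _ _
    · exact negOnePow_mul_coeffSign_mul_self _ _ _
  G k := induced (parabolicSubalgebra P ((k.2 : Set B)ᶜ)) ⋙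
    induced (parabolicSubalgebra P (k.1 : Set B))
  additive k := inferInstance
  D k r := match r with
    | .inl r => Functor.whiskerLeft (induced (parabolicSubalgebra P ((k.2 : Set B)ᶜ)))
        (heckeInclusion P (Finset.subset_insert r k.1))
    | .inr r => Functor.whiskerRight (heckeTransfer P (Finset.subset_insert r k.2))
        (induced (parabolicSubalgebra P (k.1 : Set B)))
  gen k N w n := leftGen P (k.1 : Set B) ((k.2 : Set B)ᶜ) w n
  map_gen k N N' φ w n := rfl
  span_gen k N := span_leftGen _ _ _
  gen_mem k N w n _ hw := Submodule.subset_span ⟨_, leftGen_mem n hw⟩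
  D_inl k N w n s hs := rfl
  D_inr_mem k N w n t ht := trans_leftGen_mem n (Finset.subset_insert t k.2)
  D_inr_one_sub_mem k N n t ht := trans_leftGen_one_sub_mem n (Finset.subset_insert t k.2)
  S k r := match r with
    | .inl s => leftSplit P ((k.2 : Set B)ᶜ) (coe_sdiff_subset_erase k.1 s)
    | .inr t => leftEnlarge P k t
  S_inl_eq_zero k N w n s hs h := leftSplit_gen_eq_zero n (coe_sdiff_subset_erase k.1 s) h
  S_inl_mem k N w n s hs h := by
    obtain ⟨m, hm⟩ := exists_isAdjacent (cs := cs) (k.1 : Set B) (↑k.2)ᶜ w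
    have e := leftSplit_gen (P := P) n (coe_sdiff_subset_erase k.1 s) h hm
    have h2 : leftGen P ((k.1.erase s : Finset B) : Set B) (↑k.2)ᶜ m n ∈
        Submodule.span (HeckeAlgebra P) {y | ∃ w', ∃ n' : N,
          top cs ((k.1.erase s : Finset B) : Set B) (↑k.2)ᶜ w' = top cs k.1 (↑k.2)ᶜ w ∧
            y = leftGen P ((k.1.erase s : Finset B) : Set B) (↑k.2)ᶜ w' n'} :=
      Submodule.subset_span ⟨m, n, hm.top_eq (Finset.coe_subset.mpr (Finset.erase_subset s k.1)),
        rfl⟩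
    have h3 := Submodule.smul_mem _
      (basis P w * ((basisUnit P m)⁻¹ : (HeckeAlgebra P)ˣ) : HeckeAlgebra P) h2
    rw [← e] at h3
    exact h3
  -- The splitting yields h_w h_m⁻¹ ⊗ h_m over the smaller algebra, with m ∈ W_I w. Over H_I this
  -- equals 1 ⊗ h_w by `smul_leftGen`.
  D_S_inl k N w n s hs h := by
    obtain ⟨m, hm⟩ := exists_isAdjacent (cs := cs) (k.1 : Set B) (↑k.2)ᶜ w
    have e := leftSplit_gen (P := P) n (coe_sdiff_subset_erase k.1 s) h hm
    obtain ⟨x, hx, e2⟩ := hm.1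
    have hsub : (k.1 : Set B) ⊆ ((insert s (k.1.erase s) : Finset B) : Set B) := by
      rw [Finset.insert_erase hs]
    refine (congrArg ((heckeInclusion P (Finset.subset_insert s (k.1.erase s))).app
      ((induced (parabolicSubalgebra P ((k.2 : Set B)ᶜ))).obj N)).hom e).trans ?_
    rw [map_smul]
    exact smul_leftGen n (parabolicSubgroup_mono cs hsub hx) e2
  -- The adjacent element is chosen for I rather than I ∪ {s}, which is possible because the top is
  -- the same. It then lies in W_I w, so `smul_leftGen` applies already over H_I.
  S_inl_insert k N w n s hs h := by
    obtain ⟨m, hm⟩ := exists_isAdjacent (cs := cs) (k.1 : Set B) (↑k.2)ᶜ w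
    have ht := descent_insert k h
    have hm' := hm.mono (Finset.coe_subset.mpr (Finset.subset_insert s k.1)) ht
    have e := leftSplit_gen (P := P) n (coe_sdiff_subset_erase (insert s k.1) s)
      (by rw [ht]; exact h) hm'
    obtain ⟨x, hx, e2⟩ := hm.1
    exact e.trans (smul_leftGen n
      (parabolicSubgroup_mono cs (subset_insertLabel_erase k hs) hx) e2)
  S_inr_of_mem k N w n t _ h1 h2 hw := leftEnlarge_gen_of_mem n h1 h2 hw
  S_inr_eq_zero k N w n t _ h := leftEnlarge_gen_eq_zero n h
  iso := inducedIso (fun a => by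
      rw [Finset.coe_univ]; exact mem_parabolicSubalgebra_univ P a) ≪≫
    (Functor.leftUnitor _).symm ≪≫ Functor.isoWhiskerRight (inducedIso fun a => by
      rw [Finset.coe_empty, Set.compl_empty]; exact mem_parabolicSubalgebra_univ P a) _

/-- The double complex `A ⊗_{H_Q} A ⊗_{H_I} -`. -/
noncomputable def rightBiSystem : BiSystem.{max u v, v, max u v} cs (HeckeAlgebra P) where
  sgn k := Sum.elim
    (fun r => (((k.2.card : ℤ) - Fintype.card B).negOnePow : ℤ) * coeffSign k.1 r)
    (fun r => coeffSign k.2 r)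
  sgn_mul_self k r := by
    rcases r with r | r
    · exact negOnePow_mul_coeffSign_mul_self _ _ _
    · exact coeffSign_mul_self _ _
  G k := induced (parabolicSubalgebra P (k.1 : Set B)) ⋙
    induced (parabolicSubalgebra P ((k.2 : Set B)ᶜ))
  additive k := inferInstance
  D k r := match r with
    | .inl r => Functor.whiskerRight (heckeInclusion P (Finset.subset_insert r k.1))
        (induced (parabolicSubalgebra P ((k.2 : Set B)ᶜ)))
    | .inr r => Functor.whiskerLeft (induced (parabolicSubalgebra P (k.1 : Set B)))
        (heckeTransfer P (Finset.subset_insert r k.2))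
  gen k N w n := rightGen P (k.1 : Set B) ((k.2 : Set B)ᶜ) w n
  map_gen k N N' φ w n := congrArg (inducedMk _ 1)
    (congrArg (inducedMk _ (basis P w⁻¹)) rfl)
  span_gen k N := span_rightGen _ _ _
  gen_mem k N w n _ hw := by
    rw [rightGen_mem n hw]
    exact Submodule.smul_mem _ _ (Submodule.subset_span ⟨_, rfl⟩)
  D_inl k N w n s hs := rfl
  D_inr_mem k N w n t ht := heckeTransfer_rightGen_mem n (Finset.subset_insert t k.2)
  D_inr_one_sub_mem k N n t ht :=
    heckeTransfer_rightGen_one_sub_mem n (Finset.subset_insert t k.2)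
  S k r := match r with
    | .inl s => rightSplit P ((k.2 : Set B)ᶜ) (coe_sdiff_subset_erase k.1 s)
    | .inr t => rightEnlarge P k t
  S_inl_eq_zero k N w n s hs h := rightSplit_gen_eq_zero n (coe_sdiff_subset_erase k.1 s) h
  S_inl_mem k N w n s hs h := by
    obtain ⟨m, hm⟩ := exists_isAdjacent (cs := cs) (k.1 : Set B) (↑k.2)ᶜ w
    exact Submodule.subset_span ⟨m, _,
      hm.top_eq (Finset.coe_subset.mpr (Finset.erase_subset s k.1)),
      rightSplit_gen (P := P) n (coe_sdiff_subset_erase k.1 s) h hm⟩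
  D_S_inl k N w n s hs h := by
    obtain ⟨m, hm⟩ := exists_isAdjacent (cs := cs) (k.1 : Set B) (↑k.2)ᶜ w
    have e := rightSplit_gen (P := P) n (coe_sdiff_subset_erase k.1 s) h hm
    obtain ⟨x, hx, e2⟩ := hm.1
    have hsub : (k.1 : Set B) ⊆ ((insert s (k.1.erase s) : Finset B) : Set B) := by
      rw [Finset.insert_erase hs]
    exact (congrArg ((induced (parabolicSubalgebra P ((k.2 : Set B)ᶜ))).map
      ((heckeInclusion P (Finset.subset_insert s (k.1.erase s))).app N)).hom e).trans
      (rightGen_smul n (parabolicSubgroup_mono cs hsub hx) e2)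
  S_inl_insert k N w n s hs h := by
    obtain ⟨m, hm⟩ := exists_isAdjacent (cs := cs) (k.1 : Set B) (↑k.2)ᶜ w
    have ht := descent_insert k h
    have hm' := hm.mono (Finset.coe_subset.mpr (Finset.subset_insert s k.1)) ht
    have e := rightSplit_gen (P := P) n (coe_sdiff_subset_erase (insert s k.1) s)
      (by rw [ht]; exact h) hm'
    obtain ⟨x, hx, e2⟩ := hm.1
    exact e.trans (rightGen_smul n
      (parabolicSubgroup_mono cs (subset_insertLabel_erase k hs) hx) e2)
  S_inr_of_mem k N w n t _ h1 h2 hw := rightEnlarge_gen_of_mem n h1 h2 hw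
  S_inr_eq_zero k N w n t _ h := rightEnlarge_gen_eq_zero n h
  iso := inducedIso (fun a => by
      rw [Finset.coe_empty, Set.compl_empty]; exact mem_parabolicSubalgebra_univ P a) ≪≫
    (Functor.leftUnitor _).symm ≪≫ Functor.isoWhiskerRight (inducedIso fun a => by
      rw [Finset.coe_univ]; exact mem_parabolicSubalgebra_univ P a) _

end HeckeBiSystems

end Hecke

namespace Hecke

set_option linter.unusedSectionVars false

/-! ### The inverse complex and the cells of the two compositions -/

section HeckePresentations

open CategoryTheory TensorProduct

variable {B W : Type v} [Group W] {M : CoxeterMatrix B} {cs : CoxeterSystem M W}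
  {R : Type u} [CommRing R] (P : Parameters cs R)

/-- The coefficient system `J ↦ H ⊗_{H_Q} H`, with `Q` the complement of `J`. -/
noncomputable def dualSystem [Finite W] :
    Finset B ⥤ ModuleCat.{max u v} (HeckeAlgebra P ⊗[R] (HeckeAlgebra P)ᵐᵒᵖ) where
  obj J := bimod (parabolicSubalgebra P ((J : Set B)ᶜ))
  map f := (heckeFrobenius P).transfer (parabolicSubalgebra_mono P (compl_mono (leOfHom f)))
  map_id J := (heckeFrobenius P).transfer_refl J
  map_comp _ _ := ((heckeFrobenius P).transfer_comp _ _).symm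

/-- The complex of bimodules which is inverse to `X(H)`. -/
noncomputable def dualComplex [Finite W] [Fintype B] [LinearOrder B] :
    CochainComplex (ModuleCat.{max u v} (HeckeAlgebra P ⊗[R] (HeckeAlgebra P)ᵐᵒᵖ)) ℤ :=
  shiftedCoeffComplex.{max u v, v, u} (dualSystem P) (Fintype.card B)

variable [Finite W] [Fintype B] [LinearOrder B]

/-- The cells of `X(H) ⊗_H -`. -/
noncomputable def heckeCells :
    CellSystem.{max u v, v, v, max u v} (HeckeAlgebra P) (Finset B) B :=
  (coeffCells.{max u v, v, u} (squareSystem _ (parabolicSubalgebra_monotone P))).cellSystem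
    (tensorBifunctor.{u, max u v, max u v, max u v} R (HeckeAlgebra P) (HeckeAlgebra P))

/-- The cells of the functor attached to the inverse complex. -/
noncomputable def dualCells :
    CellSystem.{max u v, v, v, max u v} (HeckeAlgebra P) (Finset B) B :=
  (shiftedCoeffCells.{max u v, v, u} (dualSystem P) (Fintype.card B)).cellSystem
    (tensorBifunctor.{u, max u v, max u v, max u v} R (HeckeAlgebra P) (HeckeAlgebra P))

/-- The description of `X(H) ⊗_H -` in terms of cells. -/
noncomputable def heckePresentation :
    Presentation (heckeCells P) (tensorComplex (heckeComplex P)) :=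
  (coeffCells.{max u v, v, u} (squareSystem _ (parabolicSubalgebra_monotone P))).presentation
    (tensorBifunctor.{u, max u v, max u v, max u v} R (HeckeAlgebra P) (HeckeAlgebra P))

/-- The description of the functor attached to the inverse complex in terms of cells. -/
noncomputable def dualPresentation :
    Presentation (dualCells P) (tensorComplex (dualComplex P)) :=
  (shiftedCoeffCells.{max u v, v, u} (dualSystem P) (Fintype.card B)).presentation
    (tensorBifunctor.{u, max u v, max u v, max u v} R (HeckeAlgebra P) (HeckeAlgebra P))

/-- The differentials agree label by label, once the two types of labels are separated; all other
data agree by definition. -/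
theorem heckeCells_comp_dualCells :
    (heckeCells P).comp (dualCells P) = (leftBiSystem P).cells := by
  have h : ((heckeCells P).comp (dualCells P)).D = (leftBiSystem P).cells.D := by
    funext k r
    rcases r with r | r <;> rfl
  exact congrArg (fun D => { (heckeCells P).comp (dualCells P) with D := D }) h

theorem heckeCells_compSwap_dualCells :
    (heckeCells P).compSwap (dualCells P) = (rightBiSystem P).cells := by
  have h : ((heckeCells P).compSwap (dualCells P)).D = (rightBiSystem P).cells.D := by
    funext k r
    rcases r with r | r <;> rfl
  exact congrArg (fun D => { (heckeCells P).compSwap (dualCells P) with D := D }) h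

/-- The description of a composition in terms of cells. -/
noncomputable def leftPresentation : Presentation (leftBiSystem P).cells
    (tensorComplex (dualComplex P) ⋙ tensorComplex (heckeComplex P)) :=
  heckeCells_comp_dualCells P ▸ (heckePresentation P).comp (dualPresentation P)

/-- The description of a composition in terms of cells. -/
noncomputable def rightPresentation : Presentation (rightBiSystem P).cells
    (tensorComplex (heckeComplex P) ⋙ tensorComplex (dualComplex P)) :=
  heckeCells_compSwap_dualCells P ▸ (dualPresentation P).compSwap (heckePresentation P)

end HeckePresentations

end Hecke

namespace Hecke

/-! ### Passage to bounded homotopy categories -/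

section BoundedEquivalence

open CategoryTheory TensorProduct

variable {R : Type u} [CommRing R] {A : Type v} [Ring A] [Algebra R A]
  {X Y : CochainComplex (ModuleCat.{z} (A ⊗[R] Aᵐᵒᵖ)) ℤ}

/-- An isomorphism on the level of complexes, up to homotopy, gives an isomorphism of functors on
the homotopy category. -/
noncomputable def tensorHomotopyIso
    (e : HomotopyCategory.quotient (ModuleCat.{z} A) (ComplexShape.up ℤ) ≅
      (tensorComplex X ⋙ tensorComplex Y) ⋙ HomotopyCategory.quotient _ _) :
    𝟭 _ ≅ tensorHomotopy X ⋙ tensorHomotopy Y :=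
  CategoryTheory.Quotient.natIsoLift _ e

/-- An isomorphism of functors on the homotopy category restricts to bounded complexes. -/
noncomputable def tensorBoundedIso {Q : ObjectProperty (ModuleCat.{z} A)}
    (hX : ∀ K, boundedProperty A Q K → boundedProperty A Q ((tensorHomotopy X).obj K))
    (hY : ∀ K, boundedProperty A Q K → boundedProperty A Q ((tensorHomotopy Y).obj K))
    (e : 𝟭 _ ≅ tensorHomotopy X ⋙ tensorHomotopy Y) :
    𝟭 _ ≅ tensorBounded X hX ⋙ tensorBounded Y hY :=
  NatIso.ofComponents (fun K => (boundedProperty A Q).isoMk (e.app K.obj)) fun f => by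
    apply (boundedProperty A Q).ι.map_injective
    exact e.hom.naturality f.hom

theorem isEquivalence_tensorBounded {Q : ObjectProperty (ModuleCat.{z} A)}
    (hX : ∀ K, boundedProperty A Q K → boundedProperty A Q ((tensorHomotopy X).obj K))
    (hY : ∀ K, boundedProperty A Q K → boundedProperty A Q ((tensorHomotopy Y).obj K))
    (e : 𝟭 _ ≅ tensorHomotopy X ⋙ tensorHomotopy Y)
    (e' : 𝟭 _ ≅ tensorHomotopy Y ⋙ tensorHomotopy X) :
    (tensorBounded X hX).IsEquivalence :=
  (CategoryTheory.Equivalence.mk (tensorBounded X hX) (tensorBounded Y hY)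
    (tensorBoundedIso hX hY e) (tensorBoundedIso hY hX e').symm).isEquivalence_functor

end BoundedEquivalence

/-! ### The two isomorphisms with the identity functor -/

section HeckeEquivalence

open CategoryTheory TensorProduct

variable {B W : Type v} [Group W] {M : CoxeterMatrix B} {cs : CoxeterSystem M W}
  {R : Type u} [CommRing R] (P : Parameters cs R) [Finite W] [Fintype B] [LinearOrder B]

theorem isBounded_dualComplex : IsBounded (dualComplex P) :=
  isBounded_shiftedCoeffComplex _ _

theorem finite_dualComplex (n : ℤ) :
    Module.Finite (HeckeAlgebra P) (leftModule ((dualComplex P).X n)) :=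
  finite_coeffComplex (dualSystem P)
    (fun _ => finite_square (h1 := HeckeAlgebra.finite P) _) (n + Fintype.card B)

/-- The inverse complex is a right inverse. -/
noncomputable def heckeDualIso :
    𝟭 _ ≅ tensorHomotopy (dualComplex P) ⋙ tensorHomotopy (heckeComplex P) :=
  tensorHomotopyIso ((leftBiSystem P).morseFiltration.quotientIso (leftPresentation P))

/-- The inverse complex is a left inverse. -/
noncomputable def dualHeckeIso :
    𝟭 _ ≅ tensorHomotopy (heckeComplex P) ⋙ tensorHomotopy (dualComplex P) :=
  tensorHomotopyIso ((rightBiSystem P).morseFiltration.quotientIso (rightPresentation P))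

end HeckeEquivalence

end Hecke

theorem theorem19 {B W : Type v} [Finite B] [LinearOrder B] [Group W] [Finite W]
    {M : CoxeterMatrix B} {cs : CoxeterSystem M W} {R : Type u} [CommRing R]
    (P : Hecke.Parameters cs R) :
    (Hecke.heckeFunctorFinite P).IsEquivalence ∧ (Hecke.heckeFunctor P).IsEquivalence := by
  have := Fintype.ofFinite B
  -- The inverse complex is bounded with terms finitely generated on the left, so tensoring with it
  -- preserves both classes of complexes, and the same two isomorphisms serve in both cases.
  exact ⟨Hecke.isEquivalence_tensorBounded _
      (fun _ hK => ⟨Hecke.isBounded_tensorComplex (Hecke.isBounded_dualComplex P) hK.1,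
        Hecke.finite_tensorComplex (Hecke.isBounded_dualComplex P)
          (Hecke.finite_dualComplex P) hK.2⟩)
      (Hecke.dualHeckeIso P) (Hecke.heckeDualIso P),
    Hecke.isEquivalence_tensorBounded _
      (fun _ hK => ⟨Hecke.isBounded_tensorComplex (Hecke.isBounded_dualComplex P) hK.1,
        fun _ => trivial⟩)
      (Hecke.dualHeckeIso P) (Hecke.heckeDualIso P)⟩
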